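/- Let $K$ be a field of characteristic $0$. Gradings are by $\mathbb Z$, differentials have degree $-1$, and the Koszul sign rule is used throughout. **The operad $A_\infty$.** For $n\ge 2$ let $A_\infty(n)$ be spanned by pairs $(T,\omega)$, where $T$ is a planar rooted tree with $n$ leaves, each vertex having at least two incoming edges, and $\omega$ is an orientation of the span of the $t_T$ internal edges of $T$, modulo $(T,-\omega)=-(T,\omega)$; its degree is $|T|=n-2-t_T$. Put $\partial(U,\sigma)=\sum_{V/e=U}(V,e\wedge\sigma)$ and, for $U$ with $n$ leaves and $V$ with $m$ leaves, $(U,\sigma)\circ_i(V,\tau)=(-1)^{i(m+1)+n|V|}(U\circ_iV,\sigma\wedge\tau\wedge e)$, $e$ being the new edge. Let $r(T,\sigma)=(-1)^n(r(T),\sigma)$, where $r(T)$ is $T$ rotated so that the rightmost leaf becomes the root and the old root becomes the first leaf. $c_n$ is the corolla. A *cyclic diagonal* is a morphism of dg operads $\Delta:A_\infty\to A_\infty\otimes A_\infty$ with $\Delta\circ r=(r\otimes r)\circ\Delta$ that induces on homology $H_*(A_\infty)=\mathcal{A}s$ the canonical diagonal of the associative operad. **Algebras.** A *cyclic $A_\infty$-algebra*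 is a finite-dimensional graded space $A$ with a differential $d$, a nondegenerate graded symmetric inner product for which $\langle da,b\rangle=(-1)^{|a|+1}\langle a,db\rangle$, and a morphism of dg operads $\rho:A_\infty\to \mathrm{End}_A$ such that, for $x\in A_\infty(n)$, $\langle\rho(r x)(a_0,\dots,a_{n-1}),a_n\rangle=(-1)^{|a_0|\sum_{l\ge 1}|a_l|}\langle\rho(x)(a_1,\dots,a_n),a_0\rangle$. The inner product is *even* if $\langle a,b\rangle\ne0$ implies $|a|\equiv|b| \pmod 2$. Given $A$, $B$ and $\Delta$, the tensor product $A\otimes B$ has differential $d\otimes \mathrm{id}+\mathrm{id}\otimes d$, inner product $\langle a\otimes b,a'\otimes b'\rangle=(-1)^{|a'||b|}\langle a,a'\rangle\langle b,b'\rangle$, and $\rho_{A\otimes B}=i\circ(\rho_A\otimes\rho_B)\circ\Delta$, where $$i(f\otimes g)(a_1\otimes b_1,\dots,a_n\otimes b_n)=(-1)^{\sum_{i<j}|b_i||a_j|+|g|\sum_j|a_j|}f(a_1,\dots,a_n)\otimes g(b_1,\dots,b_n).$$ **Graphs.** A ribbon graph is a finite nonempty connected graph with all valencies at least $3$ and a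 cyclic ordering of the half-edges at each vertex; an orientation of it is an orientation of the span of its vertices and half-edges. $\mathcal G_*$ is spanned by isomorphism classes of oriented ribbon graphs $(\Gamma,\sigma)$ modulo $(\Gamma,-\sigma)=-(\Gamma,\sigma)$, and $|\Gamma|=\sum_v(\mathrm{val}(v)-3)$. Given $(\Gamma,\sigma)$, order the vertices $v_1,\dots,v_k$ and label the half-edges at $v_i$ as $e_{i,0},\dots,e_{i,n_i}$ following the cyclic ordering. Let $A_\Gamma=\pm1$ be defined by $\sigma=A_\Gamma\langle v_1e_{1,0}\cdots e_{1,n_1}\cdots v_ke_{k,0}\cdots e_{k,n_k}\rangle$. For oriented trees $T_i\in A_\infty(n_i)$ with orientation $f_{i,1}\wedge\dots\wedge f_{i,t_i}$, let $\Gamma(T_1,\dots,T_k)$ be the graph obtained by replacing $v_i$ by $T_i$, its root glued to $e_{i,0}$ and its leaves to $e_{i,1},\dots,e_{i,n_i}$, oriented so that contracting successively $f_{1,1},\dots,f_{1,t_1},\dots,f_{k,t_k}$ gives $\sigma$; here contracting an edge with ends $v^\pm$ and half-edges $e^\pm$ turns $\langle v^-v^+e^-e^+\cdots\rangle$ into $\langle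 v\cdots\rangle$. Put $$\phi_\Gamma(T_1\otimes\dots\otimes T_k)=(-1)^{|\Gamma|}A_\Gamma(-1)^{\sum_{i<j}n_it_j}\,\Gamma(T_1,\dots,T_k),$$ so that $\phi_\Gamma^{-1}(\Gamma,\sigma)=(-1)^{|\Gamma|}A_\Gamma\, c_{n_1}\otimes\dots\otimes c_{n_k}$. * The diagonal $\delta:\mathcal G_*\to\mathcal G_*\otimes\mathcal G_*$ is the linear map with $\delta(\Gamma,\sigma)=(\phi_\Gamma\otimes\phi_\Gamma)\,\tau\,(\Delta\otimes\dots\otimes\Delta)\,\phi_\Gamma^{-1}(\Gamma,\sigma)$, where $\tau$ is the permutation of tensor factors collecting all first and all second factors of the $\Delta(c_{n_i})$. * For a finite-dimensional graded space $A$ with operations $\rho$ and even nondegenerate inner product as above, $c_A:\mathcal G_*\to K$ is the linear map for which $c_A(\Gamma,\sigma)$ is obtained from $\phi_\Gamma^{-1}(\Gamma,\sigma)$ by applying $\rho\otimes\dots\otimes\rho$, identifying $\mathrm{Hom}(A^{\otimes n_i},A)\cong(A^\vee)^{\otimes n_i+1}$ by the inner product, permuting the tensor factors according to $(e_{1,1},\dots,e_{1,n_1},e_{1,0},e_{2,1},\dots,e_{k,n_k},e_{k,0})\to(h_1^+,h_1^-,\dots,h_E^+,h_E^-)$,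 where $h_j^\pm$ are the halves of the $j$-th edge for some ordering and orientation of the edges, and contracting with $\langle-,-\rangle^{-1}$ at each edge. **Theorem.** Let $A$ and $B$ be finite-dimensional cyclic $A_\infty$-algebras over $K$ with even inner products, and let $\Delta$ be a cyclic diagonal of $A_\infty$. Then $A\otimes B$, $\delta$, $c_A$, $c_B$ and $c_{A\otimes B}$ are well defined (independent of all the choices made), and $$c_{A\otimes B}=(c_A\otimes c_B)\circ\delta\qquad\text{as maps }\mathcal G_*\to K .$$ -/

import Mathlib

open scoped TensorProduct

namespace RibbonTensor

/-! ### Sign bookkeeping -/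

section Signs

/-- `∑_{i < j} f (l_i) (l_j)` for a list `l`. -/
def pairSum {α : Type*} (f : α → α → ℤ) : List α → ℤ
  | [] => 0
  | a :: l => (l.map (f a)).sum + pairSum f l

/-- The Koszul sign of the permutation which rearranges the word `L` into the word `M` (two
orderings of the same elements), where the letter `a` has degree `deg a`: every pair of letters
whose order is reversed contributes `(-1)^(deg a * deg b)`. -/
noncomputable def koszulSign (K : Type*) [Field K] {α : Type*} [DecidableEq α] (deg : α → ℤ)
    (L M : List α) : K :=
  (-1) ^ pairSum (fun a b => if M.idxOf b < M.idxOf a then deg a * deg b else 0) L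

/-- The sign of the permutation which rearranges `L` into `M`. -/
noncomputable def permSign (K : Type*) [Field K] {α : Type*} [DecidableEq α] (L M : List α) : K :=
  koszulSign K (fun _ => 1) L M

end Signs

/-! ### Planar rooted trees

A planar rooted tree with leaves `1, …, n` (from left to right) all of whose vertices have at least
two incoming edges is recorded by its internal edges. An internal edge is recorded by the interval
`(a, b)`, `1 ≤ a < b ≤ n`, `(a, b) ≠ (1, n)`, of those leaves which lie above it; a set of such
intervals comes from a (unique) tree iff any two of them are nested or disjoint. -/

section Trees

/-- All pairs `(a, b)` with `1 ≤ a, b ≤ n`, in lexicographic order. -/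
def grid (n : ℕ) : List (ℕ × ℕ) :=
  (List.range' 1 n).flatMap fun a => (List.range' 1 n).map fun b => (a, b)

/-- Two intervals are nested or disjoint. -/
def Compatible (e f : ℕ × ℕ) : Prop :=
  e.2 < f.1 ∨ f.2 < e.1 ∨ (e.1 ≤ f.1 ∧ f.2 ≤ e.2) ∨ (f.1 ≤ e.1 ∧ e.2 ≤ f.2)

instance (e f : ℕ × ℕ) : Decidable (Compatible e f) := by unfold Compatible; infer_instance

/-- The possible internal edges of a tree with `n` leaves. -/
def intervals (n : ℕ) : Finset (ℕ × ℕ) :=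
  (Finset.Icc 1 n ×ˢ Finset.Icc 1 n).filter fun e => e.1 < e.2 ∧ e ≠ (1, n)

/-- The planar rooted trees with `n` leaves; there are none for `n < 2`. -/
def trees (n : ℕ) : Finset (Finset (ℕ × ℕ)) :=
  if 2 ≤ n then (intervals n).powerset.filter fun s => ∀ e ∈ s, ∀ f ∈ s, Compatible e f else ∅

/-- The type of planar rooted trees with `n` leaves (cells of the associahedron `K(n)`). -/
abbrev PTree (n : ℕ) : Type := {s : Finset (ℕ × ℕ) // s ∈ trees n}

/-- The internal edges in lexicographic order; this is the reference orientation of the tree. -/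
def PTree.edgeList {n : ℕ} (T : PTree n) : List (ℕ × ℕ) := (grid n).filter fun e => e ∈ T.1

/-- The dimension of the cell: `n - 2 -` number of internal edges. -/
def PTree.deg {n : ℕ} (T : PTree n) : ℤ := (n : ℤ) - 2 - (T.1.card : ℤ)

/-- `J` is a proper sub-interval of `I`. -/
def Inside (J I : ℕ × ℕ) : Prop := I.1 ≤ J.1 ∧ J.2 ≤ I.2 ∧ J ≠ I

instance (J I : ℕ × ℕ) : Decidable (Inside J I) := by unfold Inside; infer_instance

/-- The vertices of the tree `T` correspond to the intervals `I ∈ T` (upper end of the edge `I`) and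
to the whole interval `(1, n)` (the root vertex). This is the list of the incoming edges of the
vertex `I`, from left to right; the leaf `l` is recorded as `(l, l)`. -/
def PTree.children {n : ℕ} (T : PTree n) (I : ℕ × ℕ) : List (ℕ × ℕ) :=
  (grid n).filter fun J => (J ∈ T.1 ∨ J.1 = J.2) ∧ Inside J I ∧
    ∀ J' ∈ T.1, ¬ (Inside J J' ∧ Inside J' I)

end Trees

/-! ### The cyclic operad `A_∞` -/

section Operad

variable (K : Type*) [Field K]

/-- The space `A_∞(n) = C_*(K(n))`: it is spanned by oriented trees `(T, ω)` with
`(T, -ω) = -(T, ω)`, so it has one basis vector per tree, namely `T` with its reference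
orientation. -/
abbrev AInf (n : ℕ) : Type _ := PTree n →₀ K

variable {K}

/-- The basis vector of `A_∞(n)` given by the tree `T` with its reference orientation. -/
noncomputable def tree {n : ℕ} (T : PTree n) : AInf K n := Finsupp.single T 1

variable (K)

/-- The oriented tree `(T, e_1 ∧ ⋯ ∧ e_k)` where `e_1, …, e_k` are the internal edges of `T`.
It is `0` if `e_1, …, e_k` has repetitions or is not the set of internal edges of a tree. -/
noncomputable def oriented (n : ℕ) (L : List (ℕ × ℕ)) : AInf K n :=
  if h : L.Nodup ∧ L.toFinset ∈ trees n then
    permSign K L (PTree.edgeList ⟨L.toFinset, h.2⟩) • tree ⟨L.toFinset, h.2⟩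
  else 0

/-- The corolla `c_n`. -/
noncomputable def corolla (n : ℕ) : AInf K n := oriented K n []

/-- The differential: `∂(U, σ) = ∑ (V, e ∧ σ)`, over all trees `V` with an edge `e` such that
`V / e = U`. -/
noncomputable def boundary (n : ℕ) : AInf K n →ₗ[K] AInf K n :=
  Finsupp.linearCombination K fun T : PTree n =>
    ∑ e ∈ intervals n, oriented K n (e :: T.edgeList)

/-- The effect of grafting a tree with `m` leaves onto leaf `i` of `U` on the internal edges
of `U`. -/
def graftOuter (i m : ℕ) (e : ℕ × ℕ) : ℕ × ℕ :=
  (if e.1 ≤ i then e.1 else e.1 + m - 1, if e.2 < i then e.2 else e.2 + m - 1)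

/-- The effect of grafting a tree `V` onto leaf `i` of another tree on the internal edges
of `V`. -/
def graftInner (i : ℕ) (e : ℕ × ℕ) : ℕ × ℕ := (e.1 + i - 1, e.2 + i - 1)

/-- The operadic composition (`1 ≤ i ≤ n`)
`(U, σ) ∘_i (V, τ) = (-1)^(i (m + 1) + n |V|) (U ∘_i V, σ ∧ τ ∧ e)`,
`U` with `n` leaves, `V` with `m` leaves, `e` the new internal edge. -/
noncomputable def treeComp {n m : ℕ} (i : ℕ) (U : PTree n) (V : PTree m) : AInf K (n + m - 1) :=
  ((-1 : K) ^ ((i : ℤ) * (m + 1) + n * V.deg)) •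
    oriented K (n + m - 1)
      (U.edgeList.map (graftOuter i m) ++ V.edgeList.map (graftInner i) ++ [(i, i + m - 1)])

variable {K} in
/-- The bilinear extension of the operadic composition. -/
noncomputable def comp {n m : ℕ} (i : ℕ) (x : AInf K n) (y : AInf K m) : AInf K (n + m - 1) :=
  x.sum fun U a => y.sum fun V b => (a * b) • treeComp K i U V

/-- The effect on internal edges of the rotation which turns leaf `l < n` into leaf `l + 1`, the old
root into leaf `1`, and the rightmost leaf `n` into the root. -/
def rotEdge (n : ℕ) (e : ℕ × ℕ) : ℕ × ℕ := if e.2 < n then (e.1 + 1, e.2 + 1) else (1, e.1)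

/-- The generator of the cyclic group action, `r(T, σ) = (-1)^n (r(T), σ)`. -/
noncomputable def rot (n : ℕ) : AInf K n →ₗ[K] AInf K n :=
  Finsupp.linearCombination K fun T : PTree n =>
    ((-1 : K) ^ n) • oriented K n (T.edgeList.map (rotEdge n))

/-- The space `(A_∞ ⊗ A_∞)(n) = A_∞(n) ⊗ A_∞(n)`, with basis `T ⊗ T'`. -/
abbrev AInf2 (n : ℕ) : Type _ := (PTree n × PTree n) →₀ K

variable {K} in
/-- The pure tensor `x ⊗ y`. -/
noncomputable def tens {n : ℕ} (x y : AInf K n) : AInf2 K n :=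
  x.sum fun U a => y.sum fun V b => Finsupp.single (U, V) (a * b)

/-- `∂(U ⊗ U') = ∂U ⊗ U' + (-1)^|U| U ⊗ ∂U'`. -/
noncomputable def boundary2 (n : ℕ) : AInf2 K n →ₗ[K] AInf2 K n :=
  Finsupp.linearCombination K fun p : PTree n × PTree n =>
    tens (boundary K n (tree p.1)) (tree p.2) +
      ((-1 : K) ^ p.1.deg) • tens (tree p.1) (boundary K n (tree p.2))

/-- `r ⊗ r`. -/
noncomputable def rot2 (n : ℕ) : AInf2 K n →ₗ[K] AInf2 K n :=
  Finsupp.linearCombination K fun p : PTree n × PTree n =>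
    tens (rot K n (tree p.1)) (rot K n (tree p.2))

variable {K} in
/-- `(U ⊗ U') ∘_i (V ⊗ V') = (-1)^(|U'| |V|) (U ∘_i V) ⊗ (U' ∘_i V')`, extended bilinearly. -/
noncomputable def comp2 {n m : ℕ} (i : ℕ) (x : AInf2 K n) (y : AInf2 K m) :
    AInf2 K (n + m - 1) :=
  x.sum fun p a => y.sum fun q b =>
    (a * b * (-1 : K) ^ (p.2.deg * q.1.deg)) • tens (treeComp K i p.1 q.1) (treeComp K i p.2 q.2)

/-- The `0`-cycle `(⋯((c_2 ∘_1 c_2) ∘_1 c_2)⋯)` of `A_∞(k + 2)`. Its class is the generator of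
`H_*(A_∞(k + 2))` which corresponds to the `(k + 2)`-fold product of the associative operad. -/
noncomputable def productCycle : (k : ℕ) → AInf K (k + 2)
  | 0 => corolla K 2
  | k + 1 => comp (n := k + 2) (m := 2) 1 (productCycle k) (corolla K 2)

/-- A cyclic diagonal of `A_∞`: a morphism `Δ : A_∞ → A_∞ ⊗ A_∞` of dg operads which commutes with
the cyclic actions and which induces on homology `H_*(A_∞) = As` the canonical diagonal
of the associative operad. -/
structure CyclicDiagonal where
  /-- the components of the morphism -/
  map : ∀ n, AInf K n →ₗ[K] AInf2 K n
  map_deg : ∀ n (T : PTree n) (p : PTree n × PTree n),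
    map n (tree T) p ≠ 0 → p.1.deg + p.2.deg = T.deg
  map_boundary : ∀ n (x : AInf K n), map n (boundary K n x) = boundary2 K n (map n x)
  map_comp : ∀ n m i (x : AInf K n) (y : AInf K m), 1 ≤ i → i ≤ n →
    map (n + m - 1) (comp i x y) = comp2 i (map n x) (map m y)
  map_rot : ∀ n (x : AInf K n), map n (rot K n x) = rot2 K n (map n x)
  map_homology : ∀ k, ∃ z : AInf2 K (k + 2),
    map (k + 2) (productCycle K k) - tens (productCycle K k) (productCycle K k) =
      boundary2 K (k + 2) z

end Operad

/-! ### Cyclic `A_∞`-algebras -/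

section Algebras

variable (K : Type*) [Field K]

/-- The word `(a_1, …, a_n)` taken from a sequence `a`. -/
def tuple {A : Type*} (n : ℕ) (a : ℕ → A) : Fin n → A := fun k => a (k + 1)

/-- The data of a differential, of operations `ρ(x) : A^{⊗ n} → A` for `x ∈ A_∞(n)`, and of a
bilinear form on `A`. -/
@[ext]
structure AInfData (A : Type*) [AddCommGroup A] [Module K A] where
  /-- the differential -/
  d : A →ₗ[K] A
  /-- the operations `ρ : A_∞(n) → Hom(A^{⊗ n}, A)` -/
  op : ∀ n, AInf K n →ₗ[K] MultilinearMap K (fun _ : Fin n => A) A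
  /-- the inner product -/
  inner : A →ₗ[K] A →ₗ[K] K

variable {K} {A : Type*} [AddCommGroup A] [Module K A]

/-- The data `α` is a cyclic `A_∞`-algebra structure on the graded vector space `A = ⨁ 𝒜 p`: the
differential has degree `-1`, `ρ : A_∞ → End_A` is a morphism of dg operads, the inner product is
(graded) symmetric and nondegenerate, `d` is (graded) self-adjoint, and `ρ` is compatible with
the cyclic actions. The degree of a homogeneous element `a k` is called `p k`. -/
structure IsCyclicAInf (𝒜 : ℤ → Submodule K A) (α : AInfData K A) : Prop where
  d_mem : ∀ p, ∀ a ∈ 𝒜 p, α.d a ∈ 𝒜 (p - 1)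
  d_d : ∀ a, α.d (α.d a) = 0
  op_mem : ∀ n (T : PTree n) (p : ℕ → ℤ) (a : ℕ → A), (∀ k, a k ∈ 𝒜 (p k)) →
    α.op n (tree T) (tuple n a) ∈ 𝒜 (T.deg + ∑ k ∈ Finset.Icc 1 n, p k)
  op_boundary : ∀ n (T : PTree n) (p : ℕ → ℤ) (a : ℕ → A), (∀ k, a k ∈ 𝒜 (p k)) →
    α.op n (boundary K n (tree T)) (tuple n a) =
      α.d (α.op n (tree T) (tuple n a)) -
        ∑ i ∈ Finset.Icc 1 n, ((-1 : K) ^ (T.deg + ∑ l ∈ Finset.Ico 1 i, p l)) •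
          α.op n (tree T) (tuple n (Function.update a i (α.d (a i))))
  op_comp : ∀ n m i (U : PTree n) (V : PTree m) (p : ℕ → ℤ) (a : ℕ → A),
    (∀ k, a k ∈ 𝒜 (p k)) → 1 ≤ i → i ≤ n →
    α.op (n + m - 1) (treeComp K i U V) (tuple (n + m - 1) a) =
      ((-1 : K) ^ (V.deg * ∑ l ∈ Finset.Ico 1 i, p l)) •
        α.op n (tree U) (tuple n fun k =>
          if k < i then a k
          else if k = i then α.op m (tree V) (tuple m fun l => a (i + l - 1))
          else a (k + m - 1))
  inner_symm : ∀ p q, ∀ a ∈ 𝒜 p, ∀ b ∈ 𝒜 q,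
    α.inner a b = (-1 : K) ^ (p * q) * α.inner b a
  inner_nondegenerate : α.inner.Nondegenerate
  inner_d : ∀ p, ∀ a ∈ 𝒜 p, ∀ b, α.inner (α.d a) b = (-1 : K) ^ (p + 1) * α.inner a (α.d b)
  cyclic : ∀ n (T : PTree n) (p : ℕ → ℤ) (a : ℕ → A), (∀ k, a k ∈ 𝒜 (p k)) →
    α.inner (α.op n (rot K n (tree T)) (tuple n fun k => a (k - 1))) (a n) =
      (-1 : K) ^ (p 0 * ∑ l ∈ Finset.Icc 1 n, p l) *
        α.inner (α.op n (tree T) (tuple n a)) (a 0)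

/-- The inner product is even. -/
def IsEven (𝒜 : ℤ → Submodule K A) (α : AInfData K A) : Prop :=
  ∀ p q, ∀ a ∈ 𝒜 p, ∀ b ∈ 𝒜 q, α.inner a b ≠ 0 → p ≡ q [ZMOD 2]

variable {B : Type*} [AddCommGroup B] [Module K B]

/-- The total grading of `A ⊗ B`. -/
def tensorGrading (𝒜 : ℤ → Submodule K A) (ℬ : ℤ → Submodule K B) (n : ℤ) :
    Submodule K (A ⊗[K] B) :=
  Submodule.span K {x | ∃ p q, p + q = n ∧ ∃ a ∈ 𝒜 p, ∃ b ∈ ℬ q, x = a ⊗ₜ[K] b}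

/-- `γ` is the tensor product `A ⊗ B` defined by the diagonal `Δ`: the differential is
`d ⊗ id + id ⊗ d`, the operations are given by `ρ = i ∘ (ρ_A ⊗ ρ_B) ∘ Δ`, where
`i(f ⊗ g)(a_1 ⊗ b_1, …, a_n ⊗ b_n) = ± f(a_1, …, a_n) ⊗ g(b_1, …, b_n)`, with the sign
`(-1)^(∑_{i < j} |b_i| |a_j| + |g| ∑_j |a_j|)`, and
`⟨a ⊗ b, a' ⊗ b'⟩ = (-1)^(|a'| |b|) ⟨a, a'⟩ ⟨b, b'⟩`. -/
structure IsTensorAInf (Δ : CyclicDiagonal K) (𝒜 : ℤ → Submodule K A) (ℬ : ℤ → Submodule K B)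
    (α : AInfData K A) (β : AInfData K B) (γ : AInfData K (A ⊗[K] B)) : Prop where
  d_tmul : ∀ p, ∀ a ∈ 𝒜 p, ∀ b,
    γ.d (a ⊗ₜ[K] b) = α.d a ⊗ₜ[K] b + ((-1 : K) ^ p) • a ⊗ₜ[K] β.d b
  op_tmul : ∀ n (x : AInf K n) (p q : ℕ → ℤ) (a : ℕ → A) (b : ℕ → B),
    (∀ k, a k ∈ 𝒜 (p k)) → (∀ k, b k ∈ ℬ (q k)) →
    γ.op n x (tuple n fun k => a k ⊗ₜ[K] b k) =
      (Δ.map n x).sum fun T c =>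
        (c * (-1 : K) ^ (∑ j ∈ Finset.Icc 1 n, ∑ i ∈ Finset.Ico 1 j, q i * p j +
            T.2.deg * ∑ j ∈ Finset.Icc 1 n, p j)) •
          α.op n (tree T.1) (tuple n a) ⊗ₜ[K] β.op n (tree T.2) (tuple n b)
  inner_tmul : ∀ p' q a b a' b', a' ∈ 𝒜 p' → b ∈ ℬ q →
    γ.inner (a ⊗ₜ[K] b) (a' ⊗ₜ[K] b') = (-1 : K) ^ (p' * q) * (α.inner a a' * β.inner b b')

end Algebras

/-! ### The ribbon graph complex -/

section Graphs

/-- A ribbon graph: a finite connected graph with set of vertices `V` and set of half-edges `H`,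
all of whose vertices have valency at least three, together with a cyclic ordering of the
half-edges at each vertex. An edge consists of two half-edges `h`, `opp h`. -/
structure RibbonGraph where
  /-- the vertices -/
  V : Type
  /-- the half-edges -/
  H : Type
  [fintypeV : Fintype V]
  [fintypeH : Fintype H]
  [decEqV : DecidableEq V]
  [decEqH : DecidableEq H]
  /-- the cyclically ordered set of half-edges incident to a vertex -/
  cyc : V → Cycle H
  /-- the other half of the edge -/
  opp : H → H
  nodup : ∀ v, (cyc v).Nodup
  existsUnique : ∀ h, ∃! v, h ∈ cyc v
  opp_opp : ∀ h, opp (opp h) = h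
  opp_ne : ∀ h, opp h ≠ h
  valency : ∀ v, 3 ≤ (cyc v).length
  nonempty : Nonempty V
  connected : ∀ v w, Relation.ReflTransGen (fun v w => ∃ h ∈ cyc v, opp h ∈ cyc w) v w

attribute [instance] RibbonGraph.fintypeV RibbonGraph.fintypeH RibbonGraph.decEqV
  RibbonGraph.decEqH

/-- An isomorphism of ribbon graphs. -/
structure RibbonGraph.Iso (Γ Γ' : RibbonGraph) where
  /-- the bijection on vertices -/
  onV : Γ.V ≃ Γ'.V
  /-- the bijection on half-edges -/
  onH : Γ.H ≃ Γ'.H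
  map_cyc : ∀ v, (Γ.cyc v).map onH = Γ'.cyc (onV v)
  map_opp : ∀ h, onH (Γ.opp h) = Γ'.opp (onH h)

/-- The degree `∑_v (val(v) - 3)`. -/
def RibbonGraph.deg (Γ : RibbonGraph) : ℤ := ∑ v, (((Γ.cyc v).length : ℤ) - 3)

/-- A ribbon graph `Γ` with an orientation of the vector space spanned by its vertices and
half-edges. The orientation is given by an ordering `ori` of this set; two orderings give the
same orientation iff they differ by an even permutation (see `GraphComplex`). -/
structure OrientedRibbonGraph where
  /-- the ribbon graph -/
  Γ : RibbonGraph
  /-- the ordering of vertices and half-edges -/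
  ori : List (Γ.V ⊕ Γ.H)
  ori_nodup : ori.Nodup
  mem_ori : ∀ x, x ∈ ori

variable (K : Type*) [Field K]

/-- The relations in the graph complex: if `φ : Γ → Γ'` is an isomorphism, then
`(Γ, σ) = ± (Γ', σ')`, where the sign says whether `φ` takes `σ` to `σ'` or to `-σ'`. In particular
(`φ = id`) we have `(Γ, -σ) = -(Γ, σ)`. -/
def graphRelations : Set (OrientedRibbonGraph →₀ K) :=
  {x | ∃ (G G' : OrientedRibbonGraph) (φ : G.Γ.Iso G'.Γ),
    x = Finsupp.single G 1 -
      permSign K (G.ori.map (Sum.map φ.onV φ.onH)) G'.ori • Finsupp.single G' 1}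

/-- The vector space `𝒢_*` spanned by isomorphism classes of oriented ribbon graphs, modulo
`(Γ, -σ) = -(Γ, σ)`. -/
abbrev GraphComplex : Type _ :=
  (OrientedRibbonGraph →₀ K) ⧸ Submodule.span K (graphRelations K)

/-- The class of an oriented ribbon graph. -/
noncomputable def graphClass (G : OrientedRibbonGraph) : GraphComplex K :=
  Submodule.Quotient.mk (Finsupp.single G 1)

/-- An ordering `v_1, …, v_k` of the vertices, and for each vertex a labelling
`e_{v,0}, e_{v,1}, …, e_{v,n_v}` of the half-edges at `v` which follows the cyclic ordering;
`root v = e_{v,0}` and `rest v = [e_{v,1}, …, e_{v,n_v}]`. -/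
structure RibbonGraph.Labelling (Γ : RibbonGraph) where
  /-- the ordering of the vertices -/
  verts : List Γ.V
  /-- the half-edge `e_{v,0}` -/
  root : Γ.V → Γ.H
  /-- the half-edges `e_{v,1}, …, e_{v,n_v}` -/
  rest : Γ.V → List Γ.H
  verts_nodup : verts.Nodup
  mem_verts : ∀ v, v ∈ verts
  cyc_eq : ∀ v, ((root v :: rest v : List Γ.H) : Cycle Γ.H) = Γ.cyc v

namespace RibbonGraph.Labelling

variable {Γ : RibbonGraph} (c : Γ.Labelling)

/-- The number `n_v`, one less than the valency of `v`. -/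
def arity (v : Γ.V) : ℕ := (c.rest v).length

/-- The half-edge `e_{v,l}`, `0 ≤ l ≤ n_v`. -/
def half (v : Γ.V) (l : ℕ) : Γ.H := (c.root v :: c.rest v).getD l (c.root v)

/-- The ordering `v_1 e_{1,0} e_{1,1} … e_{1,n_1} v_2 e_{2,0} … e_{k,n_k}`. -/
def standardOri : List (Γ.V ⊕ Γ.H) :=
  c.verts.flatMap fun v => Sum.inl v :: (c.root v :: c.rest v).map Sum.inr

/-- The ordering `e_{1,1} … e_{1,n_1} e_{1,0} e_{2,1} … e_{k,n_k} e_{k,0}` of the half-edges. -/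
def halfEdgeList : List Γ.H := c.verts.flatMap fun v => c.rest v ++ [c.root v]

/-- The sign `A_Γ` which compares an orientation with `⟨v_1 e_{1,0} … e_{1,n_1} v_2 …⟩`. -/
noncomputable def orientationSign (ori : List (Γ.V ⊕ Γ.H)) : K :=
  permSign K ori c.standardOri

end RibbonGraph.Labelling

end Graphs

/-! ### Replacing the vertices of a ribbon graph by trees -/

section Expansion

lemma mem_grid {n : ℕ} {e : ℕ × ℕ} : e ∈ grid n ↔ (1 ≤ e.1 ∧ e.1 ≤ n) ∧ 1 ≤ e.2 ∧ e.2 ≤ n := by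
  rcases e with ⟨a, b⟩
  simp only [grid, List.mem_flatMap, List.mem_range'_1, List.mem_map, Prod.mk.injEq]
  constructor
  · rintro ⟨x, hx, y, hy, rfl, rfl⟩
    omega
  · rintro ⟨h1, h2⟩
    exact ⟨a, by omega, b, by omega, rfl, rfl⟩

lemma nodup_grid (n : ℕ) : (grid n).Nodup := by
  rw [grid, List.nodup_flatMap]
  refine ⟨fun a _ => (List.nodup_range' (s := 1) (n := n)).map fun x y h => by simpa using h, ?_⟩
  refine (List.nodup_range' (s := 1) (n := n)).imp ?_
  intro a b hab x hx hy
  simp only [List.mem_map] at hx hy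
  obtain ⟨_, _, rfl⟩ := hx
  obtain ⟨_, _, h⟩ := hy
  exact hab (by simpa using (congrArg Prod.fst h).symm)

namespace PTree

variable {n : ℕ}

/-- The intervals which correspond to the vertices of `T`. -/
def nodes (T : PTree n) : Finset (ℕ × ℕ) := insert (1, n) T.1

lemma two_le (T : PTree n) : 2 ≤ n := by
  by_contra h
  have := T.2
  simp [trees, h] at this

variable (T : PTree n)

lemma mem_edge {e : ℕ × ℕ} (he : e ∈ T.1) :
    1 ≤ e.1 ∧ e.1 < e.2 ∧ e.2 ≤ n ∧ e ≠ (1, n) := by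
  have h := T.2
  simp only [trees, if_pos T.two_le, Finset.mem_filter, Finset.mem_powerset] at h
  have := h.1 he
  simp only [intervals, Finset.mem_filter, Finset.mem_product, Finset.mem_Icc] at this
  exact ⟨this.1.1.1, this.2.1, this.1.2.2, this.2.2⟩

lemma mem_node {e : ℕ × ℕ} (he : e ∈ T.nodes) : 1 ≤ e.1 ∧ e.1 < e.2 ∧ e.2 ≤ n := by
  rcases Finset.mem_insert.1 he with rfl | he
  · have := T.two_le
    exact ⟨le_refl _, Nat.lt_of_succ_le this, le_refl _⟩
  · have := T.mem_edge he
    exact ⟨this.1, this.2.1, this.2.2.1⟩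

lemma compatible {e f : ℕ × ℕ} (he : e ∈ T.nodes) (hf : f ∈ T.nodes) : Compatible e f := by
  have h := T.2
  simp only [trees, if_pos T.two_le, Finset.mem_filter, Finset.mem_powerset] at h
  rcases Finset.mem_insert.1 he with rfl | he'
  · have := T.mem_node hf
    exact Or.inr (Or.inr (Or.inl ⟨this.1, this.2.2⟩))
  · rcases Finset.mem_insert.1 hf with rfl | hf'
    · have := T.mem_node he
      exact Or.inr (Or.inr (Or.inr ⟨this.1, this.2.2⟩))
    · exact h.2 _ he' _ hf'

lemma mem_children {I J : ℕ × ℕ} : J ∈ T.children I ↔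
    J ∈ grid n ∧ (J ∈ T.1 ∨ J.1 = J.2) ∧ Inside J I ∧
      ∀ J' ∈ T.1, ¬ (Inside J J' ∧ Inside J' I) := by
  simp [children]

lemma exists_parent {J : ℕ × ℕ} (hg : J ∈ grid n) (hJ : J ∈ T.1 ∨ J.1 = J.2) :
    ∃ I ∈ T.nodes, J ∈ T.children I := by
  have h2 := T.two_le
  have hne : (T.nodes.filter fun I => Inside J I).Nonempty := by
    refine ⟨(1, n), Finset.mem_filter.2 ⟨Finset.mem_insert_self _ _, ?_⟩⟩
    have := mem_grid.1 hg
    refine ⟨this.1.1, this.2.2, ?_⟩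
    rcases hJ with hJ | hJ
    · exact (T.mem_edge hJ).2.2.2
    · rintro rfl
      simp at hJ
      omega
  obtain ⟨I, hI, hmin⟩ := Finset.exists_min_image _ (fun I : ℕ × ℕ => I.2 - I.1) hne
  rw [Finset.mem_filter] at hI
  refine ⟨I, hI.1, T.mem_children.2 ⟨hg, hJ, hI.2, ?_⟩⟩
  rintro J' hJ' ⟨h3, h4⟩
  have h5 := hmin J' (Finset.mem_filter.2 ⟨Finset.mem_insert_of_mem hJ', h3⟩)
  have h6 := T.mem_edge hJ'
  rcases J' with ⟨x, y⟩
  rcases I with ⟨z, w⟩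
  simp only [Inside, ne_eq, Prod.mk.injEq] at h4 h5 h6
  omega

lemma parent_unique {J I I' : ℕ × ℕ} (hI : I ∈ T.nodes) (hI' : I' ∈ T.nodes)
    (h : J ∈ T.children I) (h' : J ∈ T.children I') : I = I' := by
  by_contra hne
  rw [mem_children] at h h'
  have hJ : J.1 ≤ J.2 := by
    rcases h.2.1 with h1 | h1
    · exact (T.mem_edge h1).2.1.le
    · exact h1.le
  have key : ∀ {X Y : ℕ × ℕ}, X ∈ T.nodes → Y ∈ T.nodes → Inside X Y → X ∈ T.1 := by
    intro X Y hX hY hXY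
    rcases Finset.mem_insert.1 hX with rfl | hX
    · exfalso
      have h1 := T.mem_node hY
      obtain ⟨h2, h3, h4⟩ := hXY
      apply h4
      ext
      · simp only at h2 ⊢; omega
      · simp only at h3 ⊢; omega
    · exact hX
  rcases T.compatible hI hI' with h1 | h1 | h1 | h1
  · have := h.2.2.1; have := h'.2.2.1
    simp only [Inside] at *
    omega
  · have := h.2.2.1; have := h'.2.2.1
    simp only [Inside] at *
    omega
  · have h2 : Inside I' I := ⟨h1.1, h1.2, fun e => hne e.symm⟩
    exact h.2.2.2 I' (key hI' hI h2) ⟨h'.2.2.1, h2⟩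
  · have h2 : Inside I I' := ⟨h1.1, h1.2, hne⟩
    exact h'.2.2.2 I (key hI hI' h2) ⟨h.2.2.1, h2⟩

lemma exists_child {I : ℕ × ℕ} (hI : I ∈ T.nodes) {l : ℕ} (h1 : I.1 ≤ l) (h2 : l ≤ I.2) :
    ∃ J ∈ T.children I, J.1 ≤ l ∧ l ≤ J.2 := by
  have hI' := T.mem_node hI
  have hne : ((insert (l, l) T.1).filter
      fun J => Inside J I ∧ J.1 ≤ l ∧ l ≤ J.2).Nonempty := by
    refine ⟨(l, l), Finset.mem_filter.2 ⟨Finset.mem_insert_self _ _, ⟨h1, h2, ?_⟩, le_refl _,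
      le_refl _⟩⟩
    rintro rfl
    exact lt_irrefl _ hI'.2.1
  obtain ⟨J, hJ, hmax⟩ := Finset.exists_max_image _ (fun I : ℕ × ℕ => I.2 - I.1) hne
  rw [Finset.mem_filter] at hJ
  have hJ' : J ∈ T.1 ∨ J.1 = J.2 := by
    rcases Finset.mem_insert.1 hJ.1 with rfl | h
    · exact Or.inr rfl
    · exact Or.inl h
  refine ⟨J, T.mem_children.2 ⟨mem_grid.2 ?_, hJ', hJ.2.1, ?_⟩, hJ.2.2⟩
  · obtain ⟨h3, h4, -⟩ := hJ.2.1
    omega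
  · rintro J' hJ' ⟨h3, h4⟩
    have h5 := hmax J' (Finset.mem_filter.2 ⟨Finset.mem_insert_of_mem hJ', h4, ?_⟩)
    · obtain ⟨-, h6, h7⟩ := hJ
      rcases J' with ⟨x, y⟩
      rcases J with ⟨z, w⟩
      simp only [Inside, ne_eq, Prod.mk.injEq] at h3 h5 h7
      omega
    · have := hJ.2.2
      have := h3.1
      have := h3.2.1
      omega

lemma two_le_length_children {I : ℕ × ℕ} (hI : I ∈ T.nodes) : 2 ≤ (T.children I).length := by
  have hI' := T.mem_node hI
  obtain ⟨J, hJ, h1, h2⟩ := T.exists_child hI (le_refl _) hI'.2.1.le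
  obtain ⟨J', hJ', h3, h4⟩ := T.exists_child hI hI'.2.1.le (le_refl _)
  have hne : J ≠ J' := by
    rintro rfl
    obtain ⟨h5, h6, h7⟩ := (T.mem_children.1 hJ).2.2.1
    exact h7 (Prod.ext (le_antisymm h1 h5) (le_antisymm h6 h4))
  have hnd : [J, J'].Nodup := by simpa using hne
  exact (hnd.subperm (l₂ := T.children I) (by
    intro x hx
    simp only [List.mem_cons, List.not_mem_nil, or_false] at hx
    rcases hx with rfl | rfl <;> assumption)).length_le

end PTree

variable {Γ : RibbonGraph} (c : Γ.Labelling) (T : ∀ v, PTree (c.arity v))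

namespace RibbonGraph.Labelling

lemma length_eq (v : Γ.V) : (Γ.cyc v).length = c.arity v + 1 := by
  rw [← c.cyc_eq v]; simp [arity]

lemma nodup_list (v : Γ.V) : (c.root v :: c.rest v).Nodup := by
  have := Γ.nodup v
  rwa [← c.cyc_eq v, Cycle.nodup_coe_iff] at this

lemma mem_cyc_iff {v : Γ.V} {h : Γ.H} : h ∈ Γ.cyc v ↔ ∃ l ≤ c.arity v, c.half v l = h := by
  rw [← c.cyc_eq v, Cycle.mem_coe_iff, List.mem_iff_getElem]
  constructor
  · rintro ⟨l, hl, rfl⟩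
    refine ⟨l, by simpa [arity, Nat.lt_succ_iff] using hl, ?_⟩
    rw [half, List.getD_eq_getElem _ _ hl]
  · rintro ⟨l, hl, rfl⟩
    have hl' : l < (c.root v :: c.rest v).length := by
      simpa [arity, Nat.lt_succ_iff] using hl
    exact ⟨l, hl', by rw [half, List.getD_eq_getElem _ _ hl']⟩

lemma half_injective {v w : Γ.V} {l m : ℕ} (hl : l ≤ c.arity v) (hm : m ≤ c.arity w)
    (h : c.half v l = c.half w m) : v = w ∧ l = m := by
  obtain rfl : v = w :=
    (Γ.existsUnique (c.half v l)).unique (c.mem_cyc_iff.2 ⟨l, hl, rfl⟩)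
      (c.mem_cyc_iff.2 ⟨m, hm, h.symm⟩)
  have hl' : l < (c.root v :: c.rest v).length := by simpa [arity, Nat.lt_succ_iff] using hl
  have hm' : m < (c.root v :: c.rest v).length := by simpa [arity, Nat.lt_succ_iff] using hm
  rw [half, half, List.getD_eq_getElem _ _ hl', List.getD_eq_getElem _ _ hm'] at h
  exact ⟨rfl, (c.nodup_list v).getElem_inj_iff.1 h⟩

lemma root_eq_half (v : Γ.V) : c.root v = c.half v 0 := rfl

/-- The internal edges of all the trees `T_v`. -/
abbrev InnerEdge : Type := Σ v, {e : ℕ × ℕ // e ∈ (T v).1}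

/-- The vertices of `Γ(T_1, …, T_k)`: the vertices of all the trees `T_v`. -/
abbrev ExpandV : Type := Σ v, {e : ℕ × ℕ // e ∈ (T v).nodes}

/-- The half-edges of `Γ(T_1, …, T_k)`: those of `Γ`, and the two halves of each internal edge of
the trees; `false` stands for the half at the upper vertex of the edge (away from the root),
`true` for the half at the lower vertex. -/
abbrev ExpandH : Type := Γ.H ⊕ (c.InnerEdge T × Bool)

/-- The outgoing half-edge of the vertex `I` of `T_v`; for the root vertex this is `e_{v,0}`. -/
def outHalf (v : Γ.V) (I : ℕ × ℕ) : c.ExpandH T :=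
  if h : I ∈ (T v).1 then Sum.inr (⟨v, I, h⟩, false) else Sum.inl (c.root v)

/-- The half-edge by which the incoming edge `J` is attached to its lower vertex; for the leaf
`J = (l, l)` this is `e_{v,l}`. -/
def inHalf (v : Γ.V) (J : ℕ × ℕ) : c.ExpandH T :=
  if h : J ∈ (T v).1 then Sum.inr (⟨v, J, h⟩, true) else Sum.inl (c.half v J.1)

/-- The half-edges at the vertex `I` of `T_v`: the outgoing one, then the incoming ones from left to
right. -/
def expandList (v : Γ.V) (I : ℕ × ℕ) : List (c.ExpandH T) :=
  c.outHalf T v I :: ((T v).children I).map (c.inHalf T v)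

/-- The other half of an edge of `Γ(T_1, …, T_k)`. -/
def expandOpp : c.ExpandH T → c.ExpandH T
  | Sum.inl h => Sum.inl (Γ.opp h)
  | Sum.inr (e, b) => Sum.inr (e, !b)

/-- The root vertex of the tree `T_v`; it is identified with the vertex `v` of `Γ`. -/
def rootVertex (v : Γ.V) : c.ExpandV T := ⟨v, (1, c.arity v), Finset.mem_insert_self _ _⟩

/-- The upper vertex of an internal edge. -/
def upperVertex (e : c.InnerEdge T) : c.ExpandV T :=
  ⟨e.1, e.2.1, Finset.mem_insert_of_mem e.2.2⟩

lemma whole_not_mem {n : ℕ} (S : PTree n) : (1, n) ∉ S.1 := fun h => (S.mem_edge h).2.2.2 rfl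

lemma mem_expandList_inl {v : Γ.V} {I : ℕ × ℕ} (hI : I ∈ (T v).nodes) {w : Γ.V} {l : ℕ}
    (hl : l ≤ c.arity w) :
    Sum.inl (c.half w l) ∈ c.expandList T v I ↔
      w = v ∧ ((l = 0 ∧ I = (1, c.arity v)) ∨ (1 ≤ l ∧ (l, l) ∈ (T v).children I)) := by
  simp only [expandList, List.mem_cons, List.mem_map]
  constructor
  · rintro (h | ⟨J, hJ, h⟩)
    · unfold outHalf at h
      split_ifs at h with h1
      rw [root_eq_half] at h
      obtain ⟨rfl, rfl⟩ := c.half_injective hl (Nat.zero_le _) (Sum.inl.inj h)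
      refine ⟨rfl, Or.inl ⟨rfl, ?_⟩⟩
      rcases Finset.mem_insert.1 hI with h2 | h2
      · exact h2
      · exact absurd h2 h1
    · unfold inHalf at h
      split_ifs at h with h1
      have h2 := (T v).mem_children.1 hJ
      have h3 := mem_grid.1 h2.1
      obtain ⟨rfl, rfl⟩ := c.half_injective h3.1.2 hl (Sum.inl.inj h)
      refine ⟨rfl, Or.inr ⟨h3.1.1, ?_⟩⟩
      have h4 : J.1 = J.2 := h2.2.1.resolve_left h1
      have h5 : (J.1, J.1) = J := Prod.ext rfl h4
      rwa [h5]
  · rintro ⟨rfl, ⟨rfl, rfl⟩ | ⟨h1, h2⟩⟩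
    · left
      rw [outHalf, dif_neg (whole_not_mem _), root_eq_half]
    · right
      refine ⟨_, h2, ?_⟩
      rw [inHalf, dif_neg]
      intro h3
      exact lt_irrefl _ ((T w).mem_edge h3).2.1

lemma mem_expandList_false {v : Γ.V} {I : ℕ × ℕ} (e : c.InnerEdge T) :
    Sum.inr (e, false) ∈ c.expandList T v I ↔ e.1 = v ∧ e.2.1 = I := by
  simp only [expandList, List.mem_cons, List.mem_map]
  constructor
  · rintro (h | ⟨J, hJ, h⟩)
    · unfold outHalf at h
      split_ifs at h with h1
      simp only [Sum.inr.injEq, Prod.mk.injEq, and_true] at h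
      subst h
      exact ⟨rfl, rfl⟩
    · unfold inHalf at h
      split_ifs at h
      simp at h
  · rintro ⟨rfl, rfl⟩
    left
    rw [outHalf, dif_pos e.2.2]

lemma mem_expandList_true {v : Γ.V} {I : ℕ × ℕ} (e : c.InnerEdge T) :
    Sum.inr (e, true) ∈ c.expandList T v I ↔ e.1 = v ∧ e.2.1 ∈ (T v).children I := by
  simp only [expandList, List.mem_cons, List.mem_map]
  constructor
  · rintro (h | ⟨J, hJ, h⟩)
    · unfold outHalf at h
      split_ifs at h
      simp at h
    · unfold inHalf at h
      split_ifs at h with h1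
      simp only [Sum.inr.injEq, Prod.mk.injEq, and_true] at h
      subst h
      exact ⟨rfl, hJ⟩
  · rintro ⟨rfl, h⟩
    right
    exact ⟨_, h, by rw [inHalf, dif_pos e.2.2]⟩

lemma nodup_expandList {v : Γ.V} {I : ℕ × ℕ} : (c.expandList T v I).Nodup := by
  rw [expandList, List.nodup_cons]
  constructor
  · simp only [List.mem_map, not_exists, not_and]
    intro J hJ h
    unfold inHalf outHalf at h
    have h2 := mem_grid.1 ((T v).mem_children.1 hJ).1
    split_ifs at h with h3 h4 h4
    · simp at h
    · rw [root_eq_half] at h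
      have := (c.half_injective h2.1.2 (Nat.zero_le _) (Sum.inl.inj h)).2
      omega
  · refine List.Nodup.map_on ?_ ((nodup_grid _).filter _)
    intro J hJ J' hJ' h
    unfold inHalf at h
    have h1 := (T v).mem_children.1 hJ
    have h1' := (T v).mem_children.1 hJ'
    split_ifs at h with h3 h4 h4
    · simpa using h
    · have h5 := (c.half_injective (mem_grid.1 h1.1).1.2 (mem_grid.1 h1'.1).1.2 (Sum.inl.inj h)).2
      refine Prod.ext h5 ?_
      rw [← h1.2.1.resolve_left h3, ← h1'.2.1.resolve_left h4, h5]

lemma existsUnique_expand (h : c.ExpandH T) :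
    ∃! x : c.ExpandV T, h ∈ (c.expandList T x.1 x.2.1 : Cycle (c.ExpandH T)) := by
  simp only [Cycle.mem_coe_iff]
  rcases h with h | ⟨e, b⟩
  · obtain ⟨v, hv, -⟩ := Γ.existsUnique h
    obtain ⟨l, hl, rfl⟩ := c.mem_cyc_iff.1 hv
    rcases Nat.eq_zero_or_pos l with rfl | hpos
    · refine ⟨c.rootVertex T v, ?_, ?_⟩
      · exact (c.mem_expandList_inl T (c.rootVertex T v).2.2 hl).2 ⟨rfl, Or.inl ⟨rfl, rfl⟩⟩
      · rintro ⟨w, I, hI⟩ h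
        obtain ⟨rfl, ⟨-, h2⟩ | ⟨h1, -⟩⟩ := (c.mem_expandList_inl T hI hl).1 h
        · obtain rfl : I = _ := h2
          rfl
        · omega
    · obtain ⟨I, hI, h1⟩ := (T v).exists_parent (J := (l, l))
        (mem_grid.2 ⟨⟨hpos, hl⟩, hpos, hl⟩) (Or.inr rfl)
      refine ⟨⟨v, I, hI⟩, (c.mem_expandList_inl T hI hl).2 ⟨rfl, Or.inr ⟨hpos, h1⟩⟩, ?_⟩
      rintro ⟨w, I', hI'⟩ h
      obtain ⟨rfl, ⟨h3, -⟩ | ⟨-, h3⟩⟩ := (c.mem_expandList_inl T hI' hl).1 h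
      · omega
      · obtain rfl := (T v).parent_unique hI hI' h1 h3
        rfl
  · cases b
    · refine ⟨c.upperVertex T e, (c.mem_expandList_false T e).2 ⟨rfl, rfl⟩, ?_⟩
      rintro ⟨w, I, hI⟩ h
      obtain ⟨h1, h2⟩ := (c.mem_expandList_false T e).1 h
      simp only at h1 h2
      subst h1 h2
      rfl
    · obtain ⟨v, J, hJ⟩ := e
      have hJ' := (T v).mem_edge hJ
      obtain ⟨I, hI, h1⟩ := (T v).exists_parent (J := J)
        (mem_grid.2 (by omega)) (Or.inl hJ)
      refine ⟨⟨v, I, hI⟩, (c.mem_expandList_true T ⟨v, J, hJ⟩).2 ⟨rfl, h1⟩, ?_⟩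
      rintro ⟨w, I', hI'⟩ h
      obtain ⟨h2, h3⟩ := (c.mem_expandList_true T ⟨v, J, hJ⟩).1 h
      simp only at h2 h3
      subst h2
      obtain rfl := (T v).parent_unique hI hI' h1 h3
      rfl

lemma expandOpp_expandOpp (h : c.ExpandH T) : c.expandOpp T (c.expandOpp T h) = h := by
  rcases h with h | ⟨e, b⟩ <;> simp [expandOpp, Γ.opp_opp]

/-- The relation of being joined by an edge of `Γ(T_1, …, T_k)`. -/
def ExpandAdj (x y : c.ExpandV T) : Prop :=
  ∃ h ∈ (c.expandList T x.1 x.2.1 : Cycle (c.ExpandH T)),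
    c.expandOpp T h ∈ (c.expandList T y.1 y.2.1 : Cycle (c.ExpandH T))

lemma ExpandAdj.symm {x y : c.ExpandV T} (h : c.ExpandAdj T x y) : c.ExpandAdj T y x := by
  obtain ⟨h, h1, h2⟩ := h
  exact ⟨_, h2, by rwa [expandOpp_expandOpp]⟩

lemma reach_root (v : Γ.V) (k : ℕ) : ∀ (I : ℕ × ℕ) (hI : I ∈ (T v).nodes),
    c.arity v - (I.2 - I.1) = k →
    Relation.ReflTransGen (c.ExpandAdj T) ⟨v, I, hI⟩ (c.rootVertex T v) := by
  induction k using Nat.strong_induction_on with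
  | _ k ih =>
    intro I hI hk
    rcases Finset.mem_insert.1 hI with rfl | hI'
    · exact Relation.ReflTransGen.refl
    · have h0 := (T v).mem_edge hI'
      obtain ⟨P, hP, h1⟩ := (T v).exists_parent (J := I)
        (mem_grid.2 (by omega)) (Or.inl hI')
      have h2 := (T v).mem_node hP
      have h3 := ((T v).mem_children.1 h1).2.2.1
      refine Relation.ReflTransGen.head (b := ⟨v, P, hP⟩) ?_ (ih _ ?_ P hP rfl)
      · exact ⟨Sum.inr (⟨v, I, hI'⟩, false),
          (c.mem_expandList_false T ⟨v, I, hI'⟩).2 ⟨rfl, rfl⟩,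
          (c.mem_expandList_true T ⟨v, I, hI'⟩).2 ⟨rfl, h1⟩⟩
      · rcases P with ⟨x, y⟩
        rcases I with ⟨z, w⟩
        simp only [Inside, ne_eq, Prod.mk.injEq] at h0 h2 h3 hk ⊢
        omega

lemma expand_connected (x y : c.ExpandV T) : Relation.ReflTransGen (c.ExpandAdj T) x y := by
  have hsymm : ∀ {x y : c.ExpandV T}, Relation.ReflTransGen (c.ExpandAdj T) x y →
      Relation.ReflTransGen (c.ExpandAdj T) y x := fun h =>
    (@Relation.ReflTransGen.stdSymm _ (c.ExpandAdj T) ⟨fun _ _ h => h.symm⟩).symm _ _ h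
  have hroot : ∀ x : c.ExpandV T, Relation.ReflTransGen (c.ExpandAdj T) x (c.rootVertex T x.1) :=
    fun x => c.reach_root T x.1 _ x.2.1 x.2.2 rfl
  have hadj : ∀ v w : Γ.V, Relation.ReflTransGen (fun v w => ∃ h ∈ Γ.cyc v, Γ.opp h ∈ Γ.cyc w) v w →
      Relation.ReflTransGen (c.ExpandAdj T) (c.rootVertex T v) (c.rootVertex T w) := by
    intro v w hvw
    induction hvw with
    | refl => exact Relation.ReflTransGen.refl
    | @tail v w _ hvw ih =>
    refine ih.trans ?_
    obtain ⟨h, h1, h2⟩ := hvw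
    obtain ⟨p, hp, -⟩ := c.existsUnique_expand T (Sum.inl h)
    obtain ⟨q, hq, -⟩ := c.existsUnique_expand T (Sum.inl (Γ.opp h))
    have hcl : ∀ (p : c.ExpandV T) (v : Γ.V) (h : Γ.H), h ∈ Γ.cyc v →
        Sum.inl h ∈ (c.expandList T p.1 p.2.1 : Cycle (c.ExpandH T)) → v = p.1 := by
      intro p v h hv hp
      obtain ⟨l, hl, rfl⟩ := c.mem_cyc_iff.1 hv
      exact ((c.mem_expandList_inl T p.2.2 hl).1 hp).1
    obtain rfl := hcl p v h h1 hp
    obtain rfl := hcl q w _ h2 hq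
    exact (hsymm (hroot p)).trans (Relation.ReflTransGen.head ⟨_, hp, hq⟩ (hroot q))
  exact (hroot x).trans ((hadj _ _ (Γ.connected x.1 y.1)).trans (hsymm (hroot y)))

/-- The ribbon graph `Γ(T_1, …, T_k)`, obtained by replacing each vertex `v` of `Γ` by the tree
`T_v`, gluing the root of `T_v` to `e_{v,0}` and the leaves to `e_{v,1}, …, e_{v,n_v}`. -/
def expand : RibbonGraph where
  V := c.ExpandV T
  H := c.ExpandH T
  cyc x := c.expandList T x.1 x.2.1
  opp := c.expandOpp T
  nodup x := Cycle.nodup_coe_iff.2 (c.nodup_expandList T)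
  existsUnique := c.existsUnique_expand T
  opp_opp := c.expandOpp_expandOpp T
  opp_ne h := by
    rcases h with h | ⟨e, b⟩
    · simpa [expandOpp] using Γ.opp_ne h
    · cases b <;> simp [expandOpp]
  valency x := by
    have := (T x.1).two_le_length_children x.2.2
    simp [expandList]
    omega
  nonempty := Γ.nonempty.map (c.rootVertex T)
  connected := c.expand_connected T

/-- All the internal edges of the trees, in the order `f_{1,1}, …, f_{1,t_1}, f_{2,1}, …`. -/
def innerEdges : List (c.InnerEdge T) :=
  c.verts.flatMap fun v =>
    (T v).edgeList.attach.map fun e => ⟨v, e.1, by simpa using (List.mem_filter.1 e.2).2⟩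

/-- The orientation of `Γ(T_1, …, T_k)` from which contracting successively all the edges
`f_{1,1}, …, f_{1,t_1}, f_{2,1}, …, f_{k,t_k}` yields the orientation `ori` of `Γ`. Contracting the
edge `f` with ends `v⁺`, `v⁻` and halves `f⁺`, `f⁻` turns `⟨v⁺ v⁻ f⁺ f⁻ …⟩ = ⟨v⁺ f⁺ f⁻ v⁻ …⟩` into
`⟨v …⟩`; here `v⁺` is the upper end of `f`, and the new vertex `v` keeps the name of `v⁻`. -/
def expandOri (ori : List (Γ.V ⊕ Γ.H)) : List (c.ExpandV T ⊕ c.ExpandH T) :=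
  ((c.innerEdges T).flatMap fun f =>
    [Sum.inl (c.upperVertex T f), Sum.inr (Sum.inr (f, false)), Sum.inr (Sum.inr (f, true))]) ++
  ori.map (Sum.map (c.rootVertex T) Sum.inl)

lemma mem_innerEdges (f : c.InnerEdge T) : f ∈ c.innerEdges T := by
  obtain ⟨v, e, he⟩ := f
  have h := (T v).mem_edge he
  have he' : e ∈ (T v).edgeList :=
    List.mem_filter.2 ⟨mem_grid.2 (by omega), by simpa using he⟩
  simp only [innerEdges, List.mem_flatMap, List.mem_map, List.mem_attach, true_and]
  exact ⟨v, c.mem_verts v, ⟨e, he'⟩, rfl⟩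

lemma nodup_innerEdges : (c.innerEdges T).Nodup := by
  rw [innerEdges, List.nodup_flatMap]
  constructor
  · intro v _
    refine List.Nodup.map ?_ (List.nodup_attach.2 ((nodup_grid _).filter _))
    intro e f h
    simpa [Subtype.ext_iff] using h
  · refine c.verts_nodup.imp ?_
    intro v w hvw x hx hy
    simp only [List.mem_map] at hx hy
    obtain ⟨_, _, rfl⟩ := hx
    obtain ⟨_, _, h⟩ := hy
    exact hvw (congrArg Sigma.fst h).symm

lemma nodup_expandOri {ori : List (Γ.V ⊕ Γ.H)} (h : ori.Nodup) : (c.expandOri T ori).Nodup := by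
  unfold expandOri
  refine List.Nodup.append ?_ ?_ ?_
  · rw [List.nodup_flatMap]
    refine ⟨fun f _ => by simp, (c.nodup_innerEdges T).imp ?_⟩
    intro f g hfg x hx hy
    apply hfg
    obtain ⟨v, e, he⟩ := f
    obtain ⟨w, e', he'⟩ := g
    simp only [List.mem_cons, List.not_mem_nil, or_false] at hx hy
    rcases hx with rfl | rfl | rfl
    · simp only [upperVertex, Sum.inl.injEq, reduceCtorEq, or_false] at hy
      injection hy with h1 h2
      subst h1
      obtain rfl : e = e' := congrArg Subtype.val (eq_of_heq h2)
      rfl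
    · simpa using hy
    · simpa using hy
  · refine h.map ?_
    refine Function.Injective.sumMap ?_ Sum.inl_injective
    intro v w h
    exact congrArg Sigma.fst h
  · intro x hx hy
    simp only [List.mem_flatMap, List.mem_cons, List.not_mem_nil, or_false, List.mem_map]
      at hx hy
    obtain ⟨⟨v, e, he⟩, -, hf⟩ := hx
    obtain ⟨y, -, rfl⟩ := hy
    rcases y with y | y
    · rcases hf with hf | hf | hf
      · simp only [Sum.map_inl, upperVertex, rootVertex, Sum.inl.injEq] at hf
        injection hf with h1 h2
        subst h1
        obtain rfl : _ = e := congrArg Subtype.val (eq_of_heq h2)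
        exact whole_not_mem _ he
      · simp at hf
      · simp at hf
    · simp at hf

lemma mem_expandOri {ori : List (Γ.V ⊕ Γ.H)} (h : ∀ x, x ∈ ori)
    (x : c.ExpandV T ⊕ c.ExpandH T) : x ∈ c.expandOri T ori := by
  unfold expandOri
  rw [List.mem_append]
  rcases x with ⟨v, e, he⟩ | y | ⟨f, b⟩
  · rcases Finset.mem_insert.1 he with rfl | he'
    · right
      exact List.mem_map.2 ⟨Sum.inl v, h _, rfl⟩
    · left
      exact List.mem_flatMap.2 ⟨⟨v, e, he'⟩, c.mem_innerEdges T _, List.mem_cons_self⟩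
  · right
    exact List.mem_map.2 ⟨Sum.inr y, h _, rfl⟩
  · left
    refine List.mem_flatMap.2 ⟨f, c.mem_innerEdges T _, ?_⟩
    cases b <;> simp

end RibbonGraph.Labelling

/-- The oriented ribbon graph `Γ(T_1, …, T_k)`; each tree `T_v` carries its reference
orientation. -/
def OrientedRibbonGraph.expand (G : OrientedRibbonGraph) (c : G.Γ.Labelling)
    (T : ∀ v, PTree (c.arity v)) : OrientedRibbonGraph where
  Γ := c.expand T
  ori := c.expandOri T G.ori
  ori_nodup := c.nodup_expandOri T G.ori_nodup
  mem_ori := c.mem_expandOri T G.mem_ori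

end Expansion

/-! ### The diagonal of the graph complex and the Kontsevich cocycle -/

section Main

variable (K : Type*) [Field K]

/-- The map `φ_Γ : A_∞(n_1) ⊗ ⋯ ⊗ A_∞(n_k) → 𝒢_*(Γ) ⊆ 𝒢_*` on basis vectors:
`φ_Γ(T_1, …, T_k) = (-1)^|Γ| A_Γ (-1)^(∑_{i < j} n_i t_j) Γ(T_1, …, T_k)`, where `t_j` is the number
of internal edges of `T_j`. For corollas this reads
`φ_Γ(c_{n_1}, …, c_{n_k}) = (-1)^|Γ| A_Γ (Γ, σ)`. -/
noncomputable def phi (G : OrientedRibbonGraph) (c : G.Γ.Labelling)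
    (T : ∀ v, PTree (c.arity v)) : GraphComplex K :=
  ((-1 : K) ^ G.Γ.deg * c.orientationSign K G.ori *
      (-1 : K) ^ pairSum (fun v w => (c.arity v : ℤ) * ((T w).1.card : ℤ)) c.verts) •
    graphClass K (G.expand c T)

variable {K}

/-- The element
`δ_Γ(Γ, σ) = ((φ_Γ ⊗ φ_Γ) ∘ τ ∘ (Δ ⊗ ⋯ ⊗ Δ) ∘ φ_Γ⁻¹)(Γ, σ)` of `𝒢_* ⊗ 𝒢_*`, where
`φ_Γ⁻¹(Γ, σ) = (-1)^|Γ| A_Γ c_{n_1} ⊗ ⋯ ⊗ c_{n_k}`. The sum runs over the terms `T_v ⊗ T'_v` of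
`Δ(c_{n_v})`, for all the vertices `v`, and the Koszul sign of the shuffle `τ` is
`(-1)^(∑_{i < j} |T'_i| |T_j|)`. -/
noncomputable def graphDiagonal (Δ : CyclicDiagonal K) (G : OrientedRibbonGraph)
    (c : G.Γ.Labelling) : GraphComplex K ⊗[K] GraphComplex K :=
  ((-1 : K) ^ G.Γ.deg * c.orientationSign K G.ori) •
    ∑ T : (∀ v, PTree (c.arity v) × PTree (c.arity v)),
      ((∏ v, Δ.map (c.arity v) (corolla K (c.arity v)) (T v)) *
          (-1 : K) ^ pairSum (fun v w => (T v).2.deg * (T w).1.deg) c.verts) •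
        (phi K G c (fun v => (T v).1) ⊗ₜ[K] phi K G c (fun v => (T v).2))

/-- `δ` is the diagonal of the graph complex: the linear map `𝒢_* → 𝒢_* ⊗ 𝒢_*` whose value
on `(Γ, σ) ∈ 𝒢_*(Γ)` is `δ_Γ(Γ, σ)`, no matter which labelling is used to compute it. -/
def IsGraphDiagonal (Δ : CyclicDiagonal K)
    (δ : GraphComplex K →ₗ[K] GraphComplex K ⊗[K] GraphComplex K) : Prop :=
  ∀ (G : OrientedRibbonGraph) (c : G.Γ.Labelling), δ (graphClass K G) = graphDiagonal Δ G c

/-- An ordering and orientation of the edges of `Γ`: the list `h_1⁺, …, h_E⁺` of the first halves of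
the edges. -/
structure RibbonGraph.EdgeOrdering (Γ : RibbonGraph) where
  /-- the half-edges `h_1⁺, …, h_E⁺` -/
  heads : List Γ.H
  nodup : (heads.flatMap fun h => [h, Γ.opp h]).Nodup
  mem : ∀ h, h ∈ heads.flatMap fun h => [h, Γ.opp h]

variable {A : Type*} [AddCommGroup A] [Module K A]

/-- The image of `(Γ, σ)` under
`𝒢_*(Γ) → A_∞(n_1) ⊗ ⋯ ⊗ A_∞(n_k) → Hom(A^{⊗ n_1}, A) ⊗ ⋯ ⊗ Hom(A^{⊗ n_k}, A)
≅ (A^∨)^{⊗ n_1 + 1} ⊗ ⋯ ⊗ (A^∨)^{⊗ n_k + 1} → (A^∨)^{⊗ 2} ⊗ ⋯ ⊗ (A^∨)^{⊗ 2} → K`,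
where the maps are `φ_Γ⁻¹`, then `ρ ⊗ ⋯ ⊗ ρ`, then the identification by the inner product, then the
permutation of the half-edges from `e_{1,1} … e_{1,n_1} e_{1,0} e_{2,1} … e_{k,0}` to
`h_1⁺ h_1⁻ … h_E⁺ h_E⁻`, and finally the contraction with the inverse `⟨-,-⟩⁻¹` at each edge. It is
computed in a basis `b` of `A` consisting of elements `b i` of degree `deg i`. The first sign is
the Koszul sign in the evaluation of `ρ(c_{n_1}) ⊗ ⋯ ⊗ ρ(c_{n_k})`, the second one that of the
permutation. -/
noncomputable def kontsevichWeight (α : AInfData K A) {N : ℕ} (b : Module.Basis (Fin N) K A)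
    (deg : Fin N → ℤ) (G : OrientedRibbonGraph) (c : G.Γ.Labelling) (E : G.Γ.EdgeOrdering) : K :=
  (-1 : K) ^ G.Γ.deg * c.orientationSign K G.ori *
    ∑ s : G.Γ.H → Fin N,
      (-1 : K) ^ pairSum (fun v w => ((c.arity w : ℤ) - 2) *
          (((c.rest v ++ [c.root v]).map fun h => deg (s h)).sum)) c.verts *
        koszulSign K (fun h => deg (s h)) c.halfEdgeList (E.heads.flatMap fun h => [h, G.Γ.opp h]) *
        (∏ v, α.inner
          (α.op (c.arity v) (corolla K (c.arity v)) fun k => b (s ((c.rest v).get k)))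
          (b (s (c.root v)))) *
        (E.heads.map fun h =>
          (Matrix.of fun i j => α.inner (b i) (b j))⁻¹ (s h) (s (G.Γ.opp h))).prod

/-- `κ` is the Kontsevich cocycle `c_A`: the linear functional on `𝒢_*` whose value on
`(Γ, σ) ∈ 𝒢_*(Γ)` is `c_{A,Γ}(Γ, σ)`, no matter which homogeneous basis of `A`, which
labelling and which ordering and orientation of the edges are used to compute it. -/
def IsKontsevichCocycle (𝒜 : ℤ → Submodule K A) (α : AInfData K A)
    (κ : GraphComplex K →ₗ[K] K) : Prop :=
  ∀ (N : ℕ) (b : Module.Basis (Fin N) K A) (deg : Fin N → ℤ), (∀ i, b i ∈ 𝒜 (deg i)) →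
    ∀ (G : OrientedRibbonGraph) (c : G.Γ.Labelling) (E : G.Γ.EdgeOrdering),
      κ (graphClass K G) = kontsevichWeight α b deg G c E

end Main

end RibbonTensor

open RibbonTensor

/-! Both sides are state sums. In a homogeneous basis of `A`, the number `c_A(Γ)` arises by putting
a basis vector on every half-edge, multiplying the functionals `⟨ρ(c_n)(…), -⟩` at the vertices with
entries of the inverse Gram matrix at the edges and with a Koszul sign, and summing over all states.

For `A ⊗ B` a state is a pair of states. The inverse Gram matrix is, up to sign, a product
(`IsTensorAInf.gram_inv`), and the functional at a vertex is a sum over the terms `T ⊗ T'` of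
`Δ(c_n)` of products of the functionals of `ρ_A(T)` and `ρ_B(T')` (`IsTensorAInf.cyclicOp_eq`). So
for each choice of terms at all vertices the sum factors into a sum over `Γ` with `ρ_A(T_v)` at the
vertices and one with `ρ_B(T'_v)` (`IsTensorAInf.weightSum_eq`). On the other side `δ` replaces `Γ`
by `Γ(T) ⊗ Γ(T')`. The link is `IsCyclicAInf.cocycle_stdExpansion`: the sum over `Γ` with `ρ(T_v)`
at the vertices is, up to sign, the value of `c_A` on `Γ(T)`. It holds because `ρ` respects operadic
composition, and composing two operations is contracting their functionals along the new edge with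
the inverse inner product; every tree is built by grafting corollas (`exists_hasExpansion`).

The real content is the signs. Two parity facts make them independent of the states. Evenness forces
the two ends of an edge to have equal parity wherever the propagator is nonzero, and the functional
of a tree with `n` leaves and `t` internal edges is nonzero only if the parities of its `n + 1`
arguments add up to `n + t`. The Koszul sign for letters of degree `p + q` differs from the product
of those for `p` and `q` by sums over pairs of letters before and after the permutation (`kos_add`).
At the end there remains, for `f v = |T_v|` and `g v = |T'_v|` modulo 2, an identity that expands
`(f v + g v)(f w + g w)` over pairs of vertices; its error term contains the factor `∑ f`, which
vanishes because half-edges come in pairs.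

Well-definedness: a function of labelled oriented graphs descends to the graph complex if it changes
by the orientation sign under isomorphisms, reorderings of the vertices and one-step rotations of
the labels (`existsUnique_descent`). For the cocycles this uses cyclicity of the corollas, symmetry
of the propagator and independence of the homogeneous basis. For `δ`, `phi_eq` shows that `φ_Γ`
depends on the orientation of `Γ` only formally; rotating the labels of `Γ` and the inserted trees
gives an isomorphic graph, the orientation sign of the isomorphism is the sign in `r(T, σ)`
(`PTree.kos_rot`, `rot_tree`), and `Δ ∘ r = (r ⊗ r) ∘ Δ` compares the coefficients.

The structure on `A ⊗ B` exists and is unique because homogeneous bases determine it. For its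
cocycle it suffices that the product basis satisfies the properties collected in `IsCyclicBasis`,
and these are verified directly. -/

namespace RibbonTensor

open scoped TensorProduct

/-! ### Signs as a character of `ℤ/2` -/

section SignAlgebra

variable (K : Type*) [Field K]

/-- The sign `(-1)^z` for `z ∈ ℤ/2`. -/
def sg (z : ZMod 2) : K := if z = 0 then 1 else -1

lemma sg_zero : sg K 0 = 1 := by simp [sg]

lemma sg_one : sg K 1 = -1 := by simp [sg]

lemma sg_add (a b : ZMod 2) : sg K (a + b) = sg K a * sg K b := by
  have h : ∀ a b : ZMod 2, (a + b = 0 ↔ (a = 0 ↔ b = 0)) := by decide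
  unfold sg
  by_cases ha : a = 0 <;> by_cases hb : b = 0 <;> simp [h, ha, hb]

lemma sg_mul_self (a : ZMod 2) : sg K a * sg K a = 1 := by
  rw [← sg_add, CharTwo.add_self_eq_zero, sg_zero]

lemma neg_one_zpow_eq_sg (z : ℤ) : (-1 : K) ^ z = sg K (z : ZMod 2) := by
  rcases Int.even_or_odd z with h | h
  · rw [h.neg_one_zpow, (ZMod.intCast_eq_zero_iff_even).2 h, sg_zero]
  · rw [h.neg_one_zpow, (ZMod.intCast_eq_one_iff_odd).2 h, sg_one]

lemma neg_one_pow_eq_sg (n : ℕ) : (-1 : K) ^ n = sg K (n : ZMod 2) := by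
  have := neg_one_zpow_eq_sg K (n : ℤ)
  simpa using this

lemma sg_sum {α : Type*} (s : Finset α) (f : α → ZMod 2) :
    sg K (∑ a ∈ s, f a) = ∏ a ∈ s, sg K (f a) := by
  classical
  induction s using Finset.induction_on with
  | empty => simp [sg_zero]
  | insert a s ha ih => rw [Finset.sum_insert ha, Finset.prod_insert ha, sg_add, ih]

lemma sg_list_sum (l : List (ZMod 2)) : sg K l.sum = (l.map (sg K)).prod := by
  induction l with
  | nil => simp [sg_zero]
  | cons a l ih => simp [sg_add, ih]

end SignAlgebra

/-! ### Sums over ordered pairs of letters of a word -/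

section PairSums

variable {α β ι : Type*}

/-- `∑_{i < j} f (l_i) (l_j)` modulo `2`. -/
def psum (f : α → α → ZMod 2) : List α → ZMod 2
  | [] => 0
  | a :: l => (l.map (f a)).sum + psum f l

lemma cast_pairSum (f : α → α → ℤ) (l : List α) :
    ((pairSum f l : ℤ) : ZMod 2) = psum (fun a b => (f a b : ZMod 2)) l := by
  induction l with
  | nil => simp [pairSum, psum]
  | cons a l ih =>
    simp only [pairSum, psum, Int.cast_add, ih]
    congr 1
    rw [Int.cast_list_sum, List.map_map]
    rfl

@[simp] lemma psum_nil (f : α → α → ZMod 2) : psum f [] = 0 := rfl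

lemma psum_cons (f : α → α → ZMod 2) (a : α) (l : List α) :
    psum f (a :: l) = (l.map (f a)).sum + psum f l := rfl

@[simp] lemma psum_singleton (f : α → α → ZMod 2) (a : α) : psum f [a] = 0 := by
  simp [psum]

lemma psum_append (f : α → α → ZMod 2) (l m : List α) :
    psum f (l ++ m) = psum f l + psum f m + (l.map fun a => (m.map (f a)).sum).sum := by
  induction l with
  | nil => simp
  | cons a l ih =>
    simp only [List.cons_append, psum_cons, ih, List.map_append, List.sum_append, List.map_cons,
      List.sum_cons]
    ring

lemma psum_map (f : β → β → ZMod 2) (φ : α → β) (l : List α) :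
    psum f (l.map φ) = psum (fun a b => f (φ a) (φ b)) l := by
  induction l with
  | nil => rfl
  | cons a l ih => simp [psum_cons, ih, Function.comp_def]

lemma psum_add (f g : α → α → ZMod 2) (l : List α) :
    psum (fun a b => f a b + g a b) l = psum f l + psum g l := by
  induction l with
  | nil => simp
  | cons a l ih =>
    simp only [psum_cons, ih, List.sum_map_add]
    ring

lemma psum_congr_pairwise {f g : α → α → ZMod 2} {l : List α}
    (h : l.Pairwise fun a b => f a b = g a b) : psum f l = psum g l := by
  induction l with
  | nil => rfl
  | cons a l ih =>
    rw [List.pairwise_cons] at h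
    rw [psum_cons, psum_cons, ih h.2, List.map_congr_left h.1]

lemma psum_congr {f g : α → α → ZMod 2} {l : List α}
    (h : ∀ a ∈ l, ∀ b ∈ l, f a b = g a b) : psum f l = psum g l :=
  psum_congr_pairwise (List.pairwise_of_forall_mem_list fun a ha b hb => h a ha b hb)

lemma psum_zero (l : List α) : psum (fun _ _ => 0) l = 0 := by
  induction l with
  | nil => rfl
  | cons a l ih => simp [psum_cons, ih]

lemma psum_perm {f : α → α → ZMod 2} {l m : List α} (hlm : l.Perm m) :
    (∀ a ∈ l, ∀ b ∈ l, f a b = f b a) → psum f l = psum f m := by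
  induction hlm with
  | nil => simp
  | cons a h ih =>
    intro hf
    rw [psum_cons, psum_cons, ih fun x hx y hy =>
      hf x (List.mem_cons_of_mem _ hx) y (List.mem_cons_of_mem _ hy), (h.map _).sum_eq]
  | swap a b l =>
    intro hf
    simp only [psum_cons, List.map_cons, List.sum_cons, hf a (by simp) b (by simp)]
    ring
  | trans h1 h2 ih1 ih2 =>
    intro hf
    rw [ih1 hf, ih2 fun x hx y hy => hf x (h1.mem_iff.2 hx) y (h1.mem_iff.2 hy)]

lemma sum_map_flatMap (f : α → ZMod 2) (B : ι → List α) (L : List ι) :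
    ((L.flatMap B).map f).sum = (L.map fun v => ((B v).map f).sum).sum := by
  induction L with
  | nil => simp
  | cons v L ih => simp [ih]

/-- Two letters lie either in one block or in two different blocks; pairs of the second kind are
ordered as their blocks are. -/
lemma psum_flatMap (f : α → α → ZMod 2) (B : ι → List α) (L : List ι) :
    psum f (L.flatMap B) = (L.map fun v => psum f (B v)).sum +
      psum (fun v w => ((B v).map fun a => ((B w).map (f a)).sum).sum) L := by
  induction L with
  | nil => simp
  | cons v L ih =>
    have key : (List.map (fun a => (List.map (f a) (List.flatMap B L)).sum) (B v)).sum =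
        (L.map fun w => ((B v).map fun a => ((B w).map (f a)).sum).sum).sum := by
      clear ih
      induction L with
      | nil => simp
      | cons w L ih =>
        simp only [List.flatMap_cons, List.map_append, List.sum_append, List.sum_map_add, ih,
          List.map_cons, List.sum_cons]
    rw [List.flatMap_cons, psum_append, ih, psum_cons, key, List.map_cons, List.sum_cons]
    ring

lemma sum_map_mul_sum (p q : α → ZMod 2) (l m : List α) :
    (l.map fun a => (m.map fun b => p a * q b).sum).sum = (l.map p).sum * (m.map q).sum := by
  simp [List.sum_map_mul_left, List.sum_map_mul_right]

/-- For a product weight the contribution of two blocks depends only on their total degrees.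
Together with the parity laws this turns signs depending on states into signs depending on vertices.
-/
lemma psum_mul_flatMap (p q : α → ZMod 2) (B : ι → List α)
    (L : List ι) : psum (fun a b => p a * q b) (L.flatMap B) =
    (L.map fun v => psum (fun a b => p a * q b) (B v)).sum +
      psum (fun v w => ((B v).map p).sum * ((B w).map q).sum) L := by
  rw [psum_flatMap]
  simp only [sum_map_mul_sum]

lemma flatMap_perm_right {L : List ι} {B B' : ι → List α}
    (h : ∀ v ∈ L, (B v).Perm (B' v)) : (L.flatMap B).Perm (L.flatMap B') := by
  induction L with
  | nil => simp
  | cons v L ih =>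
    simp only [List.flatMap_cons]
    exact (h v (by simp)).append (ih fun w hw => h w (List.mem_cons_of_mem _ hw))

lemma flatMap_append_perm' (L : List ι) (X Y : ι → List α) :
    (L.flatMap fun v => X v ++ Y v).Perm (L.flatMap X ++ L.flatMap Y) := by
  induction L with
  | nil => simp
  | cons v L ih =>
    simp only [List.flatMap_cons, List.append_assoc]
    refine List.Perm.append_left _ ((ih.append_left (Y v)).trans ?_)
    rw [← List.append_assoc, ← List.append_assoc]
    exact List.perm_append_comm.append_right _

end PairSums

/-! ### Koszul signs of permutations of letters and of blocks -/

section Koszul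

variable {α β ι : Type*} [DecidableEq α] [DecidableEq β] [DecidableEq ι]

/-- The exponent of the Koszul sign. -/
def kos (deg : α → ZMod 2) (L M : List α) : ZMod 2 :=
  psum (fun a b => if M.idxOf b < M.idxOf a then deg a * deg b else 0) L

lemma koszulSign_eq (K : Type*) [Field K] (deg : α → ℤ) (L M : List α) :
    koszulSign K deg L M = sg K (kos (fun a => (deg a : ZMod 2)) L M) := by
  rw [koszulSign, neg_one_zpow_eq_sg, cast_pairSum, kos]
  congr 2
  ext a b
  split_ifs <;> simp

lemma permSign_eq (K : Type*) [Field K] (L M : List α) :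
    permSign K L M = sg K (kos (fun _ => 1) L M) := by
  rw [permSign, koszulSign_eq]
  simp

lemma pairwise_idxOf {M : List α} (hM : M.Nodup) :
    M.Pairwise fun a b => M.idxOf a < M.idxOf b := by
  rw [List.pairwise_iff_getElem]
  intro i j hi hj hij
  rwa [hM.idxOf_getElem, hM.idxOf_getElem]

/-- Each unordered pair of letters occurs once in both words, so the sum over `M` can be read off
`L` if the arguments are exchanged for the inverted pairs. -/
lemma psum_reorder {f : α → α → ZMod 2} {L M : List α} (hM : M.Nodup) (h : L.Perm M) :
    psum f M = psum (fun a b => if M.idxOf b < M.idxOf a then f b a else f a b) L := by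
  rw [psum_perm h]
  · refine psum_congr_pairwise ((pairwise_idxOf hM).imp ?_)
    intro a b hab
    rw [if_neg (by omega)]
  · intro a ha b hb
    rcases lt_trichotomy (M.idxOf a) (M.idxOf b) with h1 | h1 | h1
    · rw [if_neg (by omega), if_pos h1]
    · rw [(List.idxOf_inj (h.mem_iff.1 ha)).1 h1]
    · rw [if_pos h1, if_neg (by omega)]

lemma kos_congr {p q : α → ZMod 2} {L : List α} (M : List α) (h : ∀ a ∈ L, p a = q a) :
    kos p L M = kos q L M :=
  psum_congr fun a ha b hb => by rw [h a ha, h b hb]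

lemma kos_self (deg : α → ZMod 2) {L : List α} (h : L.Nodup) : kos deg L L = 0 := by
  rw [kos, psum_congr_pairwise (g := fun _ _ => 0), psum_zero]
  exact (pairwise_idxOf h).imp fun {a b} hab => by rw [if_neg (by omega)]

/-- A pair is inverted by the composite permutation iff it is inverted by exactly one of the two
steps; modulo 2 the doubly inverted pairs cancel. -/
lemma kos_trans (deg : α → ZMod 2) {L M N : List α} (hN : N.Nodup) (h : L.Perm M)
    (h' : M.Perm N) : kos deg L N = kos deg L M + kos deg M N := by
  have hM : M.Nodup := h'.nodup_iff.2 hN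
  have hL : L.Nodup := h.nodup_iff.2 hM
  have h2 : kos deg M N = _ := psum_reorder hM h
  rw [h2, kos, kos, ← psum_add]
  refine psum_congr fun a ha b hb => ?_
  by_cases hab : a = b
  · subst hab
    simp
  have h3 : M.idxOf a ≠ M.idxOf b := fun e => hab ((List.idxOf_inj (h.mem_iff.1 ha)).1 e)
  have h4 : N.idxOf a ≠ N.idxOf b :=
    fun e => hab ((List.idxOf_inj ((h.trans h').mem_iff.1 ha)).1 e)
  rw [mul_comm (deg b) (deg a)]
  split_ifs <;> first | omega | simp [CharTwo.add_self_eq_zero]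

lemma kos_symm (deg : α → ZMod 2) {L M : List α} (hM : M.Nodup) (h : L.Perm M) :
    kos deg M L = kos deg L M := by
  have h1 := kos_trans deg (h.nodup_iff.2 hM) h h.symm
  rw [kos_self deg (h.nodup_iff.2 hM)] at h1
  exact (CharTwo.add_eq_zero.1 h1.symm).symm

lemma kos_append (deg : α → ZMod 2) {L L' M M' : List α} (hM : (M ++ M').Nodup)
    (h : L.Perm M) (h' : L'.Perm M') :
    kos deg (L ++ L') (M ++ M') = kos deg L M + kos deg L' M' := by
  have hd := List.disjoint_of_nodup_append hM
  have hi : ∀ a ∈ L, (M ++ M').idxOf a = M.idxOf a := fun a ha =>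
    List.idxOf_append_of_mem (h.mem_iff.1 ha)
  have hi' : ∀ a ∈ L', (M ++ M').idxOf a = M.length + M'.idxOf a := fun a ha =>
    List.idxOf_append_of_notMem fun h1 => hd h1 (h'.mem_iff.1 ha)
  unfold kos
  rw [psum_append]
  have h1 : (L.map fun a => (L'.map fun b => if (M ++ M').idxOf b < (M ++ M').idxOf a then
      deg a * deg b else 0).sum).sum = 0 := by
    apply List.sum_eq_zero
    intro x hx
    obtain ⟨a, ha, rfl⟩ := List.mem_map.1 hx
    apply List.sum_eq_zero
    intro x hx
    obtain ⟨b, hb, rfl⟩ := List.mem_map.1 hx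
    have := List.idxOf_lt_length_of_mem (h.mem_iff.1 ha)
    rw [hi a ha, hi' b hb, if_neg (by omega)]
  rw [h1, add_zero]
  congr 1
  · exact psum_congr fun a ha b hb => by rw [hi a ha, hi b hb]
  · exact psum_congr fun a ha b hb => by
      rw [hi' a ha, hi' b hb]
      simp

lemma kos_append_left (deg : α → ZMod 2) {X L M : List α} (hM : (X ++ M).Nodup)
    (h : L.Perm M) : kos deg (X ++ L) (X ++ M) = kos deg L M := by
  rw [kos_append deg hM (List.Perm.refl _) h, kos_self deg (List.Nodup.of_append_left hM), zero_add]

lemma kos_append_right (deg : α → ZMod 2) {X L M : List α} (hM : (M ++ X).Nodup)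
    (h : L.Perm M) : kos deg (L ++ X) (M ++ X) = kos deg L M := by
  rw [kos_append deg hM h (List.Perm.refl _), kos_self deg (List.Nodup.of_append_right hM), add_zero]

lemma kos_swap (deg : α → ZMod 2) {P Q : List α} (h : (P ++ Q).Nodup) :
    kos deg (P ++ Q) (Q ++ P) = (P.map deg).sum * (Q.map deg).sum := by
  have h' : (Q ++ P).Nodup := (List.perm_append_comm.nodup_iff).1 h
  have hd := List.disjoint_of_nodup_append h
  have hi : ∀ a ∈ P, (Q ++ P).idxOf a = Q.length + P.idxOf a := fun a ha =>
    List.idxOf_append_of_notMem fun h1 => hd ha h1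
  have hi' : ∀ a ∈ Q, (Q ++ P).idxOf a = Q.idxOf a := fun a ha => List.idxOf_append_of_mem ha
  have hP := List.Nodup.of_append_left h
  have hQ := List.Nodup.of_append_right h
  unfold kos
  rw [psum_append, psum_congr_pairwise (g := fun _ _ => 0) (l := P), psum_zero,
    psum_congr_pairwise (g := fun _ _ => 0) (l := Q), psum_zero, ← sum_map_mul_sum]
  · simp only [zero_add]
    congr 1
    refine List.map_congr_left fun a ha => ?_
    congr 1
    refine List.map_congr_left fun b hb => ?_
    have := List.idxOf_lt_length_of_mem hb
    rw [hi a ha, hi' b hb, if_pos (by omega)]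
  · refine List.Pairwise.imp_of_mem ?_ (pairwise_idxOf hQ)
    intro a b ha hb hab
    rw [hi' a ha, hi' b hb, if_neg (by omega)]
  · refine List.Pairwise.imp_of_mem ?_ (pairwise_idxOf hP)
    intro a b ha hb hab
    rw [hi a ha, hi b hb, if_neg (by omega)]

/-- The sign of exchanging two adjacent blocks. -/
lemma kos_move (deg : α → ZMod 2) {X P Q Y : List α} (h : (X ++ (P ++ (Q ++ Y))).Nodup) :
    kos deg (X ++ (P ++ (Q ++ Y))) (X ++ (Q ++ (P ++ Y))) =
      (P.map deg).sum * (Q.map deg).sum := by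
  have hp : (P ++ (Q ++ Y)).Perm (Q ++ (P ++ Y)) := by
    rw [← List.append_assoc, ← List.append_assoc]
    exact List.perm_append_comm.append_right _
  have h1 : (X ++ (Q ++ (P ++ Y))).Nodup := ((hp.append_left X).nodup_iff).1 h
  rw [kos_append_left deg h1 hp]
  have h2 := List.Nodup.of_append_right h1
  rw [← List.append_assoc] at h2
  rw [← List.append_assoc, ← List.append_assoc, kos_append_right deg h2 List.perm_append_comm,
    kos_swap]
  exact List.Nodup.of_append_left ((List.perm_append_comm.append_right _).nodup_iff.1 h2)

lemma idxOf_map_of_injOn {φ : α → β} {M : List α} {a : α}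
    (hφ : ∀ x ∈ M, φ x = φ a → x = a) : (M.map φ).idxOf (φ a) = M.idxOf a := by
  induction M with
  | nil => rfl
  | cons x M ih =>
    by_cases h : x = a
    · subst h
      simp
    · have h' : φ x ≠ φ a := fun e => h (hφ x (by simp) e)
      rw [List.map_cons, List.idxOf_cons_ne _ h', List.idxOf_cons_ne _ h,
        ih fun y hy => hφ y (List.mem_cons_of_mem _ hy)]

lemma kos_map (deg : β → ZMod 2) (φ : α → β) {L M : List α} (hLM : L.Perm M)
    (hφ : ∀ x ∈ M, ∀ y ∈ M, φ x = φ y → x = y) :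
    kos deg (L.map φ) (M.map φ) = kos (fun a => deg (φ a)) L M := by
  rw [kos, psum_map]
  refine psum_congr fun a ha b hb => ?_
  rw [idxOf_map_of_injOn fun x hx e => hφ x hx a (hLM.mem_iff.1 ha) e,
    idxOf_map_of_injOn fun x hx e => hφ x hx b (hLM.mem_iff.1 hb) e]

lemma kos_flatMap_right {κ : Type*} (deg : α → ZMod 2) {L : List κ} {B B' : κ → List α}
    (hd : (L.flatMap B').Nodup) (h : ∀ v ∈ L, (B v).Perm (B' v)) :
    kos deg (L.flatMap B) (L.flatMap B') = (L.map fun v => kos deg (B v) (B' v)).sum := by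
  induction L with
  | nil => simp [kos]
  | cons v L ih =>
    have h' : ∀ w ∈ L, (B w).Perm (B' w) := fun w hw => h w (List.mem_cons_of_mem _ hw)
    simp only [List.flatMap_cons] at hd ⊢
    rw [kos_append deg hd (h v (by simp)) (flatMap_perm_right h'), ih (List.Nodup.of_append_right hd) h',
      List.map_cons, List.sum_cons]

/-- A block behaves like one letter whose degree is the total degree of the block. It suffices to
check adjacent transpositions, which generate all permutations. -/
lemma kos_flatMap_left (deg : α → ZMod 2) {L L' : List ι} (hLL : L.Perm L') (B : ι → List α) :
    L.Nodup → (L.flatMap B).Nodup →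
    kos deg (L.flatMap B) (L'.flatMap B) = kos (fun v => ((B v).map deg).sum) L L' := by
  induction hLL with
  | nil => intros; simp [kos]
  | @cons v L L' h ih =>
    intro hL hB
    have hL' : (v :: L').Nodup := ((h.cons v).nodup_iff).1 hL
    have hB' : ((v :: L').flatMap B).Nodup := ((h.cons v).flatMap_right B).nodup_iff.1 hB
    rw [show v :: L = [v] ++ L from rfl, show v :: L' = [v] ++ L' from rfl,
      kos_append_left _ hL' h]
    rw [List.flatMap_cons] at hB hB'
    rw [List.flatMap_append, List.flatMap_append, List.flatMap_singleton,
      kos_append_left _ hB' (h.flatMap_right B)]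
    exact ih (List.Nodup.of_cons hL) (List.Nodup.of_append_right hB)
  | swap v w L =>
    intro hL hB
    have h1 := kos_move (fun v => ((B v).map deg).sum) (X := []) (P := [w]) (Q := [v]) (Y := L) hL
    have h2 := kos_move deg (X := []) (P := B w) (Q := B v) (Y := L.flatMap B)
      (by simpa only [List.flatMap_cons, List.nil_append] using hB)
    simp only [List.nil_append, List.cons_append, List.map_cons, List.map_nil, List.sum_cons,
      List.sum_nil, add_zero] at h1 h2
    simp only [List.flatMap_cons]
    rw [h1, h2]
  | @trans L M N h1 h2 ih1 ih2 =>
    intro hL hB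
    have hM := h1.nodup_iff.1 hL
    have hBM := (h1.flatMap_right B).nodup_iff.1 hB
    rw [kos_trans deg ((h2.flatMap_right B).nodup_iff.1 hBM) (h1.flatMap_right B)
      (h2.flatMap_right B), kos_trans _ (h2.nodup_iff.1 hM) h1 h2, ih1 hL hB, ih2 hM hBM]

/-- The sign of a permutation of blocks combined with permutations inside the blocks. -/
lemma kos_flatMap (deg : α → ZMod 2) {L L' : List ι} (hLL : L.Perm L') {B B' : ι → List α}
    (hL : L.Nodup) (hB : (L.flatMap B).Nodup) (h : ∀ v ∈ L, (B v).Perm (B' v)) :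
    kos deg (L.flatMap B) (L'.flatMap B') =
      kos (fun v => ((B v).map deg).sum) L L' + (L.map fun v => kos deg (B v) (B' v)).sum := by
  have h1 := flatMap_perm_right h
  have hB' := h1.nodup_iff.1 hB
  have h2 := hLL.flatMap_right B'
  rw [kos_trans deg (h2.nodup_iff.1 hB') h1 h2, kos_flatMap_right deg hB' h,
    kos_flatMap_left deg hLL B' hL hB', add_comm]
  congr 1
  exact kos_congr _ fun v hv => (((h v hv).map deg).sum_eq).symm

/-- Unshuffling `X₁Y₁X₂Y₂…` into `X₁X₂…Y₁Y₂…` inverts precisely the pairs with one letter in `Y v`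
and one in a later `X w`. -/
lemma kos_distrib {κ : Type*} (deg : α → ZMod 2) (L : List κ) (X Y : κ → List α)
    (h : (L.flatMap fun v => X v ++ Y v).Nodup) :
    kos deg (L.flatMap fun v => X v ++ Y v) (L.flatMap X ++ L.flatMap Y) =
      psum (fun v w => ((Y v).map deg).sum * ((X w).map deg).sum) L := by
  induction L with
  | nil => simp [kos]
  | cons v L ih =>
    have hp := flatMap_append_perm' L X Y
    simp only [List.flatMap_cons, List.append_assoc] at h ⊢
    have h2 := (List.Perm.append_left (X v) (hp.append_left (Y v))).nodup_iff.1 h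
    have h3 := kos_move deg h2
    have hq : (X v ++ (Y v ++ (L.flatMap X ++ L.flatMap Y))).Perm
        (X v ++ (L.flatMap X ++ (Y v ++ L.flatMap Y))) := by
      refine List.Perm.append_left _ ?_
      rw [← List.append_assoc, ← List.append_assoc]
      exact List.perm_append_comm.append_right _
    rw [kos_trans deg (hq.nodup_iff.1 h2) (List.Perm.append_left (X v) (hp.append_left (Y v))) hq,
      h3, kos_append_left _ h2 (hp.append_left _),
      kos_append_left _ (List.Nodup.of_append_right h2) hp,
      ih (List.Nodup.of_append_right (List.Nodup.of_append_right h)), psum_cons, add_comm]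
    congr 1
    rw [List.sum_map_mul_left, sum_map_flatMap]

/-- The Koszul sign for letters of degree `p + q`, in terms of those for `p` and `q`. -/
lemma kos_add (p q : α → ZMod 2) {L M : List α} (hM : M.Nodup) (h : L.Perm M) :
    kos (fun a => p a + q a) L M = kos p L M + kos q L M +
      psum (fun a b => q a * p b) L + psum (fun a b => q a * p b) M := by
  rw [psum_reorder hM h (f := fun a b => q a * p b)]
  unfold kos
  rw [← psum_add, ← psum_add, ← psum_add]
  refine psum_congr fun a _ b _ => ?_
  have h2 : (2 : ZMod 2) = 0 := rfl
  -- For an inverted pair the cross terms `p a * q b` and `q a * p b` are the contributions of the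
  -- two words; for the other pairs both words contribute the same term, which cancels modulo 2.
  split_ifs
  · ring
  · linear_combination (- q a * p b) * h2

end Koszul

/-! ### Contraction along edges as an iterated sum -/

section EdgeSums

variable {K : Type*} [Field K] {ι : Type*} [Fintype ι] {α β κ : Type*}

/-- The letters of a list of pairs. -/
def pairLetters (ps : List (α × α)) : List α := ps.flatMap fun p => [p.1, p.2]

@[simp] lemma pairLetters_nil : pairLetters ([] : List (α × α)) = [] := rfl

@[simp] lemma pairLetters_cons (p : α × α) (ps : List (α × α)) :
    pairLetters (p :: ps) = p.1 :: p.2 :: pairLetters ps := rfl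

lemma pairLetters_append (ps qs : List (α × α)) :
    pairLetters (ps ++ qs) = pairLetters ps ++ pairLetters qs := by simp [pairLetters]

lemma pairLetters_map (ψ : β → α) (ps : List (β × β)) :
    pairLetters (ps.map (Prod.map ψ ψ)) = (pairLetters ps).map ψ := by
  simp [pairLetters, List.flatMap_map, List.map_flatMap]

lemma pairLetters_flatMap (f : κ → List (α × α)) (l : List κ) :
    pairLetters (l.flatMap f) = l.flatMap fun v => pairLetters (f v) := by
  simp [pairLetters, List.flatMap_assoc]

lemma sum_pairLetters_eq_zero {π : α → ZMod 2} {ps : List (α × α)}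
    (h : ∀ p ∈ ps, π p.1 = π p.2) : ((pairLetters ps).map π).sum = 0 := by
  induction ps with
  | nil => simp
  | cons p ps ih =>
    simp only [pairLetters_cons, List.map_cons, List.sum_cons,
      ih fun q hq => h q (List.mem_cons_of_mem _ hq), h p (by simp), add_zero,
      CharTwo.add_self_eq_zero]

variable [DecidableEq α] [DecidableEq β]

/-- Summation over the states of the two letters of each pair, weighted by `h`. -/
def edgeSum (h : ι → ι → K) : List (α × α) → ((α → ι) → K) → (α → ι) → K
  | [], Φ, u => Φ u
  | p :: ps, Φ, u => ∑ x, ∑ y,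
      h x y * edgeSum h ps Φ (Function.update (Function.update u p.1 x) p.2 y)

variable (h : ι → ι → K)

@[simp] lemma edgeSum_nil (Φ : (α → ι) → K) (u : α → ι) : edgeSum h [] Φ u = Φ u := rfl

lemma edgeSum_cons (p : α × α) (ps : List (α × α)) (Φ : (α → ι) → K) (u : α → ι) :
    edgeSum h (p :: ps) Φ u = ∑ x, ∑ y,
      h x y * edgeSum h ps Φ (Function.update (Function.update u p.1 x) p.2 y) := rfl

lemma edgeSum_append (ps qs : List (α × α)) (Φ : (α → ι) → K) (u : α → ι) :
    edgeSum h (ps ++ qs) Φ u = edgeSum h ps (edgeSum h qs Φ) u := by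
  induction ps generalizing u with
  | nil => rfl
  | cons p ps ih => simp only [List.cons_append, edgeSum_cons, ih]

lemma edgeSum_mul_left (ps : List (α × α)) (a : K) (Φ : (α → ι) → K) (u : α → ι) :
    edgeSum h ps (fun w => a * Φ w) u = a * edgeSum h ps Φ u := by
  induction ps generalizing u with
  | nil => rfl
  | cons p ps ih =>
    simp only [edgeSum_cons, ih, Finset.mul_sum]
    exact Finset.sum_congr rfl fun x _ => Finset.sum_congr rfl fun y _ => by ring

/-- Only states which agree with `u` off the summed letters and have nonzero weight on every pair
contribute. The second condition lets parity arguments be used inside the sum. -/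
lemma edgeSum_congr {ps : List (α × α)} (hps : (pairLetters ps).Nodup) {Φ Ψ : (α → ι) → K}
    {u : α → ι} (hΦ : ∀ w, (∀ a, a ∉ pairLetters ps → w a = u a) →
      (∀ p ∈ ps, h (w p.1) (w p.2) ≠ 0) → Φ w = Ψ w) :
    edgeSum h ps Φ u = edgeSum h ps Ψ u := by
  induction ps generalizing u with
  | nil => exact hΦ u (fun _ _ => rfl) (by simp)
  | cons p ps ih =>
    simp only [pairLetters_cons, List.nodup_cons, List.mem_cons, not_or] at hps
    simp only [edgeSum_cons]
    refine Finset.sum_congr rfl fun x _ => Finset.sum_congr rfl fun y _ => ?_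
    by_cases hxy : h x y = 0
    · rw [hxy, zero_mul, zero_mul]
    · rw [ih hps.2.2]
      intro w hw hne
      have h1 : w p.1 = x := by
        rw [hw _ hps.1.2, Function.update_of_ne hps.1.1, Function.update_self]
      have h2 : w p.2 = y := by rw [hw _ hps.2.1, Function.update_self]
      refine hΦ w (fun a ha => ?_) ?_
      · simp only [pairLetters_cons, List.mem_cons, not_or] at ha
        rw [hw a ha.2.2, Function.update_of_ne ha.2.1, Function.update_of_ne ha.1]
      · intro q hq
        rcases List.mem_cons.1 hq with rfl | hq
        · rwa [h1, h2]
        · exact hne q hq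

/-- Change of names of the letters. Injectivity is needed only on the letters `S` that matter, since
labels outside a tree may well be identified in the graph. -/
lemma edgeSum_map {ψ : β → α} {S : Set β} (hψ : Set.InjOn ψ S) {ps : List (β × β)}
    (hps : ∀ a ∈ pairLetters ps, a ∈ S) {Φ : (α → ι) → K} {Ψ : (β → ι) → K}
    (hΦ : ∀ (w : α → ι) (w' : β → ι), (∀ a ∈ S, w (ψ a) = w' a) → Φ w = Ψ w')
    {u : α → ι} {u' : β → ι} (hu : ∀ a ∈ S, u (ψ a) = u' a) :
    edgeSum h (ps.map (Prod.map ψ ψ)) Φ u = edgeSum h ps Ψ u' := by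
  induction ps generalizing u u' with
  | nil => exact hΦ u u' hu
  | cons p ps ih =>
    simp only [pairLetters_cons, List.mem_cons, forall_eq_or_imp] at hps
    simp only [List.map_cons, edgeSum_cons]
    refine Finset.sum_congr rfl fun x _ => Finset.sum_congr rfl fun y _ => ?_
    rw [ih hps.2.2]
    intro a ha
    simp only [Function.update_apply, Prod.map_fst, Prod.map_snd, hψ.eq_iff ha hps.2.1,
      hψ.eq_iff ha hps.1, hu a ha]

lemma edgeSum_congr_set {S : Set α} {ps : List (α × α)} (hps : ∀ a ∈ pairLetters ps, a ∈ S)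
    {Φ : (α → ι) → K} (hΦ : ∀ w w' : α → ι, (∀ a ∈ S, w a = w' a) → Φ w = Φ w')
    {u u' : α → ι} (hu : ∀ a ∈ S, u a = u' a) : edgeSum h ps Φ u = edgeSum h ps Φ u' := by
  have := edgeSum_map h (ψ := id) (S := S) Function.injective_id.injOn hps hΦ hu
  rwa [Prod.map_id, List.map_id] at this

/-- Fubini: the factor of `v` depends only on the letters in `S v`, and these sets are disjoint, so
the sums separate. -/
lemma edgeSum_flatMap_prod {L : List κ} (hL : L.Nodup) {ps : κ → List (α × α)}
    {Φ : κ → (α → ι) → K} {S : κ → Set α}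
    (hnd : ∀ v ∈ L, (pairLetters (ps v)).Nodup)
    (hps : ∀ v ∈ L, ∀ a ∈ pairLetters (ps v), a ∈ S v)
    (hΦ : ∀ v ∈ L, ∀ w w' : α → ι, (∀ a ∈ S v, w a = w' a) → Φ v w = Φ v w')
    (hS : ∀ v ∈ L, ∀ w ∈ L, v ≠ w → Disjoint (S v) (S w)) (u : α → ι) :
    edgeSum h (L.flatMap ps) (fun w => (L.map fun v => Φ v w).prod) u =
      (L.map fun v => edgeSum h (ps v) (Φ v) u).prod := by
  induction L generalizing u with
  | nil => simp
  | cons v L ih =>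
    rw [List.nodup_cons] at hL
    have hmem : ∀ {w}, w ∈ L → w ∈ v :: L := fun hw => List.mem_cons_of_mem _ hw
    have hne : ∀ w ∈ L, v ≠ w := fun w hw e => hL.1 (e ▸ hw)
    have ih' := ih hL.2 (fun w hw => hnd w (hmem hw)) (fun w hw => hps w (hmem hw))
      (fun w hw => hΦ w (hmem hw)) (fun w hw w' hw' => hS w (hmem hw) w' (hmem hw'))
    have hnd' : (pairLetters (L.flatMap ps)).Nodup := by
      rw [pairLetters_flatMap, List.nodup_flatMap]
      refine ⟨fun w hw => hnd w (hmem hw), hL.2.pairwise_of_forall_ne fun w hw w' hw' hww a h1 h2 => ?_⟩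
      exact Set.disjoint_left.1 (hS w (hmem hw) w' (hmem hw') hww) (hps w (hmem hw) a h1)
        (hps w' (hmem hw') a h2)
    have h1 : ∀ w, edgeSum h (L.flatMap ps) (fun w => ((v :: L).map fun v => Φ v w).prod) w =
        Φ v w * (L.map fun v => edgeSum h (ps v) (Φ v) w).prod := by
      intro w
      rw [← ih', ← edgeSum_mul_left]
      refine edgeSum_congr h hnd' fun w' hw' _ => ?_
      rw [List.map_cons, List.prod_cons]
      congr 1
      refine hΦ v (by simp) _ _ fun a ha => hw' a fun ha' => ?_
      rw [pairLetters_flatMap, List.mem_flatMap] at ha'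
      obtain ⟨w'', hw'', ha'⟩ := ha'
      exact Set.disjoint_left.1 (hS v (by simp) w'' (hmem hw'') (hne w'' hw'')) ha
        (hps w'' (hmem hw'') a ha')
    rw [List.flatMap_cons, edgeSum_append, funext h1, List.map_cons, List.prod_cons, mul_comm,
      ← edgeSum_mul_left]
    refine edgeSum_congr h (hnd v (by simp)) fun w hw _ => ?_
    rw [mul_comm]
    congr 2
    refine List.map_congr_left fun w' hw' => ?_
    refine edgeSum_congr_set h (hps w' (hmem hw')) (hΦ w' (hmem hw')) fun a ha => hw a fun ha' => ?_
    exact Set.disjoint_left.1 (hS v (by simp) w' (hmem hw') (hne w' hw')) (hps v (by simp) a ha') ha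

/-- As the letters are distinct, no update overwrites an earlier one; fibring the states over the
values at the first pair reproduces the recursion. -/
lemma edgeSum_eq_sum_filter [Fintype α] [DecidableEq ι] {ps : List (α × α)}
    (hps : (pairLetters ps).Nodup) (Φ : (α → ι) → K) (u : α → ι) :
    edgeSum h ps Φ u = ∑ s : α → ι with ∀ a, a ∉ pairLetters ps → s a = u a,
      Φ s * (ps.map fun p => h (s p.1) (s p.2)).prod := by
  induction ps generalizing u with
  | nil =>
    rw [Finset.sum_eq_single_of_mem u]
    · simp
    · simp
    · intro s hs hne
      simp only [pairLetters_nil, List.not_mem_nil, not_false_eq_true, forall_true_left,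
        Finset.mem_filter, Finset.mem_univ, true_and] at hs
      exact absurd (funext hs) hne
  | cons p ps ih =>
    simp only [pairLetters_cons, List.nodup_cons, List.mem_cons, not_or] at hps
    have hne : p.1 ≠ p.2 := hps.1.1
    rw [edgeSum_cons, ← Finset.sum_fiberwise (g := fun s : α → ι => s p.1)]
    refine Finset.sum_congr rfl fun x _ => ?_
    rw [← Finset.sum_fiberwise (g := fun s : α → ι => s p.2)]
    refine Finset.sum_congr rfl fun y _ => ?_
    rw [ih hps.2.2, Finset.mul_sum, Finset.filter_filter, Finset.filter_filter]
    have hset : (Finset.univ.filter fun s : α → ι => ∀ a, a ∉ pairLetters ps →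
        s a = Function.update (Function.update u p.1 x) p.2 y a) =
        Finset.univ.filter fun s : α → ι => (∀ a, a ∉ pairLetters (p :: ps) → s a = u a) ∧
          s p.1 = x ∧ s p.2 = y := by
      ext s
      simp only [Finset.mem_filter, Finset.mem_univ, true_and, pairLetters_cons, List.mem_cons,
        not_or]
      constructor
      · intro hs
        refine ⟨fun a ha => ?_, ?_, ?_⟩
        · rw [hs a ha.2.2, Function.update_of_ne ha.2.1, Function.update_of_ne ha.1]
        · rw [hs _ hps.1.2, Function.update_of_ne hne, Function.update_self]
        · rw [hs _ hps.2.1, Function.update_self]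
      · rintro ⟨h1, h2, h3⟩ a ha
        by_cases e2 : a = p.2
        · rw [e2, Function.update_self, h3]
        · rw [Function.update_of_ne e2]
          by_cases e1 : a = p.1
          · rw [e1, Function.update_self, h2]
          · rw [Function.update_of_ne e1]
            exact h1 a ⟨e1, e2, ha⟩
    rw [hset]
    refine Finset.sum_congr rfl fun s hs => ?_
    simp only [Finset.mem_filter] at hs
    rw [List.map_cons, List.prod_cons, hs.2.2.1, hs.2.2.2]
    ring

lemma edgeSum_eq_sum [Fintype α] {ps : List (α × α)}
    (hps : (pairLetters ps).Nodup) (hmem : ∀ a, a ∈ pairLetters ps) (Φ : (α → ι) → K) (u : α → ι) :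
    edgeSum h ps Φ u = ∑ s : α → ι, Φ s * (ps.map fun p => h (s p.1) (s p.2)).prod := by
  classical
  rw [edgeSum_eq_sum_filter h hps, Finset.filter_true_of_mem]
  intro s _ a ha
  exact absurd (hmem a) ha

end EdgeSums

/-! ### Trees as sets of intervals; grafting a corolla -/

section TreeCombinatorics

/-- The strict lexicographic order. -/
def LexLt (e f : ℕ × ℕ) : Prop := e.1 < f.1 ∨ (e.1 = f.1 ∧ e.2 < f.2)

lemma LexLt.irrefl (e : ℕ × ℕ) : ¬ LexLt e e := by simp [LexLt]

lemma pairwise_grid (n : ℕ) : (grid n).Pairwise LexLt := by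
  rw [grid, List.pairwise_flatMap]
  refine ⟨fun a _ => ?_, ?_⟩
  · rw [List.pairwise_map]
    exact (List.pairwise_lt_range' (s := 1) (n := n)).imp fun h => Or.inr ⟨rfl, h⟩
  · refine (List.pairwise_lt_range' (s := 1) (n := n)).imp fun {a b} hab => ?_
    intro x hx y hy
    simp only [List.mem_map] at hx hy
    obtain ⟨_, _, rfl⟩ := hx
    obtain ⟨_, _, rfl⟩ := hy
    exact Or.inl hab

lemma LexLt.nodup {l : List (ℕ × ℕ)} (h : l.Pairwise LexLt) : l.Nodup :=
  h.imp fun {a b} hab e => by subst e; exact LexLt.irrefl _ hab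

/-- Edges and incoming edges are listed in increasing order, so such lists may be compared by
membership alone. -/
lemma LexLt.list_ext {l m : List (ℕ × ℕ)} (hl : l.Pairwise LexLt) (hm : m.Pairwise LexLt)
    (h : ∀ e, e ∈ l ↔ e ∈ m) : l = m := by
  refine List.Perm.eq_of_pairwise (le := LexLt) (fun a b _ _ h1 h2 => ?_) hl hm
    ((List.perm_ext_iff_of_nodup (LexLt.nodup hl) (LexLt.nodup hm)).2 h)
  simp only [LexLt] at h1 h2
  omega

/-- The condition `e ≠ (1, n)` is restated as an inequality, so that everything about trees becomes
linear arithmetic. -/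
lemma mem_trees {n : ℕ} {s : Finset (ℕ × ℕ)} : s ∈ trees n ↔
    2 ≤ n ∧ (∀ e ∈ s, 1 ≤ e.1 ∧ e.1 < e.2 ∧ e.2 ≤ n ∧ (1 < e.1 ∨ e.2 < n)) ∧
      ∀ e ∈ s, ∀ f ∈ s, Compatible e f := by
  by_cases hn : 2 ≤ n
  · rw [trees, if_pos hn]
    simp only [Finset.mem_filter, Finset.mem_powerset, hn, true_and]
    refine and_congr_left fun _ => ?_
    constructor
    · intro h e he
      have := h he
      rcases e with ⟨a, b⟩
      simp only [intervals, Finset.mem_filter, Finset.mem_product, Finset.mem_Icc, ne_eq,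
        Prod.mk.injEq] at this ⊢
      omega
    · intro h e he
      have := h e he
      rcases e with ⟨a, b⟩
      simp only [intervals, Finset.mem_filter, Finset.mem_product, Finset.mem_Icc, ne_eq,
        Prod.mk.injEq] at this ⊢
      omega
  · simp [trees, hn]

namespace PTree

variable {n : ℕ} (T : PTree n)

lemma mem_edgeList {e : ℕ × ℕ} : e ∈ T.edgeList ↔ e ∈ T.1 := by
  simp only [edgeList, List.mem_filter, decide_eq_true_eq, and_iff_right_iff_imp]
  intro he
  have := T.mem_edge he
  exact mem_grid.2 (by omega)

lemma pairwise_edgeList : T.edgeList.Pairwise LexLt := (pairwise_grid n).filter _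

lemma nodup_edgeList : T.edgeList.Nodup := LexLt.nodup T.pairwise_edgeList

lemma pairwise_children (I : ℕ × ℕ) : (T.children I).Pairwise LexLt := (pairwise_grid n).filter _

lemma length_edgeList : T.edgeList.length = T.1.card := by
  have h : T.edgeList.toFinset = T.1 := by ext e; simp [T.mem_edgeList]
  rw [← h, List.toFinset_card_of_nodup T.nodup_edgeList]

lemma edge_bounds {e : ℕ × ℕ} (he : e ∈ T.1) :
    1 ≤ e.1 ∧ e.1 < e.2 ∧ e.2 ≤ n ∧ (1 < e.1 ∨ e.2 < n) := (mem_trees.1 T.2).2.1 e he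

lemma edge_compatible {e f : ℕ × ℕ} (he : e ∈ T.1) (hf : f ∈ T.1) : Compatible e f :=
  (mem_trees.1 T.2).2.2 e he f hf

lemma mem_children' {I J : ℕ × ℕ} : J ∈ T.children I ↔
    (1 ≤ J.1 ∧ J.1 ≤ J.2 ∧ J.2 ≤ n) ∧ (J ∈ T.1 ∨ J.1 = J.2) ∧ Inside J I ∧
      ∀ J' ∈ T.1, Inside J J' → Inside J' I → False := by
  rw [T.mem_children, mem_grid]
  simp only [not_and]
  constructor
  · rintro ⟨h1, h2, h3⟩
    refine ⟨?_, h2, h3⟩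
    rcases h2 with h2 | h2
    · have := T.edge_bounds h2
      omega
    · omega
  · rintro ⟨h1, h2⟩
    exact ⟨by omega, h2⟩

end PTree

/-- `Inside` in a form suitable for linear arithmetic. -/
lemma inside_iff {J I : ℕ × ℕ} :
    Inside J I ↔ I.1 ≤ J.1 ∧ J.2 ≤ I.2 ∧ (I.1 < J.1 ∨ J.2 < I.2) := by
  rcases J with ⟨a, b⟩
  rcases I with ⟨x, y⟩
  simp only [Inside, ne_eq, Prod.mk.injEq]
  omega

section Graft

variable {n m i : ℕ}

lemma graftOuter_le (hm : 2 ≤ m) {x : ℕ × ℕ} (hx : x.1 ≤ x.2) :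
    (graftOuter i m x).1 ≤ (graftOuter i m x).2 := by
  simp only [graftOuter]
  split_ifs <;> omega

lemma graftOuter_lt (hm : 2 ≤ m) {x : ℕ × ℕ} (hx : x.1 < x.2) :
    (graftOuter i m x).1 < (graftOuter i m x).2 := by
  simp only [graftOuter]
  split_ifs <;> omega

lemma graftOuter_injective (hm : 2 ≤ m) : Function.Injective (graftOuter i m) := by
  rintro ⟨a, b⟩ ⟨a', b'⟩ h
  simp only [graftOuter, Prod.mk.injEq] at h ⊢
  obtain ⟨h1, h2⟩ := h
  constructor
  · split_ifs at h1 <;> omega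
  · split_ifs at h2 <;> omega

lemma inside_graftOuter (hm : 2 ≤ m) {x y : ℕ × ℕ} (hx : x.1 ≤ x.2) (hy : y.1 ≤ y.2) :
    Inside (graftOuter i m x) (graftOuter i m y) ↔ Inside x y := by
  simp only [inside_iff, graftOuter]
  split_ifs <;> omega

lemma not_inside_graftOuter (hm : 2 ≤ m) {x : ℕ × ℕ} (hx : x.1 ≤ x.2) :
    ¬ Inside (graftOuter i m x) (i, i + m - 1) := by
  simp only [inside_iff, graftOuter]
  split_ifs <;> omega

lemma compatible_of_graftOuter (hm : 2 ≤ m) {x y : ℕ × ℕ} (hx : x.1 < x.2) (hy : y.1 < y.2)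
    (h : Compatible (graftOuter i m x) (graftOuter i m y)) : Compatible x y := by
  simp only [Compatible, graftOuter] at h ⊢
  split_ifs at h <;> omega

/-- Leaf `i`, seen as the interval `(i, i)`, becomes the new internal edge. Hence leaves and edges
of `U` can be transported by the same map. -/
lemma graftOuter_self : graftOuter i m (i, i) = (i, i + m - 1) := by
  simp [graftOuter]

lemma lexLt_graftOuter (hm : 2 ≤ m) {x y : ℕ × ℕ} (h : LexLt x y) :
    LexLt (graftOuter i m x) (graftOuter i m y) := by
  simp only [LexLt, graftOuter] at h ⊢
  split_ifs <;> omega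

/-- The tree `T` is obtained from the tree `U` by grafting a corolla with `m` leaves onto the
leaf `i`. -/
structure IsGraft (i m : ℕ) (U : PTree n) (T : PTree (n + m - 1)) : Prop where
  one_le : 1 ≤ i
  le : i ≤ n
  two_le : 2 ≤ m
  eq : T.1 = insert (i, i + m - 1) (U.1.image (graftOuter i m))

namespace IsGraft

variable {U : PTree n} {T : PTree (n + m - 1)} (h : IsGraft i m U T)

include h

lemma mem_iff {e : ℕ × ℕ} :
    e ∈ T.1 ↔ e = (i, i + m - 1) ∨ ∃ x ∈ U.1, graftOuter i m x = e := by
  rw [h.eq, Finset.mem_insert, Finset.mem_image]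

lemma whole : graftOuter i m (1, n) = (1, n + m - 1) := by
  have := h.one_le
  have := h.le
  simp only [graftOuter]
  split_ifs <;> simp
  omega

/-- By injectivity only `(i, i)` is sent to the new edge, and it is a leaf, not an edge, of `U`. -/
lemma not_mem_image : (i, i + m - 1) ∉ U.1.image (graftOuter i m) := by
  rw [Finset.mem_image]
  rintro ⟨x, hx, h1⟩
  rw [← graftOuter_self] at h1
  have h2 := graftOuter_injective h.two_le h1
  have := U.edge_bounds hx
  rw [h2] at this
  simp at this

lemma card : T.1.card = U.1.card + 1 := by
  rw [h.eq, Finset.card_insert_of_notMem h.not_mem_image,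
    Finset.card_image_of_injective _ (graftOuter_injective h.two_le)]

lemma mem_nodes_iff {e : ℕ × ℕ} :
    e ∈ T.nodes ↔ e = (i, i + m - 1) ∨ ∃ x ∈ U.nodes, graftOuter i m x = e := by
  simp only [PTree.nodes, Finset.mem_insert, h.mem_iff, exists_eq_or_imp, h.whole]
  tauto

/-- No transported interval lies strictly inside the new edge, so its upper vertex carries just the
`m` new leaves. -/
lemma children_new :
    T.children (i, i + m - 1) = (List.range' i m).map fun l => (l, l) := by
  have hm := h.two_le
  have h1 := h.one_le
  have h2 := h.le
  refine LexLt.list_ext (T.pairwise_children _) ?_ fun J => ?_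
  · rw [List.pairwise_map]
    exact (List.pairwise_lt_range' (s := i) (n := m)).imp fun h => Or.inl h
  · simp only [T.mem_children', List.mem_map, List.mem_range'_1]
    constructor
    · rintro ⟨h3, h4, h5, h6⟩
      have hJ : J.1 = J.2 := by
        rcases h4 with h4 | h4
        · rcases h.mem_iff.1 h4 with rfl | ⟨x, hx, rfl⟩
          · simp [inside_iff] at h5
          · exact absurd h5 (not_inside_graftOuter hm (U.edge_bounds hx).2.1.le)
        · exact h4
      refine ⟨J.1, ?_, Prod.ext rfl hJ⟩
      simp only [inside_iff] at h5
      omega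
    · rintro ⟨l, hl, rfl⟩
      refine ⟨by simp only; omega, Or.inr rfl, by simp only [inside_iff]; omega, ?_⟩
      intro J' hJ' h3 h4
      rcases h.mem_iff.1 hJ' with rfl | ⟨x, hx, rfl⟩
      · simp [inside_iff] at h4
      · exact not_inside_graftOuter hm (U.edge_bounds hx).2.1.le h4

/-- Grafting takes place above leaf `i`: an old vertex keeps its incoming edges, with leaf `i`
replaced by the new edge if it was among them. -/
lemma children_graftOuter {I : ℕ × ℕ} (hI : I ∈ U.nodes) :
    T.children (graftOuter i m I) = (U.children I).map (graftOuter i m) := by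
  have hm := h.two_le
  have h1 := h.one_le
  have h2 := h.le
  have hI' := U.mem_node hI
  refine LexLt.list_ext (T.pairwise_children _) ?_ fun J => ?_
  · rw [List.pairwise_map]
    exact (U.pairwise_children I).imp fun h => lexLt_graftOuter hm h
  · have key : ∀ J0 : ℕ × ℕ, 1 ≤ J0.1 → J0.1 ≤ J0.2 → J0.2 ≤ n →
        (graftOuter i m J0 ∈ T.1 ∨ (graftOuter i m J0).1 = (graftOuter i m J0).2) →
        (J0 ∈ U.1 ∨ J0.1 = J0.2) → (graftOuter i m J0 ∈ T.children (graftOuter i m I) ↔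
        J0 ∈ U.children I) := by
      intro J0 hJ1 hJ2 hJ3 hJ4 hJ5
      rw [T.mem_children', U.mem_children', inside_graftOuter hm hJ2 hI'.2.1.le]
      constructor
      · rintro ⟨-, -, h3, h4⟩
        refine ⟨⟨hJ1, hJ2, hJ3⟩, hJ5, h3, fun J' hJ' h5 h6 => ?_⟩
        have hb := U.edge_bounds hJ'
        exact h4 (graftOuter i m J') (h.mem_iff.2 (Or.inr ⟨_, hJ', rfl⟩))
          ((inside_graftOuter hm hJ2 hb.2.1.le).2 h5) ((inside_graftOuter hm hb.2.1.le hI'.2.1.le).2 h6)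
      · rintro ⟨-, -, h3, h4⟩
        refine ⟨?_, hJ4, h3, fun J' hJ' h5 h6 => ?_⟩
        · have := graftOuter_le (i := i) hm hJ2
          refine ⟨?_, this, ?_⟩ <;> simp only [graftOuter] <;> split_ifs <;> omega
        · rcases h.mem_iff.1 hJ' with rfl | ⟨x, hx, rfl⟩
          · exact not_inside_graftOuter hm hJ2 h5
          · have hb := U.edge_bounds hx
            exact h4 x hx ((inside_graftOuter hm hJ2 hb.2.1.le).1 h5)
              ((inside_graftOuter hm hb.2.1.le hI'.2.1.le).1 h6)
    simp only [List.mem_map]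
    constructor
    · intro hJ
      have hJ' := T.mem_children'.1 hJ
      obtain ⟨hJ0, hJ1, hJ2, hJ3⟩ := hJ'
      rcases hJ1 with hJ1 | hJ1
      · rcases h.mem_iff.1 hJ1 with rfl | ⟨x, hx, rfl⟩
        · refine ⟨(i, i), (key _ h1 le_rfl h2 ?_ (Or.inr rfl)).1 ?_, graftOuter_self⟩
          · rw [graftOuter_self]; exact Or.inl hJ1
          · rwa [graftOuter_self]
        · have hb := U.edge_bounds hx
          exact ⟨x, (key _ hb.1 hb.2.1.le hb.2.2.1 (Or.inl hJ1) (Or.inl hx)).1 hJ, rfl⟩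
      · rcases J with ⟨l, l'⟩
        obtain rfl : l = l' := hJ1
        -- A leaf in this range sits above the new edge, so it cannot be attached to an old vertex.
        -- Leaves to the left are unchanged, those to the right are shifted by `m - 1`.
        by_cases hl : i ≤ l ∧ l ≤ i + m - 1
        · exfalso
          refine hJ3 (i, i + m - 1) (h.mem_iff.2 (Or.inl rfl)) (by simp only [inside_iff]; omega) ?_
          rw [← graftOuter_self, inside_graftOuter hm le_rfl hI'.2.1.le]
          simp only [inside_iff, graftOuter] at hJ2 ⊢
          split_ifs at hJ2 <;> omega
        · by_cases hl' : l < i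
          · have hg : graftOuter i m (l, l) = (l, l) := by
              simp only [graftOuter]
              split_ifs <;> simp
              omega
            refine ⟨(l, l), (key _ hJ0.1 le_rfl (by simp only; omega) ?_ (Or.inr rfl)).1 ?_, hg⟩
            · rw [hg]; exact Or.inr rfl
            · rwa [hg]
          · have hg : graftOuter i m (l - (m - 1), l - (m - 1)) = (l, l) := by
              simp only [graftOuter]
              split_ifs <;> simp <;> omega
            simp only at hJ0
            refine ⟨(l - (m - 1), l - (m - 1)), (key _ (by simp only; omega) le_rfl
              (by simp only; omega) ?_ (Or.inr rfl)).1 ?_, hg⟩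
            · rw [hg]; exact Or.inr rfl
            · rwa [hg]
    · rintro ⟨J0, hJ0, rfl⟩
      obtain ⟨hJ1, hJ2, -⟩ := U.mem_children'.1 hJ0
      refine (key _ hJ1.1 hJ1.2.1 hJ1.2.2 ?_ hJ2).2 hJ0
      rcases hJ2 with hJ2 | hJ2
      · exact Or.inl (h.mem_iff.2 (Or.inr ⟨_, hJ2, rfl⟩))
      · by_cases hi : J0 = (i, i)
        · rw [hi, graftOuter_self]
          exact Or.inl (h.mem_iff.2 (Or.inl rfl))
        · right
          have hi' : J0.1 ≠ i := fun e => hi (Prod.ext e (hJ2 ▸ e))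
          simp only [graftOuter]
          split_ifs <;> omega

end IsGraft

/-- Every tree other than a corolla is obtained by grafting a corolla onto a leaf of a smaller
tree. -/
lemma exists_isGraft {n : ℕ} (T : PTree n) (hT : T.1.Nonempty) :
    ∃ (k m i : ℕ) (hn : n = k + m - 1) (U : PTree k), IsGraft i m U (hn ▸ T) := by
  -- An internal edge of least width has no edge strictly above it, so its upper vertex is a corolla
  -- that can be cut off.
  obtain ⟨e, he, hmin⟩ := Finset.exists_min_image _ (fun I : ℕ × ℕ => I.2 - I.1) hT
  have hb := T.edge_bounds he
  rcases e with ⟨i, j⟩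
  simp only at hb hmin
  obtain ⟨m, hm⟩ : ∃ m, j = i + m - 1 ∧ 2 ≤ m := ⟨j - i + 1, by omega⟩
  obtain ⟨rfl, hm⟩ := hm
  obtain ⟨k, rfl⟩ : ∃ k, n = k + m - 1 := ⟨n - m + 1, by omega⟩
  have hin : ∀ f ∈ T.1, ¬ Inside f (i, i + m - 1) := by
    intro f hf hin
    have h1 := hmin f hf
    have h2 := T.edge_bounds hf
    simp only [inside_iff] at hin
    omega
  -- The remaining tree `U` consists of the intervals which grafting turns into edges of `T`.
  let s : Finset (ℕ × ℕ) := (intervals k).filter fun x => graftOuter i m x ∈ T.1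
  have hs : ∀ x ∈ s, 1 ≤ x.1 ∧ x.1 < x.2 ∧ x.2 ≤ k ∧ (1 < x.1 ∨ x.2 < k) := by
    rintro ⟨a, b⟩ hx
    simp only [s, intervals, Finset.mem_filter, Finset.mem_product, Finset.mem_Icc, ne_eq,
        Prod.mk.injEq] at hx ⊢
    omega
  have hs' : s ∈ trees k := by
    refine mem_trees.2 ⟨by omega, hs, fun x hx y hy => ?_⟩
    refine compatible_of_graftOuter (i := i) hm (hs x hx).2.1 (hs y hy).2.1 ?_
    exact T.edge_compatible (Finset.mem_filter.1 hx).2 (Finset.mem_filter.1 hy).2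
  refine ⟨k, m, i, rfl, ⟨s, hs'⟩, ⟨hb.1, by omega, hm, ?_⟩⟩
  ext f
  simp only [Finset.mem_insert, Finset.mem_image]
  constructor
  · intro hf
    by_cases hfe : f = (i, i + m - 1)
    · exact Or.inl hfe
    right
    have h1 := T.edge_bounds hf
    have h2 := T.edge_compatible hf he
    have h3 := hin f hf
    rcases f with ⟨a, b⟩
    obtain ⟨x, hx1, hx2⟩ : ∃ x : ℕ × ℕ, graftOuter i m x = (a, b) ∧
        (1 ≤ x.1 ∧ x.1 < x.2 ∧ x.2 ≤ k ∧ (1 < x.1 ∨ x.2 < k)) := by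
      simp only [Compatible, inside_iff, Prod.mk.injEq] at h1 h2 h3 hfe
      -- An edge compatible with the one cut off, different from it and not inside it, lies to its
      -- left, to its right, or contains it; this gives the preimage.
      by_cases hc : b < i
      · refine ⟨(a, b), ?_, by simp only; omega⟩
        simp only [graftOuter]
        split_ifs <;> simp
        omega
      · by_cases hc' : i + m - 1 < a
        · refine ⟨(a - (m - 1), b - (m - 1)), ?_, by simp only; omega⟩
          simp only [graftOuter]
          split_ifs <;> simp <;> omega
        · refine ⟨(a, b - (m - 1)), ?_, by simp only; omega⟩
          simp only [graftOuter]
          split_ifs <;> simp <;> omega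
    refine ⟨x, ?_, hx1⟩
    simp only [s, intervals, Finset.mem_filter, Finset.mem_product, Finset.mem_Icc, ne_eq]
    refine ⟨⟨by omega, hx2.2.1, ?_⟩, by rwa [hx1]⟩
    rintro rfl
    simp only at hx2
    omega
  · rintro (rfl | ⟨x, hx, rfl⟩)
    · exact he
    · exact (Finset.mem_filter.1 hx).2

end Graft

end TreeCombinatorics

/-! ### The functionals of trees, their parity, and composition through an edge -/

section Functionals

variable {K : Type*} [Field K] {A : Type*} [AddCommGroup A] [Module K A] (α : AInfData K A)
  {ι : Type*} (b : Module.Basis ι K A)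

/-- The functional `⟨ρ(x)(b_{s 1}, …, b_{s n}), b_{s 0}⟩`. -/
noncomputable def cyclicOp {n : ℕ} (x : AInf K n) (s : ℕ → ι) : K :=
  α.inner (α.op n x (tuple n fun k => b (s k))) (b (s 0))

/-- The functional `⟨ρ(c_n)(b_{l_1}, …, b_{l_n}), b_x⟩`, where `n` is the length of `l`. -/
noncomputable def corollaWeight (l : List ι) (x : ι) : K :=
  α.inner (α.op l.length (corolla K l.length) fun k => b (l.get k)) (b x)

lemma cyclicOp_smul {n : ℕ} (a : K) (x : AInf K n) (s : ℕ → ι) :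
    cyclicOp α b (a • x) s = a * cyclicOp α b x s := by
  simp [cyclicOp]

lemma cyclicOp_congr {n : ℕ} (x : AInf K n) {s t : ℕ → ι} (h : ∀ k ≤ n, s k = t k) :
    cyclicOp α b x s = cyclicOp α b x t := by
  unfold cyclicOp
  rw [h 0 (Nat.zero_le _)]
  congr 3
  funext k
  simp only [tuple]
  rw [h _ k.2]

/-- Translates between arguments given by a list, as at the vertices of a graph, and by a sequence
whose entry `0` is the root, as in the axioms of the algebra. -/
lemma corollaWeight_eq {n : ℕ} {l : List ι} (s : ℕ → ι) (hl : l = (List.range' 1 n).map s) :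
    corollaWeight α b l (s 0) = cyclicOp α b (corolla K n) s := by
  obtain rfl : n = l.length := by simp [hl]
  unfold corollaWeight cyclicOp
  congr 3
  funext k
  simp only [tuple]
  congr 1
  have h2 : l[(k : ℕ)]? = ((List.range' 1 l.length).map s)[(k : ℕ)]? :=
    congrArg (fun l : List ι => l[(k : ℕ)]?) hl
  rw [List.getElem?_eq_getElem k.2, List.getElem?_eq_getElem (by simp)] at h2
  simpa [add_comm] using h2

lemma corolla_eq_tree {n : ℕ} (h : (∅ : Finset (ℕ × ℕ)) ∈ trees n) :
    corolla K n = tree ⟨∅, h⟩ := by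
  have : permSign K [] (PTree.edgeList (⟨∅, h⟩ : PTree n)) = 1 := by
    rw [permSign_eq, kos, psum_nil, sg_zero]
  simp [corolla, oriented, h, this]

lemma empty_mem_trees {n : ℕ} : (∅ : Finset (ℕ × ℕ)) ∈ trees n ↔ 2 ≤ n := by
  simp [mem_trees]

lemma corolla_eq_zero {n : ℕ} (h : ¬ 2 ≤ n) : corolla K n = 0 := by
  rw [corolla, oriented, dif_neg]
  simpa [mem_trees] using h

lemma oriented_perm {n : ℕ} {L L' : List (ℕ × ℕ)} (hL : L.Nodup) (h : L.Perm L') :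
    oriented K n L = sg K (kos (fun _ => 1) L L') • oriented K n L' := by
  have hL' := h.nodup_iff.1 hL
  have hf : L.toFinset = L'.toFinset := List.toFinset_eq_of_perm _ _ h
  unfold oriented
  by_cases ht : L'.toFinset ∈ trees n
  · have ht' : L.toFinset ∈ trees n := hf ▸ ht
    rw [dif_pos ⟨hL, ht'⟩, dif_pos ⟨hL', ht⟩]
    have e : (⟨L.toFinset, ht'⟩ : PTree n) = ⟨L'.toFinset, ht⟩ := Subtype.ext hf
    rw [e, permSign_eq, permSign_eq, smul_smul, ← sg_add, ← kos_trans _ (PTree.nodup_edgeList _) h]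
    rw [List.perm_ext_iff_of_nodup hL' (PTree.nodup_edgeList _)]
    intro a
    simp [PTree.mem_edgeList]
  · rw [dif_neg fun hc => ht (hf ▸ hc.2), dif_neg fun hc => ht hc.2, smul_zero]

lemma oriented_edgeList {n : ℕ} (T : PTree n) : oriented K n T.edgeList = tree T := by
  have e : T.edgeList.toFinset = T.1 := by
    ext a
    simp [PTree.mem_edgeList]
  unfold oriented
  have ht : T.edgeList.toFinset ∈ trees n := e ▸ T.2
  rw [dif_pos ⟨T.nodup_edgeList, ht⟩]
  have e' : (⟨T.edgeList.toFinset, ht⟩ : PTree n) = T := Subtype.ext e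
  rw [e', permSign_eq, kos_self _ T.nodup_edgeList, sg_zero, one_smul]

lemma oriented_eq_smul_tree {n : ℕ} (T : PTree n) {L : List (ℕ × ℕ)} (hL : L.Nodup)
    (h : ∀ e, e ∈ L ↔ e ∈ T.1) :
    oriented K n L = sg K (kos (fun _ => 1) L T.edgeList) • tree T := by
  rw [← oriented_edgeList, ← oriented_perm hL]
  rw [List.perm_ext_iff_of_nodup hL T.nodup_edgeList]
  intro e
  rw [h, T.mem_edgeList]

variable {𝒜 : ℤ → Submodule K A} {deg : ι → ℤ}

/-- The parity of a basis element. -/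
abbrev par (deg : ι → ℤ) (i : ι) : ZMod 2 := (deg i : ZMod 2)

lemma cast_eq_of_modEq {p q : ℤ} (h : p ≡ q [ZMOD 2]) : (p : ZMod 2) = q :=
  (ZMod.intCast_eq_intCast_iff p q 2).2 h

variable {α}

lemma op_mem_basis (hα : IsCyclicAInf 𝒜 α) (hb : ∀ i, b i ∈ 𝒜 (deg i)) {n : ℕ} (T : PTree n)
    (s : ℕ → ι) : α.op n (tree T) (tuple n fun k => b (s k)) ∈
      𝒜 (T.deg + ∑ k ∈ Finset.Icc 1 n, deg (s k)) :=
  hα.op_mem n T (fun k => deg (s k)) (fun k => b (s k)) fun k => hb (s k)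

/-- An even inner product pairs only vectors of equal parity, and `ρ(T)` shifts degrees by `n - 2 -
t`, with `t` the number of internal edges. -/
lemma cyclicOp_parity (hα : IsCyclicAInf 𝒜 α) (he : IsEven 𝒜 α) (hb : ∀ i, b i ∈ 𝒜 (deg i))
    {n : ℕ} (T : PTree n) (s : ℕ → ι) (h : cyclicOp α b (tree T) s ≠ 0) :
    ∑ k ∈ Finset.Icc 1 n, par deg (s k) + par deg (s 0) = (n : ZMod 2) + T.1.card := by
  have h1 := he _ _ _ (op_mem_basis b hα hb T s) _ (hb (s 0)) h
  have h2 := cast_eq_of_modEq h1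
  simp only [PTree.deg, Int.cast_add, Int.cast_sub, Int.cast_natCast, Int.cast_sum,
    Int.cast_ofNat] at h2
  have h3 : (2 : ZMod 2) = 0 := rfl
  have h4 : ∀ x : ZMod 2, x + x = 0 := CharTwo.add_self_eq_zero
  simp only [par]
  rw [← h2, h3]
  linear_combination h4 (∑ k ∈ Finset.Icc 1 n, par deg (s k)) - h4 T.1.card

lemma corollaWeight_parity (hα : IsCyclicAInf 𝒜 α) (he : IsEven 𝒜 α)
    (hb : ∀ i, b i ∈ 𝒜 (deg i)) (l : List ι) (x : ι) (h : corollaWeight α b l x ≠ 0) :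
    (l.map (par deg)).sum + par deg x = l.length := by
  classical
  set s : ℕ → ι := fun k => if k = 0 then x else l.getD (k - 1) x with hs
  have hl : l = (List.range' 1 l.length).map s := by
    refine List.ext_getElem (by simp) fun k h1 h2 => ?_
    simp [hs, h1]
  have h0 : corollaWeight α b l x = cyclicOp α b (corolla K l.length) s := corollaWeight_eq α b s hl
  rw [h0] at h
  by_cases hn : 2 ≤ l.length
  · rw [corolla_eq_tree (empty_mem_trees.2 hn)] at h
    have h1 := cyclicOp_parity b hα he hb _ s h
    simp only [Finset.card_empty, Nat.cast_zero, add_zero] at h1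
    rw [← h1]
    congr 1
    conv_lhs => rw [hl]
    rw [List.map_map, ← List.sum_toFinset _ List.nodup_range']
    refine Finset.sum_congr ?_ fun _ _ => rfl
    ext k
    simp
    omega
  · exact absurd (by rw [corolla_eq_zero hn]; simp [cyclicOp]) h

variable [Fintype ι] [DecidableEq ι]

/-- The matrix of the inner product. -/
noncomputable def gram (α : AInfData K A) (b : Module.Basis ι K A) : Matrix ι ι K :=
  Matrix.of fun i j => α.inner (b i) (b j)

/-- The matrix of the inverse of the inner product. -/
noncomputable def propagator (α : AInfData K A) (b : Module.Basis ι K A) (x y : ι) : K :=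
  (gram α b)⁻¹ x y

lemma isUnit_det_gram (hα : IsCyclicAInf 𝒜 α) : IsUnit (gram α b).det := by
  have h := (LinearMap.separatingLeft_iff_det_ne_zero (B := α.inner) b).1 hα.inner_nondegenerate.1
  have e : LinearMap.toMatrix₂ b b α.inner = gram α b := by
    ext i j
    simp [gram, LinearMap.toMatrix₂_apply]
  rw [e] at h
  exact isUnit_iff_ne_zero.2 h

/-- Expansion in the dual basis. The form need not be symmetric, so the order of the indices of the
inverse matrix matters. -/
lemma sum_inner_propagator (hG : IsUnit (gram α b).det) (z : A) :
    z = ∑ y, ∑ x, (propagator α b y x * α.inner z (b y)) • b x := by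
  refine b.ext_elem fun x => ?_
  have h1 : ∀ y, α.inner z (b y) = ∑ w, b.repr z w * gram α b w y := by
    intro y
    conv_lhs => rw [← b.sum_repr z]
    simp only [map_sum, map_smul, LinearMap.sum_apply, LinearMap.smul_apply, smul_eq_mul, gram,
      Matrix.of_apply]
  have h2 : (gram α b) * (gram α b)⁻¹ = 1 := Matrix.mul_nonsing_inv _ hG
  rw [Finset.sum_comm]
  simp only [← Finset.sum_smul]
  rw [b.repr_sum_self]
  simp only [h1, Finset.mul_sum]
  rw [Finset.sum_comm]
  calc b.repr z x = ∑ w, b.repr z w * ((gram α b) * (gram α b)⁻¹) w x := by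
        rw [h2]
        simp [Matrix.one_apply]
    _ = _ := by
        refine Finset.sum_congr rfl fun w _ => ?_
        rw [Matrix.mul_apply, Finset.mul_sum]
        refine Finset.sum_congr rfl fun y _ => ?_
        unfold propagator
        ring

/-- Evaluation of `ρ(U ∘_i c_m)` by summing over the states of the new edge. -/
lemma cyclicOp_treeComp (hα : IsCyclicAInf 𝒜 α) (hb : ∀ i, b i ∈ 𝒜 (deg i))
    {n m i : ℕ} (hi : 1 ≤ i) (hin : i ≤ n) (hm : (∅ : Finset (ℕ × ℕ)) ∈ trees m) (U : PTree n)
    (s : ℕ → ι) :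
    cyclicOp α b (treeComp K i U (⟨∅, hm⟩ : PTree m)) s =
      sg K ((m : ZMod 2) * ∑ l ∈ Finset.Ico 1 i, par deg (s l)) *
        ∑ y, ∑ x, propagator α b y x *
          (cyclicOp α b (corolla K m) (fun l => if l = 0 then y else s (i + l - 1)) *
            cyclicOp α b (tree U)
              (fun l => if l < i then s l else if l = i then x else s (l + m - 1))) := by
  set V : PTree m := ⟨∅, hm⟩ with hV
  set z : A := α.op m (tree V) (tuple m fun l => b (s (i + l - 1))) with hz
  set a' : ℕ → A := fun k => if k < i then b (s k) else b (s (k + m - 1)) with ha'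
  -- The corolla has degree `m - 2`, hence parity `m`: this is the Koszul sign for moving it past
  -- the first `i - 1` arguments.
  have hs : (-1 : K) ^ (V.deg * ∑ l ∈ Finset.Ico 1 i, deg (s l)) =
      sg K ((m : ZMod 2) * ∑ l ∈ Finset.Ico 1 i, par deg (s l)) := by
    rw [neg_one_zpow_eq_sg]
    have h3 : (2 : ZMod 2) = 0 := rfl
    simp [PTree.deg, hV, h3]
  have hupd : ∀ z : A, (tuple n fun k => if k < i then b (s k) else if k = i then z
      else b (s (k + m - 1))) = Function.update (tuple n a') ⟨i - 1, by omega⟩ z := by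
    intro z
    funext k
    simp only [tuple, Function.update_apply, Fin.ext_iff, ha']
    split_ifs <;> first | rfl | omega
  unfold cyclicOp
  rw [hα.op_comp n m i U V (fun k => deg (s k)) (fun k => b (s k)) (fun k => hb _) hi hin, hs,
    map_smul, LinearMap.smul_apply, smul_eq_mul]
  congr 1
  rw [hupd, ← hz]
  -- The inner operation is inserted into leaf `i` after expansion in the basis; `y` and `x` become
  -- the states of the upper and the lower half of the new edge.
  conv_lhs => rw [sum_inner_propagator b (isUnit_det_gram b hα) z]
  rw [← MultilinearMap.toLinearMap_apply, map_sum, map_sum, LinearMap.sum_apply]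
  refine Finset.sum_congr rfl fun y _ => ?_
  rw [map_sum, map_sum, LinearMap.sum_apply]
  refine Finset.sum_congr rfl fun x _ => ?_
  rw [map_smul, map_smul, LinearMap.smul_apply, smul_eq_mul, MultilinearMap.toLinearMap_apply,
    ← hupd, mul_assoc]
  congr 2
  · rw [corolla_eq_tree hm, hz, ← hV]
    beta_reduce
    rw [if_pos rfl]
    rfl
  · beta_reduce
    rw [if_pos (by omega : 0 < i)]
    congr 3
    funext k
    simp only [tuple]
    split_ifs <;> rfl

end Functionals

/-! ### Signs of the rearrangements caused by a grafting -/

section GraftSigns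

variable {α : Type*} [DecidableEq α]

lemma sum_map_one {β : Type*} (l : List β) : (l.map fun _ => (1 : ZMod 2)).sum = l.length := by
  simp

/-- Two block moves: the block `t R S` passes `Q f`, and then `f t` passes `R`. The second move is
free because `f` and `t` have the same parity. -/
lemma kos_graft_halves (δ : α → ZMod 2) {P Q R S : List α} {f t : α}
    (h : (P ++ (Q ++ (R ++ ([f, t] ++ S)))).Nodup) (hft : δ f = δ t) :
    kos δ ((P ++ ([t] ++ (R ++ S))) ++ (Q ++ [f])) (P ++ (Q ++ (R ++ ([f, t] ++ S)))) =
      (δ t + (R.map δ).sum + (S.map δ).sum) * ((Q.map δ).sum + δ f) := by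
  have p1 : ((P ++ ([t] ++ (R ++ S))) ++ (Q ++ [f])).Perm
      (P ++ ((Q ++ [f]) ++ (([t] ++ (R ++ S)) ++ []))) := by
    rw [List.perm_iff_count]
    intro a
    simp only [List.count_append, List.count_nil]
    ring
  have p2 : (P ++ ((Q ++ [f]) ++ (([t] ++ (R ++ S)) ++ []))).Perm
      (P ++ (Q ++ (R ++ ([f, t] ++ S)))) := by
    rw [List.perm_iff_count]
    intro a
    simp only [List.count_append, List.count_nil, List.count_cons]
    ring
  have n2 := p2.nodup_iff.2 h
  have n1 := p1.nodup_iff.2 n2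
  rw [kos_trans δ h p1 p2]
  have e1 := kos_move δ (X := P) (P := [t] ++ (R ++ S)) (Q := Q ++ [f]) (Y := [])
    (by simpa [List.append_assoc] using n1)
  have e2 := kos_move δ (X := P ++ Q) (P := [f, t]) (Q := R) (Y := S)
    (by simpa [List.append_assoc] using n2)
  have e3 : (P ++ ([t] ++ (R ++ S))) ++ (Q ++ [f]) =
      P ++ (([t] ++ (R ++ S)) ++ ((Q ++ [f]) ++ [])) := by simp
  have e4 : P ++ ((Q ++ [f]) ++ (([t] ++ (R ++ S)) ++ [])) = (P ++ Q) ++ ([f, t] ++ (R ++ S)) := by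
    simp
  have e5 : P ++ (Q ++ (R ++ ([f, t] ++ S))) = (P ++ Q) ++ (R ++ ([f, t] ++ S)) := by simp
  rw [e3, e1, e4, e5, e2]
  simp only [List.map_append, List.map_cons, List.map_nil, List.sum_append, List.sum_cons,
    List.sum_nil, hft]
  linear_combination (R.map δ).sum * CharTwo.add_self_eq_zero (δ t)

lemma perm_graft_ori (X P Q R : List α) (v f t : α) :
    ([v, f, t] ++ (X ++ (P ++ (Q ++ R)))).Perm
      ((X ++ (P ++ ([t] ++ R))) ++ ([v, f] ++ Q)) := by
  rw [List.perm_iff_count]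
  intro a
  simp only [List.count_append, List.count_nil, List.count_cons]
  ring

/-- Three block moves with all letters odd: the even block `v f` goes to the end for free, `t`
passes `X P`, and `Q` passes `R` together with the even block `v f`. -/
lemma kos_graft_ori {X P Q R : List α} {v f t : α}
    (h : ([v, f, t] ++ (X ++ (P ++ (Q ++ R)))).Nodup) :
    kos (fun _ => 1) ([v, f, t] ++ (X ++ (P ++ (Q ++ R))))
      ((X ++ (P ++ ([t] ++ R))) ++ ([v, f] ++ Q)) =
      (X.length + P.length : ZMod 2) + Q.length * R.length := by
  have p1 : ([v, f] ++ (([t] ++ (X ++ (P ++ (Q ++ R)))) ++ [])).Perm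
      (([t] ++ (X ++ (P ++ (Q ++ R)))) ++ ([v, f] ++ [])) := by
    rw [List.perm_iff_count]
    intro a
    simp only [List.count_append, List.count_nil, List.count_cons]
    ring
  have p2 : ([t] ++ ((X ++ P) ++ (Q ++ R ++ [v, f]))).Perm
      ((X ++ P) ++ ([t] ++ (Q ++ R ++ [v, f]))) := by
    rw [List.perm_iff_count]
    intro a
    simp only [List.count_append, List.count_nil, List.count_cons]
    ring
  have p3 : ((X ++ P ++ [t]) ++ (Q ++ ((R ++ [v, f]) ++ []))).Perm
      ((X ++ P ++ [t]) ++ ((R ++ [v, f]) ++ (Q ++ []))) := by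
    rw [List.perm_iff_count]
    intro a
    simp only [List.count_append, List.count_nil, List.count_cons]
    ring
  have e0 : [v, f, t] ++ (X ++ (P ++ (Q ++ R))) =
      [v, f] ++ (([t] ++ (X ++ (P ++ (Q ++ R)))) ++ []) := by simp
  have e1 : ([t] ++ (X ++ (P ++ (Q ++ R)))) ++ ([v, f] ++ []) =
      [t] ++ ((X ++ P) ++ (Q ++ R ++ [v, f])) := by simp
  have e2 : (X ++ P) ++ ([t] ++ (Q ++ R ++ [v, f])) =
      (X ++ P ++ [t]) ++ (Q ++ ((R ++ [v, f]) ++ [])) := by simp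
  have e3 : (X ++ P ++ [t]) ++ ((R ++ [v, f]) ++ (Q ++ [])) =
      (X ++ (P ++ ([t] ++ R))) ++ ([v, f] ++ Q) := by simp
  rw [e0] at h
  rw [e1] at p1
  rw [e2] at p2
  rw [e3] at p3
  have n1 := p1.nodup_iff.1 h
  have n2 := p2.nodup_iff.1 n1
  have n3 := p3.nodup_iff.1 n2
  have k1 := kos_move (fun _ : α => (1 : ZMod 2)) (X := []) (P := [v, f])
    (Q := [t] ++ (X ++ (P ++ (Q ++ R)))) (Y := []) h
  have k2 := kos_move (fun _ : α => (1 : ZMod 2)) (X := []) (P := [t])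
    (Q := X ++ P) (Y := Q ++ R ++ [v, f]) n1
  have k3 := kos_move (fun _ : α => (1 : ZMod 2)) (X := X ++ P ++ [t]) (P := Q)
    (Q := R ++ [v, f]) (Y := []) n2
  rw [List.nil_append, List.nil_append, e1] at k1
  rw [List.nil_append, List.nil_append, e2] at k2
  rw [e3] at k3
  rw [e0, kos_trans _ n3 p1 (p2.trans p3), kos_trans _ n3 p2 p3, k1, k2, k3]
  simp only [sum_map_one, List.length_append, List.length_cons, List.length_nil, zero_add,
    Nat.cast_add, Nat.cast_one, Nat.reduceAdd, Nat.cast_ofNat]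
  have h2 : (2 : ZMod 2) = 0 := rfl
  rw [h2]
  ring

end GraftSigns

/-! ### Labelled half-edges of a tree and enumerations of its vertices and edges -/

/-- Labels for the half-edges of a tree: `(I, false)` is the outgoing half-edge of the vertex `I`,
and `(J, true)` is the half by which the edge `J` is attached to its lower vertex. -/
abbrev Lab : Type := (ℕ × ℕ) × Bool

/-- The labels of the leaves `a, …, a + m - 1`. -/
def leafHalves (a m : ℕ) : List Lab := (List.range' a m).map fun l => ((l, l), true)

/-- The labels of the leaves and of the root. -/
def extHalves (n : ℕ) : List Lab := leafHalves 1 n ++ [((1, n), false)]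

/-- The two halves of each edge. -/
def edgePairs (L : List (ℕ × ℕ)) : List (Lab × Lab) := L.map fun e => ((e, false), (e, true))

/-- The half-edges at a vertex, the outgoing one at the end. -/
def PTree.nodeHalves {n : ℕ} (T : PTree n) (I : ℕ × ℕ) : List Lab :=
  (T.children I).map (fun J => (J, true)) ++ [(I, false)]

/-- The vertices and half-edges, ordered by the edges of the tree. -/
def treeOri (n : ℕ) (L : List (ℕ × ℕ)) : List ((ℕ × ℕ) ⊕ Lab) :=
  (L.flatMap fun e => [Sum.inl e, Sum.inr (e, false), Sum.inr (e, true)]) ++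
    (Sum.inl (1, n) :: Sum.inr ((1, n), false) :: (leafHalves 1 n).map Sum.inr)

/-- The vertices and half-edges, ordered by the vertices of the tree. -/
def PTree.stdOri {n : ℕ} (T : PTree n) (ord : List (ℕ × ℕ)) : List ((ℕ × ℕ) ⊕ Lab) :=
  ord.flatMap fun I => Sum.inl I :: Sum.inr (I, false) ::
    (T.children I).map fun J => Sum.inr (J, true)

lemma leafHalves_append (a p q : ℕ) :
    leafHalves a p ++ leafHalves (a + p) q = leafHalves a (p + q) := by
  rw [leafHalves, leafHalves, leafHalves, ← List.map_append, List.range'_append_1]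

lemma length_leafHalves (a m : ℕ) : (leafHalves a m).length = m := by simp [leafHalves]

lemma nodup_leafHalves (a m : ℕ) : (leafHalves a m).Nodup :=
  (List.nodup_range' (s := a) (n := m)).map fun x y h => by simpa using h

lemma pairLetters_edgePairs (L : List (ℕ × ℕ)) :
    pairLetters (edgePairs L) = L.flatMap fun e => [(e, false), (e, true)] := by
  simp [pairLetters, edgePairs, List.flatMap_map]

lemma mem_leafHalves {a m : ℕ} {x : Lab} :
    x ∈ leafHalves a m ↔ ∃ l, (a ≤ l ∧ l < a + m) ∧ ((l, l), true) = x := by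
  simp [leafHalves, List.mem_range'_1]

lemma mem_pairLetters_edgePairs {L : List (ℕ × ℕ)} {x : Lab} :
    x ∈ pairLetters (edgePairs L) ↔ x.1 ∈ L := by
  rw [pairLetters_edgePairs]
  rcases x with ⟨e, _ | _⟩ <;> simp

lemma nodup_extHalves_append {n : ℕ} {L : List (ℕ × ℕ)} (hL : L.Nodup)
    (h : ∀ e ∈ L, e.1 < e.2 ∧ e ≠ (1, n)) :
    (extHalves n ++ pairLetters (edgePairs L)).Nodup := by
  refine List.Nodup.append (List.Nodup.append (nodup_leafHalves 1 n) (by simp) ?_) ?_ ?_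
  · intro x hx hy
    obtain ⟨l, -, rfl⟩ := mem_leafHalves.1 hx
    simp at hy
  · rw [pairLetters_edgePairs, List.nodup_flatMap]
    refine ⟨fun e _ => by simp, hL.imp fun {e f} hef x hx hy => ?_⟩
    simp only [List.mem_cons, List.not_mem_nil, or_false] at hx hy
    rcases hx with rfl | rfl <;> simp at hy <;> exact hef hy
  · intro x hx hy
    rw [mem_pairLetters_edgePairs] at hy
    have := h _ hy
    rcases List.mem_append.1 hx with hx | hx
    · obtain ⟨l, -, rfl⟩ := mem_leafHalves.1 hx
      simp at this
    · simp only [List.mem_singleton] at hx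
      subst hx
      exact this.2 rfl

lemma nodup_treeOri {n : ℕ} {L : List (ℕ × ℕ)} (hL : L.Nodup)
    (h : ∀ e ∈ L, e.1 < e.2 ∧ e ≠ (1, n)) : (treeOri n L).Nodup := by
  refine List.Nodup.append ?_ ?_ ?_
  · rw [List.nodup_flatMap]
    refine ⟨fun e _ => by simp, hL.imp fun {e f} hef x hx hy => ?_⟩
    simp only [List.mem_cons, List.not_mem_nil, or_false] at hx hy
    rcases hx with rfl | rfl | rfl <;> simp at hy <;> exact hef hy
  · rw [List.nodup_cons, List.nodup_cons]
    refine ⟨by simp, ?_, (nodup_leafHalves 1 n).map Sum.inr_injective⟩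
    simp [leafHalves]
  · intro x hx hy
    simp only [List.mem_flatMap, List.mem_cons, List.not_mem_nil, or_false, List.mem_map] at hx hy
    obtain ⟨e, he, hx⟩ := hx
    have := h e he
    rcases hy with rfl | rfl | ⟨y, hy, rfl⟩
    · simp at hx
      exact this.2 hx.symm
    · simp at hx
      exact this.2 hx.symm
    · obtain ⟨l, -, rfl⟩ := mem_leafHalves.1 hy
      simp at hx
      subst hx
      simp at this

/-- `ord` and `L` enumerate the vertices and the edges of `T`. -/
structure IsEnumeration {n : ℕ} (T : PTree n) (ord L : List (ℕ × ℕ)) : Prop where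
  nodup_ord : ord.Nodup
  mem_ord : ∀ I, I ∈ ord ↔ I ∈ T.nodes
  nodup_edges : L.Nodup
  mem_edges : ∀ e, e ∈ L ↔ e ∈ T.1
  sum_length : (ord.map fun I => (T.children I).length).sum = n + T.1.card
  halves_perm : (ord.flatMap T.nodeHalves).Perm (extHalves n ++ pairLetters (edgePairs L))
  ori_perm : (treeOri n L).Perm (T.stdOri ord)

namespace IsEnumeration

variable {n : ℕ} {T : PTree n} {ord L : List (ℕ × ℕ)} (h : IsEnumeration T ord L)

include h

lemma length_edges : L.length = T.1.card := by
  have e : L.toFinset = T.1 := by ext a; simp [h.mem_edges]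
  rw [← e, List.toFinset_card_of_nodup h.nodup_edges]

lemma edge_lt : ∀ e ∈ L, e.1 < e.2 ∧ e ≠ (1, n) := fun e he => by
  have := T.mem_edge ((h.mem_edges e).1 he)
  exact ⟨this.2.1, this.2.2.2⟩

lemma nodup_halves : (extHalves n ++ pairLetters (edgePairs L)).Nodup :=
  nodup_extHalves_append h.nodup_edges h.edge_lt

lemma nodup_ori : (treeOri n L).Nodup := nodup_treeOri h.nodup_edges h.edge_lt

end IsEnumeration

/-! ### Enumerations and signs under grafting -/

section GraftEnumeration

variable {n m i : ℕ} {U : PTree n} {T : PTree (n + m - 1)}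

/-- The effect of grafting on labels. -/
abbrev graftLab (i m : ℕ) : Lab → Lab := Prod.map (graftOuter i m) id

lemma graftLab_injective (hm : 2 ≤ m) : Function.Injective (graftLab i m) :=
  (graftOuter_injective hm).prodMap Function.injective_id

namespace IsGraft

variable (h : IsGraft i m U T)

include h

omit h in
lemma map_leafHalves_left : (leafHalves 1 (i - 1)).map (graftLab i m) = leafHalves 1 (i - 1) := by
  refine List.ext_getElem (by simp) fun k h1 h2 => ?_
  simp only [length_leafHalves] at h2
  simp only [leafHalves, List.getElem_map, List.getElem_range', graftOuter, Prod.map_apply, id,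
    Prod.mk.injEq, and_true]
  split_ifs <;> omega

lemma map_leafHalves_right (q : ℕ) :
    (leafHalves (i + 1) q).map (graftLab i m) = leafHalves (i + m) q := by
  have := h.two_le
  refine List.ext_getElem (by simp [leafHalves]) fun k h1 h2 => ?_
  simp only [leafHalves, List.getElem_map, List.getElem_range', graftOuter, Prod.map_apply, id,
    Prod.mk.injEq, and_true]
  split_ifs <;> omega

lemma leafHalves_source : leafHalves 1 n =
    leafHalves 1 (i - 1) ++ ([((i, i), true)] ++ leafHalves (i + 1) (n - i)) := by
  have h1 := h.one_le
  have h2 := h.le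
  have e : [((i, i), true)] = leafHalves i 1 := rfl
  rw [e, leafHalves_append i, show leafHalves i (1 + (n - i)) = leafHalves (1 + (i - 1)) (1 + (n - i)) by
    congr 1; omega, leafHalves_append]
  congr 1
  omega

lemma leafHalves_target : leafHalves 1 (n + m - 1) =
    leafHalves 1 (i - 1) ++ (leafHalves i m ++ leafHalves (i + m) (n - i)) := by
  have h1 := h.one_le
  have h2 := h.le
  rw [leafHalves_append i, show leafHalves i (m + (n - i)) = leafHalves (1 + (i - 1)) (m + (n - i)) by
    congr 1; omega, leafHalves_append]
  congr 1
  omega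

lemma map_leafHalves : (leafHalves 1 n).map (graftLab i m) = leafHalves 1 (i - 1) ++
    ([((i, i + m - 1), true)] ++ leafHalves (i + m) (n - i)) := by
  rw [h.leafHalves_source, List.map_append, List.map_append, map_leafHalves_left,
    h.map_leafHalves_right]
  congr 3
  simp [graftOuter_self]

lemma nodeHalves_graft {I : ℕ × ℕ} (hI : I ∈ U.nodes) :
    T.nodeHalves (graftOuter i m I) = (U.nodeHalves I).map (graftLab i m) := by
  simp [PTree.nodeHalves, h.children_graftOuter hI]

lemma nodeHalves_new :
    T.nodeHalves (i, i + m - 1) = leafHalves i m ++ [((i, i + m - 1), false)] := by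
  simp [PTree.nodeHalves, h.children_new, leafHalves]

variable {ord L : List (ℕ × ℕ)} (hE : IsEnumeration U ord L)

include hE

lemma flatMap_nodeHalves : (ord.map (graftOuter i m) ++ [(i, i + m - 1)]).flatMap T.nodeHalves =
    (ord.flatMap U.nodeHalves).map (graftLab i m) ++
      (leafHalves i m ++ [((i, i + m - 1), false)]) := by
  rw [List.flatMap_append, List.flatMap_singleton, h.nodeHalves_new, List.flatMap_map,
    List.map_flatMap]
  congr 1
  exact List.flatMap_congr fun I hI => h.nodeHalves_graft ((hE.mem_ord I).1 hI)

omit h hE in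
lemma edgePairs_graft : edgePairs ((i, i + m - 1) :: L.map (graftOuter i m)) =
    (((i, i + m - 1), false), ((i, i + m - 1), true)) ::
      (edgePairs L).map (Prod.map (graftLab i m) (graftLab i m)) := by
  simp [edgePairs]

omit hE in
lemma map_ext_append : (extHalves n ++ pairLetters (edgePairs L)).map (graftLab i m) =
    leafHalves 1 (i - 1) ++ ([((i, i + m - 1), true)] ++
      ((leafHalves (i + m) (n - i) ++ [((1, n + m - 1), false)]) ++
        (pairLetters (edgePairs L)).map (graftLab i m))) := by
  rw [extHalves, List.map_append, List.map_append, h.map_leafHalves]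
  simp [h.whole]

omit hE in
lemma ext_append : extHalves (n + m - 1) ++
      pairLetters (edgePairs ((i, i + m - 1) :: L.map (graftOuter i m))) =
    leafHalves 1 (i - 1) ++ (leafHalves i m ++
      ((leafHalves (i + m) (n - i) ++ [((1, n + m - 1), false)]) ++
        ([((i, i + m - 1), false), ((i, i + m - 1), true)] ++
        (pairLetters (edgePairs L)).map (graftLab i m)))) := by
  rw [extHalves, edgePairs_graft, pairLetters_cons, pairLetters_map, h.leafHalves_target]
  simp

omit hE in
lemma treeOri_graft : treeOri (n + m - 1) ((i, i + m - 1) :: L.map (graftOuter i m)) =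
    [Sum.inl (i, i + m - 1), Sum.inr ((i, i + m - 1), false), Sum.inr ((i, i + m - 1), true)] ++
    ((L.map (graftOuter i m)).flatMap
      (fun e => [Sum.inl e, Sum.inr (e, false), Sum.inr (e, true)]) ++
    ((Sum.inl (1, n + m - 1) :: Sum.inr ((1, n + m - 1), false) ::
      (leafHalves 1 (i - 1)).map Sum.inr) ++
    ((leafHalves i m).map Sum.inr ++ (leafHalves (i + m) (n - i)).map Sum.inr))) := by
  rw [treeOri, h.leafHalves_target]
  simp

omit hE in
lemma map_treeOri : (treeOri n L).map (Sum.map (graftOuter i m) (graftLab i m)) =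
    (L.map (graftOuter i m)).flatMap
      (fun e => [Sum.inl e, Sum.inr (e, false), Sum.inr (e, true)]) ++
    ((Sum.inl (1, n + m - 1) :: Sum.inr ((1, n + m - 1), false) ::
      (leafHalves 1 (i - 1)).map Sum.inr) ++
    ([Sum.inr ((i, i + m - 1), true)] ++ (leafHalves (i + m) (n - i)).map Sum.inr)) := by
  have e : ((leafHalves 1 n).map Sum.inr).map (Sum.map (graftOuter i m) (graftLab i m)) =
      ((leafHalves 1 n).map (graftLab i m)).map (Sum.inr : Lab → (ℕ × ℕ) ⊕ Lab) := by
    simp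
  rw [treeOri, List.map_append, List.map_cons, List.map_cons, e, h.map_leafHalves]
  simp [h.whole, List.map_flatMap, List.flatMap_map]

lemma stdOri_graft : T.stdOri (ord.map (graftOuter i m) ++ [(i, i + m - 1)]) =
    (U.stdOri ord).map (Sum.map (graftOuter i m) (graftLab i m)) ++
      ([Sum.inl (i, i + m - 1), Sum.inr ((i, i + m - 1), false)] ++
        (leafHalves i m).map Sum.inr) := by
  rw [PTree.stdOri, PTree.stdOri, List.flatMap_append, List.flatMap_singleton, h.children_new,
    List.flatMap_map, List.map_flatMap]
  congr 1
  · refine List.flatMap_congr fun I hI => ?_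
    rw [h.children_graftOuter ((hE.mem_ord I).1 hI)]
    simp
  · simp [leafHalves]

/-- The new vertex is put last, so its factor splits off at the end of the product; the new edge is
put first, so its states are summed outermost. The recursion of the signs relies on this order. -/
theorem isEnumeration :
    IsEnumeration T (ord.map (graftOuter i m) ++ [(i, i + m - 1)])
      ((i, i + m - 1) :: L.map (graftOuter i m)) where
  nodup_ord := by
    have hinj := graftOuter_injective (i := i) h.two_le
    refine List.Nodup.append (hE.nodup_ord.map hinj) (by simp) ?_
    intro x hx hy
    obtain ⟨y, hy', rfl⟩ := List.mem_map.1 hx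
    rw [List.mem_singleton, ← graftOuter_self] at hy
    have := U.mem_node ((hE.mem_ord y).1 hy')
    rw [hinj hy] at this
    simp at this
  mem_ord I := by
    rw [List.mem_append, List.mem_map, List.mem_singleton, h.mem_nodes_iff]
    simp only [hE.mem_ord]
    exact or_comm
  nodup_edges := by
    rw [List.nodup_cons]
    refine ⟨?_, hE.nodup_edges.map (graftOuter_injective h.two_le)⟩
    intro hc
    apply h.not_mem_image
    obtain ⟨x, hx, hx'⟩ := List.mem_map.1 hc
    exact Finset.mem_image.2 ⟨x, (hE.mem_edges x).1 hx, hx'⟩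
  mem_edges e := by
    rw [List.mem_cons, List.mem_map, h.mem_iff]
    simp only [hE.mem_edges]
  sum_length := by
    have := h.one_le
    have := h.le
    have e : (ord.map fun I => (T.children (graftOuter i m I)).length) =
        ord.map fun I => (U.children I).length := by
      refine List.map_congr_left fun I hI => ?_
      rw [h.children_graftOuter ((hE.mem_ord I).1 hI), List.length_map]
    rw [List.map_append, List.sum_append, List.map_map, Function.comp_def, e, hE.sum_length, h.card]
    simp [h.children_new]
    omega
  halves_perm := by
    rw [h.flatMap_nodeHalves hE, h.ext_append]
    refine ((hE.halves_perm.map _).append_right _).trans ?_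
    rw [h.map_ext_append, List.perm_iff_count]
    intro a
    simp only [List.count_append, List.count_nil, List.count_cons]
    ring
  ori_perm := by
    rw [h.stdOri_graft hE]
    refine List.Perm.trans ?_ ((hE.ori_perm.map _).append_right _)
    rw [h.map_treeOri, h.treeOri_graft]
    exact perm_graft_ori _ _ _ _ _ _ _

/-- The old half-edges are rearranged first, then the block of the new corolla is moved into place.
The hypotheses say that all parity laws hold for the states in question; the new block has total
parity `m`, and what it passes has parity `n` plus the number of edges of `U` plus the parity of the
leaves before `i`. -/
lemma kos_halves (δ : Lab → ZMod 2)
    (he : δ ((i, i + m - 1), false) = δ ((i, i + m - 1), true))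
    (hQ : ((leafHalves i m).map δ).sum + δ ((i, i + m - 1), false) = m)
    (hpairs : ((pairLetters (edgePairs L)).map fun a => δ (graftLab i m a)).sum = 0)
    (hU : ((ord.flatMap U.nodeHalves).map fun a => δ (graftLab i m a)).sum = n + U.1.card) :
    kos δ ((ord.map (graftOuter i m) ++ [(i, i + m - 1)]).flatMap T.nodeHalves)
      (extHalves (n + m - 1) ++
        pairLetters (edgePairs ((i, i + m - 1) :: L.map (graftOuter i m)))) =
    kos (fun a => δ (graftLab i m a)) (ord.flatMap U.nodeHalves)
      (extHalves n ++ pairLetters (edgePairs L)) +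
      m * (n + U.1.card + ((leafHalves 1 (i - 1)).map δ).sum) := by
  have hE' := h.isEnumeration hE
  have hnd := hE'.nodup_halves
  have hp := hE'.halves_perm
  have e1 := (hE.halves_perm.map fun a => δ (graftLab i m a)).sum_eq
  rw [hU, List.map_append, List.sum_append, hpairs, add_zero] at e1
  have e2 : ((extHalves n).map fun a => δ (graftLab i m a)) =
      ((extHalves n).map (graftLab i m)).map δ := by simp
  have e3 : (extHalves n).map (graftLab i m) = leafHalves 1 (i - 1) ++ ([((i, i + m - 1), true)] ++
      (leafHalves (i + m) (n - i) ++ [((1, n + m - 1), false)])) := by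
    have := h.map_ext_append (L := [])
    simpa [edgePairs] using this
  rw [e2, e3] at e1
  have p1 : ((ord.flatMap U.nodeHalves).map (graftLab i m) ++
      (leafHalves i m ++ [((i, i + m - 1), false)])).Perm
      ((extHalves n ++ pairLetters (edgePairs L)).map (graftLab i m) ++
      (leafHalves i m ++ [((i, i + m - 1), false)])) := (hE.halves_perm.map _).append_right _
  rw [h.flatMap_nodeHalves hE] at hp ⊢
  have hnd1 := p1.nodup_iff.1 (hp.nodup_iff.2 hnd)
  rw [kos_trans δ hnd p1 (p1.symm.trans hp), kos_append_right δ hnd1 (hE.halves_perm.map _),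
    kos_map δ _ hE.halves_perm fun x _ y _ hxy => graftLab_injective h.two_le hxy]
  congr 1
  rw [h.map_ext_append, h.ext_append]
  rw [h.ext_append] at hnd
  rw [kos_graft_halves δ hnd he, hQ, e1, mul_comm]
  congr 1
  rw [List.map_map, Function.comp_def, hpairs]
  simp only [List.map_append, List.sum_append, List.map_cons, List.map_nil, List.sum_cons,
    List.sum_nil]
  have h2 : ∀ x : ZMod 2, x + x = 0 := CharTwo.add_self_eq_zero
  linear_combination (-h2 ((leafHalves 1 (i - 1)).map δ).sum)

/-- The counterpart of `kos_halves` for orientations, where every vertex and half-edge is an odd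
letter. -/
lemma kos_ori :
    kos (fun _ => 1) (treeOri (n + m - 1) ((i, i + m - 1) :: L.map (graftOuter i m)))
      (T.stdOri (ord.map (graftOuter i m) ++ [(i, i + m - 1)])) =
    kos (fun _ => 1) (treeOri n L) (U.stdOri ord) + (U.1.card + i + 1 + m * (n + i)) := by
  have hE' := h.isEnumeration hE
  have hp := hE'.ori_perm
  have hnd := hE'.nodup_ori
  have hnd' := hp.nodup_iff.1 hnd
  have h1 := h.one_le
  have h2 := h.le
  rw [h.stdOri_graft hE] at hp hnd' ⊢
  have p1 := (hE.ori_perm.map (Sum.map (graftOuter i m) (graftLab i m))).append_right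
    ([Sum.inl (i, i + m - 1), Sum.inr ((i, i + m - 1), false)] ++ (leafHalves i m).map Sum.inr)
  rw [kos_trans _ hnd' (hp.trans p1.symm) p1, kos_append_right _ hnd' (hE.ori_perm.map _),
    kos_map _ _ hE.ori_perm fun x _ y _ hxy => ((graftOuter_injective h.two_le).sumMap
      (graftLab_injective h.two_le)) hxy, add_comm]
  congr 1
  rw [h.treeOri_graft] at hnd ⊢
  rw [h.map_treeOri, kos_graft_ori hnd]
  have e1 : ((L.map (graftOuter i m)).flatMap fun e : ℕ × ℕ => [(Sum.inl e : (ℕ × ℕ) ⊕ Lab),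
      Sum.inr (e, false), Sum.inr (e, true)]).length = 3 * U.1.card := by
    rw [List.length_flatMap, ← hE.length_edges]
    simp [mul_comm, Function.comp_def]
  rw [e1]
  simp only [List.length_cons, List.length_map, length_leafHalves]
  have e2 : (2 : ZMod 2) = 0 := rfl
  have e3 : ∀ x : ZMod 2, x + x = 0 := CharTwo.add_self_eq_zero
  push_cast [h1, h2]
  linear_combination ((U.1.card : ZMod 2)) * e2 - m * e3 i

end IsGraft

end GraftEnumeration

/-! ### The operation of a tree as a contraction of corollas -/

section TreeExpansion

variable {K : Type*} [Field K] {A : Type*} [AddCommGroup A] [Module K A] (α : AInfData K A)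
  {ι : Type*} (b : Module.Basis ι K A)

/-- The states of the root (`0`) and of the leaves (`1, …, n`). -/
def extState {ι : Type*} (n : ℕ) (u : Lab → ι) (l : ℕ) : ι :=
  if l = 0 then u ((1, n), false) else u ((l, l), true)

/-- The product of the functionals given by the corollas at the vertices of `T`. -/
noncomputable def vertexProd {n : ℕ} (T : PTree n) (ord : List (ℕ × ℕ)) (w : Lab → ι) : K :=
  (ord.map fun I => corollaWeight α b ((T.children I).map fun J => w (J, true)) (w (I, false))).prod

variable (deg : ι → ℤ)

/-- The signed product of the functionals given by the corollas at the vertices of `T`. -/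
noncomputable def treeIntegrand {n : ℕ} (T : PTree n) (ord L : List (ℕ × ℕ)) (w : Lab → ι) : K :=
  sg K (kos (fun a => par deg (w a)) (ord.flatMap T.nodeHalves)
    (extHalves n ++ pairLetters (edgePairs L))) * vertexProd α b T ord w

/-- The exponent of the sign in the expansion of a tree. -/
def treeSign {n : ℕ} (T : PTree n) (ord L : List (ℕ × ℕ)) : ZMod 2 :=
  T.1.card + psum (fun I J => ((T.children I).length : ZMod 2) * (T.children J).length) ord +
    kos (fun _ => 1) (treeOri n L) (T.stdOri ord)

variable [Fintype ι] [DecidableEq ι]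

/-- `⟨ρ(T)(…), -⟩` is obtained from the corollas at the vertices of `T` by summing over the states
of the internal edges. -/
def HasExpansion {n : ℕ} (T : PTree n) (ord L : List (ℕ × ℕ)) : Prop :=
  ∀ u : Lab → ι, cyclicOp α b (oriented K n L) (extState n u) =
    sg K (treeSign T ord L) *
      edgeSum (propagator α b) (edgePairs L) (treeIntegrand α b deg T ord L) u

variable {α deg} {𝒜 : ℤ → Submodule K A}

-- Add up the parity laws of the corollas at the vertices: every leaf and every internal edge is an
-- incoming edge of exactly one vertex.
omit [Fintype ι] [DecidableEq ι] in
lemma vertexProd_parity (hα : IsCyclicAInf 𝒜 α) (he : IsEven 𝒜 α) (hb : ∀ i, b i ∈ 𝒜 (deg i))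
    {n : ℕ} {T : PTree n} {ord L : List (ℕ × ℕ)} (hE : IsEnumeration T ord L) {w : Lab → ι}
    (hw : vertexProd α b T ord w ≠ 0) :
    ((ord.flatMap T.nodeHalves).map fun a => par deg (w a)).sum = n + T.1.card := by
  have h1 := congrArg (Nat.cast : ℕ → ZMod 2) hE.sum_length
  rw [Nat.cast_add, Nat.cast_list_sum, List.map_map] at h1
  rw [sum_map_flatMap, ← h1]
  congr 1
  refine List.map_congr_left fun I hI => ?_
  have h2 : corollaWeight α b ((T.children I).map fun J => w (J, true)) (w (I, false)) ≠ 0 :=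
    fun h0 => hw (List.prod_eq_zero (List.mem_map.2 ⟨I, hI, h0⟩))
  have h3 := corollaWeight_parity b hα he hb _ _ h2
  simp only [List.map_map, List.length_map] at h3
  simp only [PTree.nodeHalves, List.map_append, List.map_map, List.map_cons, List.map_nil,
    List.sum_append, List.sum_cons, List.sum_nil, add_zero, Function.comp_apply]
  exact h3

/-- The definition of the composition, solved for the grafted tree. The new edge moves from the last
place to the first, past all edges of `U`, and the edges of `U` are brought into the chosen order.
-/
lemma IsGraft.oriented_eq {n m i : ℕ} {U : PTree n} {T : PTree (n + m - 1)} (h : IsGraft i m U T)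
    {ord L : List (ℕ × ℕ)} (hE : IsEnumeration U ord L) (hm : (∅ : Finset (ℕ × ℕ)) ∈ trees m) :
    oriented K (n + m - 1) ((i, i + m - 1) :: L.map (graftOuter i m)) =
      sg K (U.1.card + i * (m + 1) + n * m + kos (fun _ => 1) L U.edgeList) •
        treeComp K i U (⟨∅, hm⟩ : PTree m) := by
  have hLU : L.Perm U.edgeList := by
    rw [List.perm_ext_iff_of_nodup hE.nodup_edges U.nodup_edgeList]
    intro e
    rw [hE.mem_edges, U.mem_edgeList]
  have hinj := graftOuter_injective (i := i) h.two_le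
  have hnd := (h.isEnumeration hE).nodup_edges
  have p1 : ((i, i + m - 1) :: L.map (graftOuter i m)).Perm
      ((i, i + m - 1) :: U.edgeList.map (graftOuter i m)) := (hLU.map _).cons _
  have p2 : ((i, i + m - 1) :: U.edgeList.map (graftOuter i m)).Perm
      (U.edgeList.map (graftOuter i m) ++ [(i, i + m - 1)]) :=
    (List.perm_append_singleton _ _).symm
  have hnd1 := p1.nodup_iff.1 hnd
  have hnd2 := p2.nodup_iff.1 hnd1
  have k1 : kos (fun _ => (1 : ZMod 2)) ((i, i + m - 1) :: L.map (graftOuter i m))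
      ((i, i + m - 1) :: U.edgeList.map (graftOuter i m)) = kos (fun _ => 1) L U.edgeList := by
    rw [show (i, i + m - 1) :: L.map (graftOuter i m) = [(i, i + m - 1)] ++ L.map (graftOuter i m)
      from rfl, show (i, i + m - 1) :: U.edgeList.map (graftOuter i m) =
      [(i, i + m - 1)] ++ U.edgeList.map (graftOuter i m) from rfl,
      kos_append_left _ hnd1 (hLU.map _), kos_map _ _ hLU fun x _ y _ hxy => hinj hxy]
  have k2 : kos (fun _ => (1 : ZMod 2)) ((i, i + m - 1) :: U.edgeList.map (graftOuter i m))
      (U.edgeList.map (graftOuter i m) ++ [(i, i + m - 1)]) = U.1.card := by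
    have := kos_swap (fun _ => (1 : ZMod 2)) (P := [(i, i + m - 1)])
      (Q := U.edgeList.map (graftOuter i m)) hnd1
    rw [sum_map_one, sum_map_one, List.length_map, U.length_edgeList] at this
    simpa using this
  have hV : PTree.edgeList (⟨∅, hm⟩ : PTree m) = [] := by simp [PTree.edgeList]
  rw [oriented_perm hnd (p1.trans p2), kos_trans _ hnd2 p1 p2, k1, k2, treeComp, hV, smul_smul]
  simp only [List.map_nil, List.append_nil]
  congr 1
  rw [neg_one_zpow_eq_sg, ← sg_add]
  congr 1
  have h2 : (2 : ZMod 2) = 0 := rfl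
  have h3 : ∀ x : ZMod 2, x + x = 0 := CharTwo.add_self_eq_zero
  simp [PTree.deg, h2]
  linear_combination (-h3 (i * (m + 1) + n * m))

/-- Inductive step: composition contributes the sum over the states of the new edge, and the
functional of `U` is already expanded. The only sign depending on the states, the parity of the
leaves before `i` times `m`, occurs both in the composition rule and in `kos_halves`, and so
disappears. -/
theorem IsGraft.hasExpansion (hα : IsCyclicAInf 𝒜 α) (he : IsEven 𝒜 α)
    (hb : ∀ i, b i ∈ 𝒜 (deg i)) (hp : ∀ x y, propagator α b x y ≠ 0 → par deg x = par deg y)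
    {n m i : ℕ} {U : PTree n} {T : PTree (n + m - 1)}
    (h : IsGraft i m U T) {ord L : List (ℕ × ℕ)} (hE : IsEnumeration U ord L)
    (hX : HasExpansion α b deg U ord L) :
    HasExpansion α b deg T (ord.map (graftOuter i m) ++ [(i, i + m - 1)])
      ((i, i + m - 1) :: L.map (graftOuter i m)) := by
  intro u
  have hm := empty_mem_trees.2 h.two_le
  have hE' := h.isEnumeration hE
  have hinj := graftLab_injective (i := i) h.two_le
  set e : ℕ × ℕ := (i, i + m - 1) with hedef
  set ord' := ord.map (graftOuter i m) ++ [e] with hord'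
  set L' := e :: L.map (graftOuter i m) with hL'
  have hi1 := h.one_le
  have hi2 := h.le
  have hm2 := h.two_le
  rw [h.oriented_eq hE hm, cyclicOp_smul, cyclicOp_treeComp b hα hb h.one_le h.le hm,
    edgePairs_graft, edgeSum_cons, ← mul_assoc, ← sg_add, Finset.mul_sum (s := (Finset.univ : Finset ι)),
    Finset.mul_sum (s := (Finset.univ : Finset ι))]
  refine Finset.sum_congr rfl fun y _ => ?_
  rw [Finset.mul_sum (s := (Finset.univ : Finset ι)),
    Finset.mul_sum (s := (Finset.univ : Finset ι))]
  refine Finset.sum_congr rfl fun x _ => ?_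
  -- States with vanishing propagator contribute nothing; for the others the two halves of the new
  -- edge have equal parity.
  by_cases hyx : propagator α b y x = 0
  · rw [hyx]; ring
  have hyx' := hp _ _ hyx
  set u' : Lab → ι := Function.update (Function.update u (e, false) y) (e, true) x with hu'
  set F : K := cyclicOp α b (corolla K m)
    (fun l => if l = 0 then y else extState (n + m - 1) u (i + l - 1)) with hF
  have hne : e ≠ (1, (n + m - 1)) := (T.mem_edge ((hE'.mem_edges e).1 (by simp [hL']))).2.2.2
  have hu1 : u' (e, false) = y := by simp [hu']
  have hu2 : u' (e, true) = x := by simp [hu']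
  have hu3 : ∀ l, u' ((l, l), true) = u ((l, l), true) := by
    intro l
    have : ((l, l) : ℕ × ℕ) ≠ e := by
      simp only [hedef, ne_eq, Prod.mk.injEq]; omega
    simp [hu', this]
  have hu4 : u' ((1, (n + m - 1)), false) = u ((1, (n + m - 1)), false) := by
    simp [hu', hne.symm]
  -- the remaining factor
  have hU : cyclicOp α b (tree U) (fun l => if l < i then extState (n + m - 1) u l else if l = i then x
      else extState (n + m - 1) u (l + m - 1)) = sg K (kos (fun _ => 1) L U.edgeList) *
        (sg K (treeSign U ord L) * edgeSum (propagator α b)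
          ((edgePairs L).map (Prod.map (graftLab i m) (graftLab i m)))
          (fun w => treeIntegrand α b deg U ord L (fun a => w (graftLab i m a))) u') := by
    have h1 : edgeSum (propagator α b) ((edgePairs L).map (Prod.map (graftLab i m) (graftLab i m)))
        (fun w => treeIntegrand α b deg U ord L (fun a => w (graftLab i m a))) u' =
        edgeSum (propagator α b) (edgePairs L) (treeIntegrand α b deg U ord L)
          (fun a => u' (graftLab i m a)) :=
      edgeSum_map _ (S := Set.univ) hinj.injOn (fun _ _ => Set.mem_univ _)
        (fun w w' hw => by rw [show w' = fun a => w (graftLab i m a) from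
          funext fun a => (hw a (Set.mem_univ _)).symm]) fun _ _ => rfl
    rw [h1, ← hX, oriented_eq_smul_tree U hE.nodup_edges hE.mem_edges, cyclicOp_smul, ← mul_assoc,
      sg_mul_self, one_mul]
    refine cyclicOp_congr α b _ fun l hl => ?_
    simp only [extState, graftLab, Prod.map_apply, id, h.whole]
    by_cases hl0 : l = 0
    · rw [if_pos (by omega), if_pos hl0, if_pos hl0, hu4]
    · rw [if_neg hl0, if_neg hl0]
      by_cases hl1 : l < i
      · have : graftOuter i m (l, l) = (l, l) := by
          simp only [graftOuter]
          rw [if_pos hl1.le, if_pos hl1]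
        rw [if_pos hl1, this, hu3]
      · rw [if_neg hl1]
        by_cases hl2 : l = i
        · rw [if_pos hl2, hl2, graftOuter_self, ← hedef, hu2]
        · have : graftOuter i m (l, l) = (l + m - 1, l + m - 1) := by
            simp only [graftOuter]
            rw [if_neg (by omega), if_neg hl1]
          rw [if_neg hl2, this, hu3, if_neg (by omega)]
  rw [hU]
  have hnd : (pairLetters ((edgePairs L).map (Prod.map (graftLab i m) (graftLab i m)))).Nodup := by
    rw [pairLetters_map]
    exact (List.Nodup.of_append_right hE.nodup_halves).map hinj
  -- comparison of the integrands
  have key : edgeSum (propagator α b) ((edgePairs L).map (Prod.map (graftLab i m) (graftLab i m)))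
      (fun w => F * treeIntegrand α b deg U ord L (fun a => w (graftLab i m a))) u' =
      edgeSum (propagator α b) ((edgePairs L).map (Prod.map (graftLab i m) (graftLab i m)))
        (fun w => sg K (m * (n + U.1.card + ((leafHalves 1 (i - 1)).map fun a => par deg (u a)).sum)) *
          treeIntegrand α b deg T ord' L' w) u' := by
    refine edgeSum_congr _ hnd fun w hw hwp => ?_
    have hwe : ∀ β, w (e, β) = u' (e, β) := fun β => by
      refine hw _ fun hc => ?_
      rw [pairLetters_map, List.mem_map] at hc
      obtain ⟨a, ha, hae⟩ := hc
      rw [mem_pairLetters_edgePairs, hE.mem_edges] at ha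
      exact h.not_mem_image (Finset.mem_image.2 ⟨a.1, ha, congrArg Prod.fst hae⟩)
    have hwl : ∀ l, w ((l, l), true) = u ((l, l), true) := fun l => by
      rw [← hu3]
      refine hw _ fun hc => ?_
      rw [pairLetters_map, List.mem_map] at hc
      obtain ⟨a, ha, hae⟩ := hc
      rw [mem_pairLetters_edgePairs, hE.mem_edges] at ha
      have h1 := graftOuter_lt (i := i) h.two_le (U.mem_edge ha).2.1
      have h2 : graftOuter i m a.1 = (l, l) := congrArg Prod.fst hae
      rw [h2] at h1
      simp at h1
    have hFw : corollaWeight α b ((T.children e).map fun J => w (J, true)) (w (e, false)) = F := by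
      rw [hF, hwe, hu1, h.children_new, List.map_map]
      have := corollaWeight_eq α b (n := m) (l := (List.range' i m).map fun l => w ((l, l), true))
        (fun l => if l = 0 then y else extState (n + m - 1) u (i + l - 1)) ?_
      · exact this
      · refine List.ext_getElem (by simp) fun k h1 h2 => ?_
        simp only [List.getElem_map, List.getElem_range', hwl, extState]
        rw [if_neg (by omega), if_neg (by omega)]
        congr 3 <;> omega
    have hprod : vertexProd α b T ord' w =
        vertexProd α b U ord (fun a => w (graftLab i m a)) * F := by
      unfold vertexProd
      rw [hord', List.map_append, List.prod_append, List.map_singleton, List.prod_singleton, hFw,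
        List.map_map]
      congr 2
      refine List.map_congr_left fun I hI => ?_
      rw [Function.comp_apply, h.children_graftOuter ((hE.mem_ord I).1 hI), List.map_map]
      rfl
    unfold treeIntegrand
    rw [hprod]
    by_cases h0 : vertexProd α b U ord (fun a => w (graftLab i m a)) = 0
    · rw [h0]; ring
    by_cases hF0 : F = 0
    · rw [hF0]; ring
    have hpairs : ∀ q ∈ edgePairs L, par deg (w (graftLab i m q.1)) =
        par deg (w (graftLab i m q.2)) := fun q hq =>
      hp _ _ (hwp (Prod.map (graftLab i m) (graftLab i m) q) (List.mem_map_of_mem hq))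
    have hkos := h.kos_halves hE (fun a => par deg (w a)) (by
        rw [← hedef, hwe, hwe, hu1, hu2]; exact hyx') (by
        rw [← hFw] at hF0
        have := corollaWeight_parity b hα he hb _ _ hF0
        rw [h.children_new] at this
        simpa [leafHalves, Function.comp_def, hedef] using this)
      (sum_pairLetters_eq_zero hpairs)
      (vertexProd_parity b hα he hb hE h0)
    have hP : ((leafHalves 1 (i - 1)).map fun a => par deg (w a)) =
        (leafHalves 1 (i - 1)).map fun a => par deg (u a) := by
      refine List.map_congr_left fun a ha => ?_
      obtain ⟨l, -, rfl⟩ := mem_leafHalves.1 ha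
      rw [hwl]
    rw [hP] at hkos
    rw [hkos, sg_add]
    have h1 := sg_mul_self K
      (m * (n + U.1.card + ((leafHalves 1 (i - 1)).map fun a => par deg (u a)).sum))
    linear_combination (-(sg K (kos (fun a => par deg (w (graftLab i m a)))
      (ord.flatMap U.nodeHalves) (extHalves n ++ pairLetters (edgePairs L))) *
      vertexProd α b U ord (fun a => w (graftLab i m a)) * F)) * h1
  rw [edgeSum_mul_left, edgeSum_mul_left] at key
  have hsum : ((leafHalves 1 (i - 1)).map fun a => par deg (u a)).sum =
      ∑ l ∈ Finset.Ico 1 i, par deg (extState (n + m - 1) u l) := by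
    rw [leafHalves, List.map_map, ← List.sum_toFinset _ List.nodup_range']
    refine Finset.sum_congr ?_ fun l hl => ?_
    · ext l
      simp
      omega
    · have := (Finset.mem_Ico.1 hl).1
      simp [extState, show l ≠ 0 by omega]
  -- The constant sign grows by the sign relating `T` to the composition and by `m` times the parity
  -- `n + t` of `U`; the three summands of `treeSign` are chosen to give exactly this.
  have hsign : treeSign T ord' L' = treeSign U ord L + (U.1.card + i * (m + 1) + n * m) + m *
      (n + U.1.card) := by
    unfold treeSign
    rw [h.card, hord', hL', h.kos_ori hE, psum_append, psum_singleton, psum_map]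
    have e1 : psum (fun I J => ((T.children (graftOuter i m I)).length : ZMod 2) *
        (T.children (graftOuter i m J)).length) ord =
        psum (fun I J => ((U.children I).length : ZMod 2) * (U.children J).length) ord := by
      refine psum_congr fun I hI J hJ => ?_
      rw [h.children_graftOuter ((hE.mem_ord I).1 hI), h.children_graftOuter ((hE.mem_ord J).1 hJ)]
      simp
    have e2 : ((ord.map (graftOuter i m)).map fun I => (([e] : List (ℕ × ℕ)).map fun J =>
        ((T.children I).length : ZMod 2) * (T.children J).length).sum).sum =
        (n + U.1.card) * m := by
      have h1 := congrArg (Nat.cast : ℕ → ZMod 2) hE.sum_length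
      rw [Nat.cast_add, Nat.cast_list_sum, List.map_map] at h1
      rw [← h1, List.map_map, ← List.sum_map_mul_right]
      congr 1
      refine List.map_congr_left fun I hI => ?_
      simp [h.children_graftOuter ((hE.mem_ord I).1 hI), hedef, h.children_new]
    rw [e1, e2]
    have h3 : ∀ x : ZMod 2, x + x = 0 := CharTwo.add_self_eq_zero
    push_cast
    linear_combination h3 1
  rw [hsum] at key
  rw [hsign]
  simp only [sg_add, mul_add] at key ⊢
  have s1 := sg_mul_self K (m * ∑ l ∈ Finset.Ico 1 i, par deg (extState (n + m - 1) u l))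
  have s2 := sg_mul_self K (kos (fun _ => 1) L U.edgeList)
  set κ := sg K (kos (fun _ => 1) L U.edgeList)
  set σ := sg K (m * ∑ l ∈ Finset.Ico 1 i, par deg (extState (n + m - 1) u l))
  generalize edgeSum (propagator α b) ((edgePairs L).map _) (fun w => treeIntegrand α b deg U ord L
    (fun a => w (graftLab i m a))) u' = X at key ⊢
  generalize edgeSum (propagator α b) ((edgePairs L).map _) (treeIntegrand α b deg T ord' L') u' = Y
    at key ⊢
  generalize sg K (treeSign U ord L) = c1
  linear_combination (sg K U.1.card * (sg K (i * m) * sg K (i * 1)) * sg K (n * m) * c1 *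
    propagator α b y x * (κ * κ * σ)) * key + (sg K U.1.card * (sg K (i * m) * sg K (i * 1)) *
    sg K (n * m) * c1 * propagator α b y x * sg K (m * n) * sg K (m * U.1.card) * Y) *
    (κ * κ * s1 + s2)

omit [Fintype ι] [DecidableEq ι] in
lemma children_of_eq_empty {n : ℕ} {T : PTree n} (hT : T.1 = ∅) :
    T.children (1, n) = (List.range' 1 n).map fun l => (l, l) := by
  have h2 := T.two_le
  refine LexLt.list_ext (T.pairwise_children _) ?_ fun J => ?_
  · rw [List.pairwise_map]
    exact (List.pairwise_lt_range' (s := 1) (n := n)).imp fun h => Or.inl h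
  · simp only [T.mem_children', List.mem_map, List.mem_range'_1, hT, Finset.notMem_empty, false_or,
      inside_iff, IsEmpty.forall_iff, implies_true, and_true]
    constructor
    · rintro ⟨h3, h4, h5⟩
      exact ⟨J.1, by omega, Prod.ext rfl h4⟩
    · rintro ⟨l, hl, rfl⟩
      simp only [true_and]
      omega

lemma nodeHalves_of_eq_empty {n : ℕ} {T : PTree n} (hT : T.1 = ∅) :
    T.nodeHalves (1, n) = extHalves n := by
  simp [PTree.nodeHalves, children_of_eq_empty hT, extHalves, leafHalves]

lemma stdOri_of_eq_empty {n : ℕ} {T : PTree n} (hT : T.1 = ∅) :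
    T.stdOri [(1, n)] = treeOri n [] := by
  simp [PTree.stdOri, children_of_eq_empty hT, treeOri, leafHalves]

lemma isEnumeration_of_eq_empty {n : ℕ} {T : PTree n} (hT : T.1 = ∅) :
    IsEnumeration T [(1, n)] [] where
  nodup_ord := by simp
  mem_ord I := by simp [PTree.nodes, hT]
  nodup_edges := by simp
  mem_edges e := by simp [hT]
  sum_length := by simp [children_of_eq_empty hT, hT]
  halves_perm := by simp [nodeHalves_of_eq_empty hT, edgePairs]
  ori_perm := by rw [stdOri_of_eq_empty hT]

/-- For a corolla there is nothing to contract, and the orderings by edges and by vertices coincide,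
so all signs are trivial. -/
lemma hasExpansion_of_eq_empty {n : ℕ} {T : PTree n} (hT : T.1 = ∅) :
    HasExpansion α b deg T [(1, n)] [] := by
  intro u
  have hE := isEnumeration_of_eq_empty hT
  have h1 : treeSign T [(1, n)] [] = 0 := by
    rw [treeSign, hT, stdOri_of_eq_empty hT, psum_singleton, kos_self _ hE.nodup_ori]
    simp
  have h2 : kos (fun a => par deg (u a)) ([(1, n)].flatMap T.nodeHalves)
      (extHalves n ++ pairLetters (edgePairs [])) = 0 := by
    have h3 : [(1, n)].flatMap T.nodeHalves = extHalves n ++ pairLetters (edgePairs []) := by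
      simp [nodeHalves_of_eq_empty hT, edgePairs]
    rw [h3, kos_self _ hE.nodup_halves]
  rw [h1, sg_zero, one_mul]
  change _ = treeIntegrand α b deg T [(1, n)] [] u
  rw [treeIntegrand, h2, sg_zero, one_mul, vertexProd, List.map_singleton, List.prod_singleton,
    children_of_eq_empty hT, List.map_map]
  symm
  refine corollaWeight_eq α b (n := n) (extState n u) (List.map_congr_left fun l hl => ?_)
  have := (List.mem_range'_1.1 hl).1
  simp [extState, show l ≠ 0 by omega]

/-- Induction on the number of internal edges, removing a corolla at each step. -/
theorem exists_hasExpansion (hα : IsCyclicAInf 𝒜 α) (he : IsEven 𝒜 α)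
    (hb : ∀ i, b i ∈ 𝒜 (deg i)) (hp : ∀ x y, propagator α b x y ≠ 0 → par deg x = par deg y)
    {n : ℕ} (T : PTree n) : ∃ ord L, IsEnumeration T ord L ∧ HasExpansion α b deg T ord L := by
  induction hk : T.1.card generalizing n with
  | zero =>
    have hT := Finset.card_eq_zero.1 hk
    exact ⟨_, _, isEnumeration_of_eq_empty hT, hasExpansion_of_eq_empty b hT⟩
  | succ k ih =>
    obtain ⟨n', m, i, rfl, U, h⟩ := exists_isGraft T (Finset.card_pos.1 (by omega))
    have h' : IsGraft i m U T := h
    obtain ⟨ord, L, hE, hX⟩ := ih U (by have := h'.card; omega)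
    exact ⟨_, _, h'.isEnumeration hE, h'.hasExpansion b hα he hb hp hE hX⟩

end TreeExpansion

/-! ### Rotating a tree: effect on edges and vertices -/

section Rotation

namespace PTree

variable {n : ℕ} (T : PTree n)

lemma mem_nodes {I : ℕ × ℕ} : I ∈ T.nodes ↔ I = (1, n) ∨ I ∈ T.1 := by
  rw [nodes, Finset.mem_insert]

/-- The set of edges of the rotated tree. -/
lemma rot_mem_trees : T.1.image (rotEdge n) ∈ trees n := by
  refine mem_trees.2 ⟨T.two_le, ?_, ?_⟩
  · intro e he
    obtain ⟨x, hx, rfl⟩ := Finset.mem_image.1 he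
    have := T.edge_bounds hx
    simp only [rotEdge]
    split_ifs <;> simp only <;> omega
  · intro e he f hf
    obtain ⟨x, hx, rfl⟩ := Finset.mem_image.1 he
    obtain ⟨y, hy, rfl⟩ := Finset.mem_image.1 hf
    have h1 := T.edge_bounds hx
    have h2 := T.edge_bounds hy
    have h3 := T.edge_compatible hx hy
    simp only [rotEdge, Compatible] at h3 ⊢
    split_ifs <;> simp only <;> omega

/-- The rotated tree. -/
def rotTree : PTree n := ⟨T.1.image (rotEdge n), T.rot_mem_trees⟩

lemma mem_rotTree {e : ℕ × ℕ} : e ∈ T.rotTree.1 ↔ ∃ x ∈ T.1, rotEdge n x = e := Finset.mem_image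

lemma rotEdge_injOn {n : ℕ} {x y : ℕ × ℕ} (hx : 1 ≤ x.1 ∧ x.2 ≤ n)
    (hy : 1 ≤ y.1 ∧ y.2 ≤ n) (h : rotEdge n x = rotEdge n y) : x = y := by
  rcases x with ⟨a, b⟩
  rcases y with ⟨a', b'⟩
  simp only [rotEdge] at h hx hy
  split_ifs at h <;> simp only [Prod.mk.injEq] at h ⊢ <;> omega

lemma card_rotTree : T.rotTree.1.card = T.1.card :=
  Finset.card_image_of_injOn fun x hx y hy h => by
    have h1 := T.edge_bounds hx
    have h2 := T.edge_bounds hy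
    exact rotEdge_injOn (by omega) (by omega) h

/-- The structure of the incoming edges at a vertex above which the last leaf lies. -/
lemma exists_last_child {I : ℕ × ℕ} (hI : I ∈ T.nodes) (hIn : I.2 = n) :
    ∃ b, I.1 < b ∧ b ≤ n ∧ (b < n → (b, n) ∈ T.1) ∧
      (∀ f ∈ T.1, f.2 = n → I.1 < f.1 → b ≤ f.1) ∧
      (∀ J ∈ T.children I, J.2 < n → J.2 < b) ∧
      T.children I = (T.children I).filter (fun J => J.2 < n) ++ [(b, n)] := by
  have hI' := T.mem_node hI
  -- The incoming edge leading to the last leaf has the form `(b, n)`; for `b = n` it is that leaf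
  -- itself.
  obtain ⟨J, hJ, h1, h2⟩ := T.exists_child hI (l := n) (by omega) (by omega)
  obtain ⟨⟨h3, h4, h5⟩, h6, h7, h8⟩ := T.mem_children'.1 hJ
  have hJn : J.2 = n := by omega
  obtain ⟨b, rfl⟩ : ∃ b, J = (b, n) := ⟨J.1, Prod.ext rfl hJn⟩
  have hlt : I.1 < b := by
    simp only [inside_iff] at h7
    omega
  have hb : b < n → (b, n) ∈ T.1 := fun h => h6.resolve_right (by simp only; omega)
  have hmin : ∀ f ∈ T.1, f.2 = n → I.1 < f.1 → b ≤ f.1 := by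
    intro f hf hfn hlt'
    by_contra hc
    refine h8 f hf ?_ ?_ <;> simp only [inside_iff] <;> omega
  have hsib : ∀ J ∈ T.children I, J.2 < n → J.2 < b := by
    intro J' hJ' hn
    obtain ⟨⟨k3, k4, k5⟩, k6, k7, k8⟩ := T.mem_children'.1 hJ'
    by_contra hc
    have hbn : (b, n) ∈ T.1 := hb (by omega)
    have h9 : ¬ Inside J' (b, n) := fun hin => k8 _ hbn hin h7
    rcases k6 with k6 | k6
    · have := T.edge_compatible k6 hbn
      simp only [Compatible, inside_iff] at this h9
      omega
    · simp only [inside_iff] at h9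
      omega
  refine ⟨b, hlt, h4.trans h5, hb, hmin, hsib, ?_⟩
  refine LexLt.list_ext (T.pairwise_children I) ?_ fun J' => ?_
  · rw [List.pairwise_append]
    refine ⟨(T.pairwise_children I).filter _, by simp, fun x hx y hy => ?_⟩
    simp only [List.mem_filter, decide_eq_true_eq] at hx
    rw [List.mem_singleton] at hy
    subst hy
    have k1 := hsib x hx.1 hx.2
    have k2 := (T.mem_children'.1 hx.1).1
    exact Or.inl (by simp only; omega)
  · rw [List.mem_append, List.mem_filter, List.mem_singleton, decide_eq_true_eq]
    constructor
    · intro hJ'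
      by_cases hn : J'.2 < n
      · exact Or.inl ⟨hJ', hn⟩
      · right
        obtain ⟨⟨k3, k4, k5⟩, k6, k7, k8⟩ := T.mem_children'.1 hJ'
        have hne : ¬ b < J'.1 := by
          intro hlt2
          refine k8 _ (hb (by omega)) ?_ h7
          simp only [inside_iff]
          omega
        have hne' : ¬ J'.1 < b := by
          intro hlt2
          have hJe : J' ∈ T.1 := k6.resolve_right (by omega)
          have := hmin J' hJe (by omega) (by simp only [inside_iff] at k7; omega)
          omega
        exact Prod.ext (by simp only; omega) (by simp only; omega)
    · rintro (h | rfl)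
      · exact h.1
      · exact hJ

/-- The effect of the rotation on vertices. -/
def rotNode (I : ℕ × ℕ) : ℕ × ℕ :=
  -- A vertex off the path from the root to the last leaf keeps its outgoing edge. On the path, the
  -- incoming edge `(b, n)` towards the last leaf becomes the outgoing one, with image `(1, b)`.
  if I.2 < n then (I.1 + 1, I.2 + 1) else (1, ((T.children I).getLastD I).1)

lemma rotNode_of_lt {I : ℕ × ℕ} (h : I.2 < n) : T.rotNode I = (I.1 + 1, I.2 + 1) := if_pos h

lemma rotNode_of_last {I : ℕ × ℕ} (hIn : I.2 = n) {b : ℕ} {l : List (ℕ × ℕ)}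
    (h : T.children I = l ++ [(b, n)]) : T.rotNode I = (1, b) := by
  rw [rotNode, if_neg (by omega), h]
  simp

/-- Off the path to the last leaf no edge changes direction; everything above such a vertex is
shifted by one. -/
lemma children_rotTree_of_lt {I : ℕ × ℕ} (hI : I ∈ T.nodes) (hIn : I.2 < n) :
    T.rotTree.children (I.1 + 1, I.2 + 1) =
      (T.children I).map fun J => (J.1 + 1, J.2 + 1) := by
  have hI' := T.mem_node hI
  refine LexLt.list_ext (T.rotTree.pairwise_children _) ?_ fun J => ?_
  · rw [List.pairwise_map]
    refine (T.pairwise_children I).imp fun {a b} h => ?_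
    simp only [LexLt] at h ⊢
    omega
  simp only [List.mem_map]
  constructor
  · intro hJ
    obtain ⟨h3, h4, h5, h6⟩ := T.rotTree.mem_children'.1 hJ
    obtain ⟨x, hx1, hx2, hx3⟩ : ∃ x : ℕ × ℕ, (x.1 + 1, x.2 + 1) = J ∧ (x ∈ T.1 ∨ x.1 = x.2) ∧
        1 ≤ x.1 := by
      simp only [inside_iff] at h5
      rcases h4 with h4 | h4
      · obtain ⟨x, hx, rfl⟩ := T.mem_rotTree.1 h4
        have hb := T.edge_bounds hx
        by_cases hxn : x.2 < n
        · exact ⟨x, by simp [rotEdge, hxn], Or.inl hx, by omega⟩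
        · exfalso
          simp only [rotEdge, if_neg hxn] at h5
          omega
      · exact ⟨(J.1 - 1, J.2 - 1), Prod.ext (by simp only; omega) (by simp only; omega),
          Or.inr (by simp only; omega), by simp only; omega⟩
    subst hx1
    refine ⟨x, T.mem_children'.2 ⟨by simp only at h3; omega, hx2, ?_, ?_⟩, rfl⟩
    · simp only [inside_iff] at h5 ⊢
      omega
    · intro y hy k1 k2
      refine h6 (rotEdge n y) (T.mem_rotTree.2 ⟨y, hy, rfl⟩) ?_ ?_ <;>
      · simp only [inside_iff, rotEdge] at k1 k2 ⊢
        rw [if_pos (by omega)]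
        simp only
        omega
  · rintro ⟨x, hx, rfl⟩
    obtain ⟨h3, h4, h5, h6⟩ := T.mem_children'.1 hx
    have h5' := h5
    simp only [inside_iff] at h5'
    refine T.rotTree.mem_children'.2 ⟨by simp only; omega, ?_, ?_, ?_⟩
    · refine h4.imp (fun h4 => T.mem_rotTree.2 ⟨x, h4, ?_⟩) fun h => by simp [h]
      simp only [rotEdge]
      rw [if_pos (by omega)]
    · simp only [inside_iff]
      omega
    · intro y hy k1 k2
      obtain ⟨z, hz, rfl⟩ := T.mem_rotTree.1 hy
      have hb := T.edge_bounds hz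
      simp only [rotEdge] at k1 k2
      split_ifs at k1 k2 with hzn
      · refine h6 z hz ?_ ?_ <;> simp only [inside_iff] at k1 k2 ⊢ <;> omega
      · simp only [inside_iff] at k2
        omega

/-- On the path the old outgoing edge becomes the first incoming edge `(1, I.1)`, and the last
incoming edge becomes the outgoing one. At the old root, `(1, 1)` is the new first leaf. -/
lemma children_rotTree_of_last {I : ℕ × ℕ} (hI : I ∈ T.nodes) (hIn : I.2 = n) {b : ℕ}
    (hlt : I.1 < b) (hbn : b ≤ n) (hb : b < n → (b, n) ∈ T.1)
    (hmin : ∀ f ∈ T.1, f.2 = n → I.1 < f.1 → b ≤ f.1)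
    (hsib : ∀ J ∈ T.children I, J.2 < n → J.2 < b) :
    T.rotTree.children (1, b) =
      (1, I.1) :: ((T.children I).filter (fun J => J.2 < n)).map fun J => (J.1 + 1, J.2 + 1) := by
  have hI' := T.mem_node hI
  have hIe : 1 < I.1 → I ∈ T.1 := fun h =>
    (T.mem_nodes.1 hI).resolve_left fun e => by rw [e] at h; simp at h
  have hrotI : rotEdge n I = (1, I.1) := by simp [rotEdge, hIn]
  have hIroot : 1 < I.1 → (1, I.1) ∈ T.rotTree.1 := fun h => T.mem_rotTree.2 ⟨I, hIe h, hrotI⟩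
  refine LexLt.list_ext (T.rotTree.pairwise_children _) ?_ fun J => ?_
  · rw [List.pairwise_cons, List.pairwise_map]
    constructor
    · intro J hJ
      obtain ⟨x, hx, rfl⟩ := List.mem_map.1 hJ
      have := (T.mem_children'.1 (List.mem_filter.1 hx).1).1
      exact Or.inl (by simp only; omega)
    · refine ((T.pairwise_children I).filter _).imp fun {a b} h => ?_
      simp only [LexLt] at h ⊢
      omega
  simp only [List.mem_cons, List.mem_map, List.mem_filter, decide_eq_true_eq]
  constructor
  · intro hJ
    obtain ⟨h3, h4, h5, h6⟩ := T.rotTree.mem_children'.1 hJ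
    have h5' := h5
    simp only [inside_iff] at h5'
    by_cases hJ1 : J.1 = 1
    · left
      have hle : J.2 ≤ I.1 := by
        rcases h4 with h4 | h4
        · obtain ⟨x, hx, rfl⟩ := T.mem_rotTree.1 h4
          have hbx := T.edge_bounds hx
          simp only [rotEdge] at hJ1 h5' ⊢
          split_ifs at hJ1 h5' ⊢ with hxn
          · simp only at hJ1; omega
          · by_contra hc
            have := hmin x hx (by omega) (by simp only at hc; omega)
            simp only at h5'
            omega
        · omega
      by_contra hne
      have hlt' : J.2 < I.1 := by
        rcases Nat.lt_or_ge J.2 I.1 with h | h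
        · exact h
        · exact absurd (Prod.ext hJ1 (by simp only; omega)) hne
      refine h6 _ (hIroot (by omega)) ?_ ?_ <;> simp only [inside_iff] <;> omega
    · right
      obtain ⟨x, hx1, hx2, hx3⟩ : ∃ x : ℕ × ℕ, (x.1 + 1, x.2 + 1) = J ∧
          (x ∈ T.1 ∨ x.1 = x.2) ∧ 1 ≤ x.1 := by
        rcases h4 with h4 | h4
        · obtain ⟨x, hx, rfl⟩ := T.mem_rotTree.1 h4
          have hbx := T.edge_bounds hx
          by_cases hxn : x.2 < n
          · exact ⟨x, by simp [rotEdge, hxn], Or.inl hx, by omega⟩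
          · simp [rotEdge, hxn] at hJ1
        · exact ⟨(J.1 - 1, J.2 - 1), Prod.ext (by simp only; omega) (by simp only; omega),
            Or.inr (by simp only; omega), by simp only; omega⟩
      subst hx1
      simp only at h3 h5' hJ1
      have hxle : x.1 ≤ x.2 := by omega
      have hxI : I.1 ≤ x.1 := by
        by_contra hc
        have hx2I : x.2 < I.1 := by
          rcases hx2 with hx2 | hx2
          · have h7 := T.edge_compatible hx2 (hIe (by omega))
            simp only [Compatible] at h7
            omega
          · omega
        refine h6 _ (hIroot (by omega)) ?_ ?_ <;> simp only [inside_iff] <;> omega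
      refine ⟨x, ⟨T.mem_children'.2 ⟨by omega, hx2, by simp only [inside_iff]; omega, ?_⟩,
        by omega⟩, rfl⟩
      intro y hy k1 k2
      have hby := T.edge_bounds hy
      simp only [inside_iff] at k1 k2
      by_cases hyn : y.2 < n
      · have hyb : y.2 < b := by
          by_cases hbn' : b < n
          · have h7 := T.edge_compatible hy (hb hbn')
            simp only [Compatible] at h7
            omega
          · omega
        refine h6 (rotEdge n y) (T.mem_rotTree.2 ⟨y, hy, rfl⟩) ?_ ?_ <;>
        · simp only [inside_iff, rotEdge]
          rw [if_pos (by omega)]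
          simp only
          omega
      · have := hmin y hy (by omega) (by omega)
        omega
  · rintro (rfl | ⟨x, ⟨hx, hxn⟩, rfl⟩)
    · refine T.rotTree.mem_children'.2 ⟨by simp only; omega, ?_, by simp only [inside_iff]; omega,
        ?_⟩
      · by_cases h1 : 1 < I.1
        · exact Or.inl (hIroot h1)
        · right
          simp only
          omega
      · intro y hy k1 k2
        obtain ⟨z, hz, rfl⟩ := T.mem_rotTree.1 hy
        have hbz := T.edge_bounds hz
        simp only [rotEdge] at k1 k2
        split_ifs at k1 k2 with hzn
        · simp only [inside_iff] at k1; omega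
        · simp only [inside_iff] at k1 k2
          have := hmin z hz (by omega) (by omega)
          omega
    · obtain ⟨h3, h4, h5, h6⟩ := T.mem_children'.1 hx
      have hxb := hsib x hx hxn
      have h5' := h5
      simp only [inside_iff] at h5'
      refine T.rotTree.mem_children'.2 ⟨by simp only; omega, ?_, by simp only [inside_iff]; omega,
        ?_⟩
      · refine h4.imp (fun h4 => T.mem_rotTree.2 ⟨x, h4, ?_⟩) fun h => by simp [h]
        simp [rotEdge, hxn]
      · intro y hy k1 k2
        obtain ⟨z, hz, rfl⟩ := T.mem_rotTree.1 hy
        have hbz := T.edge_bounds hz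
        simp only [rotEdge] at k1 k2
        split_ifs at k1 k2 with hzn
        · simp only [inside_iff] at k1 k2
          by_cases hI1 : 1 < I.1
          · have h7 := T.edge_compatible hz (hIe hI1)
            simp only [Compatible] at h7
            refine h6 z hz ?_ ?_ <;> simp only [inside_iff] <;> omega
          · refine h6 z hz ?_ ?_ <;> simp only [inside_iff] <;> omega
        · simp only [inside_iff] at k1 k2
          have := hmin z hz (by omega) (by omega)
          omega

end PTree

end Rotation

/-! ### The orientation sign of a rotation -/

section RotationSign

/-- The permutation exchanges `x` with `v` and `t` with `f`, hence is even. This is what happens at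
an internal edge on the path to the last leaf: its halves change roles, and so do the names of two
vertices. -/
lemma kos_exchange_ends {α : Type*} [DecidableEq α] {x t f v : α} {S : List α}
    (h : ([v, f, t] ++ (S ++ [x])).Nodup) :
    ([x, t, f] ++ (S ++ [v])).Perm ([v, f, t] ++ (S ++ [x])) ∧
      kos (fun _ => 1) ([x, t, f] ++ (S ++ [v])) ([v, f, t] ++ (S ++ [x])) = 0 := by
  have p3 : ([v] ++ ([t] ++ ([f] ++ (S ++ [x])))).Perm ([v] ++ ([f] ++ ([t] ++ (S ++ [x])))) :=
    (List.Perm.swap _ _ _).cons _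
  have p2 : ([] ++ ((t :: f :: S) ++ ([v] ++ [x]))).Perm ([] ++ ([v] ++ ((t :: f :: S) ++ [x]))) := by
    simpa using (List.perm_append_comm (l₁ := t :: f :: S) (l₂ := [v])).append_right [x]
  have p1 : ([x] ++ (t :: f :: S ++ [v])).Perm ((t :: f :: S ++ [v]) ++ [x]) :=
    List.perm_append_comm
  have e12 : (t :: f :: S ++ [v]) ++ [x] = [] ++ ((t :: f :: S) ++ ([v] ++ [x])) := by simp
  have e23 : [] ++ ([v] ++ ((t :: f :: S) ++ [x])) = [v] ++ ([t] ++ ([f] ++ (S ++ [x]))) := by simp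
  have n3 : ([v] ++ ([f] ++ ([t] ++ (S ++ [x])))).Nodup := h
  have n2 := p3.nodup_iff.2 n3
  rw [← e23] at n2
  have n1 := p2.nodup_iff.2 n2
  have n1' := n1
  rw [← e12] at n1'
  have n0 := p1.nodup_iff.2 n1'
  have k1 := kos_swap (fun _ => (1 : ZMod 2)) n0
  have k2 := kos_move (fun _ => (1 : ZMod 2)) n1
  have k3 := kos_move (fun _ => (1 : ZMod 2)) (p3.nodup_iff.2 n3)
  rw [e12] at k1 p1
  rw [e23] at k2 p2
  refine ⟨p1.trans (p2.trans p3), ?_⟩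
  change kos _ ([x] ++ (t :: f :: S ++ [v])) ([v] ++ ([f] ++ ([t] ++ (S ++ [x])))) = 0
  rw [kos_trans _ n3 p1 (p2.trans p3), kos_trans _ n3 p2 p3, k1, k2, k3]
  simp only [sum_map_one, List.length_append, List.length_cons, List.length_nil, zero_add,
    Nat.cast_add, Nat.cast_one]
  have h2 : (2 : ZMod 2) = 0 := rfl
  linear_combination (3 + (S.length : ZMod 2)) * h2

/-- The effect of an isomorphism of trees on labels. -/
def mapLab (edge : ℕ × ℕ → ℕ × ℕ) (flip : ℕ × ℕ → Bool) (x : Lab) : Lab :=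
  (edge x.1, xor (flip x.1) x.2)

/-- A cyclic isomorphism of trees; it need not preserve the root. -/
structure IsTreeIso {n n' : ℕ} (T : PTree n) (T' : PTree n') (vert edge : ℕ × ℕ → ℕ × ℕ)
    (flip : ℕ × ℕ → Bool) (ε : ZMod 2) : Prop where
  arity : n' = n
  card : T'.1.card = T.1.card
  vert_mem : ∀ I ∈ T.nodes, vert I ∈ T'.nodes
  vert_injOn : ∀ I ∈ T.nodes, ∀ J ∈ T.nodes, vert I = vert J → I = J
  edge_mem : ∀ e ∈ T.1, edge e ∈ T'.1
  edge_injOn : ∀ e ∈ T.1, ∀ f ∈ T.1, edge e = edge f → e = f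
  cyc : ∀ I ∈ T.nodes,
    (((I, false) :: (T.children I).map fun J => (J, true)).map (mapLab edge flip)).IsRotated
      ((vert I, false) :: (T'.children (vert I)).map fun J => (J, true))
  ori_perm : ((treeOri n T.edgeList).map (Sum.map vert (mapLab edge flip))).Perm
    (treeOri n' T'.edgeList)
  kos_ori : kos (fun _ => 1) ((treeOri n T.edgeList).map (Sum.map vert (mapLab edge flip)))
    (treeOri n' T'.edgeList) = ε

namespace PTree

variable {n : ℕ} (T : PTree n)

lemma nodup_treeOri_edgeList : (treeOri n T.edgeList).Nodup :=
  nodup_treeOri T.nodup_edgeList fun e he => by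
    have := T.mem_edge (T.mem_edgeList.1 he)
    exact ⟨this.2.1, this.2.2.2⟩

lemma isTreeIso_id : IsTreeIso T T id id (fun _ => false) 0 := by
  have hm : mapLab id (fun _ => false) = id := by
    funext x
    simp [mapLab]
  refine ⟨rfl, rfl, fun _ h => h, fun _ _ _ _ h => h, fun _ h => h, fun _ _ _ _ h => h, ?_, ?_, ?_⟩
  · intro I _
    rw [hm, List.map_id]
    exact List.IsRotated.refl _
  · rw [hm, Sum.map_id_id, List.map_id]
  · rw [hm, Sum.map_id_id, List.map_id]
    exact kos_self _ T.nodup_treeOri_edgeList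

/-- The image under the rotation of the first edge above which the last leaf lies. -/
def _root_.RibbonTensor.chainHead (n : ℕ) : List (ℕ × ℕ) → ℕ × ℕ
  | [] => (1, n)
  | e :: es => if e.2 < n then chainHead n es else rotEdge n e

/-- The edges above which the last leaf lies are of the form `(b, n)`; in increasing order the one
with least `b` comes first. -/
lemma _root_.RibbonTensor.chainHead_eq {n b : ℕ} : ∀ {es : List (ℕ × ℕ)}, es.Pairwise LexLt →
    (∀ f ∈ es, f.1 < f.2 ∧ f.2 ≤ n) → b ≤ n → (∀ f ∈ es, f.2 = n → b ≤ f.1) →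
    (b < n → (b, n) ∈ es) → chainHead n es = (1, b)
  | [], _, _, hbn, _, hb => by
    have : ¬ b < n := fun h => by simpa using hb h
    simp only [chainHead, Prod.mk.injEq, true_and]
    omega
  | f :: es, hs, hf, hbn, hmin, hb => by
    rw [List.pairwise_cons] at hs
    have hf0 := hf f List.mem_cons_self
    rw [chainHead]
    split_ifs with hfn
    · refine chainHead_eq hs.2 (fun g hg => hf g (List.mem_cons_of_mem _ hg)) hbn
        (fun g hg => hmin g (List.mem_cons_of_mem _ hg)) fun h => ?_
      rcases List.mem_cons.1 (hb h) with h1 | h1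
      · rw [← h1] at hfn
        simp at hfn
      · exact h1
    · rw [rotEdge, if_neg hfn]
      have h1 := hmin f List.mem_cons_self (by omega)
      rcases List.mem_cons.1 (hb (by omega)) with h2 | h2
      · rw [← h2]
      · have := hs.1 _ h2
        simp only [LexLt] at this
        simp only [Prod.mk.injEq, true_and]
        omega

/-- A vertex on the path is named after the next edge of the path above it, which is the first such
edge among those starting to the right of `I.1`. -/
lemma rotNode_eq_chainHead {I : ℕ × ℕ} (hI : I ∈ T.nodes) (hIn : I.2 = n)
    {es : List (ℕ × ℕ)} (hs : es.Pairwise LexLt) (hes : ∀ f ∈ es, f ∈ T.1)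
    (h1 : ∀ f ∈ T.1, f.2 = n → (f ∈ es ↔ I.1 < f.1)) : T.rotNode I = chainHead n es := by
  obtain ⟨b, hlt, hbn, hb, hmin, -, hc⟩ := T.exists_last_child hI hIn
  rw [T.rotNode_of_last hIn hc, chainHead_eq hs (fun f hf => ?_) hbn (fun f hf hfn => ?_)
    fun h => ?_]
  · have := T.edge_bounds (hes f hf)
    omega
  · exact hmin f (hes f hf) hfn ((h1 f (hes f hf) hfn).1 hf)
  · exact (h1 _ (hb h) rfl).2 hlt

/-- The half-edges which change direction under the rotation. -/
def _root_.RibbonTensor.rotFlip (n : ℕ) (e : ℕ × ℕ) : Bool := !decide (e.2 < n)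

/-- The effect of the rotation on labels. -/
abbrev _root_.RibbonTensor.rotLab (n : ℕ) : Lab → Lab := mapLab (rotEdge n) (rotFlip n)

lemma nodup_treeOri_rot : (treeOri n (T.edgeList.map (rotEdge n))).Nodup := by
  refine nodup_treeOri (T.nodup_edgeList.map_on fun x hx y hy h => ?_) fun e he => ?_
  · have h1 := T.edge_bounds (T.mem_edgeList.1 hx)
    have h2 := T.edge_bounds (T.mem_edgeList.1 hy)
    exact rotEdge_injOn (by omega) (by omega) h
  · obtain ⟨x, hx, rfl⟩ := List.mem_map.1 he
    have := T.rotTree.mem_edge (T.mem_rotTree.2 ⟨x, T.mem_edgeList.1 hx, rfl⟩)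
    exact ⟨this.2.1, this.2.2.2⟩

/-- Induction along the edge list from its end. The letter after the edges carries the vertex name
left over so far. An edge off the path matches letter by letter, an edge on the path is handled by
`kos_exchange_ends`; hence the total sign is trivial. -/
lemma kos_rot_suffix : ∀ es : List (ℕ × ℕ), es <:+ T.edgeList →
    ((es.flatMap fun e => [Sum.inl (T.rotNode e), Sum.inr (rotLab n (e, false)),
        Sum.inr (rotLab n (e, true))]) ++ [Sum.inl (chainHead n es)]).Perm
      (((es.map (rotEdge n)).flatMap fun e => [Sum.inl e, Sum.inr (e, false), Sum.inr (e, true)]) ++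
        [Sum.inl (1, n)]) ∧
    kos (fun _ => 1)
      ((es.flatMap fun e => [Sum.inl (T.rotNode e), Sum.inr (rotLab n (e, false)),
        Sum.inr (rotLab n (e, true))]) ++ [Sum.inl (chainHead n es)])
      (((es.map (rotEdge n)).flatMap fun e => [Sum.inl e, Sum.inr (e, false), Sum.inr (e, true)]) ++
        [Sum.inl (1, n)]) = 0
  | [], _ => ⟨List.Perm.refl _, kos_self _ (by simp)⟩
  | e :: es, hsuf => by
    obtain ⟨ihp, ihk⟩ := kos_rot_suffix es ((List.suffix_cons e es).trans hsuf)
    have he : e ∈ T.1 := T.mem_edgeList.1 (hsuf.subset List.mem_cons_self)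
    have hnd : (((e :: es).map (rotEdge n)).flatMap
        (fun e => [Sum.inl e, Sum.inr (e, false), Sum.inr (e, true)]) ++
        [(Sum.inl (1, n) : (ℕ × ℕ) ⊕ Lab)]).Nodup := by
      obtain ⟨pre, hpre⟩ := hsuf
      have h := T.nodup_treeOri_rot
      rw [← hpre, List.map_append, treeOri, List.flatMap_append, List.append_assoc] at h
      refine h.of_append_right.sublist (List.Sublist.append_left ?_ _)
      simp
    rw [List.map_cons, List.flatMap_cons, List.append_assoc] at hnd ⊢
    rw [List.flatMap_cons, List.append_assoc]
    by_cases hen : e.2 < n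
    · have e1 : chainHead n (e :: es) = chainHead n es := by rw [chainHead, if_pos hen]
      have e2 : T.rotNode e = rotEdge n e := by
        rw [T.rotNode_of_lt hen, rotEdge, if_pos hen]
      have e3 : ∀ β, rotLab n (e, β) = (rotEdge n e, β) := fun β => by
        simp [mapLab, rotFlip, hen]
      rw [e1, e2, e3, e3]
      exact ⟨ihp.append_left _, by rw [kos_append_left _ hnd ihp, ihk]⟩
    · have hen' : e.2 = n := by have := T.edge_bounds he; omega
      have e1 : chainHead n (e :: es) = rotEdge n e := by rw [chainHead, if_neg hen]
      have e3 : ∀ β, rotLab n (e, β) = (rotEdge n e, !β) := fun β => by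
        simp [mapLab, rotFlip, hen]
      have e2 : T.rotNode e = chainHead n es := by
        have hs := T.pairwise_edgeList
        obtain ⟨pre, hpre⟩ := hsuf
        have hmem : ∀ f, f ∈ T.1 ↔ f ∈ pre ∨ f = e ∨ f ∈ es := fun f => by
          rw [← T.mem_edgeList, ← hpre]
          simp
        rw [← hpre, List.pairwise_append, List.pairwise_cons] at hs
        refine T.rotNode_eq_chainHead (T.mem_nodes.2 (Or.inr he)) hen' hs.2.1.2
          (fun f hf => (hmem f).2 (Or.inr (Or.inr hf))) fun f hf hfn => ⟨fun h => ?_, fun h => ?_⟩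
        · have := hs.2.1.1 f h
          simp only [LexLt] at this
          omega
        · rcases (hmem f).1 hf with h1 | h1 | h1
          · have := hs.2.2 f h1 e List.mem_cons_self
            simp only [LexLt] at this
            omega
          · rw [h1] at h
            omega
          · exact h1
      rw [e1, e2, e3, e3]
      have hq := ihp.append_left [Sum.inl (rotEdge n e), Sum.inr (rotEdge n e, false),
        Sum.inr (rotEdge n e, true)]
      obtain ⟨p, k⟩ := kos_exchange_ends (hq.nodup_iff.2 hnd)
      exact ⟨p.trans hq, by
        simp only [Bool.not_false, Bool.not_true]
        rw [kos_trans _ hnd p hq, k, kos_append_left _ hnd ihp, ihk, zero_add]⟩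

lemma map_rotLab_leafHalves (h2 : 2 ≤ n) : (leafHalves 1 n).map (rotLab n) =
    leafHalves 2 (n - 1) ++ [((1, n), false)] := by
  have e : leafHalves 1 n = leafHalves 1 (n - 1) ++ leafHalves n 1 := by
    have := leafHalves_append 1 (n - 1) 1
    rw [show 1 + (n - 1) = n by omega, show n - 1 + 1 = n by omega] at this
    exact this.symm
  rw [e, List.map_append]
  congr 1
  · refine List.ext_getElem (by simp [leafHalves]) fun k h1 h2 => ?_
    simp only [length_leafHalves] at h2
    simp only [leafHalves, List.getElem_map, List.getElem_range', mapLab, rotEdge, rotFlip,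
      Prod.mk.injEq]
    rw [if_pos (by omega), decide_eq_true (by omega)]
    simp only [Prod.mk.injEq, Bool.not_true, Bool.false_bne, and_true]
    omega
  · simp [leafHalves, mapLab, rotEdge, rotFlip]

/-- The edge part is even, the half-edge of the root passes the `n` leaves, and sorting the edges of
the rotated tree moves blocks of three odd letters, which has the sign of the permutation of the
edges. -/
lemma kos_rot : ((treeOri n T.edgeList).map (Sum.map T.rotNode (rotLab n))).Perm
      (treeOri n T.rotTree.edgeList) ∧
    kos (fun _ => 1) ((treeOri n T.edgeList).map (Sum.map T.rotNode (rotLab n)))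
      (treeOri n T.rotTree.edgeList) =
        n + kos (fun _ => 1) (T.edgeList.map (rotEdge n)) T.rotTree.edgeList := by
  have h2 := T.two_le
  obtain ⟨ihp, ihk⟩ := T.kos_rot_suffix T.edgeList List.suffix_rfl
  have hroot : T.rotNode (1, n) = chainHead n T.edgeList := by
    refine T.rotNode_eq_chainHead (T.mem_nodes.2 (Or.inl rfl)) rfl T.pairwise_edgeList
      (fun f hf => T.mem_edgeList.1 hf) fun f hf hfn => ⟨fun h => ?_, fun h => T.mem_edgeList.2 hf⟩
    have := T.edge_bounds hf
    simp only
    omega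
  have e1 : (treeOri n T.edgeList).map (Sum.map T.rotNode (rotLab n)) =
      ((T.edgeList.flatMap fun e => [Sum.inl (T.rotNode e), Sum.inr (rotLab n (e, false)),
        Sum.inr (rotLab n (e, true))]) ++ [Sum.inl (chainHead n T.edgeList)]) ++
      ((leafHalves 1 n).map Sum.inr ++ [Sum.inr ((1, n), false)]) := by
    have e0 : leafHalves 1 n = ((1, 1), true) :: leafHalves 2 (n - 1) := by
      have := leafHalves_append 1 1 (n - 1)
      rw [show 1 + (n - 1) = n by omega] at this
      exact this.symm
    have e4 : rotLab n ((1, n), false) = ((1, 1), true) := by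
      simp [mapLab, rotEdge, rotFlip]
    have e5 : ((leafHalves 1 n).map (Sum.inr : Lab → (ℕ × ℕ) ⊕ Lab)).map
        (Sum.map T.rotNode (rotLab n)) =
        (leafHalves 2 (n - 1)).map Sum.inr ++ [Sum.inr ((1, n), false)] := by
      rw [List.map_map, show Sum.map T.rotNode (rotLab n) ∘ Sum.inr = Sum.inr ∘ rotLab n from rfl,
        ← List.map_map, map_rotLab_leafHalves h2]
      simp
    rw [treeOri, List.map_append, List.map_cons, List.map_cons, e5, Sum.map_inl, Sum.map_inr, hroot,
      e4, List.map_flatMap, e0]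
    simp
  have e2 : treeOri n (T.edgeList.map (rotEdge n)) =
      (((T.edgeList.map (rotEdge n)).flatMap fun e =>
        [Sum.inl e, Sum.inr (e, false), Sum.inr (e, true)]) ++ [Sum.inl (1, n)]) ++
        ([Sum.inr ((1, n), false)] ++ (leafHalves 1 n).map Sum.inr) := by
    simp [treeOri]
  have hnd := T.nodup_treeOri_rot
  have p1 : ((treeOri n T.edgeList).map (Sum.map T.rotNode (rotLab n))).Perm
      (treeOri n (T.edgeList.map (rotEdge n))) := by
    rw [e1, e2]
    exact ihp.append List.perm_append_comm
  have k1 : kos (fun _ => 1) ((treeOri n T.edgeList).map (Sum.map T.rotNode (rotLab n)))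
      (treeOri n (T.edgeList.map (rotEdge n))) = n := by
    rw [e2] at hnd
    rw [e1, e2, kos_append _ hnd ihp List.perm_append_comm, ihk,
      kos_swap _ (List.perm_append_comm.nodup_iff.2 hnd.of_append_right)]
    simp [Function.comp_def, length_leafHalves]
  have hL : (T.edgeList.map (rotEdge n)).Perm T.rotTree.edgeList := by
    refine (List.perm_ext_iff_of_nodup ?_ T.rotTree.nodup_edgeList).2 fun e => ?_
    · refine T.nodup_edgeList.map_on fun x hx y hy h => ?_
      have h1 := T.edge_bounds (T.mem_edgeList.1 hx)
      have h2 := T.edge_bounds (T.mem_edgeList.1 hy)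
      exact rotEdge_injOn (by omega) (by omega) h
    · simp [mem_edgeList, mem_rotTree]
  have p2 : (treeOri n (T.edgeList.map (rotEdge n))).Perm (treeOri n T.rotTree.edgeList) :=
    (hL.flatMap_right _).append_right _
  have hN := T.rotTree.nodup_treeOri_edgeList
  refine ⟨p1.trans p2, ?_⟩
  rw [kos_trans _ hN p1 p2, k1]
  congr 1
  rw [treeOri, treeOri, kos_append_right _ hN (hL.flatMap_right _),
    kos_flatMap_left _ hL _ (hL.nodup_iff.2 T.rotTree.nodup_edgeList) hnd.of_append_left]
  refine kos_congr _ fun e _ => ?_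
  simp only [sum_map_one, List.length_cons, List.length_nil]
  rfl

/-- The sign found here is the coefficient with which `r` acts on the basis vector of `T`, see
`rot_tree`. -/
lemma isTreeIso_rot : IsTreeIso T T.rotTree T.rotNode (rotEdge n) (rotFlip n)
    (n + kos (fun _ => 1) (T.edgeList.map (rotEdge n)) T.rotTree.edgeList) := by
  refine ⟨rfl, T.card_rotTree, ?_, ?_, fun e he => T.mem_rotTree.2 ⟨e, he, rfl⟩, ?_, ?_,
    T.kos_rot.1, T.kos_rot.2⟩
  · intro I hI
    by_cases hIn : I.2 < n
    · rw [T.rotNode_of_lt hIn]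
      have hIe : I ∈ T.1 := (T.mem_nodes.1 hI).resolve_left fun e => by rw [e] at hIn; simp at hIn
      refine T.rotTree.mem_nodes.2 (Or.inr (T.mem_rotTree.2 ⟨I, hIe, ?_⟩))
      rw [rotEdge, if_pos hIn]
    · obtain ⟨b, hlt, hbn, hb, -, -, hc⟩ := T.exists_last_child hI
        (by have := T.mem_node hI; omega)
      rw [T.rotNode_of_last (by have := T.mem_node hI; omega) hc, mem_nodes]
      rcases Nat.lt_or_ge b n with h | h
      · exact Or.inr (T.mem_rotTree.2 ⟨_, hb h, by simp [rotEdge]⟩)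
      · left
        rw [Prod.mk.injEq]
        exact ⟨rfl, by omega⟩
  · intro I hI J hJ h
    have hI' := T.mem_node hI
    have hJ' := T.mem_node hJ
    by_cases hIn : I.2 < n <;> by_cases hJn : J.2 < n
    · rw [T.rotNode_of_lt hIn, T.rotNode_of_lt hJn, Prod.mk.injEq] at h
      exact Prod.ext (by omega) (by omega)
    · obtain ⟨b, -, -, -, -, -, hc⟩ := T.exists_last_child hJ (by omega)
      rw [T.rotNode_of_lt hIn, T.rotNode_of_last (by omega) hc, Prod.mk.injEq] at h
      omega
    · obtain ⟨b, -, -, -, -, -, hc⟩ := T.exists_last_child hI (by omega)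
      rw [T.rotNode_of_lt hJn, T.rotNode_of_last (by omega) hc, Prod.mk.injEq] at h
      omega
    · obtain ⟨b, -, -, -, -, -, hc⟩ := T.exists_last_child hI (by omega)
      obtain ⟨b', -, -, -, -, -, hc'⟩ := T.exists_last_child hJ (by omega)
      rw [T.rotNode_of_last (by omega) hc, T.rotNode_of_last (by omega) hc', Prod.mk.injEq] at h
      obtain rfl := h.2
      exact T.parent_unique (J := (b, n)) hI hJ (by rw [hc]; simp) (by rw [hc']; simp)
  · intro e he f hf h
    have h1 := T.edge_bounds he
    have h2 := T.edge_bounds hf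
    exact rotEdge_injOn (by omega) (by omega) h
  · intro I hI
    have hmap : ∀ l : List (ℕ × ℕ), (∀ J ∈ l, J.2 < n) →
        (l.map fun J => (J, true)).map (rotLab n) =
          (l.map fun J => (J.1 + 1, J.2 + 1)).map fun J => (J, true) := by
      intro l hl
      rw [List.map_map, List.map_map]
      refine List.map_congr_left fun J hJ => ?_
      simp [mapLab, rotEdge, rotFlip, hl J hJ]
    by_cases hIn : I.2 < n
    · rw [T.rotNode_of_lt hIn, T.children_rotTree_of_lt hI hIn, List.map_cons, hmap]
      · simp only [mapLab, rotEdge, rotFlip, hIn, decide_true, Bool.not_true, Bool.false_bne, if_true]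
        exact List.IsRotated.refl _
      · intro J hJ
        have := (T.mem_children'.1 hJ).2.2.1
        simp only [inside_iff] at this
        omega
    · have hIn' : I.2 = n := by have := T.mem_node hI; omega
      obtain ⟨b, hlt, hbn, hb, hmin, hsib, hc⟩ := T.exists_last_child hI hIn'
      rw [T.rotNode_of_last hIn' hc, T.children_rotTree_of_last hI hIn' hlt hbn hb hmin hsib]
      nth_rewrite 1 [hc]
      rw [List.map_cons, List.map_append, List.map_append, hmap _ fun J hJ => by
        simpa using (List.mem_filter.1 hJ).2]
      have e1 : mapLab (rotEdge n) (rotFlip n) (I, false) = ((1, I.1), true) := by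
        simp [mapLab, rotEdge, rotFlip, hIn]
      have e2 : mapLab (rotEdge n) (rotFlip n) ((b, n), true) = ((1, b), false) := by
        simp [mapLab, rotEdge, rotFlip]
      rw [List.map_cons, List.map_nil, List.map_cons, List.map_nil, e1, e2, List.map_cons]
      -- The two words differ by moving the last half-edge, now the outgoing one, to the front.
      rw [← List.cons_append]
      exact List.isRotated_append

end PTree

/-- The tree `T`, rotated if `r` is true. -/
def PTree.rotBy {n : ℕ} (r : Bool) (T : PTree n) : PTree n := if r then T.rotTree else T

/-- The effect on vertices of the rotation if `r` is true. -/
def PTree.nodeBy {n : ℕ} (r : Bool) (T : PTree n) : ℕ × ℕ → ℕ × ℕ := if r then T.rotNode else id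

/-- The effect on edges of the rotation if `r` is true. -/
def edgeBy (r : Bool) (n : ℕ) : ℕ × ℕ → ℕ × ℕ := if r then rotEdge n else id

/-- The half-edges whose direction changes under the rotation if `r` is true. -/
def flipBy (r : Bool) (n : ℕ) : ℕ × ℕ → Bool := if r then rotFlip n else fun _ => false

/-- The sign of the rotation if `r` is true. -/
def PTree.rotSign {n : ℕ} (r : Bool) (T : PTree n) : ZMod 2 :=
  if r then n + kos (fun _ => 1) (T.edgeList.map (rotEdge n)) T.rotTree.edgeList else 0

lemma isTreeIso_rotBy {n n' : ℕ} (r : Bool) (T : PTree n) (T' : PTree n') (hn : n' = n)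
    (h : T'.1 = (T.rotBy r).1) :
    IsTreeIso T T' (T.nodeBy r) (edgeBy r n) (flipBy r n) (T.rotSign r) := by
  subst hn
  obtain rfl : T' = T.rotBy r := Subtype.ext h
  cases r
  · exact T.isTreeIso_id
  · exact T.isTreeIso_rot

/-- The sign in the definition of `r` agrees with the sign by which rotation changes the orientation
by vertices and half-edges. This agreement makes inserting trees compatible with rotating labels. -/
lemma rot_tree (K : Type*) [Field K] {n : ℕ} (T : PTree n) :
    rot K n (tree T) = sg K (T.rotSign true) • tree T.rotTree := by
  rw [rot, tree, Finsupp.linearCombination_single, one_smul,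
    oriented_eq_smul_tree T.rotTree (L := T.edgeList.map (rotEdge n)), smul_smul,
    neg_one_pow_eq_sg, ← sg_add]
  · rfl
  · refine T.nodup_edgeList.map_on fun x hx y hy h => ?_
    have h1 := T.edge_bounds (T.mem_edgeList.1 hx)
    have h2 := T.edge_bounds (T.mem_edgeList.1 hy)
    exact PTree.rotEdge_injOn (by omega) (by omega) h
  · intro e
    simp [PTree.mem_edgeList, PTree.mem_rotTree]

end RotationSign

section TreeIsoLemmas

variable {n n' : ℕ} {T : PTree n} {T' : PTree n'} {vert edge : ℕ × ℕ → ℕ × ℕ}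
  {flip : ℕ × ℕ → Bool} {ε : ZMod 2} (h : IsTreeIso T T' vert edge flip ε)

include h

lemma IsTreeIso.exists_edge {e' : ℕ × ℕ} (he : e' ∈ T'.1) : ∃ e ∈ T.1, edge e = e' := by
  have h1 : T.1.image edge = T'.1 := by
    refine Finset.eq_of_subset_of_card_le ?_ ?_
    · intro x hx
      obtain ⟨e, he, rfl⟩ := Finset.mem_image.1 hx
      exact h.edge_mem e he
    · rw [h.card, Finset.card_image_of_injOn fun x hx y hy => h.edge_injOn x hx y hy]
  rw [← h1] at he
  exact Finset.mem_image.1 he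

lemma IsTreeIso.exists_vert {I' : ℕ × ℕ} (hI : I' ∈ T'.nodes) : ∃ I ∈ T.nodes, vert I = I' := by
  have hc : ∀ {m : ℕ} (S : PTree m), S.nodes.card = S.1.card + 1 := fun S =>
    Finset.card_insert_of_notMem fun h => (S.mem_edge h).2.2.2 rfl
  have h1 : T.nodes.image vert = T'.nodes := by
    refine Finset.eq_of_subset_of_card_le ?_ ?_
    · intro x hx
      obtain ⟨e, he, rfl⟩ := Finset.mem_image.1 hx
      exact h.vert_mem e he
    · rw [hc, h.card, ← hc,
        Finset.card_image_of_injOn fun x hx y hy => h.vert_injOn x hx y hy]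
  rw [← h1] at hI
  exact Finset.mem_image.1 hI

end TreeIsoLemmas

/-! ### Expanded graphs with an orientation assembled from the trees -/

lemma graphClass_iso (K : Type*) [Field K] {G G' : OrientedRibbonGraph} (φ : G.Γ.Iso G'.Γ) :
    graphClass K G =
      sg K (kos (fun _ => 1) (G.ori.map (Sum.map φ.onV φ.onH)) G'.ori) • graphClass K G' := by
  rw [graphClass, graphClass, ← Submodule.Quotient.mk_smul, Submodule.Quotient.eq]
  refine Submodule.subset_span ⟨G, G', φ, ?_⟩
  rw [permSign_eq]

/-- The identity isomorphism. -/
def RibbonGraph.Iso.refl (Γ : RibbonGraph) : Γ.Iso Γ where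
  onV := Equiv.refl _
  onH := Equiv.refl _
  map_cyc v := by
    have : ∀ s : Cycle Γ.H, s.map (Equiv.refl Γ.H) = s := fun s => by
      induction s using Quotient.inductionOn' with
      | h l => exact congrArg (fun l : List Γ.H => (l : Cycle Γ.H)) (List.map_id l)
    exact this _
  map_opp h := rfl

lemma graphClass_reorient (K : Type*) [Field K] {Γ : RibbonGraph}
    {ori ori' : List (Γ.V ⊕ Γ.H)} (h1 : ori.Nodup) (h2 : ∀ x, x ∈ ori)
    (h1' : ori'.Nodup) (h2' : ∀ x, x ∈ ori') :
    graphClass K ⟨Γ, ori, h1, h2⟩ =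
      sg K (kos (fun _ => 1) ori ori') • graphClass K ⟨Γ, ori', h1', h2'⟩ := by
  rw [graphClass_iso K (G := ⟨Γ, ori, h1, h2⟩) (G' := ⟨Γ, ori', h1', h2'⟩)
    (RibbonGraph.Iso.refl Γ)]
  simp [RibbonGraph.Iso.refl]

namespace RibbonGraph.Labelling

variable {Γ Γ' : RibbonGraph}

lemma half_zero (c : Γ.Labelling) (v : Γ.V) : c.half v 0 = c.root v := rfl

lemma rest_eq_map_half (c : Γ.Labelling) (v : Γ.V) :
    c.rest v = (List.range' 1 (c.arity v)).map (c.half v) := by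
  refine List.ext_getElem (by simp [arity]) fun k h1 h2 => ?_
  rw [List.getElem_map, List.getElem_range', half, List.getD_eq_getElem _ _ (by simp; omega)]
  simp [Nat.add_comm]

section Expansions

variable (c : Γ.Labelling) (T : ∀ v, PTree (c.arity v))

/-- The half-edge with a given label. -/
def labHalf (v : Γ.V) (x : Lab) : c.ExpandH T :=
  if x.2 then c.inHalf T v x.1 else c.outHalf T v x.1

/-- The vertex given by a vertex of `T_v`. -/
def labVertex (v : Γ.V) (I : ℕ × ℕ) : c.ExpandV T :=
  -- The root vertex is only a default value for pairs which are not vertices of the tree.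
  if h : I ∈ (T v).nodes then ⟨v, I, h⟩ else c.rootVertex T v

lemma labVertex_of_mem {v : Γ.V} {I : ℕ × ℕ} (h : I ∈ (T v).nodes) :
    c.labVertex T v I = ⟨v, I, h⟩ := dif_pos h

lemma labHalf_of_mem {v : Γ.V} {x : Lab} (h : x.1 ∈ (T v).1) :
    c.labHalf T v x = Sum.inr (⟨v, x.1, h⟩, x.2) := by
  rcases x with ⟨e, _ | _⟩ <;> simp [labHalf, inHalf, outHalf, h]

lemma labHalf_leaf (v : Γ.V) (l : ℕ) : c.labHalf T v ((l, l), true) = Sum.inl (c.half v l) := by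
  have : (l, l) ∉ (T v).1 := fun h => lt_irrefl _ ((T v).mem_edge h).2.1
  simp [labHalf, inHalf, this]

lemma labHalf_root (v : Γ.V) :
    c.labHalf T v ((1, c.arity v), false) = Sum.inl (c.root v) := by
  simp [labHalf, outHalf, whole_not_mem]

/-- The ordering of the vertices and half-edges of `Γ(T_1, …, T_k)` by the trees. -/
def expandStd : List (c.ExpandV T ⊕ c.ExpandH T) :=
  c.verts.flatMap fun v =>
    (treeOri (c.arity v) (T v).edgeList).map (Sum.map (c.labVertex T v) (c.labHalf T v))

lemma flatMap_innerEdges : ((c.innerEdges T).flatMap fun f =>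
      [Sum.inl (c.upperVertex T f), Sum.inr (Sum.inr (f, false)), Sum.inr (Sum.inr (f, true))]) =
    c.verts.flatMap fun v => ((T v).edgeList.flatMap fun e =>
      [Sum.inl e, Sum.inr (e, false), Sum.inr (e, true)]).map
        (Sum.map (c.labVertex T v) (c.labHalf T v)) := by
  rw [innerEdges, List.flatMap_assoc]
  refine List.flatMap_congr fun v _ => ?_
  rw [List.flatMap_map, List.map_flatMap]
  conv_rhs => rw [← List.attach_map_subtype_val (T v).edgeList, List.flatMap_map]
  refine List.flatMap_congr fun e _ => ?_
  have he : e.1 ∈ (T v).1 := (T v).mem_edgeList.1 e.2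
  simp only [List.map_cons, List.map_nil, Sum.map_inl, Sum.map_inr]
  rw [c.labVertex_of_mem T (Finset.mem_insert_of_mem he), c.labHalf_of_mem T (x := (e.1, false)) he,
    c.labHalf_of_mem T (x := (e.1, true)) he]
  rfl

lemma map_standardOri : c.standardOri.map (Sum.map (c.rootVertex T) Sum.inl) =
    c.verts.flatMap fun v => (Sum.inl (1, c.arity v) :: Sum.inr ((1, c.arity v), false) ::
      (leafHalves 1 (c.arity v)).map Sum.inr).map (Sum.map (c.labVertex T v) (c.labHalf T v)) := by
  rw [standardOri, List.map_flatMap]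
  refine List.flatMap_congr fun v _ => ?_
  simp only [List.map_cons, Sum.map_inl, Sum.map_inr, c.labHalf_root]
  rw [c.labVertex_of_mem T (Finset.mem_insert_self _ _)]
  congr 2
  rw [c.rest_eq_map_half, leafHalves]
  simp only [List.map_map]
  refine List.map_congr_left fun l _ => ?_
  simp [c.labHalf_leaf]

lemma expandOri_standardOri : c.expandOri T c.standardOri =
    (c.verts.flatMap fun v => ((T v).edgeList.flatMap fun e =>
      [Sum.inl e, Sum.inr (e, false), Sum.inr (e, true)]).map
        (Sum.map (c.labVertex T v) (c.labHalf T v))) ++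
    (c.verts.flatMap fun v => (Sum.inl (1, c.arity v) :: Sum.inr ((1, c.arity v), false) ::
      (leafHalves 1 (c.arity v)).map Sum.inr).map
        (Sum.map (c.labVertex T v) (c.labHalf T v))) := by
  rw [expandOri, flatMap_innerEdges, map_standardOri]

lemma expandStd_eq : c.expandStd T = c.verts.flatMap fun v =>
    ((T v).edgeList.flatMap fun e => [Sum.inl e, Sum.inr (e, false), Sum.inr (e, true)]).map
        (Sum.map (c.labVertex T v) (c.labHalf T v)) ++
    (Sum.inl (1, c.arity v) :: Sum.inr ((1, c.arity v), false) ::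
      (leafHalves 1 (c.arity v)).map Sum.inr).map
        (Sum.map (c.labVertex T v) (c.labHalf T v)) := by
  simp only [← List.map_append]
  rfl

lemma expandStd_perm : (c.expandStd T).Perm (c.expandOri T c.standardOri) := by
  rw [expandStd_eq, expandOri_standardOri]
  exact flatMap_append_perm' _ _ _

lemma nodup_standardOri : c.standardOri.Nodup := by
  have hmem : ∀ {v : Γ.V} {h : Γ.H}, h ∈ c.root v :: c.rest v ↔ h ∈ Γ.cyc v := fun {v h} => by
    rw [← c.cyc_eq v, Cycle.mem_coe_iff]
  rw [standardOri, List.nodup_flatMap]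
  refine ⟨fun v _ => ?_, c.verts_nodup.imp fun {v w} hvw x hx hy => ?_⟩
  · rw [List.nodup_cons]
    exact ⟨by simp, (c.nodup_list v).map Sum.inr_injective⟩
  · rcases x with x | x
    · simp only [List.mem_cons, Sum.inl.injEq, List.mem_map, reduceCtorEq, and_false,
        exists_false, or_false] at hx hy
      exact hvw (hx.symm.trans hy)
    · rw [List.mem_cons, List.mem_map] at hx hy
      simp only [reduceCtorEq, Sum.inr.injEq, exists_eq_right, false_or, hmem] at hx hy
      exact hvw ((Γ.existsUnique x).unique hx hy)

lemma mem_standardOri (x : Γ.V ⊕ Γ.H) : x ∈ c.standardOri := by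
  rw [standardOri, List.mem_flatMap]
  rcases x with v | h
  · exact ⟨v, c.mem_verts v, List.mem_cons_self⟩
  · obtain ⟨v, hv, -⟩ := Γ.existsUnique h
    rw [← c.cyc_eq v, Cycle.mem_coe_iff] at hv
    exact ⟨v, c.mem_verts v, List.mem_cons_of_mem _ (List.mem_map_of_mem hv)⟩

lemma nodup_expandStd : (c.expandStd T).Nodup :=
  (c.expandStd_perm T).nodup_iff.2 (c.nodup_expandOri T c.nodup_standardOri)

lemma mem_expandStd (x : c.ExpandV T ⊕ c.ExpandH T) : x ∈ c.expandStd T :=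
  (c.expandStd_perm T).mem_iff.2 (c.mem_expandOri T c.mem_standardOri x)

/-- The graph `Γ(T_1, …, T_k)` oriented by the trees. -/
def stdExpansion : OrientedRibbonGraph where
  Γ := c.expand T
  ori := c.expandStd T
  ori_nodup := c.nodup_expandStd T
  mem_ori := c.mem_expandStd T

lemma perm_standardOri {ori : List (Γ.V ⊕ Γ.H)} (h : ori.Nodup) (h' : ∀ x, x ∈ ori) :
    ori.Perm c.standardOri :=
  (List.perm_ext_iff_of_nodup h c.nodup_standardOri).2 fun x =>
    ⟨fun _ => c.mem_standardOri x, fun _ => h' x⟩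

lemma sum_map_rootVertex_injective :
    Function.Injective (Sum.map (c.rootVertex T) (Sum.inl : Γ.H → c.ExpandH T)) := by
  refine Function.Injective.sumMap ?_ Sum.inl_injective
  intro v w h
  exact congrArg Sigma.fst h

/-- One orientation lists the edges of all trees first, the other treats one vertex of `Γ` after the
other. An edge gives three letters and the rest of the block of `v` gives `n_v + 2`, so unshuffling
costs the pair sum of `n_v t_w`. -/
lemma kos_expandOri [DecidableEq (c.ExpandV T ⊕ c.ExpandH T)] {ori : List (Γ.V ⊕ Γ.H)} (h : ori.Nodup) (h' : ∀ x, x ∈ ori) :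
    (c.expandOri T ori).Perm (c.expandStd T) ∧
    kos (fun _ => 1) (c.expandOri T ori) (c.expandStd T) =
      kos (fun _ => 1) ori c.standardOri +
        psum (fun v w => (c.arity v : ZMod 2) * ((T w).1.card : ZMod 2)) c.verts := by
  have hp := c.perm_standardOri h h'
  have p1 : (c.expandOri T ori).Perm (c.expandOri T c.standardOri) :=
    (hp.map _).append_left _
  have p2 := (c.expandStd_perm T).symm
  refine ⟨p1.trans p2, ?_⟩
  have hN := c.nodup_expandStd T
  have hO := c.nodup_expandOri T c.nodup_standardOri
  rw [kos_trans _ hN p1 p2]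
  congr 1
  · rw [expandOri, expandOri, kos_append_left _ hO (hp.map _), kos_map _ _ hp]
    exact fun x _ y _ hxy => c.sum_map_rootVertex_injective T hxy
  · rw [kos_symm _ hO p2.symm]
    rw [expandStd_eq] at hN ⊢
    rw [expandOri_standardOri, kos_distrib _ _ _ _ hN]
    refine psum_congr fun v _ w _ => ?_
    simp only [sum_map_one, List.length_map, List.length_cons, length_leafHalves,
      List.length_flatMap, List.length_nil]
    have h2 : (2 : ZMod 2) = 0 := rfl
    simp only [zero_add, List.map_const', List.sum_replicate, (T w).length_edgeList, smul_eq_mul]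
    push_cast
    linear_combination ((c.arity v : ZMod 2) * (T w).1.card + 3 * (T w).1.card) * h2

end Expansions

end RibbonGraph.Labelling

-- The signs `A_Γ` and `∑ n_i t_j` in the definition of `φ_Γ` are exactly the sign between the two
-- orientations of the expanded graph. They cancel, and the orientation of `Γ` disappears from the
-- formula.
open RibbonGraph.Labelling in
lemma phi_eq (K : Type*) [Field K] (G : OrientedRibbonGraph) (c : G.Γ.Labelling)
    (T : ∀ v, PTree (c.arity v)) :
    phi K G c T = (-1 : K) ^ G.Γ.deg • graphClass K (c.stdExpansion T) := by
  let _ : DecidableEq (c.ExpandV T ⊕ c.ExpandH T) :=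
    inferInstanceAs (DecidableEq ((c.expand T).V ⊕ (c.expand T).H))
  have hk := (c.kos_expandOri T G.ori_nodup G.mem_ori).2
  have h : graphClass K (G.expand c T) =
      sg K (kos (fun _ => 1) (c.expandOri T G.ori) (c.expandStd T)) •
        graphClass K (c.stdExpansion T) :=
    graphClass_reorient K (Γ := c.expand T) (c.nodup_expandOri T G.ori_nodup)
      (c.mem_expandOri T G.mem_ori) (c.nodup_expandStd T) (c.mem_expandStd T)
  rw [phi, h, smul_smul]
  congr 1
  rw [hk, orientationSign, permSign_eq, neg_one_zpow_eq_sg K (pairSum _ _),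
    cast_pairSum]
  simp only [Int.cast_mul, Int.cast_natCast]
  rw [mul_assoc, mul_assoc, ← sg_add, ← sg_add]
  have : ∀ a b : ZMod 2, a + (b + (a + b)) = 0 := by decide
  rw [this, sg_zero, mul_one]

/-! ### Relabellings and the isomorphisms of expanded graphs they induce -/

namespace RibbonGraph.Labelling

variable {Γ Γ' : RibbonGraph}

lemma verts_perm (c : Γ.Labelling) (c' : Γ'.Labelling) (φ : Γ.Iso Γ') : c.verts.Perm (c'.verts.map φ.onV.symm) :=
  (List.perm_ext_iff_of_nodup c.verts_nodup (c'.verts_nodup.map φ.onV.symm.injective)).2 fun v =>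
    ⟨fun _ => List.mem_map.2 ⟨φ.onV v, c'.mem_verts _, by simp⟩, fun _ => c.mem_verts v⟩

lemma flatMap_verts (c' : Γ'.Labelling) (φ : Γ.Iso Γ') {β : Type*} (f : Γ'.V → List β) :
    c'.verts.flatMap f = (c'.verts.map φ.onV.symm).flatMap fun v => f (φ.onV v) := by
  rw [List.flatMap_map]
  simp

/-- The labelling `c'` is obtained from `c` by transport along the isomorphism `φ`, a change of the
ordering of the vertices, and the rotation of the labels by one step at the vertices `v` where
`r v` is true. -/
structure IsRelabelling (c : Γ.Labelling) (c' : Γ'.Labelling) (φ : Γ.Iso Γ') (r : Γ.V → Bool) :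
    Prop where
  of_false : ∀ v, r v = false →
    c'.root (φ.onV v) = φ.onH (c.root v) ∧ c'.rest (φ.onV v) = (c.rest v).map φ.onH
  of_true : ∀ v, r v = true → ∃ l y, c.rest v = l ++ [y] ∧ c'.root (φ.onV v) = φ.onH y ∧
    c'.rest (φ.onV v) = φ.onH (c.root v) :: l.map φ.onH

namespace IsRelabelling

variable {c : Γ.Labelling} {c' : Γ'.Labelling} {φ : Γ.Iso Γ'} {r : Γ.V → Bool}
  (h : c.IsRelabelling c' φ r)

include h

lemma arity_eq (v : Γ.V) : c'.arity (φ.onV v) = c.arity v := by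
  cases hr : r v
  · simp [arity, (h.of_false v hr).2]
  · obtain ⟨l, y, h1, h2, h3⟩ := h.of_true v hr
    simp [arity, h1, h3]

lemma half_of_false {v : Γ.V} (hr : r v = false) (l : ℕ) :
    c'.half (φ.onV v) l = φ.onH (c.half v l) := by
  obtain ⟨h1, h2⟩ := h.of_false v hr
  rw [half, half, h1, h2, ← List.map_cons]
  simp only [List.getD_eq_getElem?_getD, List.getElem?_map]
  cases ((c.root v :: c.rest v)[l]?) <;> rfl

lemma half_zero_of_true {v : Γ.V} (hr : r v = true) :
    c'.half (φ.onV v) 0 = φ.onH (c.half v (c.arity v)) := by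
  obtain ⟨l, y, h1, h2, h3⟩ := h.of_true v hr
  rw [half_zero, h2, half, arity, h1]
  simp [List.getD_eq_getElem?_getD]

lemma half_succ_of_true {v : Γ.V} (hr : r v = true) {l : ℕ} (hl : l < c.arity v) :
    c'.half (φ.onV v) (l + 1) = φ.onH (c.half v l) := by
  obtain ⟨l', y, h1, h2, h3⟩ := h.of_true v hr
  have hl' : l < l'.length + 1 := by simpa [arity, h1] using hl
  rw [half, half, h2, h3, h1]
  rcases l with _ | l
  · simp
  · simp only [List.getD_cons_succ]
    rw [List.getD_eq_getElem _ _ (by simp; omega), List.getD_eq_getElem _ _ (by simp; omega),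
      List.getElem_map, List.getElem_append_left]

variable (T : ∀ v, PTree (c.arity v)) (T' : ∀ v, PTree (c'.arity v))

omit h in
lemma expandList_eq (v : Γ.V) (I : ℕ × ℕ) : c.expandList T v I =
    ((I, false) :: ((T v).children I).map fun J => (J, true)).map (c.labHalf T v) := by
  simp only [expandList, List.map_cons, List.map_map]
  congr 1

variable (hT : ∀ v, (T' (φ.onV v)).1 = ((T v).rotBy (r v)).1)

include hT

lemma isTreeIso (v : Γ.V) : IsTreeIso (T v) (T' (φ.onV v)) ((T v).nodeBy (r v))
    (edgeBy (r v) (c.arity v)) (flipBy (r v) (c.arity v)) ((T v).rotSign (r v)) :=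
  isTreeIso_rotBy _ _ _ (h.arity_eq v) (hT v)

/-- The map on vertices of expanded graphs. -/
def expandMapV (x : c.ExpandV T) : c'.ExpandV T' :=
  ⟨φ.onV x.1, (T x.1).nodeBy (r x.1) x.2.1, (h.isTreeIso T T' hT x.1).vert_mem _ x.2.2⟩

/-- The map on half-edges of expanded graphs. -/
def expandMapH : c.ExpandH T → c'.ExpandH T'
  | Sum.inl x => Sum.inl (φ.onH x)
  | Sum.inr (⟨v, e⟩, β) => Sum.inr (⟨φ.onV v, edgeBy (r v) (c.arity v) e.1,
      (h.isTreeIso T T' hT v).edge_mem _ e.2⟩, xor (flipBy (r v) (c.arity v) e.1) β)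

lemma expandMapV_bijective : Function.Bijective (h.expandMapV T T' hT) := by
  constructor
  · rintro ⟨v, I, hI⟩ ⟨w, J, hJ⟩ hxy
    obtain ⟨h1, h2⟩ := Sigma.mk.inj hxy
    obtain rfl := φ.onV.injective h1
    have h3 := congrArg Subtype.val (eq_of_heq h2)
    obtain rfl := (h.isTreeIso T T' hT v).vert_injOn I hI J hJ h3
    rfl
  · rintro ⟨v', I', hI'⟩
    obtain ⟨v, rfl⟩ := φ.onV.surjective v'
    obtain ⟨I, hI, rfl⟩ := (h.isTreeIso T T' hT v).exists_vert hI'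
    exact ⟨⟨v, I, hI⟩, rfl⟩

lemma expandMapH_bijective : Function.Bijective (h.expandMapH T T' hT) := by
  constructor
  · rintro (x | ⟨⟨v, e, he⟩, β⟩) (y | ⟨⟨w, f, hf⟩, γ⟩) hxy
    · exact congrArg Sum.inl (φ.onH.injective (Sum.inl.inj hxy))
    · simp [expandMapH] at hxy
    · simp [expandMapH] at hxy
    · obtain ⟨h0, hβ⟩ := Prod.mk.inj (Sum.inr.inj hxy)
      obtain ⟨h1, h2⟩ := Sigma.mk.inj h0
      obtain rfl := φ.onV.injective h1
      have h3 := congrArg Subtype.val (eq_of_heq h2)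
      obtain rfl := (h.isTreeIso T T' hT v).edge_injOn e he f hf h3
      simp only [Bool.xor_right_inj] at hβ
      rw [hβ]
  · rintro (x | ⟨⟨v', e', he'⟩, β⟩)
    · exact ⟨Sum.inl (φ.onH.symm x), by simp [expandMapH]⟩
    · obtain ⟨v, rfl⟩ := φ.onV.surjective v'
      obtain ⟨e, he, rfl⟩ := (h.isTreeIso T T' hT v).exists_edge he'
      refine ⟨Sum.inr (⟨v, e, he⟩, xor (flipBy (r v) (c.arity v) e) β), ?_⟩
      simp [expandMapH]

/-- Rotating the tree compensates for rotating the labels: leaf `l` of `T v` and leaf `l + 1` of the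
rotated tree are glued to the same half-edge, and likewise the last leaf and the new root. -/
lemma expandMapH_labHalf (v : Γ.V) {x : Lab} (hx : x.1 ∈ (T v).1 ∨ x ∈ extHalves (c.arity v)) :
    h.expandMapH T T' hT (c.labHalf T v x) = c'.labHalf T' (φ.onV v)
      (mapLab (edgeBy (r v) (c.arity v)) (flipBy (r v) (c.arity v)) x) := by
  rcases hx with hx | hx
  · rw [c.labHalf_of_mem T hx, c'.labHalf_of_mem T' (x := mapLab (edgeBy (r v) (c.arity v))
      (flipBy (r v) (c.arity v)) x)
      ((h.isTreeIso T T' hT v).edge_mem _ hx)]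
    rfl
  · have hn := h.arity_eq v
    rw [extHalves, List.mem_append, List.mem_singleton, mem_leafHalves] at hx
    cases hr : r v
    · have hm : mapLab (edgeBy false (c.arity v)) (flipBy false (c.arity v)) x = x := by
        simp [mapLab, edgeBy, flipBy]
      rw [hm]
      rcases hx with ⟨l, -, rfl⟩ | rfl
      · rw [labHalf_leaf, labHalf_leaf, h.half_of_false hr]
        rfl
      · rw [labHalf_root, ← hn, labHalf_root, (h.of_false v hr).1]
        rfl
    · rcases hx with ⟨l, hl, rfl⟩ | rfl
      · rw [labHalf_leaf]
        rcases Nat.lt_or_ge l (c.arity v) with hlt | hge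
        · have hm : mapLab (edgeBy true (c.arity v)) (flipBy true (c.arity v)) ((l, l), true) =
              ((l + 1, l + 1), true) := by
            simp [mapLab, edgeBy, flipBy, rotEdge, rotFlip, hlt]
          rw [hm, labHalf_leaf, h.half_succ_of_true hr hlt]
          rfl
        · obtain rfl : l = c.arity v := by omega
          have hm : mapLab (edgeBy true (c.arity v)) (flipBy true (c.arity v))
              ((c.arity v, c.arity v), true) = ((1, c.arity v), false) := by
            simp [mapLab, edgeBy, flipBy, rotEdge, rotFlip]
          rw [hm]
          nth_rewrite 2 [← hn]
          rw [labHalf_root, ← half_zero, h.half_zero_of_true hr]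
          rfl
      · have hm : mapLab (edgeBy true (c.arity v)) (flipBy true (c.arity v))
            ((1, c.arity v), false) = ((1, 1), true) := by
          simp [mapLab, edgeBy, flipBy, rotEdge, rotFlip]
        have h2 := (T v).two_le
        rw [hm, labHalf_root, labHalf_leaf, ← half_zero, h.half_succ_of_true hr (by omega)]
        rfl

lemma expandMapV_labVertex {v : Γ.V} {I : ℕ × ℕ} (hI : I ∈ (T v).nodes) :
    h.expandMapV T T' hT (c.labVertex T v I) =
      c'.labVertex T' (φ.onV v) ((T v).nodeBy (r v) I) := by
  rw [c.labVertex_of_mem T hI,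
    c'.labVertex_of_mem T' ((h.isTreeIso T T' hT v).vert_mem _ hI)]
  rfl

omit h hT in
lemma mem_or_mem_extHalves_of_children {v : Γ.V} {I : ℕ × ℕ} (hI : I ∈ (T v).nodes) {x : Lab}
    (hx : x ∈ (I, false) :: ((T v).children I).map fun J => (J, true)) :
    x.1 ∈ (T v).1 ∨ x ∈ extHalves (c.arity v) := by
  rw [List.mem_cons, List.mem_map] at hx
  rcases hx with rfl | ⟨J, hJ, rfl⟩
  · rcases (T v).mem_nodes.1 hI with rfl | hI
    · exact Or.inr (by simp [extHalves])
    · exact Or.inl hI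
  · obtain ⟨h1, h2, -, -⟩ := (T v).mem_children'.1 hJ
    refine h2.imp id fun h2 => List.mem_append_left _ (mem_leafHalves.2 ⟨J.1, by omega, ?_⟩)
    exact Prod.ext (Prod.ext rfl h2) rfl

/-- The isomorphism of expanded graphs. -/
noncomputable def expandIso : (c.expand T).Iso (c'.expand T') where
  onV := Equiv.ofBijective _ (h.expandMapV_bijective T T' hT)
  onH := Equiv.ofBijective _ (h.expandMapH_bijective T T' hT)
  map_cyc := by
    rintro ⟨v, I, hI⟩
    change Cycle.map (h.expandMapH T T' hT) (c.expandList T v I : Cycle (c.ExpandH T)) =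
      (c'.expandList T' (φ.onV v) ((T v).nodeBy (r v) I) : Cycle (c'.ExpandH T'))
    rw [Cycle.map_coe, Cycle.coe_eq_coe, expandList_eq, expandList_eq, List.map_map,
      List.map_congr_left (g := c'.labHalf T' (φ.onV v) ∘
        mapLab (edgeBy (r v) (c.arity v)) (flipBy (r v) (c.arity v))), ← List.map_map]
    · exact ((h.isTreeIso T T' hT v).cyc I hI).map _
    · exact fun x hx => h.expandMapH_labHalf T T' hT v (mem_or_mem_extHalves_of_children T hI hx)
  map_opp := by
    rintro (x | ⟨⟨v, e⟩, β⟩)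
    · exact congrArg Sum.inl (φ.map_opp x)
    · change Sum.inr _ = Sum.inr _
      simp

lemma map_treeOri_expand (v : Γ.V) : ((treeOri (c.arity v) (T v).edgeList).map
      (Sum.map (c.labVertex T v) (c.labHalf T v))).map
        (Sum.map (h.expandMapV T T' hT) (h.expandMapH T T' hT)) =
    ((treeOri (c.arity v) (T v).edgeList).map (Sum.map ((T v).nodeBy (r v))
      (mapLab (edgeBy (r v) (c.arity v)) (flipBy (r v) (c.arity v))))).map
        (Sum.map (c'.labVertex T' (φ.onV v)) (c'.labHalf T' (φ.onV v))) := by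
  rw [List.map_map, List.map_map]
  refine List.map_congr_left fun x hx => ?_
  rw [treeOri, List.mem_append, List.mem_flatMap] at hx
  rcases x with I | x
  · simp only [Function.comp_apply, Sum.map_inl]
    rw [h.expandMapV_labVertex T T' hT]
    rcases hx with ⟨e, he, hx⟩ | hx
    · simp only [List.mem_cons, Sum.inl.injEq, reduceCtorEq, List.not_mem_nil, or_false] at hx
      subst hx
      exact (T v).mem_nodes.2 (Or.inr ((T v).mem_edgeList.1 he))
    · simp at hx
      exact (T v).mem_nodes.2 (Or.inl hx)
  · simp only [Function.comp_apply, Sum.map_inr]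
    rw [h.expandMapH_labHalf T T' hT]
    rcases hx with ⟨e, he, hx⟩ | hx
    · left
      simp only [List.mem_cons, Sum.inr.injEq, reduceCtorEq, List.not_mem_nil, or_false,
        false_or] at hx
      rcases hx with rfl | rfl <;> exact (T v).mem_edgeList.1 he
    · right
      simp only [List.mem_cons, reduceCtorEq, false_or, Sum.inr.injEq, List.mem_map,
        exists_eq_right] at hx
      rw [extHalves, List.mem_append, List.mem_singleton]
      exact hx.symm

/-- The block of a vertex has `n + 3t + 2` letters, hence parity `n + t` when blocks are permuted;
inside a block the sign is that of the rotation of the tree. -/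
lemma kos_expandStd [DecidableEq (c'.ExpandV T' ⊕ c'.ExpandH T')] :
    kos (fun _ => 1) ((c.expandStd T).map
      (Sum.map (h.expandMapV T T' hT) (h.expandMapH T T' hT))) (c'.expandStd T') =
    kos (fun v => ((c.arity v : ZMod 2) + (T v).1.card)) c.verts (c'.verts.map φ.onV.symm) +
      (c.verts.map fun v => (T v).rotSign (r v)).sum := by
  have hN := c'.nodup_expandStd T'
  rw [expandStd, List.map_flatMap, expandStd, flatMap_verts c' φ]
  simp only [h.map_treeOri_expand T T' hT]
  have hp : ∀ v ∈ c.verts, (((treeOri (c.arity v) (T v).edgeList).map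
      (Sum.map ((T v).nodeBy (r v))
      (mapLab (edgeBy (r v) (c.arity v)) (flipBy (r v) (c.arity v))))).map
        (Sum.map (c'.labVertex T' (φ.onV v)) (c'.labHalf T' (φ.onV v)))).Perm
      ((treeOri (c'.arity (φ.onV v)) (T' (φ.onV v)).edgeList).map
        (Sum.map (c'.labVertex T' (φ.onV v)) (c'.labHalf T' (φ.onV v)))) :=
    fun v _ => (h.isTreeIso T T' hT v).ori_perm.map _
  rw [expandStd, flatMap_verts c' φ] at hN
  have hN' := ((verts_perm c c' φ).flatMap_right (fun v => (treeOri (c'.arity (φ.onV v))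
    (T' (φ.onV v)).edgeList).map
        (Sum.map (c'.labVertex T' (φ.onV v)) (c'.labHalf T' (φ.onV v))))).nodup_iff.2 hN
  rw [kos_flatMap _ (verts_perm c c' φ) c.verts_nodup
    ((flatMap_perm_right hp).nodup_iff.2 hN') hp]
  congr 1
  · refine kos_congr _ fun v _ => ?_
    rw [sum_map_one, List.length_map, List.length_map, treeOri, List.length_append,
      List.length_flatMap]
    have h2 : (2 : ZMod 2) = 0 := rfl
    simp only [List.length_cons, List.length_nil, zero_add, Nat.reduceAdd, List.map_const',
      List.sum_replicate, (T v).length_edgeList, List.length_map, length_leafHalves, smul_eq_mul]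
    push_cast
    linear_combination (1 + ((T v).1.card : ZMod 2)) * h2
  · refine congrArg List.sum (List.map_congr_left fun v hv => ?_)
    have hi := h.isTreeIso T T' hT v
    have hnd := (List.nodup_flatMap.1 hN').1 v hv
    rw [kos_map _ _ hi.ori_perm]
    · exact hi.kos_ori
    · exact fun x hx y hy hxy => List.inj_on_of_nodup_map hnd hx hy hxy

/-- Expanding with rotated trees after relabelling gives an isomorphic graph; only the orientation
has to be compared. -/
theorem graphClass_stdExpansion (K : Type*) [Field K] :
    graphClass K (c.stdExpansion T) =
      sg K (kos (fun v => ((c.arity v : ZMod 2) + (T v).1.card)) c.verts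
          (c'.verts.map φ.onV.symm) + (c.verts.map fun v => (T v).rotSign (r v)).sum) •
        graphClass K (c'.stdExpansion T') := by
  let _ : DecidableEq (c'.ExpandV T' ⊕ c'.ExpandH T') :=
    inferInstanceAs (DecidableEq ((c'.expand T').V ⊕ (c'.expand T').H))
  rw [← h.kos_expandStd T T' hT]
  exact graphClass_iso K (G := c.stdExpansion T) (G' := c'.stdExpansion T')
    (h.expandIso T T' hT)

end IsRelabelling

end RibbonGraph.Labelling

/-! ### Connecting any two labellings by elementary relabellings -/

namespace RibbonGraph.Labelling

variable {Γ Γ' : RibbonGraph}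

/-- A labelling given by lists of the half-edges at the vertices. -/
def ofLists (verts : List Γ.V) (h1 : verts.Nodup) (h2 : ∀ v, v ∈ verts) (l : Γ.V → List Γ.H)
    (hl : ∀ v, (l v : Cycle Γ.H) = Γ.cyc v) : Γ.Labelling where
  verts := verts
  root v := (l v).head (by
    have := Γ.valency v
    rw [← hl v, Cycle.length_coe] at this
    intro h
    simp [h] at this)
  rest v := (l v).tail
  verts_nodup := h1
  mem_verts := h2
  cyc_eq v := by rw [List.cons_head_tail, hl]

lemma ofLists_eq {verts : List Γ.V} {h1 : verts.Nodup} {h2 : ∀ v, v ∈ verts} {l : Γ.V → List Γ.H}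
    {hl : ∀ v, (l v : Cycle Γ.H) = Γ.cyc v} (v : Γ.V) :
    (ofLists verts h1 h2 l hl).root v :: (ofLists verts h1 h2 l hl).rest v = l v :=
  List.cons_head_tail _

lemma nonempty_labelling (Γ : RibbonGraph) : Nonempty Γ.Labelling := by
  have : ∀ v, ∃ l : List Γ.H, (l : Cycle Γ.H) = Γ.cyc v := fun v => Quotient.exists_rep (Γ.cyc v)
  choose l hl using this
  exact ⟨ofLists Finset.univ.toList (Finset.nodup_toList _) (fun v => by simp) l hl⟩

/-- The labelling of `Γ'` obtained from a labelling of `Γ` by transport of structure. -/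
def transport (c : Γ.Labelling) (φ : Γ.Iso Γ') : Γ'.Labelling where
  verts := c.verts.map φ.onV
  root v := φ.onH (c.root (φ.onV.symm v))
  rest v := (c.rest (φ.onV.symm v)).map φ.onH
  verts_nodup := c.verts_nodup.map φ.onV.injective
  mem_verts v := List.mem_map.2 ⟨φ.onV.symm v, c.mem_verts _, by simp⟩
  cyc_eq v := by
    have h := φ.map_cyc (φ.onV.symm v)
    rw [← c.cyc_eq, Cycle.map_coe, Equiv.apply_symm_apply] at h
    exact h

lemma isRelabelling_transport (c : Γ.Labelling) (φ : Γ.Iso Γ') :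
    c.IsRelabelling (c.transport φ) φ fun _ => false where
  of_false v _ := by simp [transport]
  of_true v h := by simp at h

lemma isRelabelling_of_eq {c c' : Γ.Labelling}
    (h : ∀ v, c.root v :: c.rest v = c'.root v :: c'.rest v) :
    c.IsRelabelling c' (RibbonGraph.Iso.refl Γ) fun _ => false where
  of_false v _ := by
    have := List.cons.inj (h v)
    simp [RibbonGraph.Iso.refl, this.1, this.2]
  of_true v h := by simp at h

/-- The labelling with rotated labels at all the vertices. -/
def rotateBy (c : Γ.Labelling) (k : Γ.V → ℕ) : Γ.Labelling :=
  ofLists c.verts c.verts_nodup c.mem_verts (fun v => (c.root v :: c.rest v).rotate (k v))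
    fun v => by
      rw [← c.cyc_eq v, Cycle.coe_eq_coe]
      exact (List.IsRotated.forall _ _)

lemma rotateBy_eq (c : Γ.Labelling) (k : Γ.V → ℕ) (v : Γ.V) :
    (c.rotateBy k).root v :: (c.rotateBy k).rest v = (c.root v :: c.rest v).rotate (k v) :=
  ofLists_eq v

/-- All positive amounts of rotation drop by one simultaneously. Thus rotations by different amounts
at different vertices are undone in finitely many steps, each rotating by at most one place. -/
lemma isRelabelling_rotateBy (c : Γ.Labelling) (k : Γ.V → ℕ) :
    (c.rotateBy k).IsRelabelling (c.rotateBy fun v => k v - 1) (RibbonGraph.Iso.refl Γ)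
      fun v => decide (0 < k v) where
  of_false v hv := by
    have h0 : k v = 0 := by simpa using hv
    have h1 := c.rotateBy_eq k v
    have h2 := c.rotateBy_eq (fun v => k v - 1) v
    simp only [h0, Nat.zero_sub] at h1 h2
    have := List.cons.inj (h1.trans h2.symm)
    simp [RibbonGraph.Iso.refl, this.1, this.2]
  of_true v hv := by
    have h0 : 0 < k v := by simpa using hv
    have h1 := c.rotateBy_eq k v
    have h2 := c.rotateBy_eq (fun v => k v - 1) v
    rw [show k v = (k v - 1) + 1 by omega, ← List.rotate_rotate, ← h2] at h1
    have hlen : 1 ≤ ((c.rotateBy fun v => k v - 1).rest v).length := by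
      have := Γ.valency v
      rw [← (c.rotateBy fun v => k v - 1).cyc_eq v] at this
      simp at this
      omega
    obtain ⟨y, l, hl⟩ := List.exists_cons_of_ne_nil (List.ne_nil_of_length_pos hlen)
    rw [List.rotate_cons_succ, List.rotate_zero, hl, List.cons_append] at h1
    obtain ⟨h3, h4⟩ := List.cons.inj h1
    refine ⟨l, (c.rotateBy fun v => k v - 1).root v, h4, rfl, ?_⟩
    rw [h3]
    change (c.rotateBy fun v => k v - 1).rest v = y :: l.map id
    rw [List.map_id, hl]

end RibbonGraph.Labelling

/-! ### Descent to the graph complex -/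

section Descent

open RibbonGraph.Labelling

variable {K : Type*} [Field K] {M : Type*} [AddCommGroup M] [Module K M]

omit [AddCommGroup M] in
-- After a change of the order of the vertices, two labellings differ by rotations at the vertices;
-- these are undone one step at a time.
lemma eq_of_relabelling {Γ : RibbonGraph} (f : Γ.Labelling → M)
    (hf : ∀ (c c' : Γ.Labelling) (r : Γ.V → Bool),
      c.IsRelabelling c' (RibbonGraph.Iso.refl Γ) r → f c = f c') (c c' : Γ.Labelling) :
    f c = f c' := by
  have h0 : f (c'.rotateBy fun _ => 0) = f c' := hf _ _ _ (isRelabelling_of_eq fun v => by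
    rw [rotateBy_eq, List.rotate_zero])
  have h1 : ∀ (N : ℕ) (k : Γ.V → ℕ), (∀ v, k v ≤ N) → f (c'.rotateBy k) = f c' := by
    intro N
    induction N with
    | zero =>
      intro k hk
      rw [show k = fun _ => 0 from funext fun v => Nat.le_zero.1 (hk v), h0]
    | succ N ih =>
      intro k hk
      rw [hf _ _ _ (c'.isRelabelling_rotateBy k)]
      exact ih _ fun v => by have := hk v; omega
  have h2 : ∀ v, ∃ k, (c'.root v :: c'.rest v).rotate k = c.root v :: c.rest v := fun v =>
    Cycle.coe_eq_coe.1 ((c'.cyc_eq v).trans (c.cyc_eq v).symm)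
  choose k hk using h2
  rw [hf c (c'.rotateBy k) _ (isRelabelling_of_eq fun v => by rw [rotateBy_eq, hk])]
  -- The sum of all the amounts of rotation is a convenient common bound.
  exact h1 (∑ v, k v) k fun v => Finset.single_le_sum (fun _ _ => Nat.zero_le _) (Finset.mem_univ v)

/-- A quantity computed from labelled graphs defines a linear map on the graph complex if it is
invariant under relabellings. -/
theorem existsUnique_descent (f : ∀ G : OrientedRibbonGraph, G.Γ.Labelling → M)
    (hf : ∀ (G G' : OrientedRibbonGraph) (c : G.Γ.Labelling) (c' : G'.Γ.Labelling)
      (φ : G.Γ.Iso G'.Γ) (r : G.Γ.V → Bool), c.IsRelabelling c' φ r →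
      f G c = sg K (kos (fun _ => 1) (G.ori.map (Sum.map φ.onV φ.onH)) G'.ori) • f G' c') :
    ∃! F : GraphComplex K →ₗ[K] M, ∀ G c, F (graphClass K G) = f G c := by
  have hind : ∀ (G : OrientedRibbonGraph) (c c' : G.Γ.Labelling), f G c = f G c' := fun G =>
    eq_of_relabelling _ fun c c' r h => by
      rw [hf G G c c' _ r h]
      have : Sum.map (RibbonGraph.Iso.refl G.Γ).onV (RibbonGraph.Iso.refl G.Γ).onH = id := by
        simp [RibbonGraph.Iso.refl]
      rw [this, List.map_id, kos_self _ G.ori_nodup, sg_zero, one_smul]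
  let f0 : OrientedRibbonGraph → M := fun G => f G (nonempty_labelling G.Γ).some
  -- Transport along an isomorphism is an elementary relabelling, so the relations of the graph
  -- complex hold for the values; the labelling chosen for the target is irrelevant.
  have hle : Submodule.span K (graphRelations K) ≤
      LinearMap.ker (Finsupp.linearCombination K f0) := by
    rw [Submodule.span_le]
    rintro _ ⟨G, G', φ, rfl⟩
    rw [SetLike.mem_coe, LinearMap.mem_ker, map_sub, map_smul, Finsupp.linearCombination_single,
      Finsupp.linearCombination_single, one_smul, one_smul, sub_eq_zero, permSign_eq]
    exact (hf G G' _ _ φ _ (isRelabelling_transport _ φ)).trans (congrArg _ (hind _ _ _))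
  refine ⟨Submodule.liftQ _ _ hle, fun G c => ?_, fun F hF => ?_⟩
  · rw [graphClass, Submodule.liftQ_apply, Finsupp.linearCombination_single, one_smul]
    exact hind _ _ _
  · refine Submodule.linearMap_qext _ (Finsupp.lhom_ext' fun G => LinearMap.ext_ring ?_)
    change F (graphClass K G) = _
    rw [hF G (nonempty_labelling G.Γ).some]
    change _ = Finsupp.linearCombination K f0 (Finsupp.single G 1)
    rw [Finsupp.linearCombination_single, one_smul]

end Descent

/-! ### The sign `A_Γ` under relabelling -/

namespace RibbonGraph.Labelling

variable {Γ Γ' : RibbonGraph}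

lemma deg_eq (c : Γ.Labelling) : Γ.deg = ∑ v, ((c.arity v : ℤ) - 2) := by
  refine Finset.sum_congr rfl fun v _ => ?_
  rw [c.length_eq]
  push_cast
  ring

namespace IsRelabelling

variable {c : Γ.Labelling} {c' : Γ'.Labelling} {φ : Γ.Iso Γ'} {r : Γ.V → Bool}
  (h : c.IsRelabelling c' φ r)

include h

lemma deg_eq : Γ'.deg = Γ.deg := by
  rw [c.deg_eq, c'.deg_eq, ← φ.onV.sum_comp]
  exact Finset.sum_congr rfl fun v _ => by rw [h.arity_eq]

/-- The block of `v` has `n_v + 2` letters, hence parity `n_v`, and a one-step rotation is a cyclic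
permutation of `n_v + 1` half-edges, of sign `(-1)^(n_v)`. -/
lemma kos_standardOri :
    (c.standardOri.map (Sum.map φ.onV φ.onH)).Perm c'.standardOri ∧
    kos (fun _ => 1) (c.standardOri.map (Sum.map φ.onV φ.onH)) c'.standardOri =
    kos (fun v => (c.arity v : ZMod 2)) c.verts (c'.verts.map φ.onV.symm) +
      (c.verts.map fun v => if r v then (c.arity v : ZMod 2) else 0).sum := by
  have hN := c'.nodup_standardOri
  have e1 : c.standardOri.map (Sum.map φ.onV φ.onH) = c.verts.flatMap fun v =>
      Sum.inl (φ.onV v) :: ((c.root v :: c.rest v).map φ.onH).map Sum.inr := by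
    rw [standardOri, List.map_flatMap]
    refine List.flatMap_congr fun v _ => ?_
    simp
  have e2 : c'.standardOri = (c'.verts.map φ.onV.symm).flatMap fun v =>
      Sum.inl (φ.onV v) :: (c'.root (φ.onV v) :: c'.rest (φ.onV v)).map Sum.inr :=
    flatMap_verts c' φ _
  rw [e2] at hN
  have hN' := ((verts_perm c c' φ).flatMap_right (fun v => (Sum.inl (φ.onV v) :: (c'.root (φ.onV v) :: c'.rest (φ.onV v)).map Sum.inr :
      List (Γ'.V ⊕ Γ'.H)))).nodup_iff.2 hN
  have hp : ∀ v ∈ c.verts, (Sum.inl (φ.onV v) :: ((c.root v :: c.rest v).map φ.onH).map Sum.inr :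
      List (Γ'.V ⊕ Γ'.H)).Perm
      (Sum.inl (φ.onV v) :: (c'.root (φ.onV v) :: c'.rest (φ.onV v)).map Sum.inr) := by
    intro v _
    refine List.Perm.cons _ (List.Perm.map _ ?_)
    cases hr : r v
    · rw [(h.of_false v hr).1, (h.of_false v hr).2, List.map_cons]
    · obtain ⟨l, y, h1, h2, h3⟩ := h.of_true v hr
      rw [h1, h2, h3, List.map_cons, List.map_append, ← List.cons_append]
      exact List.perm_append_comm
  have hB := (flatMap_perm_right hp).nodup_iff.2 hN'
  rw [e1, e2]
  refine ⟨(flatMap_perm_right hp).trans ((verts_perm c c' φ).flatMap_right _), ?_⟩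
  rw [kos_flatMap _ (verts_perm c c' φ) c.verts_nodup hB hp]
  have h2 : (2 : ZMod 2) = 0 := rfl
  congr 1
  · refine kos_congr _ fun v _ => ?_
    rw [sum_map_one]
    simp only [List.length_cons, List.length_map, arity]
    push_cast
    linear_combination h2
  · refine congrArg List.sum (List.map_congr_left fun v hv => ?_)
    have hnd := (List.nodup_flatMap.1 hN').1 v hv
    cases hr : r v
    · rw [(h.of_false v hr).1, (h.of_false v hr).2] at hnd ⊢
      rw [List.map_cons, kos_self _ hnd]
      rfl
    · obtain ⟨l, y, h1, h2, h3⟩ := h.of_true v hr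
      rw [h2, h3] at hnd ⊢
      have e3 : (c.root v :: c.rest v).map φ.onH = (φ.onH (c.root v) :: l.map φ.onH) ++ [φ.onH y] := by
        simp [h1]
      have e4 : φ.onH y :: φ.onH (c.root v) :: l.map φ.onH =
        [φ.onH y] ++ (φ.onH (c.root v) :: l.map φ.onH) := rfl
      rw [e4, List.map_append] at hnd ⊢
      rw [e3, List.map_append]
      refine (kos_append_left (X := [Sum.inl (φ.onV v)])
        (L := (φ.onH (c.root v) :: l.map φ.onH).map Sum.inr ++ [φ.onH y].map Sum.inr)
        (M := [φ.onH y].map Sum.inr ++ (φ.onH (c.root v) :: l.map φ.onH).map Sum.inr)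
        _ hnd List.perm_append_comm).trans ?_
      rw [kos_swap _ (List.perm_append_comm.nodup_iff.2 hnd.of_cons), sum_map_one, sum_map_one]
      simp [arity, h1]

/-- Both ways around the square formed by the two orientations and the two standard orders give the
same sign. -/
lemma orientationSign_eq (K : Type*) [Field K] {ori : List (Γ.V ⊕ Γ.H)} {ori' : List (Γ'.V ⊕ Γ'.H)}
    (h1 : ori.Nodup) (h2 : ∀ x, x ∈ ori) (h1' : ori'.Nodup) (h2' : ∀ x, x ∈ ori') :
    c.orientationSign K ori =
      sg K (kos (fun _ => 1) (ori.map (Sum.map φ.onV φ.onH)) ori') *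
      sg K (kos (fun v => (c.arity v : ZMod 2)) c.verts (c'.verts.map φ.onV.symm) +
        (c.verts.map fun v => if r v then (c.arity v : ZMod 2) else 0).sum) *
      c'.orientationSign K ori' := by
  obtain ⟨p, k⟩ := h.kos_standardOri
  have q := c.perm_standardOri h1 h2
  have q' := c'.perm_standardOri h1' h2'
  have hN := c'.nodup_standardOri
  have a1 := kos_trans (fun _ => (1 : ZMod 2)) hN (q.map (Sum.map φ.onV φ.onH)) p
  have a2 := kos_trans (fun _ => (1 : ZMod 2)) hN (((q.map _).trans p).trans q'.symm) q'
  rw [a1, k, kos_map _ _ q fun x _ y _ hxy => (φ.onV.injective.sumMap φ.onH.injective) hxy] at a2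
  rw [orientationSign, orientationSign, permSign_eq, permSign_eq, ← sg_add, ← sg_add]
  congr 1
  have : ∀ a b x y : ZMod 2, a + b = x + y → a = x + b + y := by decide
  exact this _ _ _ _ a2

end IsRelabelling

end RibbonGraph.Labelling

lemma PTree.rotTree_injective {n : ℕ} : Function.Injective (PTree.rotTree (n := n)) := by
  have key : ∀ S T : PTree n, S.rotTree = T.rotTree → ∀ e ∈ S.1, e ∈ T.1 := by
    intro S T h e he
    have h1 : rotEdge n e ∈ T.rotTree.1 := h ▸ S.mem_rotTree.2 ⟨e, he, rfl⟩
    obtain ⟨x, hx, hxe⟩ := T.mem_rotTree.1 h1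
    have b1 := S.edge_bounds he
    have b2 := T.edge_bounds hx
    rwa [rotEdge_injOn (by omega) (by omega) hxe] at hx
  intro S T h
  exact Subtype.ext (Finset.ext fun e => ⟨key S T h e, key T S h.symm e⟩)

lemma PTree.rotBy_injective {n : ℕ} (r : Bool) : Function.Injective (PTree.rotBy (n := n) r) := by
  cases r
  · exact Function.injective_id
  · exact PTree.rotTree_injective

/-- The rotation of trees, as a bijection. -/
noncomputable def rotEquiv {n n' : ℕ} (r : Bool) (h : n' = n) : PTree n ≃ PTree n' :=
  (Equiv.ofBijective _ (Finite.injective_iff_bijective.1 (PTree.rotBy_injective r))).trans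
    (Equiv.cast (by rw [h]))

lemma rotEquiv_val {n n' : ℕ} (r : Bool) (h : n' = n) (T : PTree n) :
    (rotEquiv r h T).1 = (T.rotBy r).1 := by
  subst h
  rfl

/-! ### The diagonal is well defined -/

section Diagonal

variable {K : Type*} [Field K] (Δ : CyclicDiagonal K)

/-- The coefficients of the diagonal of the corolla. -/
noncomputable def CyclicDiagonal.coeff {n : ℕ} (p : PTree n × PTree n) : K :=
  Δ.map n (corolla K n) p

/-- `Δ` preserves degrees, and the corolla has degree `n - 2`; read modulo 2. -/
lemma CyclicDiagonal.coeff_deg {n : ℕ} {p : PTree n × PTree n} (h : Δ.coeff p ≠ 0) :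
    ((n : ZMod 2) + p.1.1.card) + (n + p.2.1.card) = n := by
  have h0 : (∅ : Finset (ℕ × ℕ)) ∈ trees n := empty_mem_trees.2 p.1.two_le
  rw [coeff, corolla_eq_tree h0] at h
  have h1 := Δ.map_deg n ⟨∅, h0⟩ p h
  simp only [PTree.deg, Finset.card_empty] at h1
  have h2 := congrArg (Int.cast : ℤ → ZMod 2) h1
  push_cast at h2
  have h3 : (2 : ZMod 2) = 0 := rfl
  linear_combination -h2 + ((n : ZMod 2) - 1) * h3

lemma rot_corolla {n : ℕ} : rot K n (corolla K n) = sg K n • corolla K n := by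
  by_cases h : 2 ≤ n
  · have h0 := empty_mem_trees.2 h
    have hr : PTree.rotTree (⟨∅, h0⟩ : PTree n) = ⟨∅, h0⟩ := Subtype.ext (by simp [PTree.rotTree])
    have he : PTree.edgeList (⟨∅, h0⟩ : PTree n) = [] := by simp [PTree.edgeList]
    rw [corolla_eq_tree h0, rot_tree, hr, PTree.rotSign, if_pos rfl, hr, he]
    simp [kos]
  · rw [corolla_eq_zero h, map_zero, smul_zero]

/-- Compare the coefficients at the rotated pair in `Δ(r c_n) = (r ⊗ r) Δ(c_n)`. The corolla is
fixed up to `(-1)^n`, and as rotation is injective only the pair `p` contributes on the right. -/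
lemma CyclicDiagonal.coeff_rot {n : ℕ} (p : PTree n × PTree n) :
    sg K n * Δ.coeff (p.1.rotTree, p.2.rotTree) =
      sg K (p.1.rotSign true + p.2.rotSign true) * Δ.coeff p := by
  have h := congrArg (fun x => x (p.1.rotTree, p.2.rotTree)) (Δ.map_rot n (corolla K n))
  simp only [rot_corolla, map_smul] at h
  rw [Finsupp.smul_apply, smul_eq_mul] at h
  rw [coeff, h, rot2, Finsupp.linearCombination_apply, Finsupp.sum_apply]
  have key : ∀ q : PTree n × PTree n, tens (rot K n (tree q.1)) (rot K n (tree q.2)) =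
      Finsupp.single (q.1.rotTree, q.2.rotTree) (sg K (q.1.rotSign true + q.2.rotSign true)) := by
    intro q
    rw [rot_tree, rot_tree, tens, tree, tree, Finsupp.smul_single_one, Finsupp.smul_single_one,
      Finsupp.sum_single_index, Finsupp.sum_single_index, sg_add] <;> simp
  rw [Finsupp.sum, Finset.sum_eq_single p]
  · rw [Finsupp.smul_apply, key, Finsupp.single_eq_same, smul_eq_mul, mul_comm]
    rfl
  · intro q _ hq
    rw [Finsupp.smul_apply, key, Finsupp.single_eq_of_ne, smul_zero]
    intro hpq
    obtain ⟨h1, h2⟩ := Prod.mk.inj hpq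
    exact hq (Prod.ext (PTree.rotTree_injective h1.symm) (PTree.rotTree_injective h2.symm))
  · intro hp
    rw [Finsupp.notMem_support_iff.1 hp, zero_smul]
    rfl

lemma CyclicDiagonal.coeff_rotEquiv {n n' : ℕ} (r : Bool) (h : n' = n) (p : PTree n × PTree n) :
    Δ.coeff p = sg K ((if r then (n : ZMod 2) else 0) + p.1.rotSign r + p.2.rotSign r) *
      Δ.coeff (rotEquiv r h p.1, rotEquiv r h p.2) := by
  subst h
  cases r
  · have : ∀ T : PTree n', rotEquiv false rfl T = T := fun T => Subtype.ext (rotEquiv_val _ _ T)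
    simp [this, PTree.rotSign, sg_zero]
  · have : ∀ T : PTree n', rotEquiv true rfl T = T.rotTree :=
      fun T => Subtype.ext (rotEquiv_val _ _ T)
    rw [this, this, if_pos rfl, add_assoc, add_comm, sg_add, mul_assoc, Δ.coeff_rot, ← mul_assoc,
      sg_mul_self, one_mul]

open RibbonGraph.Labelling

/-- After `phi_eq` the factors `(-1)^|Γ|` of the two copies of `φ_Γ` cancel; what remains are the
coefficients of `Δ` and the sign of the shuffle. -/
lemma graphDiagonal_eq (G : OrientedRibbonGraph) (c : G.Γ.Labelling) : graphDiagonal Δ G c =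
    ∑ T : (∀ v, PTree (c.arity v) × PTree (c.arity v)),
      ((-1 : K) ^ G.Γ.deg * c.orientationSign K G.ori *
        ((∏ v, Δ.coeff (T v)) * sg K (psum (fun v w =>
          ((c.arity v : ZMod 2) + (T v).2.1.card) * ((c.arity w : ZMod 2) + (T w).1.1.card))
            c.verts))) •
        (graphClass K (c.stdExpansion fun v => (T v).1) ⊗ₜ[K]
          graphClass K (c.stdExpansion fun v => (T v).2)) := by
  rw [graphDiagonal, Finset.smul_sum]
  refine Finset.sum_congr rfl fun T _ => ?_
  rw [smul_smul, phi_eq, phi_eq, TensorProduct.smul_tmul_smul, smul_smul,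
    ← zpow_add₀ (by simp : (-1 : K) ≠ 0), ← two_mul, zpow_mul]
  congr 1
  have e : ∀ {n : ℕ} (S : PTree n), ((S.deg : ℤ) : ZMod 2) = (n : ZMod 2) + S.1.card := by
    intro n S
    have h2 : (2 : ZMod 2) = 0 := rfl
    simp only [PTree.deg]
    push_cast
    linear_combination (-1 - (S.1.card : ZMod 2)) * h2
  rw [neg_one_zpow_eq_sg K (pairSum _ _), cast_pairSum]
  simp only [Int.cast_mul, e]
  rw [show ((-1 : K) ^ (2 : ℤ)) = 1 by norm_num, one_zpow, mul_one]
  rfl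

/-- The summands correspond under rotation of the trees. The rotation signs of coefficients, graphs
and orientation cancel at each vertex, and those of reordering the vertices cancel by `kos_add`,
since `|T_v| + |T'_v| ≡ n_v`. -/
theorem graphDiagonal_relabelling (G G' : OrientedRibbonGraph) (c : G.Γ.Labelling)
    (c' : G'.Γ.Labelling) (φ : G.Γ.Iso G'.Γ) (r : G.Γ.V → Bool) (h : c.IsRelabelling c' φ r) :
    graphDiagonal Δ G c = sg K (kos (fun _ => 1) (G.ori.map (Sum.map φ.onV φ.onH)) G'.ori) •
      graphDiagonal Δ G' c' := by
  rw [graphDiagonal_eq, graphDiagonal_eq, Finset.smul_sum]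
  let e : (∀ v, PTree (c.arity v) × PTree (c.arity v)) ≃
      (∀ v, PTree (c'.arity v) × PTree (c'.arity v)) :=
    Equiv.piCongr φ.onV fun v =>
      (rotEquiv (r v) (h.arity_eq v)).prodCongr (rotEquiv (r v) (h.arity_eq v))
  have he : ∀ T v, e T (φ.onV v) =
      (rotEquiv (r v) (h.arity_eq v) (T v).1, rotEquiv (r v) (h.arity_eq v) (T v).2) :=
    fun T v => Equiv.piCongr_apply_apply _ _ _ _
  refine Fintype.sum_equiv e _ _ fun T => ?_
  have hD : ∏ v, Δ.coeff (T v) = sg K (∑ v, ((if r v then (c.arity v : ZMod 2) else 0) +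
      (T v).1.rotSign (r v) + (T v).2.rotSign (r v))) * ∏ v, Δ.coeff (e T v) := by
    rw [← φ.onV.prod_comp, sg_sum, ← Finset.prod_mul_distrib]
    refine Finset.prod_congr rfl fun v _ => ?_
    rw [he, ← Δ.coeff_rotEquiv]
  -- The degree relation between `T_v` and `T'_v` is available only for terms which occur in
  -- `Δ(c_n)`; the others vanish on both sides.
  by_cases h0 : ∏ v, Δ.coeff (T v) = 0
  · have h0' : ∏ v, Δ.coeff (e T v) = 0 := by
      have := congrArg (sg K (∑ v, ((if r v then (c.arity v : ZMod 2) else 0) +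
        (T v).1.rotSign (r v) + (T v).2.rotSign (r v))) * ·) hD
      simpa [← mul_assoc, sg_mul_self, h0] using this.symm
    rw [h0, h0']
    simp
  · have hdeg : ∀ v, ((c.arity v : ZMod 2) + (T v).1.1.card) +
        ((c.arity v : ZMod 2) + (T v).2.1.card) = c.arity v := fun v =>
      Δ.coeff_deg (Finset.prod_ne_zero_iff.1 h0 v (Finset.mem_univ v))
    have hc1 : ∀ v, (e T (φ.onV v)).1.1 = ((T v).1.rotBy (r v)).1 := fun v => by
      rw [he, rotEquiv_val]
    have hc2 : ∀ v, (e T (φ.onV v)).2.1 = ((T v).2.rotBy (r v)).1 := fun v => by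
      rw [he, rotEquiv_val]
    have hcard1 : ∀ v, (e T (φ.onV v)).1.1.card = (T v).1.1.card := fun v =>
      (h.isTreeIso (fun v => (T v).1) (fun v => (e T v).1) hc1 v).card
    have hcard2 : ∀ v, (e T (φ.onV v)).2.1.card = (T v).2.1.card := fun v =>
      (h.isTreeIso (fun v => (T v).2) (fun v => (e T v).2) hc2 v).card
    rw [h.graphClass_stdExpansion (fun v => (T v).1) (fun v => (e T v).1) hc1,
      h.graphClass_stdExpansion (fun v => (T v).2) (fun v => (e T v).2) hc2,
      TensorProduct.smul_tmul_smul, smul_smul, smul_smul, hD, h.deg_eq,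
      h.orientationSign_eq K G.ori_nodup G.mem_ori G'.ori_nodup G'.mem_ori]
    have hps : psum (fun v w => ((c'.arity v : ZMod 2) + (e T v).2.1.card) *
        ((c'.arity w : ZMod 2) + (e T w).1.1.card)) c'.verts =
        psum (fun v w => ((c.arity v : ZMod 2) + (T v).2.1.card) *
          ((c.arity w : ZMod 2) + (T w).1.1.card)) (c'.verts.map φ.onV.symm) := by
      have hv : c'.verts = (c'.verts.map φ.onV.symm).map φ.onV := by simp
      conv_lhs => rw [hv]
      rw [psum_map]
      refine psum_congr fun v _ w _ => ?_
      simp only [h.arity_eq, hcard1, hcard2]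
    -- The pair sums produced here are the shuffle signs for the two orders of the vertices.
    have hka := kos_add (fun v => (c.arity v : ZMod 2) + (T v).1.1.card)
      (fun v => (c.arity v : ZMod 2) + (T v).2.1.card)
      (c'.verts_nodup.map φ.onV.symm.injective) (verts_perm c c' φ)
    simp only [hdeg] at hka
    have hsum : ∀ f : G.Γ.V → ZMod 2, (c.verts.map f).sum = ∑ v, f v := fun f => by
      rw [← List.sum_toFinset f c.verts_nodup]
      congr 1
      ext v
      simp [c.mem_verts v]
    rw [hka, hps, hsum, hsum, hsum]
    congr 1
    simp only [Finset.sum_add_distrib]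
    have key : ∀ kp kq pL pM R R₁ R₂ : ZMod 2, sg K (kp + kq + pL + pM + R) *
        (sg K (R + R₁ + R₂) * (sg K pL * (sg K (kp + R₁) * sg K (kq + R₂)))) = sg K pM := by
      intro kp kq pL pM R R₁ R₂
      simp only [← sg_add]
      congr 1
      have h2 : (2 : ZMod 2) = 0 := rfl
      linear_combination (kp + kq + pL + R + R₁ + R₂) * h2
    generalize kos (fun v => (c.arity v : ZMod 2) + (T v).1.1.card) c.verts
      (c'.verts.map φ.onV.symm) = kp
    generalize kos (fun v => (c.arity v : ZMod 2) + (T v).2.1.card) c.verts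
      (c'.verts.map φ.onV.symm) = kq
    generalize psum _ c.verts = pL
    generalize psum _ (c'.verts.map φ.onV.symm) = pM
    generalize ∑ v, (T v).1.rotSign (r v) = R₁
    generalize ∑ v, (T v).2.rotSign (r v) = R₂
    generalize (∑ v, if r v = true then (c.arity v : ZMod 2) else 0) = R
    generalize sg K (kos _ _ G'.ori) = x
    linear_combination ((-1) ^ G.Γ.deg * x * c'.orientationSign K G'.ori *
      ∏ v, Δ.coeff (e T v)) * key kp kq pL pM R R₁ R₂

theorem existsUnique_isGraphDiagonal :
    ∃! δ : GraphComplex K →ₗ[K] GraphComplex K ⊗[K] GraphComplex K, IsGraphDiagonal Δ δ :=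
  existsUnique_descent (graphDiagonal Δ) (graphDiagonal_relabelling Δ)

end Diagonal

/-! ### Properties of a basis that suffice for the cocycle -/

section CyclicBasis

variable {K : Type*} [Field K] {C : Type*} [AddCommGroup C] [Module K C]
  {ι : Type*} [Fintype ι] [DecidableEq ι]

/-- The properties of a basis of a cyclic `A_∞`-algebra on which its Kontsevich cocycle depends. -/
structure IsCyclicBasis (γ : AInfData K C) (b : Module.Basis ι K C) (deg : ι → ℤ) : Prop where
  parity : ∀ l x, corollaWeight γ b l x ≠ 0 → (l.map (par deg)).sum + par deg x = l.length
  cyclic : ∀ x l y, corollaWeight γ b (x :: l) y =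
    sg K (l.length + 1 + par deg x * ((l.map (par deg)).sum + par deg y)) *
      corollaWeight γ b (l ++ [y]) x
  isUnit_det : IsUnit (gram γ b).det
  gram_symm : ∀ x y, gram γ b x y = sg K (par deg x * par deg y) * gram γ b y x
  gram_even : ∀ x y, gram γ b x y ≠ 0 → par deg x = par deg y

lemma sg_injective [CharZero K] : Function.Injective (sg K) := by
  have h : ∀ a : ZMod 2, a = 0 ∨ a = 1 := by decide
  have h1 : (1 : K) ≠ -1 := fun h => by
    have : (2 : K) = 0 := by linear_combination h
    exact two_ne_zero this
  intro a b hab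
  rcases h a with rfl | rfl <;> rcases h b with rfl | rfl
  · rfl
  · rw [sg_zero, sg_one] at hab
    exact absurd hab h1
  · rw [sg_zero, sg_one] at hab
    exact absurd hab.symm h1
  · rfl

namespace IsCyclicBasis

variable {γ : AInfData K C} {b : Module.Basis ι K C} {deg : ι → ℤ} (h : IsCyclicBasis γ b deg)

include h

/-- Evenness says that the Gram matrix commutes with the parity operator; then so does its inverse.
This yields evenness of the propagator. -/
lemma commute_diagonal : Matrix.diagonal (fun x => sg K (par deg x)) * (gram γ b)⁻¹ =
    (gram γ b)⁻¹ * Matrix.diagonal fun x => sg K (par deg x) := by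
  have hG : gram γ b * Matrix.diagonal (fun x => sg K (par deg x)) =
      Matrix.diagonal (fun x => sg K (par deg x)) * gram γ b := by
    ext x y
    rw [Matrix.mul_diagonal, Matrix.diagonal_mul]
    by_cases h0 : gram γ b x y = 0
    · simp [h0]
    · rw [h.gram_even x y h0, mul_comm]
  calc _ = (gram γ b)⁻¹ * (gram γ b * Matrix.diagonal fun x => sg K (par deg x)) * (gram γ b)⁻¹ := by
        rw [← Matrix.mul_assoc, Matrix.nonsing_inv_mul _ h.isUnit_det, Matrix.one_mul]
    _ = _ := by
        rw [hG, ← Matrix.mul_assoc, Matrix.mul_assoc, Matrix.mul_nonsing_inv _ h.isUnit_det,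
          Matrix.mul_one]

lemma propagator_even [CharZero K] {x y : ι} (hxy : propagator γ b x y ≠ 0) :
    par deg x = par deg y := by
  have h1 := congrFun (congrFun h.commute_diagonal x) y
  rw [Matrix.mul_diagonal, Matrix.diagonal_mul, mul_comm] at h1
  exact sg_injective (mul_left_cancel₀ hxy h1)

/-- Graded symmetry and evenness give `gᵀ = D g` with `D` the parity matrix, because `p² = p` modulo
2. Inverting yields `(g⁻¹)ᵀ = g⁻¹ D`. -/
lemma propagator_symm [CharZero K] (x y : ι) :
    propagator γ b x y = sg K (par deg x * par deg y) * propagator γ b y x := by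
  have hsq : ∀ a : ZMod 2, a * a = a := by decide
  have hD : Matrix.diagonal (fun x => sg K (par deg x)) *
      Matrix.diagonal (fun x => sg K (par deg x)) = 1 := by
    rw [Matrix.diagonal_mul_diagonal]
    simp [sg_mul_self]
  have hT : (gram γ b).transpose = Matrix.diagonal (fun x => sg K (par deg x)) * gram γ b := by
    ext x y
    rw [Matrix.diagonal_mul, Matrix.transpose_apply, h.gram_symm y x]
    by_cases h0 : gram γ b x y = 0
    · simp [h0]
    · rw [h.gram_even x y h0, hsq]
  have h1 : ((gram γ b)⁻¹).transpose =
      (gram γ b)⁻¹ * Matrix.diagonal fun x => sg K (par deg x) := by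
    rw [Matrix.transpose_nonsing_inv, hT, Matrix.mul_inv_rev, Matrix.inv_eq_left_inv hD]
  have h2 := congrFun (congrFun h1 y) x
  rw [Matrix.transpose_apply, Matrix.mul_diagonal] at h2
  change propagator γ b x y = propagator γ b y x * _ at h2
  rw [h2]
  by_cases h0 : propagator γ b y x = 0
  · simp [h0]
  · rw [h.propagator_even h0, hsq, mul_comm]

end IsCyclicBasis

omit [Fintype ι] [DecidableEq ι] in
/-- The states of the root and the leaves of a corolla, before and after a rotation. -/
lemma exists_rotated_states (x : ι) (l : List ι) (y : ι) : ∃ s s' : ℕ → ι,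
    s 0 = x ∧ s' 0 = y ∧ s (l.length + 1) = y ∧ (∀ k, s' (k + 1) = s k) ∧
      l ++ [y] = (List.range' 1 (l.length + 1)).map s ∧
      x :: l = (List.range' 1 (l.length + 1)).map s' := by
  let s : ℕ → ι := fun k => if k = 0 then x else (l ++ [y]).getD (k - 1) y
  let s' : ℕ → ι := fun k => if k = 0 then y else s (k - 1)
  refine ⟨s, s', if_pos rfl, if_pos rfl, ?_, fun k => if_neg (Nat.succ_ne_zero k), ?_, ?_⟩
  · simp only [s, Nat.add_one_ne_zero, if_false, Nat.add_sub_cancel]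
    rw [List.getD_eq_getElem _ _ (by simp)]
    simp
  · refine List.ext_getElem (by simp) fun k h1 h2 => ?_
    simp only [List.getElem_map, List.getElem_range', s]
    rw [if_neg (by omega), List.getD_eq_getElem _ _ (by simp at h2 ⊢; omega)]
    congr 1
    omega
  · refine List.ext_getElem (by simp) fun k h1 h2 => ?_
    simp only [List.getElem_map, List.getElem_range', s', s]
    rw [if_neg (by omega)]
    rcases k with _ | k
    · simp
    · simp only [List.length_cons] at h1
      rw [if_neg (by omega), List.getD_eq_getElem _ _ (by simp; omega),
        List.getElem_append_left (by omega)]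
      simp only [List.getElem_cons_succ]
      congr 1
      omega

omit [Fintype ι] [DecidableEq ι] in
lemma IsCyclicAInf.cyclicOp_rot {𝒞 : ℤ → Submodule K C} {γ : AInfData K C}
    (hγ : IsCyclicAInf 𝒞 γ) {b : Module.Basis ι K C} {deg : ι → ℤ} (hb : ∀ i, b i ∈ 𝒞 (deg i))
    {n : ℕ} (T : PTree n) {s s' : ℕ → ι} (h0 : s' 0 = s n) (hs : ∀ k, s' (k + 1) = s k) :
    cyclicOp γ b (rot K n (tree T)) s' =
      sg K (par deg (s 0) * ((List.range' 1 n).map fun k => par deg (s k)).sum) *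
        cyclicOp γ b (tree T) s := by
  have hc := hγ.cyclic n T (fun k => deg (s k)) (fun k => b (s k)) fun k => hb _
  have e4 : ((deg (s 0) * ∑ k ∈ Finset.Icc 1 n, deg (s k) : ℤ) : ZMod 2) =
      par deg (s 0) * ((List.range' 1 n).map fun k => par deg (s k)).sum := by
    rw [← List.sum_toFinset _ List.nodup_range']
    push_cast
    congr 1
    refine Finset.sum_congr ?_ fun _ _ => rfl
    ext k
    simp
    omega
  rw [neg_one_zpow_eq_sg, e4] at hc
  rw [cyclicOp, h0]
  refine Eq.trans ?_ hc
  congr 3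
  funext k
  simp only [tuple, hs, Nat.add_sub_cancel]

/-- Cyclicity of the corolla functionals is the cyclicity axiom for the corolla combined with `r c_n
= (-1)^n c_n`. -/
lemma IsCyclicAInf.isCyclicBasis {𝒞 : ℤ → Submodule K C} {γ : AInfData K C}
    (hγ : IsCyclicAInf 𝒞 γ) (he : IsEven 𝒞 γ) {b : Module.Basis ι K C} {deg : ι → ℤ}
    (hb : ∀ i, b i ∈ 𝒞 (deg i)) : IsCyclicBasis γ b deg where
  parity := corollaWeight_parity b hγ he hb
  cyclic x l y := by
    obtain ⟨s, s', rfl, h0, rfl, hs, hl, hl'⟩ := exists_rotated_states x l y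
    have e1 := corollaWeight_eq γ b s' hl'
    have e2 := corollaWeight_eq γ b s hl
    rw [h0] at e1
    rw [e1, e2]
    by_cases h2 : 2 ≤ l.length + 1
    · have hc := hγ.cyclicOp_rot hb ⟨∅, empty_mem_trees.2 h2⟩ h0 hs
      have h5 : (l.map (par deg)).sum + par deg (s (l.length + 1)) =
          ((List.range' 1 (l.length + 1)).map fun k => par deg (s k)).sum := by
        have h6 : (l.map (par deg)).sum + par deg (s (l.length + 1)) =
          ((l ++ [s (l.length + 1)]).map (par deg)).sum := by simp
        rw [h6, hl, List.map_map]
        rfl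
      rw [← corolla_eq_tree, rot_corolla, cyclicOp_smul] at hc
      calc _ = sg K ((l.length + 1 : ℕ) : ZMod 2) * (sg K ((l.length + 1 : ℕ) : ZMod 2) *
            cyclicOp γ b (corolla K (l.length + 1)) s') := by
            rw [← mul_assoc, sg_mul_self, one_mul]
        _ = _ := by
            rw [hc, ← mul_assoc, ← sg_add, h5]
            push_cast
            rfl
    · simp [corolla_eq_zero h2, cyclicOp]
  isUnit_det := isUnit_det_gram b hγ
  gram_symm x y := by
    have := hγ.inner_symm _ _ _ (hb x) _ (hb y)
    rw [neg_one_zpow_eq_sg, Int.cast_mul] at this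
    exact this
  gram_even x y hxy := cast_eq_of_modEq (he _ _ _ (hb x) _ (hb y) hxy)

end CyclicBasis

/-! ### The product of the vertex functionals as a multilinear form -/

section VertexForm

variable {K : Type*} [Field K] {C : Type*} [AddCommGroup C] [Module K C] {Γ : RibbonGraph}

namespace RibbonGraph.Labelling

lemma mem_list_iff (c : Γ.Labelling) {v : Γ.V} {x : Γ.H} :
    x ∈ c.root v :: c.rest v ↔ x ∈ Γ.cyc v := by
  rw [← c.cyc_eq v, Cycle.mem_coe_iff]

/-- The factor of the vertex form at the vertex `v`. -/
noncomputable def vertexFactor (c : Γ.Labelling) (γ : AInfData K C) (v : Γ.V)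
    (X : AInf K (c.arity v)) (x : Γ.H → C) : K :=
  γ.inner (γ.op (c.arity v) X fun k => x ((c.rest v).get k)) (x (c.root v))

variable (c : Γ.Labelling) (γ : AInfData K C) (X : ∀ v, AInf K (c.arity v))

lemma vertexFactor_update_of_notMem {v : Γ.V} (Y : AInf K (c.arity v)) {x : Γ.H → C} {y : Γ.H}
    (hy : y ∉ Γ.cyc v) (a : C) :
    c.vertexFactor γ v Y (Function.update x y a) = c.vertexFactor γ v Y x := by
  rw [← c.mem_list_iff, List.mem_cons, not_or] at hy
  rw [vertexFactor, vertexFactor, Function.update_of_ne (Ne.symm hy.1)]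
  congr 3
  funext k
  rw [Function.update_of_ne]
  rintro rfl
  exact hy.2 (List.get_mem _ _)

lemma vertexFactor_update_of_mem {v : Γ.V} (Y : AInf K (c.arity v)) (x : Γ.H → C) {y : Γ.H}
    (hy : y ∈ Γ.cyc v) :
    ∃ f : C →ₗ[K] K, ∀ a, c.vertexFactor γ v Y (Function.update x y a) = f a := by
  have hnd := c.nodup_list v
  rw [List.nodup_cons] at hnd
  rw [← c.mem_list_iff, List.mem_cons] at hy
  rcases hy with rfl | hy
  · refine ⟨γ.inner (γ.op (c.arity v) Y fun k => x ((c.rest v).get k)), fun a => ?_⟩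
    rw [vertexFactor, Function.update_self]
    congr 3
    funext k
    rw [Function.update_of_ne]
    intro h
    exact hnd.1 (h ▸ List.get_mem _ _)
  · obtain ⟨k, rfl⟩ := List.get_of_mem hy
    refine ⟨γ.inner.flip (x (c.root v)) ∘ₗ
      (γ.op (c.arity v) Y).toLinearMap (fun k => x ((c.rest v).get k)) k, fun a => ?_⟩
    rw [vertexFactor, Function.update_of_ne fun h => hnd.1 (by rw [h]; exact List.get_mem _ _)]
    have : (fun j => Function.update x ((c.rest v).get k) a ((c.rest v).get j)) =
        Function.update (fun j => x ((c.rest v).get j)) k a :=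
      Function.update_comp_eq_of_injective x (List.nodup_iff_injective_get.1 hnd.2) k a
    exact congrArg (fun z => γ.inner (γ.op (c.arity v) Y z) (x (c.root v))) this

/-- A half-edge lies at exactly one vertex, so a change of its argument affects one factor only, and
that factor linearly. -/
lemma exists_linear_update (x : Γ.H → C) (y : Γ.H) : ∃ f : C →ₗ[K] K, ∀ a,
    ∏ v, c.vertexFactor γ v (X v) (Function.update x y a) = f a := by
  obtain ⟨w, hw, huniq⟩ := Γ.existsUnique y
  obtain ⟨f, hf⟩ := c.vertexFactor_update_of_mem γ (X w) x hw
  refine ⟨(∏ v ∈ Finset.univ.erase w, c.vertexFactor γ v (X v) x) • f, fun a => ?_⟩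
  rw [← Finset.mul_prod_erase _ _ (Finset.mem_univ w), hf, LinearMap.smul_apply, smul_eq_mul,
    mul_comm]
  congr 1
  refine Finset.prod_congr rfl fun v hv => ?_
  exact c.vertexFactor_update_of_notMem γ (X v)
    (fun h => (Finset.mem_erase.1 hv).1 (huniq v h)) a

/-- The product over the vertices of the functionals `⟨ρ(X_v)(…), -⟩`. -/
noncomputable def vertexForm : MultilinearMap K (fun _ : Γ.H => C) K where
  toFun x := ∏ v, c.vertexFactor γ v (X v) x
  map_update_add' := by
    intro inst x y a a'
    obtain rfl : inst = Γ.decEqH := Subsingleton.elim _ _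
    obtain ⟨f, hf⟩ := c.exists_linear_update γ X x y
    rw [hf, hf, hf, map_add]
  map_update_smul' := by
    intro inst x y r a
    obtain rfl : inst = Γ.decEqH := Subsingleton.elim _ _
    obtain ⟨f, hf⟩ := c.exists_linear_update γ X x y
    rw [hf, hf, map_smul]

lemma vertexForm_apply (x : Γ.H → C) :
    c.vertexForm γ X x = ∏ v, c.vertexFactor γ v (X v) x := rfl

end RibbonGraph.Labelling

end VertexForm

/-! ### Independence of the basis -/

section BasisChange

variable {K : Type*} [Field K] {C : Type*} [AddCommGroup C] [Module K C]

/-- Fubini for a product over disjoint pairs of letters: an iterated edge sum with all weights equal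
to one. -/
lemma sum_prod_pairs {α ι : Type*} [Fintype α] [DecidableEq α] [Fintype ι] {ps : List (α × α)}
    (hps : (pairLetters ps).Nodup) (hmem : ∀ a, a ∈ pairLetters ps) (g : α × α → ι → ι → K) :
    ∑ s : α → ι, (ps.map fun p => g p (s p.1) (s p.2)).prod =
      (ps.map fun p => ∑ x, ∑ y, g p x y).prod := by
  have hps' : ps.Nodup := by
    rw [pairLetters, List.nodup_flatMap] at hps
    refine hps.2.imp fun {p q} hpq h => ?_
    subst h
    exact hpq (a := p.1) (by simp) (by simp)
  -- Without states there is no starting point for the iterated sum. In this case some letter exists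
  -- but has no states, so both sides are zero.
  rcases isEmpty_or_nonempty (α → ι) with he | ⟨⟨u⟩⟩
  · rw [Finset.univ_eq_empty, Finset.sum_empty]
    obtain ⟨⟨a⟩, hι⟩ : Nonempty α ∧ IsEmpty ι := by
      rwa [isEmpty_fun] at he
    have ha := hmem a
    rw [pairLetters, List.mem_flatMap] at ha
    obtain ⟨p, hp, -⟩ := ha
    exact (List.prod_eq_zero (List.mem_map.2 ⟨p, hp, by simp⟩)).symm
  · have h1 := edgeSum_eq_sum (fun _ _ => (1 : K)) hps hmem
      (fun s => (ps.map fun p => g p (s p.1) (s p.2)).prod) u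
    have h2 := edgeSum_flatMap_prod (fun _ _ => (1 : K)) hps' (ps := fun p => [p])
      (Φ := fun p s => g p (s p.1) (s p.2)) (S := fun p => {p.1, p.2}) ?_ ?_ ?_ ?_ u
    · rw [List.flatMap_singleton', h1] at h2
      simp only [List.map_const', List.prod_replicate, one_pow, mul_one] at h2
      rw [h2]
      refine congrArg List.prod (List.map_congr_left fun p hp => ?_)
      have hne : p.1 ≠ p.2 := by
        have := (List.nodup_flatMap.1 hps).1 p hp
        simpa using this
      simp only [edgeSum_cons, edgeSum_nil, one_mul, Function.update_self,
        Function.update_of_ne hne]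
    · intro p hp
      have := (List.nodup_flatMap.1 hps).1 p hp
      simpa [pairLetters] using this
    · intro p _ a ha
      simpa [pairLetters] using ha
    · intro p _ w w' hw
      rw [hw p.1 (by simp), hw p.2 (by simp)]
    · intro p hp q hq hpq
      rw [pairLetters, List.nodup_flatMap] at hps
      have : Std.Symm (Function.onFun List.Disjoint fun p : α × α => [p.1, p.2]) :=
        ⟨fun _ _ h => List.Disjoint.symm h⟩
      have h3 : (Function.onFun List.Disjoint fun p : α × α => [p.1, p.2]) p q :=
        hps.2.forall hp hq hpq
      rw [Set.disjoint_left]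
      intro a ha ha'
      exact h3 (a := a) (by simpa using ha) (by simpa using ha')

/-- The inverse of a bilinear form is a tensor in `C ⊗ C`, and its matrix transforms
contravariantly. -/
lemma propagator_basis_change {ι ι' : Type*} [Fintype ι] [DecidableEq ι] [Fintype ι']
    [DecidableEq ι'] {γ : AInfData K C} (b : Module.Basis ι K C) (b' : Module.Basis ι' K C)
    (hG : IsUnit (gram γ b).det) (x y : ι) :
    ∑ j, ∑ k, b.repr (b' j) x * b.repr (b' k) y * propagator γ b' j k = propagator γ b x y := by
  have h1 : b.toMatrix b' * b'.toMatrix b = 1 := b.toMatrix_mul_toMatrix_flip b'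
  have h2 : b'.toMatrix b * b.toMatrix b' = 1 := b'.toMatrix_mul_toMatrix_flip b
  have hg : gram γ b' = (b.toMatrix b').transpose * gram γ b * b.toMatrix b' := by
    ext j k
    simp only [Matrix.mul_apply, Matrix.transpose_apply, gram, Matrix.of_apply,
      Module.Basis.toMatrix_apply]
    conv_lhs => rw [← b.sum_repr (b' j), ← b.sum_repr (b' k)]
    simp only [map_sum, map_smul, LinearMap.sum_apply, LinearMap.smul_apply, smul_eq_mul,
      Finset.mul_sum, Finset.sum_mul]
    refine Finset.sum_congr rfl fun p _ => Finset.sum_congr rfl fun q _ => by ring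
  have hinv : (gram γ b')⁻¹ =
      b'.toMatrix b * (gram γ b)⁻¹ * (b'.toMatrix b).transpose := by
    refine Matrix.inv_eq_right_inv ?_
    rw [hg]
    calc _ = (b.toMatrix b').transpose * (gram γ b * ((b.toMatrix b' * b'.toMatrix b) *
          (gram γ b)⁻¹)) * (b'.toMatrix b).transpose := by simp only [Matrix.mul_assoc]
      _ = (b'.toMatrix b * b.toMatrix b').transpose := by
          rw [h1, Matrix.one_mul, Matrix.mul_nonsing_inv _ hG, Matrix.mul_one,
            Matrix.transpose_mul]
      _ = 1 := by rw [h2, Matrix.transpose_one]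
  have hfin : b.toMatrix b' * (gram γ b')⁻¹ * (b.toMatrix b').transpose = (gram γ b)⁻¹ := by
    rw [hinv]
    calc _ = (b.toMatrix b' * b'.toMatrix b) * (gram γ b)⁻¹ *
          ((b'.toMatrix b).transpose * (b.toMatrix b').transpose) := by
          simp only [Matrix.mul_assoc]
      _ = _ := by
          rw [← Matrix.transpose_mul, h1, Matrix.one_mul, Matrix.transpose_one, Matrix.mul_one]
  have h3 := congrFun (congrFun hfin x) y
  rw [propagator, ← h3]
  simp only [Matrix.mul_apply, Matrix.transpose_apply, Module.Basis.toMatrix_apply,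
    Finset.sum_mul, propagator]
  rw [Finset.sum_comm]
  refine Finset.sum_congr rfl fun j _ => Finset.sum_congr rfl fun k _ => by ring

/-- The contraction of a multilinear form on the half-edges along the edges, with signs which depend
on the parities of the states. -/
noncomputable def stateSum {H ι : Type*} [Fintype H] [DecidableEq H] [Fintype ι] [DecidableEq ι]
    (γ : AInfData K C) (b : Module.Basis ι K C) (deg : ι → ℤ) (ps : List (H × H))
    (ε : (H → ZMod 2) → K) (Ψ : MultilinearMap K (fun _ : H => C) K) : K :=
  ∑ s : H → ι, ε (fun x => par deg (s x)) * Ψ (fun x => b (s x)) *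
    (ps.map fun p => propagator γ b (s p.1) (s p.2)).prod

/-- The signs depend only on parities, and the base change never mixes parities. So the form can be
expanded multilinearly under the signs, and each edge is then treated by `propagator_basis_change`.
-/
theorem stateSum_basis_change {H ι ι' : Type*} [Fintype H] [DecidableEq H] [Fintype ι]
    [DecidableEq ι] [Fintype ι'] [DecidableEq ι'] {γ : AInfData K C} (b : Module.Basis ι K C)
    (deg : ι → ℤ) (b' : Module.Basis ι' K C) (deg' : ι' → ℤ)
    (hG : IsUnit (gram γ b).det) (hdeg : ∀ j i, b.repr (b' j) i ≠ 0 → par deg i = par deg' j)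
    {ps : List (H × H)} (hps : (pairLetters ps).Nodup) (hmem : ∀ a, a ∈ pairLetters ps)
    (ε : (H → ZMod 2) → K) (Ψ : MultilinearMap K (fun _ : H => C) K) :
    stateSum γ b' deg' ps ε Ψ = stateSum γ b deg ps ε Ψ := by
  have hprod : ∀ f : H → K, ∏ x, f x = (ps.map fun p => f p.1 * f p.2).prod := by
    intro f
    have : (Finset.univ : Finset H) = (pairLetters ps).toFinset := by
      ext a
      simp [hmem a]
    rw [this, List.prod_toFinset _ hps]
    clear this hmem hps
    induction ps with
    | nil => rfl
    | cons p ps ih => simp [ih, mul_assoc]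
  have hΨ : ∀ s' : H → ι', Ψ (fun x => b' (s' x)) =
      ∑ s : H → ι, (∏ x, b.repr (b' (s' x)) (s x)) * Ψ fun x => b (s x) := by
    intro s'
    have h1 : (fun x => b' (s' x)) = fun x => ∑ i, b.repr (b' (s' x)) i • b i :=
      funext fun x => (b.sum_repr _).symm
    rw [h1, MultilinearMap.map_sum]
    exact Finset.sum_congr rfl fun s _ => by rw [MultilinearMap.map_smul_univ, smul_eq_mul]
  unfold stateSum
  simp only [hΨ, Finset.mul_sum, Finset.sum_mul]
  rw [Finset.sum_comm]
  refine Finset.sum_congr rfl fun s _ => ?_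
  have h2 : ∀ s' : H → ι', ε (fun x => par deg' (s' x)) *
      ((∏ x, b.repr (b' (s' x)) (s x)) * Ψ fun x => b (s x)) *
        (ps.map fun p => propagator γ b' (s' p.1) (s' p.2)).prod =
      ε (fun x => par deg (s x)) * (Ψ fun x => b (s x)) *
        (ps.map fun p => b.repr (b' (s' p.1)) (s p.1) * b.repr (b' (s' p.2)) (s p.2) *
          propagator γ b' (s' p.1) (s' p.2)).prod := by
    intro s'
    rw [List.prod_map_mul, ← hprod fun x => b.repr (b' (s' x)) (s x)]
    by_cases h0 : ∏ x, b.repr (b' (s' x)) (s x) = 0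
    · rw [h0]
      ring
    · have h3 : (fun x => par deg' (s' x)) = fun x => par deg (s x) := funext fun x =>
        (hdeg _ _ (Finset.prod_ne_zero_iff.1 h0 x (Finset.mem_univ x))).symm
      rw [h3]
      ring
  rw [Finset.sum_congr rfl fun s' _ => h2 s', ← Finset.mul_sum,
    sum_prod_pairs hps hmem fun p j k => b.repr (b' j) (s p.1) * b.repr (b' k) (s p.2) *
      propagator γ b' j k]
  congr 2
  exact List.map_congr_left fun p _ => propagator_basis_change b b' hG _ _

end BasisChange

/-! ### Independence of the ordering and orientation of the edges -/

section EdgeOrderings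

namespace RibbonGraph.EdgeOrdering

variable {Γ Γ' : RibbonGraph}

/-- The edges, as pairs of half-edges. -/
def pairs (E : Γ.EdgeOrdering) : List (Γ.H × Γ.H) := E.heads.map fun x => (x, Γ.opp x)

lemma pairLetters_pairs (E : Γ.EdgeOrdering) :
    pairLetters E.pairs = E.heads.flatMap fun x => [x, Γ.opp x] := by
  simp [pairs, pairLetters, List.flatMap_map]

lemma nodup_pairs (E : Γ.EdgeOrdering) : (pairLetters E.pairs).Nodup := by
  rw [pairLetters_pairs]
  exact E.nodup

lemma mem_pairs (E : Γ.EdgeOrdering) (x : Γ.H) : x ∈ pairLetters E.pairs := by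
  rw [pairLetters_pairs]
  exact E.mem x

lemma mem_or (E : Γ.EdgeOrdering) (x : Γ.H) : x ∈ E.heads ∨ Γ.opp x ∈ E.heads := by
  obtain ⟨y, hy, hx⟩ := List.mem_flatMap.1 (E.mem x)
  simp only [List.mem_cons, List.not_mem_nil, or_false] at hx
  rcases hx with rfl | rfl
  · exact Or.inl hy
  · exact Or.inr (by rwa [Γ.opp_opp])

lemma opp_notMem (E : Γ.EdgeOrdering) {x : Γ.H} (hx : x ∈ E.heads) : Γ.opp x ∉ E.heads := by
  intro h
  have hs : Std.Symm (Function.onFun List.Disjoint fun x => [x, Γ.opp x]) :=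
    ⟨fun _ _ h => List.Disjoint.symm h⟩
  have h1 := ((List.nodup_flatMap.1 E.nodup).2).forall hx h (Γ.opp_ne x).symm
  exact h1 (a := Γ.opp x) (by simp) (by simp)

lemma nodup_heads (E : Γ.EdgeOrdering) : E.heads.Nodup := by
  refine (List.nodup_flatMap.1 E.nodup).2.imp fun {x y} h hxy => ?_
  subst hxy
  exact h (a := x) (by simp) (by simp)

/-- The transport of an edge ordering along an isomorphism. -/
def transport (E : Γ.EdgeOrdering) (φ : Γ.Iso Γ') : Γ'.EdgeOrdering where
  heads := E.heads.map φ.onH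
  nodup := by
    have e : ((E.heads.map φ.onH).flatMap fun x => [x, Γ'.opp x]) =
        (E.heads.flatMap fun x => [x, Γ.opp x]).map φ.onH := by
      simp [List.flatMap_map, List.map_flatMap, φ.map_opp]
    rw [e]
    exact E.nodup.map φ.onH.injective
  mem x := by
    have e : ((E.heads.map φ.onH).flatMap fun x => [x, Γ'.opp x]) =
        (E.heads.flatMap fun x => [x, Γ.opp x]).map φ.onH := by
      simp [List.flatMap_map, List.map_flatMap, φ.map_opp]
    rw [e]
    exact List.mem_map.2 ⟨φ.onH.symm x, E.mem _, by simp⟩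

lemma pairs_transport (E : Γ.EdgeOrdering) (φ : Γ.Iso Γ') :
    (E.transport φ).pairs = E.pairs.map (Prod.map φ.onH φ.onH) := by
  simp [transport, pairs, φ.map_opp]

end RibbonGraph.EdgeOrdering

/-- Edges are collected greedily. Keeping the set of used half-edges closed under `opp` ensures that
the partner of a new half-edge is also new. -/
lemma RibbonGraph.nonempty_edgeOrdering (Γ : RibbonGraph) : Nonempty Γ.EdgeOrdering := by
  have key : ∀ S : Finset Γ.H, ∃ l : List Γ.H, (l.flatMap fun x => [x, Γ.opp x]).Nodup ∧
      (∀ x ∈ S, x ∈ l.flatMap fun x => [x, Γ.opp x]) ∧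
      ∀ x, x ∈ (l.flatMap fun x => [x, Γ.opp x]) → Γ.opp x ∈ l.flatMap fun x => [x, Γ.opp x] := by
    intro S
    induction S using Finset.induction_on with
    | empty => exact ⟨[], by simp, by simp, by simp⟩
    | insert a S ha ih =>
      obtain ⟨l, h1, h2, h3⟩ := ih
      by_cases hal : a ∈ l.flatMap fun x => [x, Γ.opp x]
      · refine ⟨l, h1, fun x hx => ?_, h3⟩
        rcases Finset.mem_insert.1 hx with rfl | hx
        · exact hal
        · exact h2 x hx
      · refine ⟨a :: l, ?_, fun x hx => ?_, fun x hx => ?_⟩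
        · have hoa : Γ.opp a ∉ l.flatMap fun x => [x, Γ.opp x] := fun h =>
            hal (by simpa [Γ.opp_opp] using h3 _ h)
          rw [List.flatMap_cons, List.cons_append, List.cons_append, List.nil_append,
            List.nodup_cons, List.nodup_cons]
          refine ⟨?_, hoa, h1⟩
          rw [List.mem_cons, not_or]
          exact ⟨(Γ.opp_ne a).symm, hal⟩
        · rw [List.flatMap_cons, List.mem_append]
          rcases Finset.mem_insert.1 hx with rfl | hx
          · exact Or.inl (by simp)
          · exact Or.inr (h2 x hx)
        · rw [List.flatMap_cons, List.mem_append] at hx ⊢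
          rcases hx with hx | hx
          · left
            simp only [List.mem_cons, List.not_mem_nil, or_false] at hx ⊢
            rcases hx with rfl | rfl
            · exact Or.inr rfl
            · exact Or.inl (Γ.opp_opp _)
          · exact Or.inr (h3 x hx)
  obtain ⟨l, h1, h2, -⟩ := key Finset.univ
  exact ⟨⟨l, h1, fun x => h2 x (Finset.mem_univ x)⟩⟩

lemma kos_eq_zero {α : Type*} [DecidableEq α] {p : α → ZMod 2} {L : List α} (M : List α)
    (h : ∀ a ∈ L, p a = 0) : kos p L M = 0 := by
  rw [kos_congr M (q := fun _ => 0) h]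
  unfold kos
  rw [psum_congr (g := fun _ _ => 0) (by simp), psum_zero]

variable {K : Type*} [Field K] [CharZero K] {C : Type*} [AddCommGroup C] [Module K C]
  {ι : Type*} [Fintype ι] [DecidableEq ι]
  {γ : AInfData K C} {b : Module.Basis ι K C} {deg : ι → ℤ}

/-- Reversing an edge costs a Koszul sign that the symmetry of the propagator repays; permuting the
edges is free since each has even total parity wherever its propagator is nonzero. -/
lemma IsCyclicBasis.edge_reorder (hγ : IsCyclicBasis γ b deg) {Γ : RibbonGraph}
    (E E' : Γ.EdgeOrdering) (s : Γ.H → ι) {L : List Γ.H} (hL : L.Perm (pairLetters E.pairs)) :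
    sg K (kos (fun x => par deg (s x)) L (pairLetters E.pairs)) *
        (E.pairs.map fun p => propagator γ b (s p.1) (s p.2)).prod =
      sg K (kos (fun x => par deg (s x)) L (pairLetters E'.pairs)) *
        (E'.pairs.map fun p => propagator γ b (s p.1) (s p.2)).prod := by
  -- `g x` is the half which `E'` takes as the first one of the edge containing `x`.
  set g : Γ.H → Γ.H := fun x => if x ∈ E'.heads then x else Γ.opp x with hg
  have hgx : ∀ x, g x = x ∨ g x = Γ.opp x := fun x => by
    simp only [hg]
    split_ifs <;> simp
  have hg' : ∀ x, g x ∈ E'.heads := fun x => by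
    simp only [hg]
    split_ifs with h
    · exact h
    · exact (E'.mem_or x).resolve_left h
  have hperm : (E.heads.map g).Perm E'.heads := by
    refine (List.perm_ext_iff_of_nodup (E.nodup_heads.map_on ?_) E'.nodup_heads).2 fun y => ?_
    · intro x hx y hy hxy
      rcases hgx x with h1 | h1 <;> rcases hgx y with h2 | h2
      · rw [← h1, hxy, h2]
      · rw [h1, h2] at hxy
        exact absurd (hxy ▸ hx) (E.opp_notMem hy)
      · rw [h1, h2] at hxy
        exact absurd (hxy ▸ hy) (E.opp_notMem hx)
      · rw [h1, h2] at hxy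
        rw [← Γ.opp_opp x, hxy, Γ.opp_opp]
    · rw [List.mem_map]
      constructor
      · rintro ⟨x, -, rfl⟩
        exact hg' x
      · intro hy
        rcases E.mem_or y with h | h
        · exact ⟨y, h, by simp [hg, hy]⟩
        · refine ⟨_, h, ?_⟩
          simp only [hg]
          rw [if_neg (E'.opp_notMem hy), Γ.opp_opp]
  have hB : ∀ x ∈ E.heads, ([x, Γ.opp x] : List Γ.H).Perm [g x, Γ.opp (g x)] := fun x _ => by
    rcases hgx x with h | h
    · rw [h]
    · rw [h, Γ.opp_opp]
      exact List.Perm.swap _ _ _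
  have hp1 := flatMap_perm_right hB
  have hp2 : (E.heads.flatMap fun x => [g x, Γ.opp (g x)]).Perm
      (E'.heads.flatMap fun x => [x, Γ.opp x]) := by
    rw [← List.flatMap_map (f := g) (g := fun x => [x, Γ.opp x])]
    exact hperm.flatMap_right _
  have hn2 := hp1.nodup_iff.1 E.nodup
  have k1 := kos_flatMap_right (fun x => par deg (s x)) hn2 hB
  have e1 : (E.heads.flatMap fun x => [g x, Γ.opp (g x)]) =
      (E.heads.map g).flatMap fun x => [x, Γ.opp x] := by rw [List.flatMap_map]
  have k2 := kos_flatMap_left (fun x => par deg (s x)) hperm (fun x => [x, Γ.opp x])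
    (hperm.nodup_iff.2 E'.nodup_heads) (e1 ▸ hn2)
  rw [E.pairLetters_pairs] at hL ⊢
  rw [E'.pairLetters_pairs, kos_trans _ E'.nodup hL (hp1.trans hp2), kos_trans _ E'.nodup hp1 hp2,
    k1, e1, k2]
  have hh : (E.pairs.map fun p => propagator γ b (s p.1) (s p.2)).prod =
      sg K (E.heads.map fun x => kos (fun x => par deg (s x)) [x, Γ.opp x]
        [g x, Γ.opp (g x)]).sum *
      (E'.pairs.map fun p => propagator γ b (s p.1) (s p.2)).prod := by
    rw [RibbonGraph.EdgeOrdering.pairs, RibbonGraph.EdgeOrdering.pairs, List.map_map, List.map_map,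
      ← (hperm.map _).prod_eq, List.map_map, sg_list_sum, List.map_map, ← List.prod_map_mul]
    refine congrArg List.prod (List.map_congr_left fun x _ => ?_)
    simp only [Function.comp_apply]
    rcases hgx x with h | h
    · rw [h, kos_self _ (by simpa using (Γ.opp_ne x).symm), sg_zero, one_mul]
    · rw [h, Γ.opp_opp]
      have := kos_swap (fun x => par deg (s x)) (P := [x]) (Q := [Γ.opp x])
        (by simpa using (Γ.opp_ne x).symm)
      simp only [List.singleton_append, List.map_cons, List.map_nil, List.sum_cons, List.sum_nil,
        add_zero] at this
      rw [this, hγ.propagator_symm]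
  by_cases h0 : (E'.pairs.map fun p => propagator γ b (s p.1) (s p.2)).prod = 0
  · rw [hh, h0]
    ring
  · rw [kos_eq_zero (p := fun v => (([v, Γ.opp v] : List Γ.H).map fun x => par deg (s x)).sum),
      add_zero, sg_add, hh, mul_assoc]
    intro y hy
    obtain ⟨x, -, rfl⟩ := List.mem_map.1 hy
    have h1 : propagator γ b (s (g x)) (s (Γ.opp (g x))) ≠ 0 := fun h2 => h0
      (List.prod_eq_zero (List.mem_map.2 ⟨(g x, Γ.opp (g x)),
        List.mem_map.2 ⟨g x, hg' x, rfl⟩, h2⟩))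
    have h2 := hγ.propagator_even h1
    simp only [List.map_cons, List.map_nil, List.sum_cons, List.sum_nil, add_zero, h2]
    exact CharTwo.add_self_eq_zero _

end EdgeOrderings

/-! ### The Kontsevich weight and its invariance -/

section Weights

open RibbonGraph RibbonGraph.Labelling

variable {K : Type*} [Field K] {C : Type*} [AddCommGroup C] [Module K C]
  {ι : Type*} [Fintype ι] [DecidableEq ι]
  (γ : AInfData K C) (b : Module.Basis ι K C) (deg : ι → ℤ)

omit [Fintype ι] [DecidableEq ι] in
lemma vertexFactor_eq_cyclicOp {Γ : RibbonGraph} (c : Γ.Labelling) (v : Γ.V)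
    (X : AInf K (c.arity v)) (s : Γ.H → ι) :
    c.vertexFactor γ v X (fun x => b (s x)) = cyclicOp γ b X fun k => s (c.half v k) := by
  have e : (fun k : Fin (c.arity v) => b (s ((c.rest v).get k))) =
      tuple (c.arity v) fun k => b (s (c.half v k)) := by
    funext k
    simp only [tuple, half]
    rw [List.getD_eq_getElem _ _ (by simp; exact k.2)]
    simp
    rfl
  exact congrArg (fun z => γ.inner (γ.op (c.arity v) X z) (b (s (c.root v)))) e

omit [Fintype ι] [DecidableEq ι] in
lemma vertexFactor_corolla {Γ : RibbonGraph} (c : Γ.Labelling) (v : Γ.V) (s : Γ.H → ι) :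
    c.vertexFactor γ v (corolla K (c.arity v)) (fun x => b (s x)) =
      corollaWeight γ b ((c.rest v).map s) (s (c.root v)) := by
  rw [vertexFactor_eq_cyclicOp, ← corollaWeight_eq γ b (l := (c.rest v).map s), half_zero]
  rw [c.rest_eq_map_half, List.map_map]
  rfl

/-- The contraction of the functionals `⟨ρ(X_v)(…), -⟩` along the edges of a graph. -/
noncomputable def weightSum {Γ : RibbonGraph} (c : Γ.Labelling) (X : ∀ v, AInf K (c.arity v))
    (E : Γ.EdgeOrdering) : K :=
  stateSum γ b deg E.pairs (fun p => sg K (kos p c.halfEdgeList (pairLetters E.pairs)))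
    (c.vertexForm γ X)

/-- The value of the Kontsevich cocycle, computed in a basis. -/
noncomputable def graphWeight (G : OrientedRibbonGraph) (c : G.Γ.Labelling)
    (E : G.Γ.EdgeOrdering) : K :=
  (-1 : K) ^ G.Γ.deg * c.orientationSign K G.ori *
    (sg K (psum (fun v w => (c.arity v : ZMod 2) * c.arity w) c.verts) *
      weightSum γ b deg c (fun v => corolla K (c.arity v)) E)

lemma halfEdgeList_perm {Γ : RibbonGraph} (c : Γ.Labelling) (E : Γ.EdgeOrdering) :
    c.halfEdgeList.Perm (pairLetters E.pairs) := by
  refine (List.perm_ext_iff_of_nodup ?_ E.nodup_pairs).2 fun x => ⟨fun _ => E.mem_pairs x, fun _ => ?_⟩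
  · rw [halfEdgeList, List.nodup_flatMap]
    refine ⟨fun v _ => ?_, c.verts_nodup.imp fun {v w} hvw x hx hy => ?_⟩
    · exact List.perm_append_comm.nodup_iff.2 (c.nodup_list v)
    · have hx' := c.mem_list_iff.1 (List.perm_append_comm.mem_iff.1 hx :
        x ∈ [c.root v] ++ c.rest v)
      have hy' := c.mem_list_iff.1 (List.perm_append_comm.mem_iff.1 hy :
        x ∈ [c.root w] ++ c.rest w)
      exact hvw ((Γ.existsUnique x).unique hx' hy')
  · obtain ⟨v, hv, -⟩ := Γ.existsUnique x
    exact List.mem_flatMap.2 ⟨v, c.mem_verts v,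
      List.perm_append_comm.mem_iff.1 (c.mem_list_iff.2 hv : x ∈ [c.root v] ++ c.rest v)⟩

variable {γ b deg}

lemma IsCyclicBasis.corolla_parity (hγ : IsCyclicBasis γ b deg) {Γ : RibbonGraph} (c : Γ.Labelling)
    {s : Γ.H → ι} (h : c.vertexForm γ (fun v => corolla K (c.arity v)) (fun x => b (s x)) ≠ 0)
    (v : Γ.V) : ((c.rest v ++ [c.root v]).map fun x => par deg (s x)).sum = c.arity v := by
  rw [vertexForm_apply] at h
  have h1 := Finset.prod_ne_zero_iff.1 h v (Finset.mem_univ v)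
  rw [vertexFactor_corolla] at h1
  have h2 := hγ.parity _ _ h1
  rw [List.map_map, List.length_map] at h2
  simpa [arity, Function.comp_def] using h2

/-- The form of the weight used from here on: the basis is replaced by the reference one, and the
Koszul sign of evaluating the operations leaves the sum, because the total parity at `v` is `n_v`
for every contributing state. -/
theorem kontsevichWeight_eq (hγ : IsCyclicBasis γ b deg) {N : ℕ} (b' : Module.Basis (Fin N) K C)
    (deg' : Fin N → ℤ) (hdeg : ∀ j i, b.repr (b' j) i ≠ 0 → par deg i = par deg' j)
    (G : OrientedRibbonGraph) (c : G.Γ.Labelling) (E : G.Γ.EdgeOrdering) :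
    kontsevichWeight γ b' deg' G c E = graphWeight γ b deg G c E := by
  have h1 : kontsevichWeight γ b' deg' G c E = (-1 : K) ^ G.Γ.deg * c.orientationSign K G.ori *
      stateSum γ b' deg' E.pairs (fun p => sg K (psum (fun v w => (c.arity w : ZMod 2) *
        ((c.rest v ++ [c.root v]).map p).sum) c.verts) *
        sg K (kos p c.halfEdgeList (pairLetters E.pairs)))
      (c.vertexForm γ fun v => corolla K (c.arity v)) := by
    rw [kontsevichWeight, stateSum]
    congr 1
    refine Finset.sum_congr rfl fun s _ => ?_
    rw [koszulSign_eq, neg_one_zpow_eq_sg K (pairSum _ _), cast_pairSum, E.pairLetters_pairs,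
      EdgeOrdering.pairs, List.map_map]
    congr 4
    refine psum_congr fun v _ w _ => ?_
    have h2 : (2 : ZMod 2) = 0 := rfl
    push_cast
    rw [h2, sub_zero, List.map_map]
    rfl
  rw [h1, stateSum_basis_change b deg b' deg' hγ.isUnit_det hdeg E.nodup_pairs E.mem_pairs,
    graphWeight]
  congr 1
  rw [weightSum, stateSum, stateSum, Finset.mul_sum]
  refine Finset.sum_congr rfl fun s _ => ?_
  by_cases h0 : c.vertexForm γ (fun v => corolla K (c.arity v)) (fun x => b (s x)) = 0
  · rw [h0]
    ring
  · rw [psum_congr (g := fun v w => (c.arity v : ZMod 2) * c.arity w) fun v _ w _ => by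
      rw [hγ.corolla_parity c h0, mul_comm]]
    ring

/-- At a rotated vertex, cyclicity contributes `n_v` plus the parity of the root times that of the
other half-edges, and the Koszul sign of the half-edges contributes the same product; only `n_v`
survives. Reordering moves blocks of parity `n_v`. -/
theorem IsCyclicBasis.weightSum_relabelling [CharZero K] (hγ : IsCyclicBasis γ b deg)
    {Γ Γ' : RibbonGraph} {c : Γ.Labelling} {c' : Γ'.Labelling} {φ : Γ.Iso Γ'} {r : Γ.V → Bool}
    (h : c.IsRelabelling c' φ r) (E : Γ.EdgeOrdering) (E' : Γ'.EdgeOrdering) :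
    weightSum γ b deg c (fun v => corolla K (c.arity v)) E =
      sg K (kos (fun v => (c.arity v : ZMod 2)) c.verts (c'.verts.map φ.onV.symm) +
        (c.verts.map fun v => if r v then (c.arity v : ZMod 2) else 0).sum) *
      weightSum γ b deg c' (fun v => corolla K (c'.arity v)) E' := by
  rw [weightSum, weightSum, stateSum, stateSum, Finset.mul_sum]
  refine (Equiv.sum_comp (Equiv.arrowCongr φ.onH.symm (Equiv.refl ι)) _).symm.trans
    (Finset.sum_congr rfl fun s _ => ?_)
  have hs : ∀ x, (Equiv.arrowCongr φ.onH.symm (Equiv.refl ι)) s x = s (φ.onH x) := fun _ => rfl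
  simp only [hs]
  set p : Γ'.H → ZMod 2 := fun x => par deg (s x) with hp
  -- the vertices
  have hV : c.vertexForm γ (fun v => corolla K (c.arity v)) (fun x => b (s (φ.onH x))) =
      sg K (c.verts.map fun v => if r v then (c.arity v : ZMod 2) + p (φ.onH (c.root v)) *
        ((c.rest v).map fun x => p (φ.onH x)).sum else 0).sum *
      c'.vertexForm γ (fun v => corolla K (c'.arity v)) (fun x => b (s x)) := by
    have hsum : ∀ f : Γ.V → ZMod 2, (c.verts.map f).sum = ∑ v, f v := fun f => by
      rw [← List.sum_toFinset f c.verts_nodup]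
      congr 1
      ext v
      simp [c.mem_verts v]
    rw [vertexForm_apply, vertexForm_apply, hsum, sg_sum, ← φ.onV.prod_comp,
      ← Finset.prod_mul_distrib]
    refine Finset.prod_congr rfl fun v _ => ?_
    rw [vertexFactor_corolla γ b c v fun x => s (φ.onH x), vertexFactor_corolla]
    cases hr : r v
    · obtain ⟨h1, h2⟩ := h.of_false v hr
      rw [h1, h2, List.map_map]
      simp [sg_zero, Function.comp_def]
    · obtain ⟨l, y, h1, h2, h3⟩ := h.of_true v hr
      rw [h2, h3, List.map_cons, hγ.cyclic, h1]
      simp only [if_true, List.map_append, List.map_cons, List.map_nil, List.map_map, arity, h1,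
        List.length_append, List.length_map, List.length_cons, List.length_nil, List.sum_append,
        List.sum_cons, List.sum_nil, add_zero, zero_add, Nat.cast_add, Nat.cast_one, hp]
      rw [← mul_assoc]
      have e : ∀ z : ZMod 2, ∀ a : K, sg K z * sg K z * a = a := fun z a => by
        rw [sg_mul_self, one_mul]
      exact (e _ _).symm
  rw [hV]
  -- From here on the parity law holds at every vertex.
  by_cases h0 : c'.vertexForm γ (fun v => corolla K (c'.arity v)) (fun x => b (s x)) = 0
  · rw [h0]
    ring
  have hpar := hγ.corolla_parity c' h0
  -- the half-edges
  have e1 : c.halfEdgeList.map φ.onH = c.verts.flatMap fun v =>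
      (c.rest v ++ [c.root v]).map φ.onH := by
    rw [halfEdgeList, List.map_flatMap]
  have e2 : c'.halfEdgeList = (c'.verts.map φ.onV.symm).flatMap fun v =>
      c'.rest (φ.onV v) ++ [c'.root (φ.onV v)] := flatMap_verts c' φ _
  have hpB : ∀ v ∈ c.verts, ((c.rest v ++ [c.root v]).map φ.onH).Perm
      (c'.rest (φ.onV v) ++ [c'.root (φ.onV v)]) := by
    intro v _
    cases hr : r v
    · obtain ⟨h1, h2⟩ := h.of_false v hr
      rw [h1, h2, List.map_append]
      rfl
    · obtain ⟨l, y, h1, h2, h3⟩ := h.of_true v hr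
      rw [h1, h2, h3, List.map_append, List.map_append]
      exact List.perm_append_comm
  have hN' : c'.halfEdgeList.Nodup := (halfEdgeList_perm c' E').nodup_iff.2 E'.nodup_pairs
  have hN := hN'
  rw [e2] at hN
  have hN2 := ((verts_perm c c' φ).flatMap_right fun v =>
    c'.rest (φ.onV v) ++ [c'.root (φ.onV v)]).nodup_iff.2 hN
  have hph : (c.halfEdgeList.map φ.onH).Perm c'.halfEdgeList := by
    rw [e1, e2]
    exact (flatMap_perm_right hpB).trans ((verts_perm c c' φ).flatMap_right _)
  have hk : kos p (c.halfEdgeList.map φ.onH) c'.halfEdgeList =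
      kos (fun v => (c.arity v : ZMod 2)) c.verts (c'.verts.map φ.onV.symm) +
      (c.verts.map fun v => if r v then p (φ.onH (c.root v)) *
        ((c.rest v).map fun x => p (φ.onH x)).sum else 0).sum := by
    rw [e1, e2, kos_flatMap _ (verts_perm c c' φ) c.verts_nodup
      ((flatMap_perm_right hpB).nodup_iff.2 hN2) hpB]
    congr 1
    · refine kos_congr _ fun v hv => ?_
      rw [← h.arity_eq, ← hpar]
      exact ((hpB v hv).map _).sum_eq
    · refine congrArg List.sum (List.map_congr_left fun v hv => ?_)
      have hnd := (List.nodup_flatMap.1 hN2).1 v hv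
      cases hr : r v
      · obtain ⟨h1, h2⟩ := h.of_false v hr
        rw [h1, h2] at hnd ⊢
        rw [List.map_append]
        exact kos_self _ hnd
      · obtain ⟨l, y, h1, h2, h3⟩ := h.of_true v hr
        rw [h2, h3] at hnd ⊢
        have e3 : (c.rest v ++ [c.root v]).map φ.onH =
            (l.map φ.onH ++ [φ.onH y]) ++ [φ.onH (c.root v)] := by simp [h1]
        have e4 : φ.onH (c.root v) :: l.map φ.onH ++ [φ.onH y] =
            [φ.onH (c.root v)] ++ (l.map φ.onH ++ [φ.onH y]) := rfl
        rw [e4] at hnd ⊢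
        rw [e3, kos_swap _ (List.perm_append_comm.nodup_iff.2 hnd), h1]
        simp [mul_comm, Function.comp_def]
  -- the edges
  have hE := hγ.edge_reorder (E.transport φ) E' s (halfEdgeList_perm c' (E.transport φ))
  have e5 : kos (fun x => p (φ.onH x)) c.halfEdgeList (pairLetters E.pairs) =
      kos p (c.halfEdgeList.map φ.onH) c'.halfEdgeList +
        kos p c'.halfEdgeList (pairLetters (E.transport φ).pairs) := by
    rw [← kos_trans _ (E.transport φ).nodup_pairs hph (halfEdgeList_perm c' _),
      E.pairs_transport, pairLetters_map, kos_map _ _ (halfEdgeList_perm c E)]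
    exact fun x _ y _ hxy => φ.onH.injective hxy
  have e6 : (E.pairs.map fun q => propagator γ b (s (φ.onH q.1)) (s (φ.onH q.2))).prod =
      ((E.transport φ).pairs.map fun q => propagator γ b (s q.1) (s q.2)).prod := by
    rw [E.pairs_transport, List.map_map]
    rfl
  have e7 : (c.verts.map fun v => if r v then (c.arity v : ZMod 2) else 0).sum =
      (c.verts.map fun v => if r v then p (φ.onH (c.root v)) *
        ((c.rest v).map fun x => p (φ.onH x)).sum else 0).sum +
      (c.verts.map fun v => if r v then (c.arity v : ZMod 2) + p (φ.onH (c.root v)) *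
        ((c.rest v).map fun x => p (φ.onH x)).sum else 0).sum := by
    rw [← List.sum_map_add]
    refine congrArg List.sum (List.map_congr_left fun v _ => ?_)
    have h2 : (2 : ZMod 2) = 0 := rfl
    split_ifs
    · linear_combination -(p (φ.onH (c.root v)) * ((c.rest v).map fun x => p (φ.onH x)).sum) * h2
    · simp
  rw [e5, e6, hk, e7]
  simp only [sg_add]
  linear_combination
    (sg K (kos (fun v => (c.arity v : ZMod 2)) c.verts (c'.verts.map φ.onV.symm)) *
      sg K (c.verts.map fun v => if r v then p (φ.onH (c.root v)) *
        ((c.rest v).map fun x => p (φ.onH x)).sum else 0).sum *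
      sg K (c.verts.map fun v => if r v then (c.arity v : ZMod 2) + p (φ.onH (c.root v)) *
        ((c.rest v).map fun x => p (φ.onH x)).sum else 0).sum *
      c'.vertexForm γ (fun v => corolla K (c'.arity v)) (fun x => b (s x))) * hE

/-- The sign by which the contraction changes is also the sign by which `A_Γ` changes, so only the
change of orientation remains. -/
theorem IsCyclicBasis.graphWeight_relabelling [CharZero K] (hγ : IsCyclicBasis γ b deg)
    {G G' : OrientedRibbonGraph} {c : G.Γ.Labelling} {c' : G'.Γ.Labelling} {φ : G.Γ.Iso G'.Γ}
    {r : G.Γ.V → Bool} (h : c.IsRelabelling c' φ r) (E : G.Γ.EdgeOrdering)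
    (E' : G'.Γ.EdgeOrdering) : graphWeight γ b deg G c E =
      sg K (kos (fun _ => 1) (G.ori.map (Sum.map φ.onV φ.onH)) G'.ori) •
        graphWeight γ b deg G' c' E' := by
  rw [graphWeight, graphWeight, hγ.weightSum_relabelling h E E', h.deg_eq,
    h.orientationSign_eq K G.ori_nodup G.mem_ori G'.ori_nodup G'.mem_ori, smul_eq_mul]
  have e : psum (fun v w => (c'.arity v : ZMod 2) * c'.arity w) c'.verts =
      psum (fun v w => (c.arity v : ZMod 2) * c.arity w) c.verts := by
    have hv : c'.verts = (c'.verts.map φ.onV.symm).map φ.onV := by simp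
    rw [hv, psum_map]
    simp only [h.arity_eq]
    exact (psum_perm (verts_perm c c' φ) fun _ _ _ _ => mul_comm _ _).symm
  rw [e]
  have := sg_mul_self K (kos (fun v => (c.arity v : ZMod 2)) c.verts (c'.verts.map φ.onV.symm) +
    (c.verts.map fun v => if r v then (c.arity v : ZMod 2) else 0).sum)
  linear_combination ((-1 : K) ^ G.Γ.deg *
    sg K (kos (fun _ => 1) (G.ori.map (Sum.map φ.onV φ.onH)) G'.ori) *
    c'.orientationSign K G'.ori *
    sg K (psum (fun v w => (c.arity v : ZMod 2) * c.arity w) c.verts) *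
    weightSum γ b deg c' (fun v => corolla K (c'.arity v)) E') * this

/-- The Kontsevich cocycle is well defined, and it may be computed in any cyclic basis. -/
theorem IsCyclicBasis.existsUnique_cocycle [CharZero K] (hγ : IsCyclicBasis γ b deg)
    {𝒞 : ℤ → Submodule K C} (hb : ∀ i, b i ∈ 𝒞 (deg i))
    (h𝒞 : ∀ (p : ℤ) x i, x ∈ 𝒞 p → b.repr x i ≠ 0 → deg i = p) :
    (∃! κ : GraphComplex K →ₗ[K] K, IsKontsevichCocycle 𝒞 γ κ) ∧
      ∀ κ, IsKontsevichCocycle 𝒞 γ κ → ∀ G c E, κ (graphClass K G) = graphWeight γ b deg G c E := by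
  have hall : ∀ {N : ℕ} (b' : Module.Basis (Fin N) K C) (deg' : Fin N → ℤ),
      (∀ i, b' i ∈ 𝒞 (deg' i)) → ∀ G c E,
      kontsevichWeight γ b' deg' G c E = graphWeight γ b deg G c E := fun b' deg' hb' G c E =>
    kontsevichWeight_eq hγ b' deg' (fun j i hij => by rw [par, h𝒞 _ _ _ (hb' j) hij]) G c E
  have heval : ∀ κ, IsKontsevichCocycle 𝒞 γ κ → ∀ G c E,
      κ (graphClass K G) = graphWeight γ b deg G c E := fun κ hκ G c E => by
    rw [hκ _ (b.reindex (Fintype.equivFin ι)) (fun i => deg ((Fintype.equivFin ι).symm i))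
      (fun i => by rw [Module.Basis.reindex_apply]; exact hb _) G c E, hall]
    exact fun i => by rw [Module.Basis.reindex_apply]; exact hb _
  refine ⟨?_, heval⟩
  obtain ⟨κ, hκ, huniq⟩ := existsUnique_descent
    (fun G c => graphWeight γ b deg G c (nonempty_edgeOrdering G.Γ).some)
    (fun G G' c c' φ r h => hγ.graphWeight_relabelling h _ _)
  have hE : ∀ (G : OrientedRibbonGraph) (c : G.Γ.Labelling) (E E' : G.Γ.EdgeOrdering),
      graphWeight γ b deg G c E = graphWeight γ b deg G c E' := fun G c E E' => by
    rw [hγ.graphWeight_relabelling (isRelabelling_of_eq (c := c) (c' := c) fun _ => rfl) E E']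
    have : Sum.map (RibbonGraph.Iso.refl G.Γ).onV (RibbonGraph.Iso.refl G.Γ).onH = id := by
      simp [RibbonGraph.Iso.refl]
    rw [this, List.map_id, kos_self _ G.ori_nodup, sg_zero, one_smul]
  refine ⟨κ, fun N b' deg' hb' G c E => ?_, fun κ' hκ' => huniq κ' fun G c => heval κ' hκ' _ _ _⟩
  rw [hκ G c, hall b' deg' hb']
  exact hE _ _ _ _

end Weights

/-- The inner letters of each block have even total parity and can be moved out of all the blocks
for free; what remains are the signs inside the blocks and that of the outer letters. -/
lemma kos_flatMap_inner {X V : Type*} [DecidableEq X] (p : X → ZMod 2) {vs : List V}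
    {B ext inn : V → List X} {O : List X} (hN : (vs.flatMap fun v => ext v ++ inn v).Nodup)
    (hB : ∀ v ∈ vs, (B v).Perm (ext v ++ inn v)) (hO : (vs.flatMap ext).Perm O)
    (hinn : ∀ v ∈ vs, ((inn v).map p).sum = 0) :
    kos p (vs.flatMap B) (O ++ vs.flatMap inn) =
      (vs.map fun v => kos p (B v) (ext v ++ inn v)).sum + kos p (vs.flatMap ext) O := by
  have p1 := flatMap_perm_right hB
  have p2 := flatMap_append_perm' vs ext inn
  have p3 : (vs.flatMap ext ++ vs.flatMap inn).Perm (O ++ vs.flatMap inn) := hO.append_right _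
  have n2 := p2.nodup_iff.1 hN
  have n3 := p3.nodup_iff.1 n2
  rw [kos_trans p n3 p1 (p2.trans p3), kos_trans p n3 p2 p3, kos_flatMap_right p hN hB,
    kos_distrib p vs ext inn hN, kos_append_right p n3 hO,
    psum_congr (g := fun _ _ => 0) fun v hv w _ => by rw [hinn v hv, zero_mul], psum_zero, zero_add]

lemma flatMap_map_fst {X : Type*} {f : X → X} {ps : List (X × X)} (h : ∀ p ∈ ps, p.2 = f p.1) :
    ((ps.map Prod.fst).flatMap fun x => [x, f x]) = pairLetters ps := by
  rw [List.flatMap_map, pairLetters]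
  exact List.flatMap_congr fun p hp => by rw [h p hp]

lemma map_map_fst {X : Type*} {f : X → X} {ps : List (X × X)} (h : ∀ p ∈ ps, p.2 = f p.1) :
    (ps.map Prod.fst).map (fun x => (x, f x)) = ps := by
  rw [List.map_map]
  refine (List.map_congr_left fun p hp => ?_).trans (List.map_id _)
  exact Prod.ext rfl (h p hp).symm

lemma kos_treeOri {n : ℕ} {L L' : List (ℕ × ℕ)} (hp : L.Perm L') (hL : L.Nodup)
    (h : ∀ e ∈ L, e.1 < e.2 ∧ e ≠ (1, n)) :
    (treeOri n L).Perm (treeOri n L') ∧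
      kos (fun _ => 1) (treeOri n L) (treeOri n L') = kos (fun _ => 1) L L' := by
  have hN' : (treeOri n L').Nodup := nodup_treeOri (hp.nodup_iff.1 hL) fun e he =>
    h e (hp.mem_iff.2 he)
  have hN : (treeOri n L).Nodup := nodup_treeOri hL h
  refine ⟨(hp.flatMap_right _).append_right _, ?_⟩
  unfold treeOri at hN hN' ⊢
  rw [kos_append_right _ hN' (hp.flatMap_right _), kos_flatMap_left _ hp _ hL
    (List.Nodup.of_append_left hN)]
  exact kos_congr _ fun v _ => by simp; rfl

lemma treeIntegrand_congr {K : Type*} [Field K] {A : Type*} [AddCommGroup A] [Module K A]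
    (α : AInfData K A) {ι : Type*} (b : Module.Basis ι K A) (deg : ι → ℤ) {n : ℕ} (T : PTree n)
    (ord L : List (ℕ × ℕ)) {w w' : Lab → ι} (h : ∀ a ∈ ord.flatMap T.nodeHalves, w a = w' a) :
    treeIntegrand α b deg T ord L w = treeIntegrand α b deg T ord L w' := by
  rw [treeIntegrand, treeIntegrand, vertexProd, vertexProd]
  congr 1
  · rw [kos_congr _ fun a ha => by rw [h a ha]]
  · refine congrArg List.prod (List.map_congr_left fun I hI => ?_)
    have h1 : w (I, false) = w' (I, false) := h _ (List.mem_flatMap.2 ⟨I, hI, by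
      simp [PTree.nodeHalves]⟩)
    rw [h1, List.map_congr_left fun J hJ => h (J, true) (List.mem_flatMap.2 ⟨I, hI, by
      simp [PTree.nodeHalves, hJ]⟩)]

/-! ### Labellings and edges of an expanded graph -/

namespace RibbonGraph.Labelling

variable {Γ : RibbonGraph} (c : Γ.Labelling) (T : ∀ v, PTree (c.arity v))
  {ord L : Γ.V → List (ℕ × ℕ)} (hE : ∀ v, IsEnumeration (T v) (ord v) (L v))

/-- The labelling of `Γ(T_1, …, T_k)` for which the root of each vertex is its outgoing half-edge. -/
def expandLabelling : (c.expand T).Labelling where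
  verts := c.verts.flatMap fun v => (ord v).map (c.labVertex T v)
  root x := c.outHalf T x.1 x.2.1
  rest x := ((T x.1).children x.2.1).map (c.inHalf T x.1)
  verts_nodup := by
    rw [List.nodup_flatMap]
    refine ⟨fun v _ => (hE v).nodup_ord.map_on fun I hI J hJ h => ?_,
      c.verts_nodup.imp fun {v w} hvw x hx hy => ?_⟩
    · rw [c.labVertex_of_mem T (((hE v).mem_ord I).1 hI),
        c.labVertex_of_mem T (((hE v).mem_ord J).1 hJ)] at h
      exact congrArg Subtype.val (eq_of_heq (Sigma.mk.inj h).2)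
    · obtain ⟨I, hI, rfl⟩ := List.mem_map.1 hx
      obtain ⟨J, hJ, h⟩ := List.mem_map.1 hy
      rw [c.labVertex_of_mem T (((hE v).mem_ord I).1 hI),
        c.labVertex_of_mem T (((hE w).mem_ord J).1 hJ)] at h
      exact hvw (congrArg Sigma.fst h).symm
  mem_verts := by
    rintro ⟨v, I, hI⟩
    exact List.mem_flatMap.2 ⟨v, c.mem_verts v, List.mem_map.2 ⟨I, ((hE v).mem_ord I).2 hI,
      c.labVertex_of_mem T hI⟩⟩
  cyc_eq x := rfl

/-- The labels of the half-edges of `T_v`. -/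
def treeHalves (L : Γ.V → List (ℕ × ℕ)) (v : Γ.V) : List Lab :=
  extHalves (c.arity v) ++ pairLetters (edgePairs (L v))

lemma halfEdgeList_expandLabelling : (c.expandLabelling T hE).halfEdgeList =
    c.verts.flatMap fun v => ((ord v).flatMap (T v).nodeHalves).map (c.labHalf T v) := by
  have e : (c.expandLabelling T hE).halfEdgeList =
    ((c.verts.flatMap fun v => (ord v).map (c.labVertex T v)).flatMap fun x : c.ExpandV T =>
      ((T x.1).children x.2.1).map (c.inHalf T x.1) ++ [c.outHalf T x.1 x.2.1] :
        List (c.ExpandH T)) := rfl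
  refine e.trans ?_
  rw [List.flatMap_assoc]
  refine List.flatMap_congr fun v _ => ?_
  rw [List.flatMap_map, List.map_flatMap]
  refine List.flatMap_congr fun I hI => ?_
  rw [c.labVertex_of_mem T (((hE v).mem_ord I).1 hI)]
  simp only [PTree.nodeHalves, List.map_append, List.map_map, List.map_cons, List.map_nil]
  rfl

lemma nodup_halfEdgeList {Γ : RibbonGraph} (c : Γ.Labelling) : c.halfEdgeList.Nodup :=
  (halfEdgeList_perm c Γ.nonempty_edgeOrdering.some).nodup_iff.2
    Γ.nonempty_edgeOrdering.some.nodup_pairs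

lemma mem_halfEdgeList {Γ : RibbonGraph} (c : Γ.Labelling) (x : Γ.H) : x ∈ c.halfEdgeList :=
  (halfEdgeList_perm c Γ.nonempty_edgeOrdering.some).mem_iff.2
    (Γ.nonempty_edgeOrdering.some.mem_pairs x)

include hE in
lemma nodup_flatMap_treeHalves :
    (c.verts.flatMap fun v => (c.treeHalves L v).map (c.labHalf T v)).Nodup := by
  have h := (c.expandLabelling T hE).nodup_halfEdgeList
  rw [halfEdgeList_expandLabelling] at h
  exact (flatMap_perm_right fun v _ => ((hE v).halves_perm.map _)).nodup_iff.1 h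

lemma map_labHalf_extHalves (v : Γ.V) : (extHalves (c.arity v)).map (c.labHalf T v) =
    (c.rest v ++ [c.root v]).map Sum.inl := by
  rw [extHalves, List.map_append, List.map_append, c.rest_eq_map_half, leafHalves]
  simp [c.labHalf_root, c.labHalf_leaf]

lemma flatMap_extHalves : (c.verts.flatMap fun v => (extHalves (c.arity v)).map (c.labHalf T v)) =
    c.halfEdgeList.map Sum.inl := by
  rw [halfEdgeList, List.map_flatMap]
  exact List.flatMap_congr fun v _ => c.map_labHalf_extHalves T v

include hE in
lemma labHalf_injOn {v : Γ.V} {x y : Lab} (hx : x ∈ c.treeHalves L v) (hy : y ∈ c.treeHalves L v)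
    (h : c.labHalf T v x = c.labHalf T v y) : x = y :=
  List.inj_on_of_nodup_map ((List.nodup_flatMap.1 (c.nodup_flatMap_treeHalves T hE)).1 v
    (c.mem_verts v)) hx hy h

/-- The edges inside the trees, as pairs of half-edges. -/
def innerPairs (L : Γ.V → List (ℕ × ℕ)) : List (c.ExpandH T × c.ExpandH T) :=
  c.verts.flatMap fun v => (edgePairs (L v)).map (Prod.map (c.labHalf T v) (c.labHalf T v))

lemma pairLetters_innerPairs : pairLetters (c.innerPairs T L) =
    c.verts.flatMap fun v => (pairLetters (edgePairs (L v))).map (c.labHalf T v) := by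
  rw [innerPairs, pairLetters_flatMap]
  exact List.flatMap_congr fun v _ => pairLetters_map _ _

/-- The pairs of half-edges of the edges of `Γ(T_1, …, T_k)`. -/
def expandPairs (L : Γ.V → List (ℕ × ℕ)) (E : Γ.EdgeOrdering) :
    List (c.ExpandH T × c.ExpandH T) :=
  E.pairs.map (Prod.map Sum.inl Sum.inl) ++ c.innerPairs T L

include hE in
lemma halfEdgeList_perm_expandPairs (E : Γ.EdgeOrdering) :
    (c.expandLabelling T hE).halfEdgeList.Perm (pairLetters (c.expandPairs T L E)) := by
  rw [halfEdgeList_expandLabelling]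
  change List.Perm (α := c.ExpandH T) _ (pairLetters (α := c.ExpandH T) _)
  rw [expandPairs, pairLetters_append, pairLetters_map, pairLetters_innerPairs]
  refine (flatMap_perm_right (B' := fun v => (extHalves (c.arity v)).map (c.labHalf T v) ++
    (pairLetters (edgePairs (L v))).map (c.labHalf T v)) fun v _ => ?_).trans
    ((flatMap_append_perm' _ _ _).trans ?_)
  · rw [← List.map_append]
    exact (hE v).halves_perm.map _
  · rw [flatMap_extHalves]
    exact ((halfEdgeList_perm c E).map _).append_right _

include hE in
lemma expandPairs_opp (E : Γ.EdgeOrdering) (p : c.ExpandH T × c.ExpandH T)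
    (hp : p ∈ c.expandPairs T L E) : p.2 = c.expandOpp T p.1 := by
  rw [expandPairs, List.mem_append] at hp
  rcases hp with hp | hp
  · obtain ⟨q, hq, rfl⟩ := List.mem_map.1 hp
    obtain ⟨x, -, rfl⟩ := List.mem_map.1 hq
    rfl
  · obtain ⟨v, -, hv⟩ := List.mem_flatMap.1 hp
    obtain ⟨q, hq, rfl⟩ := List.mem_map.1 hv
    obtain ⟨e, he, rfl⟩ := List.mem_map.1 hq
    have he' := ((hE v).mem_edges e).1 he
    simp only [Prod.map_apply]
    rw [c.labHalf_of_mem T (x := (e, false)) he', c.labHalf_of_mem T (x := (e, true)) he']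
    rfl

/-- The ordering of the edges of `Γ(T_1, …, T_k)` which begins with the edges of `Γ`. -/
def expandEdgeOrdering (E : Γ.EdgeOrdering) : (c.expand T).EdgeOrdering where
  heads := (c.expandPairs T L E).map Prod.fst
  nodup := by
    have h := (c.halfEdgeList_perm_expandPairs T hE E).nodup_iff.1
      (c.expandLabelling T hE).nodup_halfEdgeList
    exact (congrArg List.Nodup (flatMap_map_fst (c.expandPairs_opp T hE E))).mpr h
  mem x := by
    have h := (c.halfEdgeList_perm_expandPairs T hE E).mem_iff.1
      ((c.expandLabelling T hE).mem_halfEdgeList x)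
    exact (congrArg (x ∈ ·) (flatMap_map_fst (c.expandPairs_opp T hE E))).mpr h

lemma pairs_expandEdgeOrdering (E : Γ.EdgeOrdering) :
    (c.expandEdgeOrdering T hE E).pairs = c.expandPairs T L E := by
  exact map_map_fst (c.expandPairs_opp T hE E)

end RibbonGraph.Labelling

open RibbonGraph RibbonGraph.Labelling

lemma RibbonGraph.Labelling.prod_eq_prod_verts {Γ : RibbonGraph} (c : Γ.Labelling) {M : Type*}
    [CommMonoid M] (f : Γ.V → M) : ∏ v, f v = (c.verts.map f).prod := by
  rw [← List.prod_toFinset f c.verts_nodup]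
  congr 1
  ext v
  simp [c.mem_verts v]

lemma prod_map_flatMap {M α κ : Type*} [CommMonoid M] (f : α → M) (B : κ → List α) (l : List κ) :
    ((l.flatMap B).map f).prod = (l.map fun v => ((B v).map f).prod).prod := by
  induction l with
  | nil => simp
  | cons a l ih => simp [ih]

/-! ### The cocycle on expanded graphs -/

section

variable {K : Type*} [Field K] {C : Type*} [AddCommGroup C] [Module K C]
  {ι : Type*} [Fintype ι] [DecidableEq ι]
  (γ : AInfData K C) (b : Module.Basis ι K C) (deg : ι → ℤ)
  {Γ : RibbonGraph} (c : Γ.Labelling) (T : ∀ v, PTree (c.arity v))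
  {ord L : Γ.V → List (ℕ × ℕ)} (hE : ∀ v, IsEnumeration (T v) (ord v) (L v))

omit [Fintype ι] [DecidableEq ι] in
lemma vertexForm_expandLabelling (s : c.ExpandH T → ι) :
    (c.expandLabelling T hE).vertexForm γ (fun x => corolla K ((c.expandLabelling T hE).arity x))
      (fun x => b (s x)) =
    (c.verts.map fun v => vertexProd γ b (T v) (ord v) fun a => s (c.labHalf T v a)).prod := by
  rw [vertexForm_apply, (c.expandLabelling T hE).prod_eq_prod_verts]
  have e : ∀ x : c.ExpandV T, (c.expandLabelling T hE).vertexFactor γ x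
      (corolla K ((c.expandLabelling T hE).arity x)) (fun x => b (s x)) =
      corollaWeight γ b (((T x.1).children x.2.1).map fun J => s (c.labHalf T x.1 (J, true)))
        (s (c.labHalf T x.1 (x.2.1, false))) := fun x => by
    refine (vertexFactor_corolla γ b (c.expandLabelling T hE) x s).trans ?_
    exact congrArg (fun l => corollaWeight γ b l (s (c.labHalf T x.1 (x.2.1, false))))
      (List.map_map (l := (T x.1).children x.2.1) (f := c.inHalf T x.1) (g := s))
  have e2 : ((c.expandLabelling T hE).verts.map fun x : c.ExpandV T =>
      (c.expandLabelling T hE).vertexFactor γ x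
      (corolla K ((c.expandLabelling T hE).arity x)) (fun x => b (s x))) =
      (c.verts.flatMap fun v => (ord v).map (c.labVertex T v)).map fun x : c.ExpandV T =>
        corollaWeight γ b (((T x.1).children x.2.1).map fun J => s (c.labHalf T x.1 (J, true)))
        (s (c.labHalf T x.1 (x.2.1, false))) := List.map_congr_left fun x _ => e x
  refine (congrArg List.prod e2).trans ?_
  rw [prod_map_flatMap]
  refine congrArg List.prod (List.map_congr_left fun v _ => ?_)
  rw [vertexProd, List.map_map]
  refine congrArg List.prod (List.map_congr_left fun I hI => ?_)
  rw [Function.comp_apply, c.labVertex_of_mem T (((hE v).mem_ord I).1 hI)]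

variable {γ b deg}

-- With the states on the half-edges of `Γ` fixed, the Koszul sign splits over the vertices of `Γ`,
-- the sum over the internal edges factors accordingly, and each factor is the expansion of one
-- tree.
include hE in
lemma IsCyclicBasis.edgeSum_innerPairs [CharZero K] (hγ : IsCyclicBasis γ b deg)
    (hX : ∀ v, HasExpansion γ b deg (T v) (ord v) (L v)) (E : Γ.EdgeOrdering)
    (w : c.ExpandH T → ι) :
    edgeSum (propagator γ b) (c.innerPairs T L) (fun z =>
        sg K (kos (fun x => par deg (z x))
          (c.verts.flatMap fun v => ((ord v).flatMap (T v).nodeHalves).map (c.labHalf T v))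
          (pairLetters (c.expandPairs T L E))) *
        (c.verts.map fun v => vertexProd γ b (T v) (ord v) fun a => z (c.labHalf T v a)).prod) w =
      sg K (c.verts.map fun v => treeSign (T v) (ord v) (L v)).sum *
        (sg K (kos (fun x => par deg (w (Sum.inl x))) c.halfEdgeList (pairLetters E.pairs)) *
          (c.verts.map fun v => cyclicOp γ b (oriented K (c.arity v) (L v))
            fun k => w (Sum.inl (c.half v k))).prod) := by
  have hN := c.nodup_flatMap_treeHalves T hE
  have hN0 : (c.verts.flatMap fun v => (extHalves (c.arity v)).map (c.labHalf T v) ++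
      (pairLetters (edgePairs (L v))).map (c.labHalf T v)).Nodup := by
    simpa only [treeHalves, List.map_append] using hN
  have hinN : (pairLetters (c.innerPairs T L)).Nodup := by
    rw [pairLetters_innerPairs]
    exact List.Nodup.of_append_right ((flatMap_append_perm' _ _ _).nodup_iff.1 hN0)
  have hin : ∀ v a, a ∈ pairLetters (edgePairs (L v)) → a ∈ c.treeHalves L v :=
    fun v a ha => List.mem_append_right _ ha
  have hout : ∀ x : Γ.H, (Sum.inl x : c.ExpandH T) ∉ pairLetters (c.innerPairs T L) := by
    intro x hx
    rw [pairLetters_innerPairs] at hx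
    obtain ⟨v, -, hv⟩ := List.mem_flatMap.1 hx
    obtain ⟨a, ha, hax⟩ := List.mem_map.1 hv
    rw [c.labHalf_of_mem T (((hE v).mem_edges _).1 (mem_pairLetters_edgePairs.1 ha))] at hax
    cases hax
  -- splitting the sign
  have h1 : edgeSum (propagator γ b) (c.innerPairs T L) (fun z =>
        sg K (kos (fun x => par deg (z x))
          (c.verts.flatMap fun v => ((ord v).flatMap (T v).nodeHalves).map (c.labHalf T v))
          (pairLetters (c.expandPairs T L E))) *
        (c.verts.map fun v => vertexProd γ b (T v) (ord v) fun a => z (c.labHalf T v a)).prod) w =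
      edgeSum (propagator γ b) (c.innerPairs T L) (fun z =>
        sg K (kos (fun x => par deg (w (Sum.inl x))) c.halfEdgeList (pairLetters E.pairs)) *
        (c.verts.map fun v => treeIntegrand γ b deg (T v) (ord v) (L v)
          fun a => z (c.labHalf T v a)).prod) w := by
    refine edgeSum_congr _ hinN fun z hz hp => ?_
    have hk := kos_flatMap_inner (fun x => par deg (z x)) (vs := c.verts)
      (B := fun v => ((ord v).flatMap (T v).nodeHalves).map (c.labHalf T v))
      (O := (pairLetters E.pairs).map Sum.inl) hN0
      (fun v _ => by rw [← List.map_append]; exact (hE v).halves_perm.map _)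
      (by rw [flatMap_extHalves]; exact (halfEdgeList_perm c E).map _)
      (fun v hv => by
        rw [List.map_map]
        refine sum_pairLetters_eq_zero (π := fun a => par deg (z (c.labHalf T v a))) fun p hp' =>
          hγ.propagator_even (hp (Prod.map (c.labHalf T v) (c.labHalf T v) p) ?_)
        exact List.mem_flatMap.2 ⟨v, hv, List.mem_map.2 ⟨p, hp', rfl⟩⟩)
    rw [flatMap_extHalves, ← pairLetters_innerPairs] at hk
    rw [expandPairs, pairLetters_append, pairLetters_map, hk, sg_add,
      kos_map (fun x => par deg (z x)) Sum.inl (halfEdgeList_perm c E)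
        (fun x _ y _ h => Sum.inl_injective h)]
    rw [kos_congr (q := fun x => par deg (w (Sum.inl x))) _ fun x _ => by rw [hz _ (hout x)]]
    simp only [treeIntegrand]
    rw [List.prod_map_mul, sg_list_sum, List.map_map]
    have e : (c.verts.map (sg K ∘ fun v => kos (fun x => par deg (z x))
        (((ord v).flatMap (T v).nodeHalves).map (c.labHalf T v))
        ((extHalves (c.arity v)).map (c.labHalf T v) ++
          (pairLetters (edgePairs (L v))).map (c.labHalf T v)))).prod =
        (c.verts.map fun v => sg K (kos (fun a => par deg (z (c.labHalf T v a)))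
          ((ord v).flatMap (T v).nodeHalves)
          (extHalves (c.arity v) ++ pairLetters (edgePairs (L v))))).prod := by
      refine congrArg List.prod (List.map_congr_left fun v _ => ?_)
      rw [Function.comp_apply, ← List.map_append, kos_map _ _ (hE v).halves_perm]
      exact fun x hx y hy => c.labHalf_injOn T hE hx hy
    rw [e]
    ring
  rw [h1, edgeSum_mul_left, innerPairs, edgeSum_flatMap_prod (propagator γ b) c.verts_nodup
    (S := fun v => {x | x ∈ (c.treeHalves L v).map (c.labHalf T v)})
    (Φ := fun v z => treeIntegrand γ b deg (T v) (ord v) (L v) fun a => z (c.labHalf T v a))]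
  · rw [sg_list_sum, List.map_map, mul_left_comm, ← List.prod_map_mul]
    congr 2
    refine List.map_congr_left fun v _ => ?_
    rw [edgeSum_map (propagator γ b) (S := {a | a ∈ c.treeHalves L v})
      (Ψ := treeIntegrand γ b deg (T v) (ord v) (L v)) (u' := fun a => w (c.labHalf T v a))
      (fun x hx y hy => c.labHalf_injOn T hE hx hy) (fun a ha => hin v a ha) _ (fun _ _ => rfl),
      Function.comp_apply]
    · have h2 := congrArg (sg K (treeSign (T v) (ord v) (L v)) * ·)
        (hX v fun a => w (c.labHalf T v a))
      rw [← mul_assoc, sg_mul_self, one_mul] at h2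
      rw [← h2]
      refine congrArg (_ * ·) (congrArg _ (funext fun k => ?_))
      rw [extState]
      split_ifs with hk
      · rw [labHalf_root, hk]
        rfl
      · rw [labHalf_leaf]
    · intro z z' hz
      exact treeIntegrand_congr γ b deg _ _ _ fun a ha => hz a ((hE v).halves_perm.mem_iff.1 ha)
  · intro v hv
    rw [pairLetters_map]
    exact (List.Nodup.of_append_right ((List.nodup_flatMap.1 hN0).1 v hv))
  · intro v _ a ha
    rw [pairLetters_map] at ha
    obtain ⟨x, hx, rfl⟩ := List.mem_map.1 ha
    exact List.mem_map_of_mem (hin v x hx)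
  · intro v _ z z' hz
    refine treeIntegrand_congr γ b deg _ _ _ fun a ha => hz _ ?_
    exact List.mem_map_of_mem ((hE v).halves_perm.mem_iff.1 ha)
  · intro v hv v' hv' hne
    have hs : Std.Symm (Function.onFun List.Disjoint
        fun v => (c.treeHalves L v).map (c.labHalf T v)) :=
      ⟨fun _ _ h => List.Disjoint.symm h⟩
    have := ((List.nodup_flatMap.1 hN).2).forall hv hv' hne
    exact Set.disjoint_left.2 fun x hx hy => this hx hy

/-- The edges of the expanded graph are those of `Γ` followed by the internal ones. Carrying out the
inner sums leaves a contraction over `Γ` with the trees at its vertices. -/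
theorem IsCyclicBasis.weightSum_expandLabelling [CharZero K] (hγ : IsCyclicBasis γ b deg)
    (hX : ∀ v, HasExpansion γ b deg (T v) (ord v) (L v)) (E : Γ.EdgeOrdering) :
    weightSum γ b deg (c.expandLabelling T hE)
        (fun x => corolla K ((c.expandLabelling T hE).arity x)) (c.expandEdgeOrdering T hE E) =
      sg K (c.verts.map fun v => treeSign (T v) (ord v) (L v)).sum *
        weightSum γ b deg c (fun v => oriented K (c.arity v) (L v)) E := by
  have hH : Nonempty Γ.H := ⟨c.root Γ.nonempty.some⟩
  have hmem : ∀ x : c.ExpandH T, x ∈ pairLetters (c.expandPairs T L E) := fun x =>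
    (c.halfEdgeList_perm_expandPairs T hE E).mem_iff.1
      ((c.expandLabelling T hE).mem_halfEdgeList x)
  have hnd : (pairLetters (c.expandPairs T L E)).Nodup :=
    (c.halfEdgeList_perm_expandPairs T hE E).nodup_iff.1
      (c.expandLabelling T hE).nodup_halfEdgeList
  have e1 : weightSum γ b deg (c.expandLabelling T hE)
        (fun x => corolla K ((c.expandLabelling T hE).arity x)) (c.expandEdgeOrdering T hE E) =
      ∑ s : c.ExpandH T → ι, (sg K (kos (fun x => par deg (s x))
          (c.verts.flatMap fun v => ((ord v).flatMap (T v).nodeHalves).map (c.labHalf T v))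
          (pairLetters (c.expandPairs T L E))) *
        (c.verts.map fun v => vertexProd γ b (T v) (ord v) fun a => s (c.labHalf T v a)).prod) *
        ((c.expandPairs T L E).map fun p => propagator γ b (s p.1) (s p.2)).prod := by
    rw [weightSum, stateSum, pairs_expandEdgeOrdering, halfEdgeList_expandLabelling]
    exact Finset.sum_congr rfl fun s _ => congrArg
      (fun z => sg K (kos (fun x => par deg (s x))
          (c.verts.flatMap fun v => ((ord v).flatMap (T v).nodeHalves).map (c.labHalf T v))
          (pairLetters (c.expandPairs T L E))) * z *
        ((c.expandPairs T L E).map fun p => propagator γ b (s p.1) (s p.2)).prod)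
      (vertexForm_expandLabelling γ b c T hE s)
  have e2 : ∀ s : Γ.H → ι, c.vertexForm γ (fun v => oriented K (c.arity v) (L v))
      (fun x => b (s x)) = (c.verts.map fun v => cyclicOp γ b (oriented K (c.arity v) (L v))
            fun k => s (c.half v k)).prod := fun s => by
    rw [vertexForm_apply, c.prod_eq_prod_verts]
    exact congrArg List.prod (List.map_congr_left fun v _ => vertexFactor_eq_cyclicOp γ b c v _ s)
  rw [e1, weightSum, stateSum]
  simp only [e2]
  -- If the basis is empty there are no states at all, since `Γ` has half-edges; both sums are
  -- empty.
  rcases isEmpty_or_nonempty ι with hι | ⟨⟨i⟩⟩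
  · have : IsEmpty (c.ExpandH T → ι) := ⟨fun s => hι.elim (s (Sum.inl hH.some))⟩
    have : IsEmpty (Γ.H → ι) := ⟨fun s => hι.elim (s hH.some)⟩
    simp
  · rw [← edgeSum_eq_sum (propagator γ b) hnd hmem _ fun _ => i, expandPairs, edgeSum_append,
      ← edgeSum_eq_sum (propagator γ b) E.nodup_pairs E.mem_pairs _ fun _ => i, ← edgeSum_mul_left]
    refine edgeSum_map (propagator γ b) (S := Set.univ) Sum.inl_injective.injOn
      (fun _ _ => Set.mem_univ _) ?_ (fun _ _ => rfl)
    intro w w' hw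
    have := hγ.edgeSum_innerPairs c T hE hX E w
    rw [expandPairs] at this
    rw [this]
    simp only [hw _ (Set.mem_univ _)]

lemma vertexForm_smul (a : Γ.V → K) (X : ∀ v, AInf K (c.arity v)) :
    c.vertexForm γ (fun v => a v • X v) = (∏ v, a v) • c.vertexForm γ X := by
  ext x
  rw [vertexForm_apply, smul_apply, vertexForm_apply, smul_eq_mul,
    ← Finset.prod_mul_distrib]
  refine Finset.prod_congr rfl fun v _ => ?_
  simp only [vertexFactor, map_smul, smul_apply, LinearMap.smul_apply, smul_eq_mul]

lemma weightSum_smul (a : Γ.V → K) (X : ∀ v, AInf K (c.arity v)) (E : Γ.EdgeOrdering) :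
    weightSum γ b deg c (fun v => a v • X v) E = (∏ v, a v) * weightSum γ b deg c X E := by
  rw [weightSum, weightSum, stateSum, stateSum, vertexForm_smul, Finset.mul_sum]
  refine Finset.sum_congr rfl fun s _ => ?_
  rw [smul_apply, smul_eq_mul]
  ring

-- Both orders run through the trees one after the other, so the sign is the sum of those for
-- passing from edge order to vertex order within each tree.
omit [Fintype ι] [DecidableEq ι] in
lemma kos_expandStd_expandLabelling [DecidableEq (c.ExpandV T ⊕ c.ExpandH T)] :
    kos (fun _ => 1) (c.expandStd T) (c.expandLabelling T hE).standardOri =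
      (c.verts.map fun v => kos (fun _ => 1) (L v) (T v).edgeList +
        kos (fun _ => 1) (treeOri (c.arity v) (L v)) ((T v).stdOri (ord v))).sum := by
  have e : (c.expandLabelling T hE).standardOri = c.verts.flatMap fun v =>
      ((T v).stdOri (ord v)).map (Sum.map (c.labVertex T v) (c.labHalf T v)) := by
    have e : (c.expandLabelling T hE).standardOri =
      ((c.verts.flatMap fun v => (ord v).map (c.labVertex T v)).flatMap fun x : c.ExpandV T =>
        Sum.inl x :: (c.outHalf T x.1 x.2.1 ::
          ((T x.1).children x.2.1).map (c.inHalf T x.1)).map Sum.inr :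
            List (c.ExpandV T ⊕ c.ExpandH T)) := rfl
    refine e.trans ?_
    rw [List.flatMap_assoc]
    refine List.flatMap_congr fun v _ => ?_
    rw [List.flatMap_map, PTree.stdOri, List.map_flatMap]
    refine List.flatMap_congr fun I hI => ?_
    rw [c.labVertex_of_mem T (((hE v).mem_ord I).1 hI)]
    simp only [List.map_map, List.map_cons, Sum.map_inl,
      Sum.map_inr, c.labVertex_of_mem T (((hE v).mem_ord I).1 hI)]
    rfl
  have hN : (c.verts.flatMap fun v =>
      ((T v).stdOri (ord v)).map (Sum.map (c.labVertex T v) (c.labHalf T v))).Nodup := by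
    have := (c.expandLabelling T hE).nodup_standardOri
    rw [e] at this
    exact this
  have hL : ∀ v, (T v).edgeList.Perm (L v) := fun v =>
    (List.perm_ext_iff_of_nodup (T v).nodup_edgeList (hE v).nodup_edges).2 fun x => by
      rw [(T v).mem_edgeList, (hE v).mem_edges]
  have hk := fun v => kos_treeOri (n := c.arity v) (hL v) (T v).nodup_edgeList fun x hx =>
    (hE v).edge_lt x ((hL v).mem_iff.1 hx)
  rw [e, expandStd, kos_flatMap_right _ hN fun v _ => ((hk v).1.trans (hE v).ori_perm).map _]
  refine congrArg List.sum (List.map_congr_left fun v hv => ?_)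
  have hv' := (List.nodup_flatMap.1 hN).1 v hv
  rw [kos_map _ _ ((hk v).1.trans (hE v).ori_perm)
    (fun x hx y hy => List.inj_on_of_nodup_map hv' hx hy),
    kos_trans _ (List.Nodup.of_map _ hv') (hk v).1 (hE v).ori_perm, (hk v).2,
    kos_symm _ (hE v).nodup_edges (hL v)]

omit [Fintype ι] [DecidableEq ι] in
lemma RibbonGraph.Labelling.arity_expandLabelling (x : c.ExpandV T) :
    (c.expandLabelling T hE).arity x = ((T x.1).children x.2.1).length :=
  List.length_map (c.inHalf T x.1)

-- Pairs of vertices within one tree and in two trees are separated; the arities within the tree at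
-- `v` add up to `n_v + t_v`.
omit [Fintype ι] [DecidableEq ι] in
lemma psum_arity_expandLabelling :
    psum (fun x y => ((c.expandLabelling T hE).arity x : ZMod 2) *
      (c.expandLabelling T hE).arity y) (c.expandLabelling T hE).verts =
    (c.verts.map fun v => psum (fun I J => (((T v).children I).length : ZMod 2) *
      ((T v).children J).length) (ord v)).sum +
    psum (fun v w => ((c.arity v : ZMod 2) + (T v).1.card) * (c.arity w + (T w).1.card)) c.verts := by
  have e : psum (fun x y => ((c.expandLabelling T hE).arity x : ZMod 2) *
      (c.expandLabelling T hE).arity y) (c.expandLabelling T hE).verts =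
      psum (fun x y : c.ExpandV T => (((T x.1).children x.2.1).length : ZMod 2) *
        ((T y.1).children y.2.1).length)
        (c.verts.flatMap fun v => (ord v).map (c.labVertex T v)) :=
    psum_congr fun x _ y _ => congrArg₂ (fun m n : ℕ => (m : ZMod 2) * n)
      (c.arity_expandLabelling T hE x) (c.arity_expandLabelling T hE y)
  have hlen : ∀ v, ∀ I ∈ ord v, ((T (c.labVertex T v I).1).children (c.labVertex T v I).2.1) =
      (T v).children I := fun v I hI => by
    rw [c.labVertex_of_mem T (((hE v).mem_ord I).1 hI)]
  rw [e, psum_mul_flatMap]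
  congr 1
  · refine congrArg List.sum (List.map_congr_left fun v _ => ?_)
    rw [psum_map]
    exact psum_congr fun I hI J hJ => by rw [hlen v I hI, hlen v J hJ]
  · have hs : ∀ v, (((ord v).map (c.labVertex T v)).map fun x : c.ExpandV T =>
        (((T x.1).children x.2.1).length : ZMod 2)).sum = (c.arity v : ZMod 2) + (T v).1.card := by
      intro v
      have h1 := congrArg (Nat.cast : ℕ → ZMod 2) (hE v).sum_length
      rw [Nat.cast_add, Nat.cast_list_sum, List.map_map] at h1
      rw [← h1, List.map_map]
      exact congrArg List.sum (List.map_congr_left fun I hI => by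
        simp only [Function.comp_apply]
        rw [hlen v I hI])
    exact psum_congr fun v _ w _ => by rw [hs, hs]

-- Modulo 2 the degree is the sum of the arities, and a tree contributes `n_v + t_v` in place of
-- `n_v`.
omit [Fintype ι] [DecidableEq ι] in
include hE in
lemma cast_deg_expand :
    ((c.expand T).deg : ZMod 2) = Γ.deg + (c.verts.map fun v => ((T v).1.card : ZMod 2)).sum := by
  have h2 : (2 : ZMod 2) = 0 := rfl
  have hs : ∀ {Γ : RibbonGraph} (c : Γ.Labelling) (f : Γ.V → ZMod 2),
      ∑ v, f v = (c.verts.map f).sum := fun c f => by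
    rw [← List.sum_toFinset f c.verts_nodup]
    congr 1
    ext v
    simp [c.mem_verts v]
  rw [c.deg_eq, (c.expandLabelling T hE).deg_eq]
  push_cast
  simp only [h2, sub_zero]
  rw [hs c, hs (c.expandLabelling T hE), ← List.sum_map_add]
  have e : ((c.expandLabelling T hE).verts.map fun x =>
      ((c.expandLabelling T hE).arity x : ZMod 2)) =
      (c.verts.flatMap fun v => (ord v).map (c.labVertex T v)).map fun x : c.ExpandV T =>
        (((T x.1).children x.2.1).length : ZMod 2) :=
    List.map_congr_left fun x _ =>
      congrArg (Nat.cast : ℕ → ZMod 2) (c.arity_expandLabelling T hE x)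
  rw [e, sum_map_flatMap]
  refine congrArg List.sum (List.map_congr_left fun v _ => ?_)
  have h1 := congrArg (Nat.cast : ℕ → ZMod 2) (hE v).sum_length
  rw [Nat.cast_add, Nat.cast_list_sum, List.map_map] at h1
  rw [← h1, List.map_map]
  exact congrArg List.sum (List.map_congr_left fun I hI => by
    simp only [Function.comp_apply]
    rw [c.labVertex_of_mem T (((hE v).mem_ord I).1 hI)])

-- The signs belonging to single trees in the degree, the orientation, the pair sum and the
-- expansions cancel. Only the sign from pairs of different trees, of parities `n_v + t_v`, is left.
include hE in
theorem IsCyclicBasis.graphWeight_stdExpansion [CharZero K] (hγ : IsCyclicBasis γ b deg)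
    (hX : ∀ v, HasExpansion γ b deg (T v) (ord v) (L v)) (E : Γ.EdgeOrdering) :
    ∃ c' E', graphWeight γ b deg (c.stdExpansion T) c' E' =
      (-1 : K) ^ Γ.deg * (sg K (psum (fun v w => ((c.arity v : ZMod 2) + (T v).1.card) *
        (c.arity w + (T w).1.card)) c.verts) *
          weightSum γ b deg c (fun v => tree (T v)) E) := by
  refine ⟨c.expandLabelling T hE, c.expandEdgeOrdering T hE E, ?_⟩
  let _ : DecidableEq (c.ExpandV T ⊕ c.ExpandH T) :=
    inferInstanceAs (DecidableEq ((c.expand T).V ⊕ (c.expand T).H))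
  have ho : (c.expandLabelling T hE).orientationSign K (c.expandStd T) =
      sg K (c.verts.map fun v => kos (fun _ => 1) (L v) (T v).edgeList +
        kos (fun _ => 1) (treeOri (c.arity v) (L v)) ((T v).stdOri (ord v))).sum := by
    rw [← kos_expandStd_expandLabelling c T hE]
    exact permSign_eq K _ _
  have ht : (fun v => oriented K (c.arity v) (L v)) =
      fun v => sg K (kos (fun _ => 1) (L v) (T v).edgeList) • tree (T v) :=
    funext fun v => oriented_eq_smul_tree (T v) (hE v).nodup_edges (hE v).mem_edges
  have hw : graphWeight γ b deg (c.stdExpansion T) (c.expandLabelling T hE)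
      (c.expandEdgeOrdering T hE E) = (-1 : K) ^ (c.expand T).deg *
      (c.expandLabelling T hE).orientationSign K (c.expandStd T) *
      (sg K (psum (fun x y => ((c.expandLabelling T hE).arity x : ZMod 2) *
      (c.expandLabelling T hE).arity y) (c.expandLabelling T hE).verts) *
      weightSum γ b deg (c.expandLabelling T hE)
        (fun x => corolla K ((c.expandLabelling T hE).arity x)) (c.expandEdgeOrdering T hE E)) := rfl
  rw [hw, ho, psum_arity_expandLabelling, hγ.weightSum_expandLabelling c T hE hX, ht,
    weightSum_smul, c.prod_eq_prod_verts, neg_one_zpow_eq_sg, neg_one_zpow_eq_sg,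
    cast_deg_expand c T hE]
  have e : (c.verts.map fun v => sg K (kos (fun _ => 1) (L v) (T v).edgeList)).prod =
      sg K (c.verts.map fun v => kos (fun _ => 1) (L v) (T v).edgeList).sum := by
    rw [sg_list_sum, List.map_map]
    rfl
  rw [e]
  simp only [treeSign, List.sum_map_add]
  generalize (c.verts.map fun v => kos (fun _ => 1) (L v) (T v).edgeList).sum = x1
  generalize (c.verts.map fun v =>
    kos (fun _ => 1) (treeOri (c.arity v) (L v)) ((T v).stdOri (ord v))).sum = x2
  generalize (c.verts.map fun v => ((T v).1.card : ZMod 2)).sum = x3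
  generalize (c.verts.map fun v => psum (fun I J => (((T v).children I).length : ZMod 2) *
      ((T v).children J).length) (ord v)).sum = x4
  generalize psum (fun v w => ((c.arity v : ZMod 2) + (T v).1.card) *
        (c.arity w + (T w).1.card)) c.verts = x5
  generalize ((Γ.deg : ℤ) : ZMod 2) = x6
  have key : sg K (x6 + x3) * sg K (x1 + x2) * (sg K (x4 + x5) * (sg K (x3 + x4 + x2) * sg K x1)) =
      sg K x6 * sg K x5 := by
    simp only [← sg_add]
    congr 1
    have h2 : (2 : ZMod 2) = 0 := rfl
    linear_combination (x1 + x2 + x3 + x4) * h2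
  linear_combination (weightSum γ b deg c (fun v => tree (T v)) E) * key

/-- The value of the Kontsevich cocycle on a graph obtained by inserting trees is computed from the
operations given by the trees. -/
theorem IsCyclicAInf.cocycle_stdExpansion [CharZero K] {𝒞 : ℤ → Submodule K C}
    (hγ : IsCyclicAInf 𝒞 γ) (he : IsEven 𝒞 γ) (hb : ∀ i, b i ∈ 𝒞 (deg i))
    (h𝒞 : ∀ (p : ℤ) x i, x ∈ 𝒞 p → b.repr x i ≠ 0 → deg i = p)
    {κ : GraphComplex K →ₗ[K] K} (hκ : IsKontsevichCocycle 𝒞 γ κ) (E : Γ.EdgeOrdering) :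
    κ (graphClass K (c.stdExpansion T)) =
      (-1 : K) ^ Γ.deg * (sg K (psum (fun v w => ((c.arity v : ZMod 2) + (T v).1.card) *
        (c.arity w + (T w).1.card)) c.verts) *
          weightSum γ b deg c (fun v => tree (T v)) E) := by
  have hB := hγ.isCyclicBasis he hb
  choose ord L hE hX using fun v =>
    exists_hasExpansion b hγ he hb (fun _ _ h => hB.propagator_even h) (T v)
  obtain ⟨c', E', h⟩ := hB.graphWeight_stdExpansion c T hE hX E
  rw [← h]
  exact (hB.existsUnique_cocycle hb h𝒞).2 κ hκ _ _ _

end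

/-! ### Homogeneous bases -/

section HomogeneousBases

variable {K : Type*} [Field K] {A : Type*} [AddCommGroup A] [Module K A]
  {B : Type*} [AddCommGroup B] [Module K B] {ι κ : Type*}

/-- The basis `b` consists of homogeneous elements `b i` of degree `deg i`. -/
structure IsHomogeneousBasis (𝒜 : ℤ → Submodule K A) (b : Module.Basis ι K A) (deg : ι → ℤ) :
    Prop where
  mem : ∀ i, b i ∈ 𝒜 (deg i)
  deg_eq : ∀ (p : ℤ) x i, x ∈ 𝒜 p → b.repr x i ≠ 0 → deg i = p

lemma exists_isHomogeneousBasis [Module.Finite K A] {𝒜 : ℤ → Submodule K A}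
    (h : DirectSum.IsInternal 𝒜) :
    ∃ (N : ℕ) (b : Module.Basis (Fin N) K A) (deg : Fin N → ℤ), IsHomogeneousBasis 𝒜 b deg := by
  let v : ∀ p, Module.Basis _ K (𝒜 p) := fun p => Module.Basis.ofVectorSpace K (𝒜 p)
  let b := h.collectedBasis v
  have hf : Finite (Σ p, Module.Basis.ofVectorSpaceIndex K (𝒜 p)) := Module.Finite.finite_basis b
  have := Fintype.ofFinite (Σ p, Module.Basis.ofVectorSpaceIndex K (𝒜 p))
  let e := Fintype.equivFin (Σ p, Module.Basis.ofVectorSpaceIndex K (𝒜 p))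
  refine ⟨_, b.reindex e, fun i => (e.symm i).1, fun i => ?_, fun p x i hx hi => ?_⟩
  · rw [Module.Basis.reindex_apply]
    exact h.collectedBasis_mem v _
  · rw [Module.Basis.repr_reindex_apply] at hi
    by_contra hne
    exact hi (h.collectedBasis_repr_of_mem_ne v (Ne.symm hne) hx)

variable {𝒜 : ℤ → Submodule K A} {ℬ : ℤ → Submodule K B} {b : Module.Basis ι K A} {deg : ι → ℤ}
  {b' : Module.Basis κ K B} {deg' : κ → ℤ}

lemma IsHomogeneousBasis.tensor (h : IsHomogeneousBasis 𝒜 b deg)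
    (h' : IsHomogeneousBasis ℬ b' deg') :
    IsHomogeneousBasis (tensorGrading 𝒜 ℬ) (b.tensorProduct b') fun i => deg i.1 + deg' i.2 where
  mem i := by
    rw [Module.Basis.tensorProduct_apply']
    exact Submodule.subset_span ⟨_, _, rfl, _, h.mem _, _, h'.mem _, rfl⟩
  deg_eq p x i hx := by
    refine Submodule.span_induction (p := fun x _ => (b.tensorProduct b').repr x i ≠ 0 →
      deg i.1 + deg' i.2 = p) ?_ (by simp) ?_ ?_ hx
    · rintro _ ⟨r, s, rfl, y, hy, z, hz, rfl⟩ hne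
      rw [Module.Basis.tensorProduct_repr_tmul_apply, smul_eq_mul] at hne
      rw [h.deg_eq r y i.1 hy (right_ne_zero_of_mul hne),
        h'.deg_eq s z i.2 hz (left_ne_zero_of_mul hne)]
    · intro y z _ _ hy hz hne
      by_cases h0 : (b.tensorProduct b').repr y i = 0
      · exact hz fun h1 => hne (by rw [map_add, Finsupp.add_apply, h0, h1, add_zero])
      · exact hy h0
    · intro a y _ hy hne
      exact hy fun h0 => hne (by rw [map_smul, Finsupp.smul_apply, h0, smul_zero])

/-- The operator which multiplies an element of degree `p` by `(-1)^p`. -/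
noncomputable def signOp (b : Module.Basis ι K A) (deg : ι → ℤ) : A →ₗ[K] A :=
  b.constr K fun i => ((-1 : K) ^ deg i) • b i

lemma IsHomogeneousBasis.signOp_apply [Fintype ι] (h : IsHomogeneousBasis 𝒜 b deg) {p : ℤ} {x : A}
    (hx : x ∈ 𝒜 p) : signOp b deg x = ((-1 : K) ^ p) • x := by
  conv_rhs => rw [← b.sum_repr x]
  rw [signOp, Module.Basis.constr_apply_fintype, Finset.smul_sum]
  refine Finset.sum_congr rfl fun i _ => ?_
  rw [b.equivFun_apply]
  by_cases h0 : b.repr x i = 0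
  · simp [h0]
  · rw [h.deg_eq p x i hx h0, smul_comm]

end HomogeneousBases

/-! ### Existence and uniqueness of the tensor product -/

section TensorProducts

/-- A sequence with the given first terms. -/
def stretch {M : Type*} {n : ℕ} (z : M) (f : Fin n → M) (k : ℕ) : M :=
  if h : k - 1 < n then f ⟨k - 1, h⟩ else z

lemma tuple_stretch {M : Type*} {n : ℕ} (z : M) (f : Fin n → M) : tuple n (stretch z f) = f := by
  funext k
  simp [tuple, stretch]

/-- The exponent of the sign in the definition of the operations on a tensor product. -/
def tensorExponent (n : ℕ) (t : ℤ) (p q : ℕ → ℤ) : ℤ :=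
  ∑ j ∈ Finset.Icc 1 n, ∑ i ∈ Finset.Ico 1 j, q i * p j + t * ∑ j ∈ Finset.Icc 1 n, p j

lemma tensorExponent_congr {n : ℕ} (t : ℤ) {p q p' q' : ℕ → ℤ}
    (hp : ∀ k ∈ Finset.Icc 1 n, p k = p' k) (hq : ∀ k ∈ Finset.Icc 1 n, q k = q' k) :
    tensorExponent n t p q = tensorExponent n t p' q' := by
  rw [tensorExponent, tensorExponent, Finset.sum_congr rfl hp]
  congr 1
  refine Finset.sum_congr rfl fun j hj => Finset.sum_congr rfl fun i hi => ?_
  rw [hp j hj, hq i]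
  rw [Finset.mem_Icc] at hj ⊢
  rw [Finset.mem_Ico] at hi
  omega

variable {K : Type*} [Field K] {A : Type*} [AddCommGroup A] [Module K A]
  {B : Type*} [AddCommGroup B] [Module K B] {ι κ : Type*} [Fintype ι] [Fintype κ]
  {𝒜 : ℤ → Submodule K A} {ℬ : ℤ → Submodule K B}
  (α : AInfData K A) (β : AInfData K B)
  (b : Module.Basis ι K A) (deg : ι → ℤ) (b' : Module.Basis κ K B) (deg' : κ → ℤ)

lemma multilinear_expand {M : Type*} [AddCommGroup M] [Module K M] {n : ℕ}
    (f : MultilinearMap K (fun _ : Fin n => A) M) (x : Fin n → A) :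
    f x = ∑ s : Fin n → ι, (∏ k, b.repr (x k) (s k)) • f fun k => b (s k) := by
  have h1 : x = fun k => ∑ i, b.repr (x k) i • b i := funext fun k => (b.sum_repr _).symm
  conv_lhs => rw [h1]
  rw [MultilinearMap.map_sum]
  exact Finset.sum_congr rfl fun s _ => by rw [MultilinearMap.map_smul_univ]

/-- The operation on `A ⊗ B` given by a pair of trees. -/
noncomputable def tensorTerm {n : ℕ} (T : PTree n × PTree n) :
    MultilinearMap K (fun _ : Fin n => A ⊗[K] B) (A ⊗[K] B) :=
  -- The operation is prescribed on tuples of basis vectors, where the degrees in the sign are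
  -- known, and extended multilinearly by coordinates.
  ∑ s : Fin n → ι × κ, ((MultilinearMap.mkPiAlgebra K (Fin n) K).compLinearMap fun k =>
    (b.tensorProduct b').coord (s k)).smulRight
      (((-1 : K) ^ tensorExponent n T.2.deg (stretch 0 fun k => deg (s k).1)
          (stretch 0 fun k => deg' (s k).2)) •
        α.op n (tree T.1) (fun k => b (s k).1) ⊗ₜ[K] β.op n (tree T.2) (fun k => b' (s k).2))

variable {b deg b' deg'}

/-- Homogeneous arguments have coordinates only at basis vectors of their own degree, so the sign is
constant over the terms that do not vanish. -/
lemma tensorTerm_apply (hb : IsHomogeneousBasis 𝒜 b deg) (hb' : IsHomogeneousBasis ℬ b' deg')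
    {n : ℕ} (T : PTree n × PTree n) (p q : ℕ → ℤ) (x : ℕ → A) (y : ℕ → B)
    (hx : ∀ k, x k ∈ 𝒜 (p k)) (hy : ∀ k, y k ∈ ℬ (q k)) :
    tensorTerm α β b deg b' deg' T (tuple n fun k => x k ⊗ₜ[K] y k) =
      ((-1 : K) ^ tensorExponent n T.2.deg p q) •
        α.op n (tree T.1) (tuple n x) ⊗ₜ[K] β.op n (tree T.2) (tuple n y) := by
  rw [multilinear_expand b (α.op n (tree T.1)), multilinear_expand b' (β.op n (tree T.2)),
    TensorProduct.sum_tmul, Finset.smul_sum]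
  simp only [TensorProduct.tmul_sum, Finset.smul_sum]
  rw [tensorTerm, sum_apply, ← Fintype.sum_prod_type'
    (f := fun (s : Fin n → ι) (t : Fin n → κ) => (-1 : K) ^ tensorExponent n T.2.deg p q •
      (((∏ k, b.repr (tuple n x k) (s k)) • α.op n (tree T.1) fun k => b (s k)) ⊗ₜ[K]
        ((∏ k, b'.repr (tuple n y k) (t k)) • β.op n (tree T.2) fun k => b' (t k))))]
  refine Fintype.sum_equiv (Equiv.arrowProdEquivProdArrow (Fin n) (fun _ => ι) fun _ => κ) _ _
    fun s => ?_
  simp only [MultilinearMap.smulRight_apply, MultilinearMap.compLinearMap_apply,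
    MultilinearMap.mkPiAlgebra_apply, Module.Basis.coord_apply, tuple,
    Equiv.arrowProdEquivProdArrow_apply, TensorProduct.smul_tmul_smul]
  have hr : ∀ k : Fin n, (b.tensorProduct b').repr (x (k + 1) ⊗ₜ[K] y (k + 1)) (s k) =
      b'.repr (y (k + 1)) (s k).2 * b.repr (x (k + 1)) (s k).1 := fun k =>
    Module.Basis.tensorProduct_repr_tmul_apply b b' _ _ (s k).1 (s k).2
  simp only [hr, Finset.prod_mul_distrib]
  by_cases h0 : (∏ k : Fin n, b.repr (x (k + 1)) (s k).1) *
      ∏ k : Fin n, b'.repr (y (k + 1)) (s k).2 = 0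
  · rw [mul_comm, h0]
    simp
  · have h1 := Finset.prod_ne_zero_iff.1 (left_ne_zero_of_mul h0)
    have h2 := Finset.prod_ne_zero_iff.1 (right_ne_zero_of_mul h0)
    have e : tensorExponent n T.2.deg (stretch 0 fun k => deg (s k).1)
        (stretch 0 fun k => deg' (s k).2) = tensorExponent n T.2.deg p q := by
      refine tensorExponent_congr _ (fun k hk => ?_) fun k hk => ?_
      all_goals
        rw [Finset.mem_Icc] at hk
        have hk' : k - 1 < n := by omega
        rw [stretch, dif_pos hk']
      · have := hb.deg_eq _ _ _ (hx _) (h1 ⟨k - 1, hk'⟩ (Finset.mem_univ _))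
        rw [this]
        exact congrArg p (by simp; omega)
      · have := hb'.deg_eq _ _ _ (hy _) (h2 ⟨k - 1, hk'⟩ (Finset.mem_univ _))
        rw [this]
        exact congrArg q (by simp; omega)
    rw [e, smul_comm, mul_comm]

-- The defining formula asks for sequences indexed by all natural numbers; the finitely many
-- arguments are continued by zero, which is homogeneous of every degree.
omit [Fintype ι] [Fintype κ] in
lemma IsTensorAInf.op_basis {Δ : CyclicDiagonal K} {γ : AInfData K (A ⊗[K] B)}
    (hγ : IsTensorAInf Δ 𝒜 ℬ α β γ) (hb : IsHomogeneousBasis 𝒜 b deg)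
    (hb' : IsHomogeneousBasis ℬ b' deg') (n : ℕ) (x : AInf K n) (s : Fin n → ι × κ) :
    γ.op n x (fun k => b.tensorProduct b' (s k)) = (Δ.map n x).sum fun T c =>
      (c * (-1 : K) ^ tensorExponent n T.2.deg (stretch 0 fun k => deg (s k).1)
        (stretch 0 fun k => deg' (s k).2)) •
      α.op n (tree T.1) (fun k => b (s k).1) ⊗ₜ[K] β.op n (tree T.2) (fun k => b' (s k).2) := by
  have h := hγ.op_tmul n x (stretch 0 fun k => deg (s k).1) (stretch 0 fun k => deg' (s k).2)
    (stretch 0 fun k => b (s k).1) (stretch 0 fun k => b' (s k).2)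
    (fun k => by unfold stretch; split_ifs; exacts [hb.mem _, zero_mem _])
    (fun k => by unfold stretch; split_ifs; exacts [hb'.mem _, zero_mem _])
  simp only [tuple_stretch] at h
  refine Eq.trans (congrArg _ (funext fun k => ?_)) h
  simp [tuple, stretch, Module.Basis.tensorProduct_apply']

omit [Fintype ι] [Fintype κ] in
lemma IsTensorAInf.eq [Finite ι] [Finite κ] {Δ : CyclicDiagonal K} {γ γ' : AInfData K (A ⊗[K] B)}
    (hγ : IsTensorAInf Δ 𝒜 ℬ α β γ) (hb : IsHomogeneousBasis 𝒜 b deg)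
    (hb' : IsHomogeneousBasis ℬ b' deg') (hγ' : IsTensorAInf Δ 𝒜 ℬ α β γ') : γ = γ' := by
  refine AInfData.ext ?_ ?_ ?_
  · refine (b.tensorProduct b').ext fun i => ?_
    rw [Module.Basis.tensorProduct_apply', hγ.d_tmul _ _ (hb.mem _), hγ'.d_tmul _ _ (hb.mem _)]
  · funext n
    refine LinearMap.ext fun x => Module.Basis.ext_multilinear (fun _ => b.tensorProduct b')
      fun s => ?_
    rw [hγ.op_basis α β hb hb', hγ'.op_basis α β hb hb']
  · refine (b.tensorProduct b').ext fun i => (b.tensorProduct b').ext fun j => ?_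
    rw [Module.Basis.tensorProduct_apply', Module.Basis.tensorProduct_apply',
      hγ.inner_tmul _ _ _ _ _ _ (hb.mem _) (hb'.mem _),
      hγ'.inner_tmul _ _ _ _ _ _ (hb.mem _) (hb'.mem _)]

/-- The tensor product of `A_∞`-algebras exists and is unique. -/
theorem existsUnique_isTensorAInf (Δ : CyclicDiagonal K) (hb : IsHomogeneousBasis 𝒜 b deg)
    (hb' : IsHomogeneousBasis ℬ b' deg') :
    ∃! γ : AInfData K (A ⊗[K] B), IsTensorAInf Δ 𝒜 ℬ α β γ := by
  classical
  let γ₀ : AInfData K (A ⊗[K] B) := {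
    -- The parity operator on `A` produces the sign of the second summand.
    d := TensorProduct.map α.d LinearMap.id + TensorProduct.map (signOp b deg) β.d
    op := fun n => Finsupp.linearCombination K (tensorTerm α β b deg b' deg') ∘ₗ Δ.map n
    -- To obtain `(-1)^(|a'||b|)`, the vector `b` is split along the basis of `B` and the parity
    -- operator is applied to `a'` once for each unit of the degree of `b' j`. The absolute value
    -- makes the exponent a natural number and does not change its parity.
    inner := ∑ j, LinearMap.BilinForm.tmul (α.inner.compl₂ (signOp b deg ^ (deg' j).natAbs))
      (β.inner ∘ₗ (b'.coord j).smulRight (b' j)) }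
  have h : IsTensorAInf Δ 𝒜 ℬ α β γ₀ := by
    refine ⟨?_, ?_, ?_⟩
    · intro p x hx y
      simp [γ₀, hb.signOp_apply hx, TensorProduct.smul_tmul']
    · intro n x p q u v hu hv
      simp only [γ₀, LinearMap.comp_apply, Finsupp.linearCombination_apply, Finsupp.sum,
        sum_apply, smul_apply]
      refine Finset.sum_congr rfl fun T _ => ?_
      rw [tensorTerm_apply α β hb hb' T p q u v hu hv, smul_smul]
      rfl
    · intro p' q x y x' y' hx' hy
      have hT : ∀ j, LinearMap.BilinForm.tmul (α.inner.compl₂ (signOp b deg ^ (deg' j).natAbs))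
          (β.inner ∘ₗ (b'.coord j).smulRight (b' j)) (x ⊗ₜ[K] y) (x' ⊗ₜ[K] y') =
          β.inner (b'.repr y j • b' j) y' * α.inner x ((signOp b deg ^ (deg' j).natAbs) x') :=
        fun j => rfl
      simp only [γ₀, LinearMap.sum_apply, hT, map_smul, LinearMap.smul_apply, smul_eq_mul]
      have hs : ∀ m : ℕ, (signOp b deg ^ m) x' = ((-1 : K) ^ (p' * m)) • x' := by
        intro m
        induction m with
        | zero => simp
        | succ m ih =>
          rw [pow_succ', Module.End.mul_apply, ih, map_smul, hb.signOp_apply hx', smul_smul,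
            ← zpow_add₀ (by simp)]
          congr 2
          push_cast
          ring
      have hy' : β.inner y y' = ∑ j, b'.repr y j * β.inner (b' j) y' := by
        conv_lhs => rw [← b'.sum_repr y]
        simp only [map_sum, map_smul, LinearMap.sum_apply, LinearMap.smul_apply, smul_eq_mul]
      rw [hy', Finset.mul_sum, Finset.mul_sum]
      refine Finset.sum_congr rfl fun j _ => ?_
      by_cases h0 : b'.repr y j = 0
      · simp [h0]
      · have e : (-1 : K) ^ (p' * ((deg' j).natAbs : ℤ)) = (-1 : K) ^ (p' * q) := by
          rw [hb'.deg_eq q y j hy h0, neg_one_zpow_eq_sg, neg_one_zpow_eq_sg]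
          congr 1
          push_cast
          congr 1
          rcases abs_choice q with h | h <;> rw [h]
          rw [Int.cast_neg, ZMod.neg_eq_self_mod_two]
        rw [hs, e, map_smul, smul_eq_mul]
        ring
  exact ⟨γ₀, h, fun γ hγ => hγ.eq α β hb hb' h⟩

end TensorProducts

lemma psum_range' (f : ℕ → ℕ → ZMod 2) (n : ℕ) : psum f (List.range' 1 n) =
    ∑ j ∈ Finset.Icc 1 n, ∑ i ∈ Finset.Ico 1 j, f i j := by
  induction n with
  | zero => simp
  | succ n ih =>
    rw [List.range'_1_concat, psum_append, ih, Finset.sum_Icc_succ_top (by omega)]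
    simp only [psum_singleton, add_zero, List.map_cons, List.map_nil, List.sum_cons, List.sum_nil]
    congr 1
    rw [← List.sum_toFinset _ List.nodup_range', add_comm 1 n]
    refine Finset.sum_congr ?_ fun _ _ => rfl
    ext k
    simp
    omega

lemma sum_Icc_eq_sum_range' (f : ℕ → ZMod 2) (n : ℕ) :
    ∑ k ∈ Finset.Icc 1 n, f k = ((List.range' 1 n).map f).sum := by
  rw [← List.sum_toFinset _ List.nodup_range']
  refine Finset.sum_congr ?_ fun _ _ => rfl
  ext k
  simp
  omega

/-! ### Operations, propagator and cyclic basis of a tensor product -/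

section

variable {K : Type*} [Field K] {A : Type*} [AddCommGroup A] [Module K A]
  {B : Type*} [AddCommGroup B] [Module K B] {ι κ : Type*}
  {𝒜 : ℤ → Submodule K A} {ℬ : ℤ → Submodule K B}
  {α : AInfData K A} {β : AInfData K B} {Δ : CyclicDiagonal K} {γ : AInfData K (A ⊗[K] B)}
  {b : Module.Basis ι K A} {deg : ι → ℤ} {b' : Module.Basis κ K B} {deg' : κ → ℤ}

/-- The cyclic operations on a tensor product. -/
theorem IsTensorAInf.cyclicOp_eq (hγ : IsTensorAInf Δ 𝒜 ℬ α β γ) (hα : IsCyclicAInf 𝒜 α)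
    (hα' : IsEven 𝒜 α) (hβ : IsCyclicAInf ℬ β) (hb : IsHomogeneousBasis 𝒜 b deg)
    (hb' : IsHomogeneousBasis ℬ b' deg') {n : ℕ} (x : AInf K n) (s : ℕ → ι × κ) :
    cyclicOp γ (b.tensorProduct b') x s = ∑ T : PTree n × PTree n, Δ.map n x T *
      (sg K (((n : ZMod 2) + T.1.1.card) * (n + T.2.1.card) +
        psum (fun k l => par deg' (s k).2 * par deg (s l).1) (List.range' 1 n ++ [0])) *
      (cyclicOp α b (tree T.1) (fun k => (s k).1) *
        cyclicOp β b' (tree T.2) fun k => (s k).2)) := by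
  have h1 := hγ.op_tmul n x (fun k => deg (s k).1) (fun k => deg' (s k).2) (fun k => b (s k).1)
    (fun k => b' (s k).2) (fun k => hb.mem _) fun k => hb'.mem _
  have h2 : (fun k => b.tensorProduct b' (s k)) = fun k => b (s k).1 ⊗ₜ[K] b' (s k).2 :=
    funext fun k => Module.Basis.tensorProduct_apply' b b' (s k)
  rw [cyclicOp, h2, h1, Finsupp.sum_fintype _ _ (by simp), map_sum, LinearMap.sum_apply]
  refine Finset.sum_congr rfl fun T _ => ?_
  rw [map_smul, LinearMap.smul_apply, smul_eq_mul, Module.Basis.tensorProduct_apply',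
    hγ.inner_tmul _ _ _ _ _ _ (hb.mem _) (op_mem_basis b' hβ hb'.mem T.2 fun k => (s k).2),
    mul_assoc]
  congr 1
  rw [← mul_assoc]
  change _ * (cyclicOp α b (tree T.1) (fun k => (s k).1) *
    cyclicOp β b' (tree T.2) fun k => (s k).2) = _
  by_cases h0 : cyclicOp α b (tree T.1) (fun k => (s k).1) = 0
  · rw [h0]
    ring
  congr 1
  -- The degree of `T.2` is multiplied by the total parity of all `A`-arguments including the root,
  -- one part coming from the operation and one from the inner product. Where the functional is
  -- nonzero this parity is that of `T.1`.
  have hp := cyclicOp_parity b hα hα' hb.mem T.1 _ h0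
  rw [neg_one_zpow_eq_sg, neg_one_zpow_eq_sg, ← sg_add]
  congr 1
  have h3 : (2 : ZMod 2) = 0 := rfl
  simp only [PTree.deg]
  push_cast
  simp only [h3, sub_zero]
  rw [psum_append, psum_range', ← hp]
  simp only [psum_singleton, List.map_cons, List.map_nil, List.sum_cons, List.sum_nil, add_zero,
    List.sum_map_mul_right, ← sum_Icc_eq_sum_range', par]
  have h5 : ∀ z : ZMod 2, -z = z := ZMod.neg_eq_self_mod_two
  have h6 : ∀ x y : ZMod 2, x - y = x + y := fun x y => by rw [sub_eq_add_neg, h5]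
  simp only [h6]
  ring

variable [Fintype ι] [Fintype κ] [DecidableEq ι] [DecidableEq κ]

omit [Fintype ι] [Fintype κ] [DecidableEq ι] [DecidableEq κ] in
lemma IsTensorAInf.gram_apply (hγ : IsTensorAInf Δ 𝒜 ℬ α β γ)
    (hb : IsHomogeneousBasis 𝒜 b deg) (hb' : IsHomogeneousBasis ℬ b' deg') (i j : ι × κ) :
    gram γ (b.tensorProduct b') i j =
      sg K (par deg j.1 * par deg' i.2) * (gram α b i.1 j.1 * gram β b' i.2 j.2) := by
  simp only [gram, Matrix.of_apply, Module.Basis.tensorProduct_apply']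
  rw [hγ.inner_tmul _ _ _ _ _ _ (hb.mem _) (hb'.mem _), neg_one_zpow_eq_sg]
  push_cast
  rfl

/-- The inverse of the inner product of a tensor product. -/
lemma IsTensorAInf.gram_inv [CharZero K] (hγ : IsTensorAInf Δ 𝒜 ℬ α β γ)
    (hb : IsHomogeneousBasis 𝒜 b deg) (hb' : IsHomogeneousBasis ℬ b' deg')
    (hA : IsCyclicBasis α b deg) (hB : IsCyclicBasis β b' deg') :
    IsUnit (gram γ (b.tensorProduct b')).det ∧
    ∀ i j, propagator γ (b.tensorProduct b') i j =
      sg K (par deg i.1 * par deg' i.2) * (propagator α b i.1 j.1 * propagator β b' i.2 j.2) := by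
  have h1 : gram γ (b.tensorProduct b') * (Matrix.of fun i j : ι × κ =>
      sg K (par deg i.1 * par deg' i.2) * (propagator α b i.1 j.1 * propagator β b' i.2 j.2)) = 1 := by
    ext i j
    have e1 := congrFun (congrFun (Matrix.mul_nonsing_inv _ hA.isUnit_det) i.1) j.1
    have e2 := congrFun (congrFun (Matrix.mul_nonsing_inv _ hB.isUnit_det) i.2) j.2
    rw [Matrix.mul_apply] at e1 e2 ⊢
    have e3 : (1 : Matrix (ι × κ) (ι × κ) K) i j = (1 : Matrix ι ι K) i.1 j.1 *
        (1 : Matrix κ κ K) i.2 j.2 := by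
      simp only [Matrix.one_apply, Prod.ext_iff]
      split_ifs <;> simp_all
    rw [e3, ← e1, ← e2, Finset.sum_mul_sum, Fintype.sum_prod_type]
    refine Finset.sum_congr rfl fun x _ => Finset.sum_congr rfl fun y _ => ?_
    rw [hγ.gram_apply hb hb', Matrix.of_apply]
    by_cases h0 : gram β b' i.2 y = 0
    · simp [h0]
    -- As the form of `B` pairs equal parities, the sign of the Gram matrix depends on the summation
    -- index just as that of the candidate inverse does, and they cancel.
    · rw [hB.gram_even _ _ h0]
      have := sg_mul_self K (par deg x * par deg' y)
      simp only [propagator]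
      linear_combination (gram α b i.1 x * gram β b' i.2 y * ((gram α b)⁻¹ x j.1 *
        (gram β b')⁻¹ y j.2)) * this
  refine ⟨Matrix.isUnit_det_of_right_inverse h1, fun i j => ?_⟩
  rw [propagator, Matrix.inv_eq_right_inv h1, Matrix.of_apply]

/-- The tensor products of the elements of homogeneous bases. -/
theorem IsTensorAInf.isCyclicBasis [CharZero K] (hγ : IsTensorAInf Δ 𝒜 ℬ α β γ)
    (hα : IsCyclicAInf 𝒜 α) (hα' : IsEven 𝒜 α) (hβ : IsCyclicAInf ℬ β) (hβ' : IsEven ℬ β)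
    (hb : IsHomogeneousBasis 𝒜 b deg) (hb' : IsHomogeneousBasis ℬ b' deg') :
    IsCyclicBasis γ (b.tensorProduct b') (fun i => deg i.1 + deg' i.2) where
  parity l x h := by
    obtain ⟨s, -, rfl, -, -, -, hl, -⟩ := exists_rotated_states x l x
    rw [List.range'_1_concat, List.map_append] at hl
    have hl' := List.append_inj_left hl (by simp)
    have e := corollaWeight_eq γ (b.tensorProduct b') s hl'
    rw [e, hγ.cyclicOp_eq hα hα' hβ hb hb'] at h
    obtain ⟨T, -, hT⟩ := Finset.exists_ne_zero_of_sum_ne_zero h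
    have h1 := Δ.coeff_deg (left_ne_zero_of_mul hT)
    have h2 := right_ne_zero_of_mul (right_ne_zero_of_mul hT)
    have h3 := cyclicOp_parity b hα hα' hb.mem T.1 _ (left_ne_zero_of_mul h2)
    have h4 := cyclicOp_parity b' hβ hβ' hb'.mem T.2 _ (right_ne_zero_of_mul h2)
    rw [sum_Icc_eq_sum_range' (fun k => par deg (s k).1)] at h3
    rw [sum_Icc_eq_sum_range' (fun k => par deg' (s k).2)] at h4
    have h5 : (l.map (par fun i => deg i.1 + deg' i.2)).sum =
        ((List.range' 1 l.length).map fun k => par deg (s k).1).sum +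
        ((List.range' 1 l.length).map fun k => par deg' (s k).2).sum := by
      conv_lhs => rw [hl']
      rw [List.map_map, ← List.sum_map_add]
      simp [par, Function.comp_def]
    have hpar : par (fun i => deg i.1 + deg' i.2) (s 0) = par deg (s 0).1 + par deg' (s 0).2 := by
      simp [par]
    rw [h5, hpar, ← h1, ← h3, ← h4]
    ring
  cyclic x l y := by
    obtain ⟨s, s', rfl, h0, rfl, hs, hl, hl'⟩ := exists_rotated_states x l y
    have e1 := corollaWeight_eq γ (b.tensorProduct b') s' hl'
    have e2 := corollaWeight_eq γ (b.tensorProduct b') s hl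
    rw [h0] at e1
    rw [e1, e2, hγ.cyclicOp_eq hα hα' hβ hb hb', hγ.cyclicOp_eq hα hα' hβ hb hb', Finset.mul_sum,
      -- The terms of the diagonal on the left are reindexed by rotated pairs of trees, so that
      -- cyclicity of `Δ`, `A` and `B` applies term by term.
      ← ((rotEquiv true (rfl : l.length + 1 = l.length + 1)).prodCongr
        (rotEquiv true (rfl : l.length + 1 = l.length + 1))).sum_comp]
    refine Finset.sum_congr rfl fun T _ => ?_
    have hr : ∀ T : PTree (l.length + 1), rotEquiv true rfl T = T.rotTree :=
      fun T => Subtype.ext (rotEquiv_val _ _ T)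
    have hT : (rotEquiv true (rfl : l.length + 1 = l.length + 1)).prodCongr
        (rotEquiv true (rfl : l.length + 1 = l.length + 1)) T = (T.1.rotTree, T.2.rotTree) :=
      Prod.ext (hr _) (hr _)
    rw [hT]
    change Δ.coeff _ * (sg K (_ + _) * (cyclicOp α b (tree T.1.rotTree) (fun k => (s' k).1) *
      cyclicOp β b' (tree T.2.rotTree) fun k => (s' k).2)) = _ * (Δ.coeff _ * _)
    have hcA := hα.cyclicOp_rot hb.mem T.1 (s := fun k => (s k).1) (s' := fun k => (s' k).1)
      (by rw [h0]) fun k => by rw [hs]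
    have hcB := hβ.cyclicOp_rot hb'.mem T.2 (s := fun k => (s k).2) (s' := fun k => (s' k).2)
      (by rw [h0]) fun k => by rw [hs]
    have hc := Δ.coeff_rot T
    rw [rot_tree, cyclicOp_smul] at hcA hcB
    have hcard : ∀ T : PTree (l.length + 1), T.rotTree.1.card = T.1.card := fun T =>
      (T.isTreeIso_rot).card
    simp only [hcard]
    have hL : (l.map (par fun i => deg i.1 + deg' i.2)).sum +
        par (fun i => deg i.1 + deg' i.2) (s (l.length + 1)) =
        ((List.range' 1 (l.length + 1)).map fun k => par deg (s k).1).sum +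
        ((List.range' 1 (l.length + 1)).map fun k => par deg' (s k).2).sum := by
      have h6 : (l.map (par fun i => deg i.1 + deg' i.2)).sum +
        par (fun i => deg i.1 + deg' i.2) (s (l.length + 1)) =
        ((l ++ [s (l.length + 1)]).map (par fun i => deg i.1 + deg' i.2)).sum := by simp
      rw [h6, hl, List.map_map, ← List.sum_map_add]
      simp [par, Function.comp_def]
    have hpar : par (fun i => deg i.1 + deg' i.2) (s 0) = par deg (s 0).1 + par deg' (s 0).2 := by
      simp [par]
    rw [hL, hpar]
    -- Listing leaves before the root, the rotated states form the word which begins with the old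
    -- root.
    have hw : psum (fun k m => par deg' (s' k).2 * par deg (s' m).1)
          (List.range' 1 (l.length + 1) ++ [0]) =
        psum (fun k m => par deg' (s k).2 * par deg (s m).1)
          (0 :: List.range' 1 (l.length + 1)) := by
      have e5 : ∀ f : ι × κ → ZMod 2, ∀ g : ι × κ → ZMod 2, ∀ t : ℕ → ι × κ, ∀ M : List ℕ,
          psum (fun k m => f (t k) * g (t m)) M = psum (fun x y => f x * g y) (M.map t) :=
        fun f g t M => (psum_map (fun x y => f x * g y) t M).symm
      rw [e5 (fun i => par deg' i.2) (fun i => par deg i.1), e5 (fun i => par deg' i.2) (fun i => par deg i.1),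
        List.map_append, ← hl', List.map_cons (f := s), ← hl]
      simp [h0]
    rw [hw, psum_cons, psum_append]
    simp only [psum_singleton, List.map_cons, List.map_nil, List.sum_cons, List.sum_nil, add_zero,
      List.sum_map_mul_right, List.sum_map_mul_left]
    generalize psum (fun k m => par deg' (s k).2 * par deg (s m).1)
      (List.range' 1 (l.length + 1)) = w
    generalize ((List.range' 1 (l.length + 1)).map fun k => par deg (s k).1).sum = P at *
    generalize ((List.range' 1 (l.length + 1)).map fun k => par deg' (s k).2).sum = Q at *
    generalize par deg (s 0).1 = p at *
    generalize par deg' (s 0).2 = q at *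
    generalize PTree.rotSign true T.1 = r₁ at *
    generalize PTree.rotSign true T.2 = r₂ at *
    have solve : ∀ {x y : K} {a : ZMod 2}, sg K a * x = y → x = sg K a * y := by
      intro x y a h
      rw [← h, ← mul_assoc, sg_mul_self, one_mul]
    rw [solve hc, solve hcA, solve hcB]
    have h2 : (2 : ZMod 2) = 0 := rfl
    generalize Δ.coeff T = c₀
    generalize (cyclicOp α b (tree T.1) fun k => (s k).1) = f
    generalize (cyclicOp β b' (tree T.2) fun k => (s k).2) = g
    generalize (((l.length + 1 : ℕ) : ZMod 2) + T.1.1.card) *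
      (((l.length + 1 : ℕ) : ZMod 2) + T.2.1.card) = t
    have hn : ((l.length + 1 : ℕ) : ZMod 2) = l.length + 1 := by push_cast; rfl
    rw [hn]
    generalize (l.length : ZMod 2) + 1 = n
    -- The rotation signs of both trees cancel against those of the coefficient of `Δ`; moving the
    -- old root from the front to the end of the word supplies the mixed parity products.
    have key : sg K n * sg K (r₁ + r₂) * sg K (t + (q * P + w)) * (sg K r₁ * sg K (p * P)) *
        (sg K r₂ * sg K (q * Q)) = sg K (n + (p + q) * (P + Q)) * sg K (t + (w + Q * p)) := by
      simp only [← sg_add]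
      congr 1
      linear_combination (r₁ + r₂ - p * Q) * h2
    linear_combination (c₀ * f * g) * key
  isUnit_det := (hγ.gram_inv hb hb' (hα.isCyclicBasis hα' hb.mem) (hβ.isCyclicBasis hβ' hb'.mem)).1
  gram_symm i j := by
    rw [hγ.gram_apply hb hb', hγ.gram_apply hb hb',
      (hα.isCyclicBasis hα' hb.mem).gram_symm i.1, (hβ.isCyclicBasis hβ' hb'.mem).gram_symm i.2]
    have hpar : ∀ i, par (fun i : ι × κ => deg i.1 + deg' i.2) i = par deg i.1 + par deg' i.2 :=
      fun i => by simp [par]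
    rw [hpar, hpar]
    have h2 : (2 : ZMod 2) = 0 := rfl
    have key : sg K (par deg j.1 * par deg' i.2) * sg K (par deg i.1 * par deg j.1) *
        sg K (par deg' i.2 * par deg' j.2) =
        sg K ((par deg i.1 + par deg' i.2) * (par deg j.1 + par deg' j.2)) *
          sg K (par deg i.1 * par deg' j.2) := by
      simp only [← sg_add]
      congr 1
      linear_combination -(par deg i.1 * par deg' j.2) * h2
    linear_combination (gram α b j.1 i.1 * gram β b' j.2 i.2) * key
  gram_even i j h := by
    rw [hγ.gram_apply hb hb'] at h
    have h1 := right_ne_zero_of_mul h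
    have hpar : ∀ i, par (fun i : ι × κ => deg i.1 + deg' i.2) i = par deg i.1 + par deg' i.2 :=
      fun i => by simp [par]
    rw [hpar, hpar,
      (hα.isCyclicBasis hα' hb.mem).gram_even _ _ (left_ne_zero_of_mul h1),
      (hβ.isCyclicBasis hβ' hb'.mem).gram_even _ _ (right_ne_zero_of_mul h1)]

end

open RibbonGraph RibbonGraph.Labelling

/-- The two halves of a later edge have equal parity and cancel, so each edge contributes only its
own two letters. -/
lemma psum_pairLetters {α : Type*} {p q : α → ZMod 2} {ps : List (α × α)}
    (hp : ∀ e ∈ ps, p e.1 = p e.2) (hq : ∀ e ∈ ps, q e.1 = q e.2) :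
    psum (fun x y => q x * p y) (pairLetters ps) = (ps.map fun e => p e.1 * q e.1).sum := by
  induction ps with
  | nil => rfl
  | cons e ps ih =>
    have h1 := ih (fun e he => hp e (List.mem_cons_of_mem _ he))
      fun e he => hq e (List.mem_cons_of_mem _ he)
    have h2 := sum_pairLetters_eq_zero fun e he => hp e (List.mem_cons_of_mem _ he)
    simp only [pairLetters_cons, psum_cons, List.map_cons, List.sum_cons, List.sum_map_mul_left, h1,
      h2, ← hp e (by simp), mul_zero, add_zero, zero_add]
    ring

lemma GraphComplex.ext {K : Type*} [Field K] {M : Type*} [AddCommGroup M] [Module K M]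
    {f g : GraphComplex K →ₗ[K] M} (h : ∀ G, f (graphClass K G) = g (graphClass K G)) : f = g := by
  refine Submodule.linearMap_qext _ (Finsupp.lhom_ext' fun G => LinearMap.ext_ring ?_)
  exact h G

/-! ### The cocycle of a tensor product -/

section

variable {K : Type*} [Field K] [CharZero K] {A : Type*} [AddCommGroup A] [Module K A]
  {ι : Type*} [Fintype ι] [DecidableEq ι] {𝒜 : ℤ → Submodule K A}
  {α : AInfData K A} {b : Module.Basis ι K A} {deg : ι → ℤ}
  {Γ : RibbonGraph} (c : Γ.Labelling)

omit [CharZero K] [Fintype ι] [DecidableEq ι] in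
lemma vertexForm_eq_prod (X : ∀ v, AInf K (c.arity v)) (s : Γ.H → ι) :
    c.vertexForm α X (fun x => b (s x)) = ∏ v, cyclicOp α b (X v) fun k => s (c.half v k) :=
  Finset.prod_congr rfl fun v _ => vertexFactor_eq_cyclicOp α b c v _ s

lemma RibbonGraph.Labelling.rest_append_root (v : Γ.V) :
    c.rest v ++ [c.root v] = (List.range' 1 (c.arity v) ++ [0]).map (c.half v) := by
  rw [List.map_append, ← c.rest_eq_map_half]
  rfl

omit [CharZero K] [Fintype ι] [DecidableEq ι] in
lemma IsCyclicAInf.tree_parity (hα : IsCyclicAInf 𝒜 α) (he : IsEven 𝒜 α) (hb : ∀ i, b i ∈ 𝒜 (deg i))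
    {v : Γ.V} {T : PTree (c.arity v)} {s : Γ.H → ι}
    (h : cyclicOp α b (tree T) (fun k => s (c.half v k)) ≠ 0) :
    ((c.rest v ++ [c.root v]).map fun x => par deg (s x)).sum = (c.arity v : ZMod 2) + T.1.card := by
  rw [← cyclicOp_parity b hα he hb T _ h, c.rest_append_root, List.map_map, List.map_append,
    List.sum_append, sum_Icc_eq_sum_range' fun k => par deg (s (c.half v k))]
  simp [Function.comp_def]

/-- Count the parities of all half-edges of a contributing state: edge by edge they cancel, vertex
by vertex they give `n_v + t_v`. -/
lemma IsCyclicAInf.sum_dim_eq_zero (hα : IsCyclicAInf 𝒜 α) (he : IsEven 𝒜 α)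
    (hb : ∀ i, b i ∈ 𝒜 (deg i)) {T : ∀ v, PTree (c.arity v)} {E : Γ.EdgeOrdering}
    (h : weightSum α b deg c (fun v => tree (T v)) E ≠ 0) :
    (c.verts.map fun v => (c.arity v : ZMod 2) + (T v).1.card).sum = 0 := by
  obtain ⟨s, -, hs⟩ := Finset.exists_ne_zero_of_sum_ne_zero h
  have h1 := right_ne_zero_of_mul (left_ne_zero_of_mul hs)
  rw [vertexForm_eq_prod] at h1
  have h2 : (c.halfEdgeList.map fun x => par deg (s x)).sum = 0 := by
    rw [((halfEdgeList_perm c E).map _).sum_eq]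
    refine sum_pairLetters_eq_zero (π := fun x => par deg (s x)) fun e he' =>
      (hα.isCyclicBasis he hb).propagator_even fun h0 => right_ne_zero_of_mul hs ?_
    exact List.prod_eq_zero (List.mem_map.2 ⟨e, he', h0⟩)
  rw [halfEdgeList, sum_map_flatMap] at h2
  rw [← h2]
  exact congrArg List.sum (List.map_congr_left fun v _ =>
    (hα.tree_parity c he hb (Finset.prod_ne_zero_iff.1 h1 v (Finset.mem_univ v))).symm)

variable {B : Type*} [AddCommGroup B] [Module K B] {κ : Type*} [Fintype κ] [DecidableEq κ]
  {ℬ : ℤ → Submodule K B} {β : AInfData K B} {Δ : CyclicDiagonal K} {γ : AInfData K (A ⊗[K] B)}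
  {b' : Module.Basis κ K B} {deg' : κ → ℤ}

/-- The contraction for a tensor product, with a fixed term of the diagonal and fixed states. -/
lemma IsTensorAInf.state_term (hγ : IsTensorAInf Δ 𝒜 ℬ α β γ) (hα : IsCyclicAInf 𝒜 α)
    (hα' : IsEven 𝒜 α) (hβ : IsCyclicAInf ℬ β) (hβ' : IsEven ℬ β)
    (hb : IsHomogeneousBasis 𝒜 b deg) (hb' : IsHomogeneousBasis ℬ b' deg') (E : Γ.EdgeOrdering)
    (T : ∀ v, PTree (c.arity v) × PTree (c.arity v)) (s : Γ.H → ι × κ) :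
    sg K (kos (fun x => par deg (s x).1 + par deg' (s x).2) c.halfEdgeList (pairLetters E.pairs)) *
      (∏ v, Δ.coeff (T v) * (sg K (((c.arity v : ZMod 2) + (T v).1.1.card) *
          (c.arity v + (T v).2.1.card) +
          psum (fun x y => par deg' (s x).2 * par deg (s y).1) (c.rest v ++ [c.root v])) *
        (cyclicOp α b (tree (T v).1) (fun k => (s (c.half v k)).1) *
          cyclicOp β b' (tree (T v).2) fun k => (s (c.half v k)).2))) *
      (E.pairs.map fun e => propagator γ (b.tensorProduct b') (s e.1) (s e.2)).prod =
    (∏ v, Δ.coeff (T v)) * (sg K ((c.verts.map fun v => ((c.arity v : ZMod 2) + (T v).1.1.card) *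
          (c.arity v + (T v).2.1.card)).sum + psum (fun v w =>
          ((c.arity v : ZMod 2) + (T v).2.1.card) * (c.arity w + (T w).1.1.card)) c.verts) *
      ((sg K (kos (fun x => par deg (s x).1) c.halfEdgeList (pairLetters E.pairs)) *
          (∏ v, cyclicOp α b (tree (T v).1) fun k => (s (c.half v k)).1) *
          (E.pairs.map fun e => propagator α b (s e.1).1 (s e.2).1).prod) *
        (sg K (kos (fun x => par deg' (s x).2) c.halfEdgeList (pairLetters E.pairs)) *
          (∏ v, cyclicOp β b' (tree (T v).2) fun k => (s (c.half v k)).2) *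
          (E.pairs.map fun e => propagator β b' (s e.1).2 (s e.2).2).prod))) := by
  have hA := hα.isCyclicBasis hα' hb.mem
  have hB := hβ.isCyclicBasis hβ' hb'.mem
  have hprop : (E.pairs.map fun e => propagator γ (b.tensorProduct b') (s e.1) (s e.2)).prod =
      sg K (E.pairs.map fun e => par deg (s e.1).1 * par deg' (s e.1).2).sum *
      ((E.pairs.map fun e => propagator α b (s e.1).1 (s e.2).1).prod *
        (E.pairs.map fun e => propagator β b' (s e.1).2 (s e.2).2).prod) := by
    rw [sg_list_sum, List.map_map, ← List.prod_map_mul, ← List.prod_map_mul]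
    exact congrArg List.prod (List.map_congr_left fun e _ => (hγ.gram_inv hb hb' hA hB).2 _ _)
  rw [hprop]
  simp only [Finset.prod_mul_distrib]
  by_cases h1 : (∏ v, cyclicOp α b (tree (T v).1) fun k => (s (c.half v k)).1) = 0
  · rw [h1]
    ring
  by_cases h2 : (∏ v, cyclicOp β b' (tree (T v).2) fun k => (s (c.half v k)).2) = 0
  · rw [h2]
    ring
  by_cases h3 : (E.pairs.map fun e => propagator α b (s e.1).1 (s e.2).1).prod = 0
  · rw [h3]
    ring
  by_cases h4 : (E.pairs.map fun e => propagator β b' (s e.1).2 (s e.2).2).prod = 0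
  · rw [h4]
    ring
  have p1 : ∀ e ∈ E.pairs, par deg (s e.1).1 = par deg (s e.2).1 := fun e he =>
    hA.propagator_even fun h0 => h3 (List.prod_eq_zero (List.mem_map.2 ⟨e, he, h0⟩))
  have p2 : ∀ e ∈ E.pairs, par deg' (s e.1).2 = par deg' (s e.2).2 := fun e he =>
    hB.propagator_even fun h0 => h4 (List.prod_eq_zero (List.mem_map.2 ⟨e, he, h0⟩))
  have q1 : ∀ v, ((c.rest v ++ [c.root v]).map fun x => par deg (s x).1).sum = _ := fun v =>
    hα.tree_parity c hα' hb.mem (s := fun x => (s x).1)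
      (Finset.prod_ne_zero_iff.1 h1 v (Finset.mem_univ v))
  have q2 : ∀ v, ((c.rest v ++ [c.root v]).map fun x => par deg' (s x).2).sum = _ := fun v =>
    hβ.tree_parity c hβ' hb'.mem (s := fun x => (s x).2)
      (Finset.prod_ne_zero_iff.1 h2 v (Finset.mem_univ v))
  -- The pair sum over all half-edges, split by vertices: the part inside the vertices cancels the
  -- signs of the operations on `A ⊗ B`, the part between vertices becomes the shuffle sign of `δ`.
  -- The pair sum over the edges cancels the sign of the propagator.
  have hL : psum (fun x y => par deg' (s x).2 * par deg (s y).1) c.halfEdgeList =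
      (c.verts.map fun v => psum (fun x y => par deg' (s x).2 * par deg (s y).1)
        (c.rest v ++ [c.root v])).sum + psum (fun v w =>
          ((c.arity v : ZMod 2) + (T v).2.1.card) * (c.arity w + (T w).1.1.card)) c.verts := by
    rw [halfEdgeList, psum_mul_flatMap (fun x => par deg' (s x).2) fun x => par deg (s x).1]
    congr 1
    exact psum_congr fun v _ w _ => by rw [q1, q2]
  rw [kos_add (fun x => par deg (s x).1) (fun x => par deg' (s x).2) E.nodup_pairs
    (halfEdgeList_perm c E), hL, psum_pairLetters (p := fun x => par deg (s x).1)
    (q := fun x => par deg' (s x).2) p1 p2, c.prod_eq_prod_verts fun v => sg K (_ + _)]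
  have e : ∀ f : Γ.V → ZMod 2, (c.verts.map fun v => sg K (f v)).prod =
      sg K (c.verts.map f).sum := fun f => by
    rw [sg_list_sum, List.map_map]
    rfl
  rw [e, List.sum_map_add]
  generalize (c.verts.map fun v => psum (fun x y => par deg' (s x).2 * par deg (s y).1)
        (c.rest v ++ [c.root v])).sum = x1
  generalize psum (fun v w => ((c.arity v : ZMod 2) + (T v).2.1.card) *
    (c.arity w + (T w).1.1.card)) c.verts = x2
  generalize (E.pairs.map fun e => par deg (s e.1).1 * par deg' (s e.1).2).sum = x3
  generalize (c.verts.map fun v => ((c.arity v : ZMod 2) + (T v).1.1.card) *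
          (c.arity v + (T v).2.1.card)).sum = x4
  generalize kos (fun x => par deg (s x).1) c.halfEdgeList (pairLetters E.pairs) = x5
  generalize kos (fun x => par deg' (s x).2) c.halfEdgeList (pairLetters E.pairs) = x6
  generalize (∏ v, Δ.coeff (T v)) = y1
  generalize (∏ v, cyclicOp α b (tree (T v).1) fun k => (s (c.half v k)).1) = y2
  generalize (∏ v, cyclicOp β b' (tree (T v).2) fun k => (s (c.half v k)).2) = y3
  generalize (E.pairs.map fun e => propagator α b (s e.1).1 (s e.2).1).prod = y4
  generalize (E.pairs.map fun e => propagator β b' (s e.1).2 (s e.2).2).prod = y5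
  have h2 : (2 : ZMod 2) = 0 := rfl
  have key : sg K (x5 + x6 + (x1 + x2) + x3) * sg K (x4 + x1) * sg K x3 =
      sg K (x4 + x2) * sg K x5 * sg K x6 := by
    simp only [← sg_add]
    congr 1
    linear_combination (x1 + x3) * h2
  linear_combination (y1 * y2 * y3 * y4 * y5) * key

/-- The contraction for a tensor product is computed from the contractions for the factors. -/
theorem IsTensorAInf.weightSum_eq (hγ : IsTensorAInf Δ 𝒜 ℬ α β γ) (hα : IsCyclicAInf 𝒜 α)
    (hα' : IsEven 𝒜 α) (hβ : IsCyclicAInf ℬ β) (hβ' : IsEven ℬ β)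
    (hb : IsHomogeneousBasis 𝒜 b deg) (hb' : IsHomogeneousBasis ℬ b' deg') (E : Γ.EdgeOrdering) :
    weightSum γ (b.tensorProduct b') (fun i => deg i.1 + deg' i.2) c
        (fun v => corolla K (c.arity v)) E =
      ∑ T : (∀ v, PTree (c.arity v) × PTree (c.arity v)), (∏ v, Δ.coeff (T v)) *
        (sg K ((c.verts.map fun v => ((c.arity v : ZMod 2) + (T v).1.1.card) *
          (c.arity v + (T v).2.1.card)).sum + psum (fun v w =>
          ((c.arity v : ZMod 2) + (T v).2.1.card) * (c.arity w + (T w).1.1.card)) c.verts) *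
          (weightSum α b deg c (fun v => tree (T v).1) E *
            weightSum β b' deg' c (fun v => tree (T v).2) E)) := by
  simp only [weightSum, stateSum, vertexForm_eq_prod]
  have hw : ∀ (s : Γ.H → ι × κ) v, psum (fun k l => par deg' (s (c.half v k)).2 *
      par deg (s (c.half v l)).1) (List.range' 1 (c.arity v) ++ [0]) =
      psum (fun x y => par deg' (s x).2 * par deg (s y).1) (c.rest v ++ [c.root v]) := fun s v => by
    rw [c.rest_append_root, psum_map]
  have hF : ∀ s : Γ.H → ι × κ, (∏ v, cyclicOp γ (b.tensorProduct b') (corolla K (c.arity v))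
      fun k => s (c.half v k)) = ∑ T : (∀ v, PTree (c.arity v) × PTree (c.arity v)),
      ∏ v, Δ.coeff (T v) * (sg K (((c.arity v : ZMod 2) + (T v).1.1.card) *
          (c.arity v + (T v).2.1.card) +
          psum (fun x y => par deg' (s x).2 * par deg (s y).1) (c.rest v ++ [c.root v])) *
        (cyclicOp α b (tree (T v).1) (fun k => (s (c.half v k)).1) *
          cyclicOp β b' (tree (T v).2) fun k => (s (c.half v k)).2)) := fun s => by
    refine Eq.trans ?_ (Fintype.prod_sum fun v (t : PTree (c.arity v) × PTree (c.arity v)) =>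
      Δ.coeff t * (sg K (((c.arity v : ZMod 2) + t.1.1.card) * (c.arity v + t.2.1.card) +
          psum (fun x y => par deg' (s x).2 * par deg (s y).1) (c.rest v ++ [c.root v])) *
        (cyclicOp α b (tree t.1) (fun k => (s (c.half v k)).1) *
          cyclicOp β b' (tree t.2) fun k => (s (c.half v k)).2)))
    refine Finset.prod_congr rfl fun v _ => ?_
    rw [hγ.cyclicOp_eq hα hα' hβ hb hb']
    simp only [hw]
    rfl
  have hpar : ∀ i, par (fun i : ι × κ => deg i.1 + deg' i.2) i = par deg i.1 + par deg' i.2 :=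
    fun i => by simp [par]
  simp only [hF, hpar, Finset.mul_sum, Finset.sum_mul,
    hγ.state_term c hα hα' hβ hβ' hb hb' E]
  -- The sum over the terms of the diagonal is moved outside; for each choice of terms a state of `A
  -- ⊗ B` is a pair of independent states, so the sum is a product.
  rw [Finset.sum_comm]
  refine Finset.sum_congr rfl fun T _ => ?_
  rw [← Fintype.sum_prod_type']
  exact Fintype.sum_equiv ((Equiv.arrowProdEquivProdArrow Γ.H (fun _ => ι) fun _ => κ).trans
    (Equiv.prodComm _ _)) _ _ fun s => rfl

/-- The Kontsevich cocycle of a tensor product. -/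
theorem IsTensorAInf.cocycle_eq (hγ : IsTensorAInf Δ 𝒜 ℬ α β γ) (hα : IsCyclicAInf 𝒜 α)
    (hα' : IsEven 𝒜 α) (hβ : IsCyclicAInf ℬ β) (hβ' : IsEven ℬ β)
    (hb : IsHomogeneousBasis 𝒜 b deg) (hb' : IsHomogeneousBasis ℬ b' deg')
    {δ : GraphComplex K →ₗ[K] GraphComplex K ⊗[K] GraphComplex K} {cA cB cAB : GraphComplex K →ₗ[K] K}
    (hδ : IsGraphDiagonal Δ δ) (hA : IsKontsevichCocycle 𝒜 α cA) (hB : IsKontsevichCocycle ℬ β cB)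
    (hAB : IsKontsevichCocycle (tensorGrading 𝒜 ℬ) γ cAB) :
    cAB = LinearMap.mul' K K ∘ₗ TensorProduct.map cA cB ∘ₗ δ := by
  refine GraphComplex.ext fun G => ?_
  obtain ⟨c⟩ := nonempty_labelling G.Γ
  obtain ⟨E⟩ := G.Γ.nonempty_edgeOrdering
  have hbb := hb.tensor hb'
  rw [((hγ.isCyclicBasis hα hα' hβ hβ' hb hb').existsUnique_cocycle hbb.mem hbb.deg_eq).2 cAB hAB
    G c E, graphWeight, hγ.weightSum_eq c hα hα' hβ hβ' hb hb' E, LinearMap.comp_apply,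
    LinearMap.comp_apply, hδ G c, graphDiagonal_eq, map_sum, map_sum, Finset.mul_sum, Finset.mul_sum]
  refine Finset.sum_congr rfl fun T _ => ?_
  rw [map_smul, map_smul, TensorProduct.map_tmul, LinearMap.mul'_apply,
    hα.cocycle_stdExpansion c _ hα' hb.mem hb.deg_eq hA E,
    hβ.cocycle_stdExpansion c _ hβ' hb'.mem hb'.deg_eq hB E, smul_eq_mul]
  -- Terms with vanishing contraction or coefficient are discarded, so that the parity of the
  -- dimensions and the degree relation for `Δ` are at hand.
  by_cases hW : weightSum α b deg c (fun v => tree (T v).1) E = 0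
  · rw [hW]
    ring
  by_cases hT : ∏ v, Δ.coeff (T v) = 0
  · rw [hT]
    ring
  have h0 := hα.sum_dim_eq_zero c hα' hb.mem hW
  have hn : ∀ v, (c.arity v : ZMod 2) = ((c.arity v : ZMod 2) + (T v).1.1.card) +
      (c.arity v + (T v).2.1.card) := fun v =>
    (Δ.coeff_deg (Finset.prod_ne_zero_iff.1 hT v (Finset.mem_univ v))).symm
  have hsq : (-1 : K) ^ G.Γ.deg * (-1 : K) ^ G.Γ.deg = 1 := by
    rw [neg_one_zpow_eq_sg, sg_mul_self]
  -- Of the mixed terms, `f v * g w` and `g v * f w` over ordered pairs together with the diagonal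
  -- terms `f v * g v` make up the full product of the two sums.
  have key : ∀ (f g : G.Γ.V → ZMod 2) (l : List G.Γ.V), psum (fun v w => (f v + g v) * (f w + g w)) l +
      (l.map fun v => f v * g v).sum = psum (fun v w => f v * f w) l +
      psum (fun v w => g v * g w) l + (l.map f).sum * (l.map g).sum := by
    intro f g l
    have h2 : (2 : ZMod 2) = 0 := rfl
    induction l with
    | nil => simp
    | cons v l ih =>
      simp only [psum_cons, List.map_cons, List.sum_cons, List.sum_map_mul_left, List.sum_map_add]
      -- Over `ℤ/2` the induction step only rearranges terms.
      linear_combination ih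
  have hk := key (fun v => (c.arity v : ZMod 2) + (T v).1.1.card)
    (fun v => (c.arity v : ZMod 2) + (T v).2.1.card) c.verts
  simp only [← hn] at hk
  -- The total dimension of the trees inserted for `A` is even, so the product of sums vanishes.
  -- This is the last sign to be matched.
  rw [h0, zero_mul, add_zero] at hk
  generalize (c.verts.map fun v => ((c.arity v : ZMod 2) + (T v).1.1.card) *
          (c.arity v + (T v).2.1.card)).sum = x1 at *
  generalize psum (fun v w => ((c.arity v : ZMod 2) + (T v).2.1.card) *
    (c.arity w + (T w).1.1.card)) c.verts = x2 at *
  generalize psum (fun v w => (c.arity v : ZMod 2) * c.arity w) c.verts = x3 at *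
  generalize psum (fun v w => ((c.arity v : ZMod 2) + (T v).1.1.card) *
    (c.arity w + (T w).1.1.card)) c.verts = x4 at *
  generalize psum (fun v w => ((c.arity v : ZMod 2) + (T v).2.1.card) *
    (c.arity w + (T w).2.1.card)) c.verts = x5 at *
  have e : sg K x3 * sg K (x1 + x2) = sg K x2 * sg K x4 * sg K x5 := by
    simp only [← sg_add]
    congr 1
    linear_combination hk
  generalize (-1 : K) ^ G.Γ.deg = d at *
  generalize weightSum α b deg c (fun v => tree (T v).1) E = W at *
  generalize weightSum β b' deg' c (fun v => tree (T v).2) E = W' at *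
  generalize (∏ v, Δ.coeff (T v)) = y at *
  generalize c.orientationSign K G.ori = o at *
  linear_combination (d * o * y * W * W') * e - (d * o * y * W * W' * sg K x2 * sg K x4 * sg K x5) * hsq

end

end RibbonTensor

open RibbonTensor

theorem theorem4p13 {K : Type*} [Field K] [CharZero K]
    {A B : Type*} [AddCommGroup A] [Module K A] [Module.Finite K A]
    [AddCommGroup B] [Module K B] [Module.Finite K B]
    (𝒜 : ℤ → Submodule K A) (ℬ : ℤ → Submodule K B)
    (h𝒜 : DirectSum.IsInternal 𝒜) (hℬ : DirectSum.IsInternal ℬ)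
    (α : AInfData K A) (β : AInfData K B)
    (hα : IsCyclicAInf 𝒜 α) (hβ : IsCyclicAInf ℬ β)
    (hα_even : IsEven 𝒜 α) (hβ_even : IsEven ℬ β)
    (Δ : CyclicDiagonal K) :
    (∃! γ : AInfData K (A ⊗[K] B), IsTensorAInf Δ 𝒜 ℬ α β γ) ∧
    (∃! δ : GraphComplex K →ₗ[K] GraphComplex K ⊗[K] GraphComplex K, IsGraphDiagonal Δ δ) ∧
    (∃! cA : GraphComplex K →ₗ[K] K, IsKontsevichCocycle 𝒜 α cA) ∧
    (∃! cB : GraphComplex K →ₗ[K] K, IsKontsevichCocycle ℬ β cB) ∧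
    ∀ γ : AInfData K (A ⊗[K] B), IsTensorAInf Δ 𝒜 ℬ α β γ →
      (∃! cAB : GraphComplex K →ₗ[K] K, IsKontsevichCocycle (tensorGrading 𝒜 ℬ) γ cAB) ∧
      ∀ δ cA cB cAB, IsGraphDiagonal Δ δ → IsKontsevichCocycle 𝒜 α cA →
        IsKontsevichCocycle ℬ β cB → IsKontsevichCocycle (tensorGrading 𝒜 ℬ) γ cAB →
        cAB = LinearMap.mul' K K ∘ₗ TensorProduct.map cA cB ∘ₗ δ := by
  obtain ⟨N, b, deg, hb⟩ := exists_isHomogeneousBasis h𝒜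
  obtain ⟨N', b', deg', hb'⟩ := exists_isHomogeneousBasis hℬ
  have hbb := hb.tensor hb'
  refine ⟨existsUnique_isTensorAInf α β Δ hb hb', existsUnique_isGraphDiagonal Δ,
    ((hα.isCyclicBasis hα_even hb.mem).existsUnique_cocycle hb.mem hb.deg_eq).1,
    ((hβ.isCyclicBasis hβ_even hb'.mem).existsUnique_cocycle hb'.mem hb'.deg_eq).1,
    fun γ hγ => ⟨((hγ.isCyclicBasis hα hα_even hβ hβ_even hb hb').existsUnique_cocycle hbb.mem
      hbb.deg_eq).1, fun δ cA cB cAB hδ hA hB hAB => ?_⟩⟩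
  exact hγ.cocycle_eq hα hα_even hβ hβ_even hb hb' hδ hA hB hAB
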